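/- **Setting.** Let $\sigma_1^\infty,\sigma_2^\infty,\tau^\infty,p,\tau\in\mathbb R$, put $\sigma=\sigma_1^\infty+\sigma_2^\infty-p$, $a=\frac12(\sigma-p)+i\tau$, $b=\frac12(\sigma_2^\infty-\sigma_1^\infty)+i\tau^\infty$, assume $a\ne0$, and let $\gamma=|b/a|$. Let $0<k<1$, $-1<\zeta_\infty<1$ and $c_{-1}=c'+ic''\neq0$. Put $l_0=[-1/k,-1]$, $l_1=[1,1/k]$, $l=l_0\cup l_1$, $p_2(\zeta)=(\zeta^2-1)(\zeta^2-1/k^2)$, let $\mathcal D=\hat{\mathbb C}\setminus l$ be the slit domain, and let $f=p_2^{1/2}$ be the branch on $\mathcal D$ with $f(\zeta)\sim\zeta^2$ at $\infty$. With $\alpha^+=\sigma_2^\infty-p$, $\alpha^-=p-\sigma_1^\infty$, $\beta^\pm=\tau^\infty\mp\tau$ define $$A_0^+=-c'\beta^+-c''\alpha^+,\quad A_0^-=-c'\alpha^-+c''\beta^-,\quad d^+=\sqrt{|p_2(\zeta_\infty)|}\,(c'\alpha^+-c''\beta^+),\quad d^-=\sqrt{|p_2(\zeta_\infty)|}\,(c'\beta^-+c''\alpha^-),$$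 $$I_j^\pm=\int_1^{1/k}\frac{\xi^j\,d\xi}{(\xi\pm\zeta_\infty)^2\sqrt{|p_2(\xi)|}}\ (j=0,1,2),\quad \lambda_0=\zeta_\infty^2I_0^--2\zeta_\infty I_1^-+I_2^-,\quad \lambda_1=\frac{p_2'(\zeta_\infty)}{2p_2(\zeta_\infty)},$$ $$A_1^\pm=\tfrac{d^\pm}{\lambda_0}[\zeta_\infty(\lambda_1\zeta_\infty-2)I_1^-+(1-\lambda_1\zeta_\infty)I_2^-],\quad A_2^\pm=\tfrac{d^\pm}{\lambda_0}[\zeta_\infty(2-\lambda_1\zeta_\infty)I_0^-+\lambda_1I_2^-],\quad A_3^\pm=-\tfrac{d^\pm}{\lambda_0}[(1-\lambda_1\zeta_\infty)I_0^-+\lambda_1I_1^-],$$ $A_0=iA_0^+-A_0^-$, $A_j=A_j^+-iA_j^-$ $(j=1,2,3)$, and $$F_+(\zeta)=\frac{1}{(\zeta-\zeta_\infty)^2}\Big(iA_0^++\frac{A_1^++A_2^+\zeta+A_3^+\zeta^2}{f(\zeta)}\Big),\qquad F_-(\zeta)=\frac{1}{(\zeta-\zeta_\infty)^2}\Big(A_0^-+\frac{i(A_1^-+A_2^-\zeta+A_3^-\zeta^2)}{f(\zeta)}\Big),$$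 $$\omega'(\zeta)=\frac{1}{2\bar a(\zeta-\zeta_\infty)^2}\Big(A_0+\frac{A_1+A_2\zeta+A_3\zeta^2}{f(\zeta)}\Big),\qquad \psi=\frac{F_++F_-}{2\omega'} .$$ **Theorem.** 1. *(Coefficients.)* The integrals $I_j^\pm$ converge and $\lambda_0\ne0$. For each sign, $(A_1^\pm,A_2^\pm,A_3^\pm)$ is the unique real solution of $A_1^\pm+\zeta_\infty A_2^\pm+\zeta_\infty^2A_3^\pm=d^\pm$, $\ A_2^\pm+2\zeta_\infty A_3^\pm=d^\pm p_2'(\zeta_\infty)/(2p_2(\zeta_\infty))$, $\ A_1^\pm I_0^-+A_2^\pm I_1^-+A_3^\pm I_2^-=0$, and it also satisfies $A_1^\pm I_0^+-A_2^\pm I_1^++A_3^\pm I_2^+=0$. 2. *(Schwarz problems.)* $F_\pm$ are analytic in $\mathbb C\setminus(l\cup\{\zeta_\infty\})$, continuous up to both sides of the open slits, have at most integrable power singularities at the slit ends, satisfy $\operatorname{Re}F_+=0$ and $\operatorname{Im}F_-=0$ on both sides of $l$, $F_\pm(\zeta)=-c_{-1}(b\pm\bar a)(\zeta-\zeta_\infty)^{-2}+O(1)$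 at $\zeta_\infty$, $F_\pm=O(\zeta^{-2})$ at $\infty$, and $\int_{l_j}(F_+-F_-)\,d\zeta=0$ over both loops $l_j$. They are the only pair with these properties. A pair with these properties for which moreover $F_+-F_-$ has no zeros in $\mathcal D$ (at $\infty$: $\lim\zeta^2(F_+-F_-)\ne0$) exists if and only if $\gamma\le1$. 3. *(Single-valuedness and boundary condition.)* $\omega'=(F_+-F_-)/(2\bar a)$, $\int_{l_0}\omega'd\zeta=\int_{l_1}\omega'd\zeta=0$, $\psi\omega'+a\overline{\omega'}=0$ on both sides of the open slits, and $\psi(\zeta)=b+O((\zeta-\zeta_\infty)^2)$ at $\zeta_\infty$. 4. *(The map.)* For every $\zeta_0\in\mathbb C\setminus(l\cup\{\zeta_\infty\})$ and every $B\in\mathbb C$ the formula $$\omega(\zeta)=\frac1{2\bar a}\Big[-\frac{A_0}{\zeta-\zeta_\infty}+\int_{\zeta_0}^{\zeta}\frac{(A_1+A_2\xi+A_3\xi^2)\,d\xi}{(\xi-\zeta_\infty)^2f(\xi)}\Big]+B,$$ with any $C^1$ path in $\mathbb C\setminus(l\cup\{\zeta_\infty\})$, defines a single-valued function with derivative $\omega'$,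 with $\omega(\zeta)=c_{-1}/(\zeta-\zeta_\infty)+{}$(analytic) near $\zeta_\infty$, with a finite limit at $\infty$, and with continuous boundary values along the two-sided loops $l_0,l_1$, which describe contours $L_0,L_1$. * If $\gamma\le1$, then $\omega$ is one-to-one on $\mathcal D\setminus\{\zeta_\infty\}$ and its image $D^e$ is a domain containing a neighbourhood of infinity with boundary $L_0\cup L_1$, $L_0\cap L_1=\emptyset$. * If $\gamma<1$, then $L_0,L_1$ are simple closed regular $C^1$ curves, and $D^e$ solves the equal-strength problem: for every $C'\in\mathbb R$, with the constant $\Phi=\frac14(\sigma_1^\infty+\sigma_2^\infty)+iC'$ there is $\Psi$ with $\Psi(\omega(\zeta))=\psi(\zeta)$, analytic in $D^e$, continuous up to the boundary, with $\Psi(z)=b+O(z^{-2})$ at infinity, such that the stresses given by $\sigma_1+\sigma_2=4\operatorname{Re}\Phi$, $\sigma_2-\sigma_1+2i\tau_{12}=2(\bar z\Phi'+\Psi)$ extend continuously to the boundary, tend to $\sigma_1^\infty,\sigma_2^\infty,\tau^\infty$ at infinity, and satisfy $\sigma_n=p$, $\tau_{nt}=\tau$, $\sigma_t=\sigma$ on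 $L_0\cup L_1$. * If $\gamma=1$, then $L_0$ and $L_1$ are (nondegenerate) straight segments. 5. *(Zero count.)* In $\mathcal D$ the poles of $\psi$ are exactly the zeros of $\omega'$, with the same multiplicities. Let $Z$ be the number of zeros of $\omega'$ in $\mathcal D$ with multiplicities, where a zero at $\infty$ is understood with respect to the derivative of $\omega$ in the coordinate $1/\zeta$; it is finite. If $\gamma\ne1$, then $$Z=2+\frac1{2\pi i}\Big(\int_{-1/k}^{-1}-\int_1^{1/k}\Big)\Big(\frac{\eta_0^-(\xi)}{\eta^-(\xi)}-\frac{\eta_0^+(\xi)}{\eta^+(\xi)}\Big)\frac{d\xi}{\sqrt{|p_2(\xi)|}}$$ with convergent integrals, where $\eta^\pm(\xi)=\pm i\sqrt{|p_2(\xi)|}A_0+A_1+A_2\xi+A_3\xi^2$ and $\eta_0^\pm(\xi)=\mp iA_0\xi(2\xi^2-1-1/k^2)+\sqrt{|p_2(\xi)|}(A_2+2A_3\xi)$. If $\gamma<1$, then $Z=0$; if $\gamma>1$, then $Z=4$. If $\gamma=1$, then $\psi\equiv b$, and on each of the two loops $l_0$, $l_1$ (two sides joined at the ends) the boundary values $\eta^\pm$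 have exactly two zeros. -/

import Mathlib

open Filter Topology Set MeasureTheory Asymptotics
open scoped ComplexConjugate Real

namespace TwoCavities

noncomputable section

/-- The loading: constant stresses `σ₁^∞, σ₂^∞, τ^∞` at infinity, and the constant normal and
tangential traction components `p, τ` on the boundaries of the cavities. -/
structure Loading where
  sigma1 : ℝ
  sigma2 : ℝ
  tauInf : ℝ
  p : ℝ
  tau : ℝ

namespace Loading

variable (Q : Loading)

/-- The prescribed value `σ = σ₁^∞ + σ₂^∞ - p` of the tangential normal stress on the contours. -/
def sigma : ℝ := Q.sigma1 + Q.sigma2 - Q.p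

/-- `a = (σ - p)/2 + iτ`. -/
def a : ℂ := ((Q.sigma - Q.p) / 2 : ℝ) + Complex.I * Q.tau

/-- `b = (σ₂^∞ - σ₁^∞)/2 + iτ^∞`. -/
def b : ℂ := ((Q.sigma2 - Q.sigma1) / 2 : ℝ) + Complex.I * Q.tauInf

/-- `γ = |b/a|`. -/
def gam : ℝ := ‖Q.b / Q.a‖

end Loading

/-! ### The elasticity problem -/

/-- `De` is a domain containing a neighbourhood of infinity whose boundary consists of the two
disjoint contours `L₀`, `L₁`: the exterior of two cavities bounded by `L₀` and `L₁`. -/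
structure IsExteriorDomain (De L₀ L₁ : Set ℂ) : Prop where
  isOpen : IsOpen De
  isConnected : IsConnected De
  mem_infinity : De ∈ cocompact ℂ
  disjoint : Disjoint L₀ L₁
  frontier_eq : frontier De = L₀ ∪ L₁

/-- A `2π`-periodic parametrization of a simple closed regular `C¹` curve. -/
structure IsSimpleClosedCurve (L : ℝ → ℂ) : Prop where
  periodic : Function.Periodic L (2 * π)
  contDiff : ContDiff ℝ 1 L
  regular : ∀ θ, deriv L θ ≠ 0
  simple : InjOn L (Ico 0 (2 * π))

/-- For a stress tensor with components `s₁ = σ₁`, `s₂ = σ₂`, `t = τ₁₂`: the normal stress `σ_n`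
on an element with normal `n = (cos α, sin α)`. -/
def normalStress (s₁ s₂ t α : ℝ) : ℝ :=
  s₁ * Real.cos α ^ 2 + s₂ * Real.sin α ^ 2 + 2 * t * Real.sin α * Real.cos α

/-- The tangential normal stress `σ_t`, along the tangent `(-sin α, cos α)`. -/
def tangentNormalStress (s₁ s₂ t α : ℝ) : ℝ :=
  s₁ * Real.sin α ^ 2 + s₂ * Real.cos α ^ 2 - 2 * t * Real.sin α * Real.cos α

/-- The shear stress `τ_{nt}`. -/
def shearStress (s₁ s₂ t α : ℝ) : ℝ :=
  (s₂ - s₁) * Real.sin α * Real.cos α + t * (Real.cos α ^ 2 - Real.sin α ^ 2)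

/-- The exterior `De` of two cavities with smooth contours `L 0`, `L 1`, together with the
Kolosov-Muskhelishvili potentials `Φ, Ψ`, solves the equal-strength problem for the loading `Q`.
`C'` is the (stress-free) rotation constant. On the contours the stresses are
required for both unit normals `e^{iα}` of the contour; the stress components
`σ_n, σ_t, τ_{nt}` do not depend on which of the two is taken. -/
structure SolvesEqualStrength (Q : Loading) (De : Set ℂ) (L : Fin 2 → ℝ → ℂ)
    (Φ Ψ : ℂ → ℂ) (C' : ℝ) : Prop where
  exterior : IsExteriorDomain De (range (L 0)) (range (L 1))
  contours : ∀ j, IsSimpleClosedCurve (L j)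
  analytic_Phi : DifferentiableOn ℂ Φ De
  analytic_Psi : DifferentiableOn ℂ Ψ De
  continuous_Phi : ContinuousOn Φ (closure De)
  continuous_Psi : ContinuousOn Ψ (closure De)
  infinity_Phi : (fun z => Φ z - (((Q.sigma1 + Q.sigma2) / 4 : ℝ) + Complex.I * C'))
    =O[cocompact ℂ] fun z => (‖z‖ ^ 2)⁻¹
  infinity_Psi : (fun z => Ψ z - Q.b) =O[cocompact ℂ] fun z => (‖z‖ ^ 2)⁻¹
  stresses : ∃ s₁ s₂ t : ℂ → ℝ,
    ContinuousOn s₁ (closure De) ∧ ContinuousOn s₂ (closure De) ∧ ContinuousOn t (closure De) ∧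
    (∀ z ∈ De, s₁ z + s₂ z = 4 * (Φ z).re ∧
      ((s₂ z - s₁ z : ℝ) : ℂ) + 2 * Complex.I * t z = 2 * (conj z * deriv Φ z + Ψ z)) ∧
    Tendsto s₁ (cocompact ℂ) (𝓝 Q.sigma1) ∧ Tendsto s₂ (cocompact ℂ) (𝓝 Q.sigma2) ∧
    Tendsto t (cocompact ℂ) (𝓝 Q.tauInf) ∧
    ∀ j θ α, (Complex.exp (Complex.I * (α : ℝ)) * conj (deriv (L j) θ)).re = 0 →
      normalStress (s₁ (L j θ)) (s₂ (L j θ)) (t (L j θ)) α = Q.p ∧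
      shearStress (s₁ (L j θ)) (s₂ (L j θ)) (t (L j θ)) α = Q.tau ∧
      tangentNormalStress (s₁ (L j θ)) (s₂ (L j θ)) (t (L j θ)) α = Q.sigma

/-! ### The parametric slit domain -/

/-- Left end of the slit `l_j`; `l₀ = [-1/k, -1]`, `l₁ = [1, 1/k]`. -/
def lo (k : ℝ) (j : Fin 2) : ℝ := if j = 0 then -(1 / k) else 1

/-- Right end of the slit `l_j`. -/
def hi (k : ℝ) (j : Fin 2) : ℝ := if j = 0 then -1 else 1 / k

/-- The slit `l_j` as a subset of the plane. -/
def slit (k : ℝ) (j : Fin 2) : Set ℂ := (fun ξ : ℝ => (ξ : ℂ)) '' Icc (lo k j) (hi k j)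

/-- The (finite part of the) slit domain `ℂ \ (l₀ ∪ l₁)`. -/
def slitDomain (k : ℝ) : Set ℂ := (slit k 0 ∪ slit k 1)ᶜ

/-- The open upper (`true`) or lower (`false`) half-plane. -/
def halfPlane : Bool → Set ℂ
  | true => {ζ | 0 < ζ.im}
  | false => {ζ | ζ.im < 0}

/-- `g true`, `g false` are the boundary values of `F` on the upper and the lower side of the
open slit `l_j`. -/
def HasSides (k : ℝ) (j : Fin 2) (F : ℂ → ℂ) (g : Bool → ℝ → ℂ) : Prop :=
  ∀ s, ∀ ξ ∈ Ioo (lo k j) (hi k j),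
    Tendsto F (𝓝[halfPlane s] (ξ : ℂ)) (𝓝 (g s ξ))

/-- The integral of `F` over the loop around the slit `l_j` (its two sides, traversed with the
slit domain on the left) converges and vanishes. -/
def LoopIntegralVanishes (k : ℝ) (j : Fin 2) (F : ℂ → ℂ) : Prop :=
  ∃ g : Bool → ℝ → ℂ, HasSides k j F g ∧
    (∀ s, IntervalIntegrable (g s) volume (lo k j) (hi k j)) ∧
    (∫ ξ in lo k j..hi k j, g true ξ) - (∫ ξ in lo k j..hi k j, g false ξ) = 0

/-- The point of `l_j` with angular parameter `θ` of the loop around `l_j`; the upper side is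
`sin θ > 0`, the lower side is `sin θ < 0`. -/
def loopPoint (k : ℝ) (j : Fin 2) (θ : ℝ) : ℝ :=
  (lo k j + hi k j) / 2 + (hi k j - lo k j) / 2 * Real.cos θ

/-- `L` is the contour traversed by `ω(ζ)` when `ζ` traverses the two-sided loop `l_j`. -/
def IsContour (k : ℝ) (j : Fin 2) (ω : ℂ → ℂ) (L : ℝ → ℂ) : Prop :=
  ∀ θ, Tendsto ω
    (𝓝[{ζ | ζ ∈ slitDomain k ∧ (Real.sin θ ≠ 0 → 0 < Real.sin θ * ζ.im)}]
      (loopPoint k j θ : ℂ)) (𝓝 (L θ))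

/-- `p₂(ζ) = (ζ² - 1)(ζ² - 1/k²)`. -/
def p2 (k : ℝ) (ξ : ℝ) : ℝ := (ξ ^ 2 - 1) * (ξ ^ 2 - 1 / k ^ 2)

/-- The branch `f` of `p₂^{1/2}`, single-valued off the slits, with `f(ζ) ~ ζ²` at infinity.
The principal root below is cut exactly where `(ζ² - 1)/(ζ² - 1/k²) ≤ 0`, that is on the slits. -/
def branch (k : ℝ) (ζ : ℂ) : ℂ :=
  (ζ ^ 2 - 1 / (k : ℂ) ^ 2) * ((ζ ^ 2 - 1) / (ζ ^ 2 - 1 / (k : ℂ) ^ 2)) ^ (1 / 2 : ℂ)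

theorem branch_sq {k : ℝ} {ζ : ℂ} (h : ζ ^ 2 - 1 / (k : ℂ) ^ 2 ≠ 0) :
    branch k ζ ^ 2 = (ζ ^ 2 - 1) * (ζ ^ 2 - 1 / (k : ℂ) ^ 2) := by
  unfold branch
  rw [mul_pow, ← Complex.cpow_nat_mul]
  norm_num
  field_simp

/-- The loading together with the parameters `k`, `ζ_∞` and `c_{-1} = c' + i c''` of the map. -/
structure Data extends Loading where
  k : ℝ
  zinf : ℝ
  c : ℂ

namespace Data

variable (P : Data)

/-- `ℂ` without the slits and without `ζ_∞`. -/
def punctured : Set ℂ := slitDomain P.k \ {(P.zinf : ℂ)}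

/-! ### The two coupled Schwarz problems -/

/-- `F` solves the Schwarz problem `part F = 0` on `l` (`part` is the real or the imaginary part)
with `F = -c_{-1} m (ζ - ζ_∞)^{-2} + O(1)` at `ζ_∞` and `F = O(ζ^{-2})` at infinity, with at most
integrable singularities at the ends of the slits. -/
structure IsSchwarz (part : ℂ → ℝ) (m : ℂ) (F : ℂ → ℂ) : Prop where
  analytic : DifferentiableOn ℂ F P.punctured
  boundary : ∀ j, ∃ g : Bool → ℝ → ℂ, HasSides P.k j F g ∧
    ∀ s, ∀ ξ ∈ Ioo (lo P.k j) (hi P.k j), part (g s ξ) = 0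
  endpoints : ∀ j, ∀ e : ℝ, e = lo P.k j ∨ e = hi P.k j → ∃ C μ : ℝ, μ < 1 ∧
    ∀ᶠ ζ in 𝓝[slitDomain P.k] (e : ℂ), ‖F ζ‖ ≤ C * ‖ζ - e‖ ^ (-μ)
  pole : (fun ζ => F ζ + P.c * m / (ζ - P.zinf) ^ 2) =O[𝓝[≠] (P.zinf : ℂ)] fun _ => (1 : ℝ)
  infinity : F =O[cocompact ℂ] fun ζ => (‖ζ‖ ^ 2)⁻¹

/-- The two Schwarz problems for `F₊`, `F₋`, coupled by the vanishing of the integrals of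
`F₊ - F₋` over both loops. -/
structure IsSchwarzPair (Fp Fm : ℂ → ℂ) : Prop where
  plus : P.IsSchwarz Complex.re (P.b + conj P.a) Fp
  minus : P.IsSchwarz Complex.im (P.b - conj P.a) Fm
  loops : ∀ j, LoopIntegralVanishes P.k j fun ζ => Fp ζ - Fm ζ

/-- A derivative `g = ω'` (or a multiple of it) has no zeros in the slit domain, including the
point at infinity, where `ω(ζ) = d₀ + d₁/ζ + …` and the requirement is `d₁ ≠ 0`. -/
def NoZeros (g : ℂ → ℂ) : Prop :=
  (∀ ζ ∈ P.punctured, g ζ ≠ 0) ∧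
    ∃ d : ℂ, d ≠ 0 ∧ Tendsto (fun ζ => ζ ^ 2 * g ζ) (cocompact ℂ) (𝓝 d)

/-! ### The explicit coefficients -/

def alphaP : ℝ := P.sigma2 - P.p
def alphaM : ℝ := P.p - P.sigma1
def betaP : ℝ := P.tauInf - P.tau
def betaM : ℝ := P.tauInf + P.tau

/-- `A₀⁺`. -/
def A0P : ℝ := -P.c.re * P.betaP - P.c.im * P.alphaP

/-- `A₀⁻`. -/
def A0M : ℝ := -P.c.re * P.alphaM + P.c.im * P.betaM

/-- `d⁺`. -/
def dP : ℝ := √|p2 P.k P.zinf| * (P.c.re * P.alphaP - P.c.im * P.betaP)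

/-- `d⁻`. -/
def dM : ℝ := √|p2 P.k P.zinf| * (P.c.re * P.betaM + P.c.im * P.alphaM)

/-- The integrand of `I_j⁻` (`x = ζ_∞`) and `I_j⁺` (`x = -ζ_∞`). -/
def intI (x : ℝ) (j : ℕ) (ξ : ℝ) : ℝ := ξ ^ j / ((ξ - x) ^ 2 * √|p2 P.k ξ|)

/-- `I_j⁻`. -/
def IM (j : ℕ) : ℝ := ∫ ξ in (1 : ℝ)..(1 / P.k), P.intI P.zinf j ξ

/-- `I_j⁺`. -/
def IP (j : ℕ) : ℝ := ∫ ξ in (1 : ℝ)..(1 / P.k), P.intI (-P.zinf) j ξ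

def lam0 : ℝ := P.zinf ^ 2 * P.IM 0 - 2 * P.zinf * P.IM 1 + P.IM 2

def lam1 : ℝ := deriv (p2 P.k) P.zinf / (2 * p2 P.k P.zinf)

/-- The coefficients `A₁^±, A₂^±, A₃^±`, with `d = d^±`. -/
def coef1 (d : ℝ) : ℝ :=
  d / P.lam0 * (P.zinf * (P.lam1 * P.zinf - 2) * P.IM 1 + (1 - P.lam1 * P.zinf) * P.IM 2)

def coef2 (d : ℝ) : ℝ :=
  d / P.lam0 * (P.zinf * (2 - P.lam1 * P.zinf) * P.IM 0 + P.lam1 * P.IM 2)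

def coef3 (d : ℝ) : ℝ :=
  -(d / P.lam0) * ((1 - P.lam1 * P.zinf) * P.IM 0 + P.lam1 * P.IM 1)

/-- The two equations at `ζ_∞`. -/
def PoleEquations (d A₁ A₂ A₃ : ℝ) : Prop :=
  A₁ + P.zinf * A₂ + P.zinf ^ 2 * A₃ = d ∧
  A₂ + 2 * P.zinf * A₃ = d * deriv (p2 P.k) P.zinf / (2 * p2 P.k P.zinf)

/-- The equation expressing the vanishing of the integral over `l₁`. -/
def RightLoopEquation (A₁ A₂ A₃ : ℝ) : Prop :=
  A₁ * P.IM 0 + A₂ * P.IM 1 + A₃ * P.IM 2 = 0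

/-- The equation expressing the vanishing of the integral over `l₀`. -/
def LeftLoopEquation (A₁ A₂ A₃ : ℝ) : Prop :=
  A₁ * P.IP 0 - A₂ * P.IP 1 + A₃ * P.IP 2 = 0

/-- `A₀ = iA₀⁺ - A₀⁻`. -/
def A0 : ℂ := Complex.I * P.A0P - P.A0M

/-- `A_j = A_j⁺ - iA_j⁻`. -/
def A1 : ℂ := P.coef1 P.dP - Complex.I * P.coef1 P.dM
def A2 : ℂ := P.coef2 P.dP - Complex.I * P.coef2 P.dM
def A3 : ℂ := P.coef3 P.dP - Complex.I * P.coef3 P.dM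

/-! ### The explicit solution -/

def Fplus (ζ : ℂ) : ℂ :=
  1 / (ζ - P.zinf) ^ 2 * (Complex.I * P.A0P +
    (P.coef1 P.dP + P.coef2 P.dP * ζ + P.coef3 P.dP * ζ ^ 2) / branch P.k ζ)

def Fminus (ζ : ℂ) : ℂ :=
  1 / (ζ - P.zinf) ^ 2 * (P.A0M +
    Complex.I * (P.coef1 P.dM + P.coef2 P.dM * ζ + P.coef3 P.dM * ζ ^ 2) / branch P.k ζ)

/-- The derivative `ω'` of the map. -/
def omegaDeriv (ζ : ℂ) : ℂ :=
  1 / (2 * conj P.a * (ζ - P.zinf) ^ 2) *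
    (P.A0 + (P.A1 + P.A2 * ζ + P.A3 * ζ ^ 2) / branch P.k ζ)

/-- The integrand of the elliptic integral. -/
def ellipticIntegrand (ξ : ℂ) : ℂ :=
  (P.A1 + P.A2 * ξ + P.A3 * ξ ^ 2) / ((ξ - P.zinf) ^ 2 * branch P.k ξ)

/-- `ω` is given at every point `ζ` by
`(2ā)⁻¹ [-A₀/(ζ - ζ_∞) + ∫_{ζ₀}^ζ (A₁ + A₂ξ + A₃ξ²) / ((ξ - ζ_∞)² p₂^{1/2}(ξ)) dξ] + B`
with the integral taken along any `C¹` path from `ζ₀` to `ζ` in the slit domain that avoids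
`ζ_∞`. -/
def IsEllipticMap (ζ₀ B : ℂ) (ω : ℂ → ℂ) : Prop :=
  ∀ q : ℝ → ℂ, ContDiff ℝ 1 q → (∀ t ∈ Icc (0 : ℝ) 1, q t ∈ P.punctured) → q 0 = ζ₀ →
    ω (q 1) = 1 / (2 * conj P.a) * (-(P.A0 / (q 1 - P.zinf)) +
      ∫ t in (0 : ℝ)..1, P.ellipticIntegrand (q t) * deriv q t) + B

/-- The potential `ψ(ζ) = Ψ(ω(ζ))`. -/
def psi (ζ : ℂ) : ℂ := (P.Fplus ζ + P.Fminus ζ) / (2 * P.omegaDeriv ζ)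

/-- The image of the extended slit domain punctured at `ζ_∞`, where `d₀ = ω(∞)`. -/
def elasticDomain (ω : ℂ → ℂ) (d₀ : ℂ) : Set ℂ := insert d₀ (ω '' P.punctured)

/-! ### Counting zeros and poles -/

/-- Multiplicity of `ζ` as a zero of `ω'` (zero at the pole `ζ_∞`). -/
def zeroOrder (ζ : ℂ) : ℕ := (meromorphicOrderAt P.omegaDeriv ζ).untop₀.toNat

/-- Multiplicity of `ζ = ∞` as a zero of the derivative of `ω` with respect to the local
coordinate `t = 1/ζ`, which is `-ω'(1/t)/t²`. -/
def zeroOrderInf : ℕ :=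
  (meromorphicOrderAt (fun t : ℂ => -P.omegaDeriv t⁻¹ / t ^ 2) 0).untop₀.toNat

/-- The number `Z` of zeros of `ω'` in the extended slit domain, with multiplicities. -/
def Z : ℕ := (∑ᶠ ζ ∈ slitDomain P.k, P.zeroOrder ζ) + P.zeroOrderInf

/-- Multiplicity of `ζ` as a pole of `ψ`. -/
def poleOrder (ζ : ℂ) : ℕ := (-(meromorphicOrderAt P.psi ζ).untop₀).toNat

/-- Multiplicity of `ζ = ∞` as a pole of `ψ`. -/
def poleOrderInf : ℕ := (-(meromorphicOrderAt (fun t : ℂ => P.psi t⁻¹) 0).untop₀).toNat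

/-- `η^±(ξ) = ± i |p₂(ξ)|^{1/2} A₀ + A₁ + A₂ξ + A₃ξ²`; here `s = ±1`. -/
def etaSide (s : ℝ) (ξ : ℝ) : ℂ :=
  s * Complex.I * (√|p2 P.k ξ| : ℝ) * P.A0 + P.A1 + P.A2 * ξ + P.A3 * (ξ : ℂ) ^ 2

/-- `η₀^±(ξ) = ∓ i A₀ ξ (2ξ² - 1 - 1/k²) + |p₂(ξ)|^{1/2} (A₂ + 2A₃ξ)`; here `s = ±1`. -/
def eta0Side (s : ℝ) (ξ : ℝ) : ℂ :=
  -s * Complex.I * P.A0 * ξ * (2 * (ξ : ℂ) ^ 2 - 1 - 1 / (P.k : ℂ) ^ 2) +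
    (√|p2 P.k ξ| : ℝ) * (P.A2 + 2 * P.A3 * ξ)

/-- The integrand in the formula for `Z`. -/
def countIntegrand (ξ : ℝ) : ℂ :=
  (P.eta0Side (-1) ξ / P.etaSide (-1) ξ - P.eta0Side 1 ξ / P.etaSide 1 ξ) /
    (√|p2 P.k ξ| : ℝ)

end Data

end

end TwoCavities

/-! Everything is governed by one function. Let `quad` be the real quadratic with the coefficients
belonging to `d = 1`, and put `G = scale * quad / branch` with `scale = √|p₂(ζ_∞)|`. The two
equations at `ζ_∞` say that `G = -1 + O((ζ - ζ_∞)²)`; on the slits `G` is imaginary, with opposite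
values on the two sides. Since the coefficients are linear in `d`, the functions `F₊`, `F₋` and `ω'`
are all combinations of `1` and `G` divided by `(ζ - ζ_∞)²`. With `mb = conj (c b)` and `na = c *
conj a`, `ω'` is a multiple of `den / (ζ - ζ_∞)²`, where `den = mb (1 + G) - na (1 - G)`, and `γ` is
compared with `1` by comparing `‖mb‖` with `‖na‖`. The boundary conditions for `F₊`, `F₋` and `ψ`
become algebra with `conj G = -G`.

In the variable `u = 1 / (ζ - ζ_∞)` the function `G` turns into `-g`, where `g = E / R`, `E` is a
monic real quadratic and `R` is the square root of the quartic vanishing at the ends of the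
transformed slits. The structure `TwoSlits` isolates this situation. The period of `g` around the
right slit vanishes by the third linear equation. The left one vanishes because `g` has no residue
at infinity (`Y_a₀`), and this yields the fourth equation for the coefficients.

The central fact is `TwoSlits.Closed.g_re_pos`: `Re g > 0` off the slits. Vanishing periods and
Rolle's theorem put one root of `E` inside each slit. If `g = i t` at some point, then `E² + t² R² =
0` there; this real quartic has sign changes that account for four roots on the slits, so it has no
others. Hence `Re g` has no zeros, and its sign is seen far to the right. Integrating along
segments, as in the Noshiro-Warschawski theorem, the difference quotients of the primitive `H` of
`g` have nonnegative real part, boundary values included (`TwoSlits.Closed.quot`). A segment that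
crosses a slit meets a jump `2iY` with `Y ≥ 0`, which only helps.

The map is `ω = α u + β H + C`, and `Re (α conj β)` has the sign of `1 - γ`. If two values of `ω`
agree, then `α + β q = 0` for a difference quotient `q`, so `Re (α conj β) + |β|² Re q = 0`. For `γ
≤ 1` this is impossible unless both points lie on one slit, which gives injectivity and disjoint
contours; properness of `ω` then identifies the boundary of the image. For `γ < 1` boundary points
of one slit are separated too, and the contours are simple and regular. For `γ = 1` the number `α
conj β` is imaginary, and since `Re H` is constant along a slit, each contour lies on a line.

For `γ < 1` the function `ψ`, written as a quotient without poles up to the slit ends, descends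
through the closed map `ω` to a potential `Ψ` continuous on the closed elastic domain. On a contour
with tangent `L'` it satisfies `Ψ L' = -a conj L'`, which is the prescription of the three stress
components.

Uniqueness of the Schwarz pair follows by reflection in the real axis: a homogeneous solution is `C
/ branch` with a real constant `C`, by Morera and Liouville, and the condition on one loop removes
the constants.

For `γ ≤ 1` there are no zeros of `ω'`, because `Re G < 0` makes `|1 + G| < |1 - G|`. For `γ > 1`
the zeros are the points where `G = crit`, with `Re crit < 0`. There `p₂ (G² - crit²)` is a
polynomial of degree at most four, the factor `G + crit` has no zeros, there are no roots on the
slits, and a defect of the degree is a zero at infinity; so `Z = 4`. In the integral formula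
constant multiples of `η^±` stay in the slit plane along a whole slit, so principal logarithms give
a primitive. -/

namespace TwoCavities

noncomputable section

/-! ### Square roots in the closed upper half-plane -/

/-- The continuous square root on the closed upper half-plane with values in the closed first
quadrant, extended evenly with respect to conjugation. -/
def upperSqrt (w : ℂ) : ℂ :=
  (√((‖w‖ + w.re) / 2) : ℝ) + (√((‖w‖ - w.re) / 2) : ℝ) * Complex.I

theorem continuous_upperSqrt : Continuous upperSqrt := by
  unfold upperSqrt; fun_prop

theorem upperSqrt_re (w : ℂ) : (upperSqrt w).re = √((‖w‖ + w.re) / 2) := by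
  simp [upperSqrt]

theorem upperSqrt_im (w : ℂ) : (upperSqrt w).im = √((‖w‖ - w.re) / 2) := by
  simp [upperSqrt]

theorem upperSqrt_conj (w : ℂ) : upperSqrt (conj w) = upperSqrt w := by
  simp [upperSqrt]

theorem upperSqrt_sq {w : ℂ} (hw : 0 ≤ w.im) : upperSqrt w ^ 2 = w := by
  have h1 := Complex.abs_re_le_norm w
  have h2 : 0 ≤ (‖w‖ + w.re) / 2 := by linarith [neg_abs_le w.re]
  have h3 : 0 ≤ (‖w‖ - w.re) / 2 := by linarith [le_abs_self w.re]
  have h4 : ‖w‖ ^ 2 = w.re ^ 2 + w.im ^ 2 := by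
    rw [← Complex.normSq_eq_norm_sq, Complex.normSq_apply]; ring
  apply Complex.ext
  · rw [pow_two, Complex.mul_re, upperSqrt_re, upperSqrt_im, Real.mul_self_sqrt h2,
      Real.mul_self_sqrt h3]; ring
  · rw [pow_two, Complex.mul_im, upperSqrt_re, upperSqrt_im,
      mul_comm (√((‖w‖ - w.re) / 2)), ← two_mul, ← Real.sqrt_mul h2]
    have : (‖w‖ + w.re) / 2 * ((‖w‖ - w.re) / 2) = (w.im / 2) ^ 2 := by nlinarith
    rw [this, Real.sqrt_sq (by linarith)]; ring

theorem upperSqrt_re_nonneg (w : ℂ) : 0 ≤ (upperSqrt w).re := by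
  rw [upperSqrt_re]; positivity

theorem upperSqrt_im_nonneg (w : ℂ) : 0 ≤ (upperSqrt w).im := by
  rw [upperSqrt_im]; positivity

theorem upperSqrt_re_pos {w : ℂ} (hw : 0 < w.im) : 0 < (upperSqrt w).re := by
  refine lt_of_le_of_ne (upperSqrt_re_nonneg w) fun h => ?_
  have := congrArg Complex.im (upperSqrt_sq hw.le)
  rw [pow_two, Complex.mul_im, ← h] at this
  simp at this; linarith

theorem upperSqrt_im_pos {w : ℂ} (hw : 0 < w.im) : 0 < (upperSqrt w).im := by
  refine lt_of_le_of_ne (upperSqrt_im_nonneg w) fun h => ?_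
  have := congrArg Complex.im (upperSqrt_sq hw.le)
  rw [pow_two, Complex.mul_im, ← h] at this
  simp at this; linarith

theorem norm_upperSqrt (w : ℂ) : ‖upperSqrt w‖ = √‖w‖ := by
  wlog h : 0 ≤ w.im generalizing w
  · have := this (conj w) (by simp; linarith)
    rwa [upperSqrt_conj, RCLike.norm_conj] at this
  rw [eq_comm, Real.sqrt_eq_iff_mul_self_eq (norm_nonneg _) (norm_nonneg _), ← norm_mul, ← pow_two,
    upperSqrt_sq h]

theorem upperSqrt_eq_zero {w : ℂ} : upperSqrt w = 0 ↔ w = 0 := by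
  rw [← norm_eq_zero, norm_upperSqrt, Real.sqrt_eq_zero (norm_nonneg _), norm_eq_zero]

theorem upperSqrt_ofReal_nonneg {x : ℝ} (hx : 0 ≤ x) : upperSqrt x = (√x : ℝ) := by
  simp [upperSqrt, abs_of_nonneg hx]

theorem upperSqrt_ofReal_nonpos {x : ℝ} (hx : x ≤ 0) : upperSqrt x = (√(-x) : ℝ) * Complex.I := by
  have : (-x - x) / 2 = -x := by ring
  simp [upperSqrt, abs_of_nonpos hx, this]

theorem upperSqrt_eq_sqrt {w : ℂ} (hw : 0 ≤ w.im) : upperSqrt w = w ^ (1 / 2 : ℂ) := by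
  have := Complex.sqrt_eq_real_add_ite (a := w)
  rw [if_pos hw, Complex.sqrt] at this
  rw [one_div, this, upperSqrt, one_mul]

theorem half_cpow_of_sq_eq {w x : ℂ} (h : w ^ 2 = x) (hw : 0 < w.re) : x ^ (1 / 2 : ℂ) = w := by
  rw [← h, one_div]; exact Complex.sq_cpow_two_inv hw

theorem half_cpow_conj {w : ℂ} (hw : w ∈ Complex.slitPlane) :
    conj w ^ (1 / 2 : ℂ) = conj (w ^ (1 / 2 : ℂ)) := by
  have := Complex.cpow_conj w (1 / 2) (Complex.slitPlane_arg_ne_pi hw)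
  simp only [map_div₀, map_one, Complex.conj_ofNat] at this
  rw [this, Complex.conj_conj]

theorem half_cpow_sq (w : ℂ) : (w ^ (1 / 2 : ℂ)) ^ 2 = w := by
  rw [← Complex.cpow_nat_mul]; norm_num

theorem half_cpow_ofReal {x : ℝ} (hx : 0 ≤ x) : (x : ℂ) ^ (1 / 2 : ℂ) = (√x : ℝ) := by
  rw [← upperSqrt_eq_sqrt (by simp), upperSqrt_ofReal_nonneg hx]

/-- Quotients of the upper square roots of `u - a` and `u - b` for `a < b` lie in the fourth
quadrant. -/
theorem upperSqrt_div_re_pos {w₁ w₂ : ℂ} (h1 : 0 < w₁.im) (h2 : 0 < w₂.im) :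
    0 < (upperSqrt w₁ / upperSqrt w₂).re := by
  have a1 := upperSqrt_re_pos h1
  have a2 := upperSqrt_im_pos h1
  have b1 := upperSqrt_re_pos h2
  have b2 := upperSqrt_im_pos h2
  have hn : 0 < Complex.normSq (upperSqrt w₂) := by
    rw [Complex.normSq_pos]; intro h; rw [h] at b1; simp at b1
  rw [Complex.div_re]; positivity

/-! ### The square root of a quadratic polynomial, cut along a real segment -/

/-- The segment `[a, b]` of the real axis as a subset of the plane. -/
def realSeg (a b : ℝ) : Set ℂ := (fun x : ℝ => (x : ℂ)) '' Icc a b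

theorem mem_realSeg {a b : ℝ} {u : ℂ} : u ∈ realSeg a b ↔ u.im = 0 ∧ a ≤ u.re ∧ u.re ≤ b := by
  constructor
  · rintro ⟨x, hx, rfl⟩; simpa using hx
  · rintro ⟨h, h1, h2⟩; exact ⟨u.re, ⟨h1, h2⟩, Complex.ext rfl h.symm⟩

theorem isClosed_realSeg (a b : ℝ) : IsClosed (realSeg a b) :=
  (isCompact_Icc.image Complex.continuous_ofReal).isClosed

theorem conj_notMem_realSeg {a b : ℝ} {u : ℂ} (h : u ∉ realSeg a b) : conj u ∉ realSeg a b := by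
  simpa [mem_realSeg] using h

/-- The branch of `√((u - a)(u - b))` cut along `[a, b]` with `~ u` at infinity. -/
def slitSqrt (a b : ℝ) (u : ℂ) : ℂ := (u - b) * ((u - a) / (u - b)) ^ (1 / 2 : ℂ)

section slitSqrt

variable {a b : ℝ} {u : ℂ}

theorem ne_of_notMem_realSeg (hab : a ≤ b) (hu : u ∉ realSeg a b) : u - a ≠ 0 ∧ u - b ≠ 0 := by
  constructor <;> intro h <;> rw [sub_eq_zero] at h <;> apply hu <;> rw [mem_realSeg, h] <;> simp [hab]

/-- The cut of the principal root is pulled back by the Möbius map `u ↦ (u - a) / (u - b)` into the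
segment: a nonpositive quotient forces `u` to be real and between `a` and `b`. -/
theorem quot_mem_slitPlane (hab : a < b) (hu : u ∉ realSeg a b) :
    (u - a) / (u - b) ∈ Complex.slitPlane := by
  obtain ⟨h1, h2⟩ := ne_of_notMem_realSeg hab.le hu
  rw [Complex.mem_slitPlane_iff_not_le_zero]
  intro hle
  obtain ⟨hr, hi⟩ := Complex.le_def.1 hle
  set w := (u - a) / (u - b) with hw
  have hw' : w * (u - b) = u - a := by rw [hw]; field_simp
  have e1 := congrArg Complex.re hw'
  have e2 := congrArg Complex.im hw'
  simp only [Complex.mul_re, Complex.mul_im, Complex.sub_re, Complex.sub_im, Complex.ofReal_re,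
    Complex.ofReal_im, Complex.zero_re, Complex.zero_im] at e1 e2 hr hi
  rw [hi] at e1 e2
  have hi0 : u.im = 0 := by nlinarith [mul_self_nonneg u.im]
  apply hu
  rw [mem_realSeg]
  refine ⟨hi0, ?_, ?_⟩ <;> nlinarith

theorem slitSqrt_sq (hab : a ≤ b) (hu : u ∉ realSeg a b) :
    slitSqrt a b u ^ 2 = (u - a) * (u - b) := by
  have h2 := (ne_of_notMem_realSeg hab hu).2
  rw [slitSqrt, mul_pow, half_cpow_sq]; field_simp

theorem slitSqrt_ne_zero (hab : a ≤ b) (hu : u ∉ realSeg a b) : slitSqrt a b u ≠ 0 := by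
  obtain ⟨h1, h2⟩ := ne_of_notMem_realSeg hab hu
  intro h
  have := slitSqrt_sq hab hu
  rw [h] at this
  exact mul_ne_zero h1 h2 (by rw [← this]; simp)

theorem differentiableAt_slitSqrt (hab : a < b) (hu : u ∉ realSeg a b) :
    DifferentiableAt ℂ (slitSqrt a b) u := by
  have h2 := (ne_of_notMem_realSeg hab.le hu).2
  unfold slitSqrt
  refine DifferentiableAt.mul (by fun_prop) (DifferentiableAt.cpow_const ?_ ?_)
  · exact DifferentiableAt.div (by fun_prop) (by fun_prop) h2
  · exact quot_mem_slitPlane hab hu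

theorem slitSqrt_conj (hab : a < b) (hu : u ∉ realSeg a b) :
    slitSqrt a b (conj u) = conj (slitSqrt a b u) := by
  unfold slitSqrt
  rw [map_mul, ← half_cpow_conj (quot_mem_slitPlane hab hu)]
  simp

/-- The quotient of the two upper square roots squares to `(u - a) / (u - b)` and has positive real
part, which singles it out as the principal root. -/
theorem slitSqrt_eq_upper (hab : a < b) (hu : u ∉ realSeg a b) (him : 0 ≤ u.im) :
    slitSqrt a b u = upperSqrt (u - a) * upperSqrt (u - b) := by
  obtain ⟨h1, h2⟩ := ne_of_notMem_realSeg hab.le hu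
  have ha : (u - a).im = u.im := by simp
  have hb : (u - b).im = u.im := by simp
  have hq : ((upperSqrt (u - a)) / upperSqrt (u - b)) ^ 2 = (u - a) / (u - b) := by
    rw [div_pow, upperSqrt_sq (ha ▸ him), upperSqrt_sq (hb ▸ him)]
  have hb0 : upperSqrt (u - b) ≠ 0 := by rwa [Ne, upperSqrt_eq_zero]
  have hre : 0 < ((upperSqrt (u - a)) / upperSqrt (u - b)).re := by
    rcases him.lt_or_eq with h | h
    · exact upperSqrt_div_re_pos (ha ▸ h) (hb ▸ h)
    · obtain ⟨x, rfl⟩ : ∃ x : ℝ, u = x := ⟨u.re, Complex.ext rfl (by simpa using h.symm)⟩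
      have hx : x < a ∨ b < x := by
        by_contra! hc; exact hu (mem_realSeg.2 (by simpa using hc))
      rcases hx with hx | hx
      · rw [← Complex.ofReal_sub, ← Complex.ofReal_sub, upperSqrt_ofReal_nonpos (by linarith),
          upperSqrt_ofReal_nonpos (by linarith), mul_div_mul_right _ _ Complex.I_ne_zero,
          ← Complex.ofReal_div, Complex.ofReal_re]
        exact div_pos (Real.sqrt_pos.2 (by linarith)) (Real.sqrt_pos.2 (by linarith))
      · rw [← Complex.ofReal_sub, ← Complex.ofReal_sub, upperSqrt_ofReal_nonneg (by linarith),
          upperSqrt_ofReal_nonneg (by linarith), ← Complex.ofReal_div, Complex.ofReal_re]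
        exact div_pos (Real.sqrt_pos.2 (by linarith)) (Real.sqrt_pos.2 (by linarith))
  rw [slitSqrt, half_cpow_of_sq_eq hq hre]
  have : u - b = upperSqrt (u - b) ^ 2 := (upperSqrt_sq (hb ▸ him)).symm
  nth_rw 1 [this]
  field_simp

end slitSqrt

/-! ### Connectedness -/

/-- A convex open set with a set of real points removed is connected, if a real point is left. -/
theorem isPreconnected_diff_of_real {W K : Set ℂ} (hW : Convex ℝ W) (hWo : IsOpen W)
    (hK : ∀ w ∈ K, w.im = 0) {x₀ : ℂ} (hx₀ : x₀ ∈ W) (hx₀K : x₀ ∉ K) (hx₀r : x₀.im = 0) :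
    IsPreconnected (W \ K) := by
  set A : Set ℂ := insert x₀ (W ∩ {w | w.im ≠ 0}) with hA
  -- A segment from the real point `x₀` to a nonreal point leaves the real axis at once, so `A` is
  -- star-shaped about `x₀`. The set in question lies between `A` and its closure.
  have hstar : StarConvex ℝ x₀ A := by
    rw [starConvex_iff_forall_pos (by simp [hA])]
    intro y hy p q hp hq hpq
    rcases hy with rfl | ⟨hyW, hy⟩
    · rw [← add_smul, hpq, one_smul]; exact mem_insert _ _
    · refine Or.inr ⟨hW hx₀ hyW hp.le hq.le hpq, ?_⟩
      simp only [mem_ofPred_eq] at hy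
      simp [hx₀r, hq.ne', hy]
  have hAc : IsPreconnected A := (hstar.isPathConnected (mem_insert _ _)).isConnected.isPreconnected
  refine hAc.subset_closure ?_ ?_
  · rintro y (rfl | ⟨hyW, hy⟩)
    · exact ⟨hx₀, hx₀K⟩
    · exact ⟨hyW, fun h => hy (hK y h)⟩
  · rintro w ⟨hw, -⟩
    by_cases him : w.im = 0
    · have ht : Tendsto (fun ε : ℝ => w + ε * Complex.I) (𝓝[>] 0) (𝓝 w) := by
        have : Continuous fun ε : ℝ => w + ε * Complex.I := by fun_prop
        have h := this.tendsto 0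
        simp only [Complex.ofReal_zero, zero_mul, add_zero] at h
        exact h.mono_left nhdsWithin_le_nhds
      refine mem_closure_of_tendsto ht ?_
      filter_upwards [ht.eventually (hWo.mem_nhds hw), self_mem_nhdsWithin] with ε h1 h2
      refine Or.inr ⟨h1, ?_⟩
      simp only [mem_ofPred_eq, Complex.add_im, him, Complex.mul_im, Complex.ofReal_re,
        Complex.I_im, Complex.ofReal_im, Complex.I_re]
      simpa using (ne_of_gt h2)
    · exact subset_closure (Or.inr ⟨hw, him⟩)

/-! ### Primitives on the upper half-plane and their boundary values -/

/-- The open upper half-plane. -/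
abbrev upperHalf : Set ℂ := {u | 0 < u.im}

/-- The closed upper half-plane. -/
abbrev closedUpperHalf : Set ℂ := {u | 0 ≤ u.im}

theorem isOpen_upperHalf : IsOpen upperHalf := isOpen_lt continuous_const Complex.continuous_im

theorem convex_upperHalf : Convex ℝ upperHalf := convex_halfSpace_im_gt 0

theorem closure_upperHalf : closure upperHalf = closedUpperHalf := Complex.closure_setOfPred_lt_im 0

theorem nhdsWithin_upperHalf_neBot (x : ℝ) : (𝓝[upperHalf] (x : ℂ)).NeBot := by
  rw [← mem_closure_iff_nhdsWithin_neBot, closure_upperHalf]; simp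

section primitive

variable {H g : ℂ → ℂ}

/-- The comparison function `2C(√y - √y₁)` has derivative `C / √y`: a blow-up of order `-1/2` at the
axis is integrable along verticals. -/
theorem norm_vertical_sub_le (hH : ∀ u ∈ upperHalf, HasDerivAt H (g u) u) {x y₁ y₂ C : ℝ}
    (h1 : 0 < y₁) (h12 : y₁ ≤ y₂)
    (hb : ∀ y ∈ Icc y₁ y₂, ‖g (x + y * Complex.I)‖ ≤ C / √y) :
    ‖H (x + y₂ * Complex.I) - H (x + y₁ * Complex.I)‖ ≤ 2 * C * √y₂ := by
  have hC : 0 ≤ C := by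
    have := (norm_nonneg _).trans (hb y₁ ⟨le_rfl, h12⟩)
    by_contra! hc
    exact absurd this (not_le.2 (div_neg_of_neg_of_pos hc (Real.sqrt_pos.2 h1)))
  have hd : ∀ y : ℝ, 0 < y → HasDerivAt (fun y : ℝ => H (x + y * Complex.I) - H (x + y₁ * Complex.I))
      (g (x + y * Complex.I) * Complex.I) y := by
    intro y hy
    have h0 : HasDerivAt (fun y : ℝ => (x + y * Complex.I : ℂ)) Complex.I y := by
      simpa using ((Complex.ofRealCLM.hasDerivAt (x := y)).mul_const Complex.I).const_add (x : ℂ)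
    exact ((hH _ (by simpa using hy)).comp y h0).sub_const _
  have key := image_norm_le_of_norm_deriv_right_le_deriv_boundary'
    (f := fun y : ℝ => H (x + y * Complex.I) - H (x + y₁ * Complex.I))
    (f' := fun y : ℝ => g (x + y * Complex.I) * Complex.I) (a := y₁) (b := y₂)
    (B := fun y => 2 * C * (√y - √y₁)) (B' := fun y => C / √y)
    (fun y hy => (hd y (h1.trans_le hy.1)).continuousAt.continuousWithinAt)
    (fun y hy => (hd y (h1.trans_le hy.1)).hasDerivWithinAt) (by simp)
    (fun y hy => ((continuous_const.mul (Real.continuous_sqrt.sub continuous_const))).continuousWithinAt)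
    (fun y hy => by
      have hy0 : 0 < y := h1.trans_le hy.1
      have h := (((Real.hasDerivAt_sqrt hy0.ne').sub_const (√y₁)).const_mul (2 * C)).hasDerivWithinAt
        (s := Ici y)
      have e : C / √y = 2 * C * (1 / (2 * √y)) := by
        have := (Real.sqrt_pos.2 hy0).ne'
        field_simp
      rw [e]; exact h)
    (fun y hy => by
      rw [norm_mul, Complex.norm_I, mul_one]; exact hb y ⟨hy.1, hy.2.le⟩)
  refine (key ⟨h12, le_rfl⟩).trans ?_
  have : 0 ≤ 2 * C * √y₁ := by positivity
  linarith

theorem norm_horizontal_sub_le (hH : ∀ u ∈ upperHalf, HasDerivAt H (g u) u) {x₁ x₂ y M : ℝ}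
    (hy : 0 < y) (hb : ∀ x ∈ uIcc x₁ x₂, ‖g (x + y * Complex.I)‖ ≤ M) :
    ‖H (x₂ + y * Complex.I) - H (x₁ + y * Complex.I)‖ ≤ M * |x₂ - x₁| := by
  have hd : ∀ x : ℝ, HasDerivAt (fun x : ℝ => H (x + y * Complex.I)) (g (x + y * Complex.I)) x := by
    intro x
    have h0 : HasDerivAt (fun x : ℝ => (x + y * Complex.I : ℂ)) 1 x := by
      simpa using (Complex.ofRealCLM.hasDerivAt (x := x)).add_const (y * Complex.I : ℂ)
    have h := (hH _ (by simpa using hy)).comp x h0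
    rw [mul_one] at h
    exact h
  have := (convex_uIcc x₁ x₂).norm_image_sub_le_of_norm_hasDerivWithin_le
    (fun x _ => (hd x).hasDerivWithinAt) hb left_mem_uIcc right_mem_uIcc
  simpa using this

/-- Cauchy criterion. A point at distance less than `h` from `x₀` is joined to `x₀ + ih` by rising
to height `h` and then moving across; the two legs cost at most `2C√h` and `C√h`. -/
theorem exists_tendsto_of_norm_deriv_le (hH : ∀ u ∈ upperHalf, HasDerivAt H (g u) u) {x₀ r C : ℝ}
    (hr : 0 < r) (hb : ∀ u ∈ Metric.ball (x₀ : ℂ) r, 0 < u.im → ‖g u‖ ≤ C / √u.im) :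
    ∃ y, Tendsto H (𝓝[upperHalf] (x₀ : ℂ)) (𝓝 y) := by
  have hne := nhdsWithin_upperHalf_neBot x₀
  have hC : 0 ≤ C := by
    have h := hb (x₀ + (r / 2 : ℝ) * Complex.I) (by simp [abs_of_pos hr]; linarith) (by simpa using hr)
    have := (norm_nonneg _).trans h
    by_contra! hc
    refine absurd this (not_le.2 (div_neg_of_neg_of_pos hc (Real.sqrt_pos.2 ?_)))
    simpa using hr
  have hest : ∀ h, 0 < h → h < r / 2 → ∀ u ∈ upperHalf ∩ Metric.ball (x₀ : ℂ) h,
      ‖H u - H (x₀ + h * Complex.I)‖ ≤ 3 * C * √h := by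
    rintro h h0 hhr u ⟨hu, hub⟩
    have hu' : 0 < u.im := hu
    rw [Metric.mem_ball, Complex.dist_eq] at hub
    have hre : |u.re - x₀| < h := by
      have := (Complex.abs_re_le_norm (u - x₀)).trans_lt hub; simpa using this
    have him : u.im < h := by
      have := (Complex.abs_im_le_norm (u - x₀)).trans_lt hub
      simp at this; exact (le_abs_self _).trans_lt this
    have hin : ∀ x y : ℝ, |x - x₀| < h → 0 < y → y ≤ h →
        ‖g (x + y * Complex.I)‖ ≤ C / √y := by
      intro x y hx hy hyh
      have := hb (x + y * Complex.I) (by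
        rw [Metric.mem_ball, Complex.dist_eq]
        refine (Complex.norm_le_abs_re_add_abs_im _).trans_lt ?_
        simp [abs_of_pos hy]; linarith) (by simpa using hy)
      simpa using this
    have e1 := norm_vertical_sub_le hH (x := u.re) (C := C) hu' him.le
      (fun y hy => hin _ _ hre (hu'.trans_le hy.1) hy.2)
    have e2 := norm_horizontal_sub_le hH (x₁ := x₀) (x₂ := u.re) (M := C / √h) h0
      (fun x hx => by
        refine hin _ _ ?_ h0 le_rfl
        refine lt_of_le_of_lt ?_ hre
        rcases le_total x₀ u.re with hxx | hxx
        · rw [uIcc_of_le hxx] at hx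
          rw [abs_of_nonneg (by linarith [hx.1]), abs_of_nonneg (by linarith)]; linarith [hx.2]
        · rw [uIcc_of_ge hxx] at hx
          rw [abs_of_nonpos (by linarith [hx.2]), abs_of_nonpos (by linarith)]; linarith [hx.1])
    rw [Complex.re_add_im] at e1
    have e3 : C / √h * |u.re - x₀| ≤ C * √h := by
      calc C / √h * |u.re - x₀| ≤ C / √h * h := by gcongr
        _ = C * √h := by
          rw [div_mul_eq_mul_div, mul_div_assoc, Real.div_sqrt]
    calc ‖H u - H (x₀ + h * Complex.I)‖
        = ‖(H (u.re + h * Complex.I) - H (x₀ + h * Complex.I)) -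
            (H (u.re + h * Complex.I) - H u)‖ := by congr 1; ring
      _ ≤ _ := norm_sub_le _ _
      _ ≤ 3 * C * √h := by linarith
  have hcauchy : Cauchy (map H (𝓝[upperHalf] (x₀ : ℂ))) := by
    rw [Metric.cauchy_iff]
    refine ⟨inferInstance, fun ε hε => ?_⟩
    obtain ⟨h, h0, hhr, hhe⟩ : ∃ h, 0 < h ∧ h < r / 2 ∧ 3 * C * √h < ε / 2 := by
      have ht : Tendsto (fun h : ℝ => 3 * C * √h) (𝓝[>] 0) (𝓝 0) := by
        have : Continuous fun h : ℝ => 3 * C * √h := by fun_prop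
        have := this.tendsto 0
        simp only [Real.sqrt_zero, mul_zero] at this
        exact this.mono_left nhdsWithin_le_nhds
      have e1 := ht.eventually (gt_mem_nhds (half_pos hε))
      have e2 : ∀ᶠ h : ℝ in 𝓝[>] 0, h < r / 2 :=
        nhdsWithin_le_nhds (gt_mem_nhds (half_pos hr))
      obtain ⟨h, ⟨h1, h2⟩, h3⟩ := ((e1.and e2).and self_mem_nhdsWithin).exists
      exact ⟨h, h3, h2, h1⟩
    refine ⟨H '' (upperHalf ∩ Metric.ball (x₀ : ℂ) h), image_mem_map
      (inter_mem self_mem_nhdsWithin (mem_nhdsWithin_of_mem_nhds (Metric.ball_mem_nhds _ h0))), ?_⟩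
    rintro _ ⟨u, hu, rfl⟩ _ ⟨w, hw, rfl⟩
    have e1 := hest h h0 hhr u hu
    have e2 := hest h h0 hhr w hw
    rw [← dist_eq_norm] at e1 e2
    linarith [dist_triangle_right (H u) (H w) (H (x₀ + h * Complex.I))]
  exact CompleteSpace.complete hcauchy

/-- A holomorphic function on the upper half-plane which near the real axis is locally
`O(1 / √(im u))` has a primitive that is continuous on the closed half-plane. -/
theorem exists_primitive_closedUpperHalf (hg : DifferentiableOn ℂ g upperHalf)
    (hb : ∀ x₀ : ℝ, ∃ r C : ℝ, 0 < r ∧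
      ∀ u ∈ Metric.ball (x₀ : ℂ) r, 0 < u.im → ‖g u‖ ≤ C / √u.im) :
    ∃ F : ℂ → ℂ, F 0 = 0 ∧ ContinuousOn F closedUpperHalf ∧
      ∀ u ∈ upperHalf, HasDerivAt F (g u) u := by
  obtain ⟨F₀, hF₀⟩ := convex_upperHalf.exists_forall_hasDerivWithinAt hg
  have hF : ∀ u ∈ upperHalf, HasDerivAt F₀ (g u) u := fun u hu =>
    (hF₀ u hu).hasDerivAt (isOpen_upperHalf.mem_nhds hu)
  have hlim : ∀ u ∈ closedUpperHalf, ∃ y, Tendsto F₀ (𝓝[upperHalf] u) (𝓝 y) := by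
    intro u hu
    rcases (show 0 ≤ u.im from hu).lt_or_eq with h | h
    · exact ⟨F₀ u, (hF u h).continuousAt.continuousWithinAt⟩
    · obtain ⟨r, C, hr, hC⟩ := hb u.re
      have := exists_tendsto_of_norm_deriv_le hF hr hC
      have hu' : (u.re : ℂ) = u := Complex.ext rfl (by simpa using h)
      rwa [hu'] at this
  have hcont := continuousOn_extendFrom (closure_upperHalf ▸ Subset.rfl) hlim
  set F₁ := extendFrom upperHalf F₀ with hF₁
  have heq : ∀ u ∈ upperHalf, F₁ u = F₀ u := fun u hu =>
    extendFrom_eq (subset_closure hu) (hF u hu).continuousAt.continuousWithinAt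
  refine ⟨fun u => F₁ u - F₁ 0, sub_self _, hcont.sub continuousOn_const, fun u hu => ?_⟩
  refine ((hF u hu).congr_of_eventuallyEq ?_).sub_const _
  filter_upwards [isOpen_upperHalf.mem_nhds hu] with w hw using heq w hw

/-- On a convex set, a limit of the derivative at a boundary point is the derivative of the
continuous extension there. The result is available for real Fréchet derivatives and is read back as
a complex derivative. -/
theorem hasDerivWithinAt_closedUpperHalf {F : ℂ → ℂ} (hc : ContinuousOn F closedUpperHalf)
    (hF : ∀ u ∈ upperHalf, HasDerivAt F (g u) u) {x : ℂ} {l : ℂ}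
    (hl : Tendsto g (𝓝[upperHalf] x) (𝓝 l)) : HasDerivWithinAt F l closedUpperHalf x := by
  have h := hasFDerivWithinAt_closure_of_tendsto_fderiv (f := F) (s := upperHalf) (x := x)
    (f' := ContinuousLinearMap.restrictScalars ℝ (ContinuousLinearMap.toSpanSingleton ℂ l))
    (fun u hu => ((hF u hu).differentiableAt.restrictScalars ℝ).differentiableWithinAt)
    convex_upperHalf isOpen_upperHalf
    (fun y hy => (hc y (closure_upperHalf ▸ hy)).mono (fun u (hu : 0 < u.im) => hu.le)) ?_
  · rw [closure_upperHalf] at h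
    rw [hasDerivWithinAt_iff_hasFDerivWithinAt, hasFDerivWithinAt_iff_isLittleO] 
    rw [hasFDerivWithinAt_iff_isLittleO] at h
    exact h
  · have hcl : Continuous fun w : ℂ =>
        ContinuousLinearMap.restrictScalars ℝ (ContinuousLinearMap.toSpanSingleton ℂ w) := by
      have h1 : Continuous fun w : ℂ => ContinuousLinearMap.toSpanSingleton ℂ w :=
        (ContinuousLinearMap.toSpanSingletonCLE (𝕜 := ℂ) (E := ℂ)).continuous
      exact (ContinuousLinearMap.continuous_restrictScalars ℝ).comp h1
    refine ((hcl.tendsto l).comp hl).congr' ?_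
    filter_upwards [self_mem_nhdsWithin] with u hu
    have := (hF u hu).hasFDerivAt.restrictScalars ℝ
    exact this.fderiv.symm

end primitive

/-! ### A quartic with four real roots -/

/-- If the zeros of the quadratic `c(x-y₀)(x-y₁)` lie in the intervals `(v₁,v₂)` and `(v₃,v₄)`, then
for `t > 0` the quartic `c²(x-y₀)²(x-y₁)² + t(x-v₁)(x-v₂)(x-v₃)(x-v₄)` has exactly four complex
roots, two in each of the intervals, separated by `y₀` and `y₁`. -/
theorem exists_quartic_roots {v₁ v₂ v₃ v₄ y₀ y₁ c t : ℝ} (h1 : v₁ < y₀) (h2 : y₀ < v₂)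
    (h23 : v₂ < v₃) (h3 : v₃ < y₁) (h4 : y₁ < v₄) (hc : c ≠ 0) (ht : 0 < t) :
    ∃ r₁ ∈ Ioo v₁ y₀, ∃ r₂ ∈ Ioo y₀ v₂, ∃ r₃ ∈ Ioo v₃ y₁, ∃ r₄ ∈ Ioo y₁ v₄, ∀ u : ℂ,
      (c * (u - y₀) * (u - y₁)) ^ 2 + t * ((u - v₁) * (u - v₂) * (u - v₃) * (u - v₄)) = 0 ↔
        u = r₁ ∨ u = r₂ ∨ u = r₃ ∨ u = r₄ := by
  set F : ℝ → ℝ := fun x =>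
    (c * (x - y₀) * (x - y₁)) ^ 2 + t * ((x - v₁) * (x - v₂) * (x - v₃) * (x - v₄)) with hF
  have hFc : Continuous F := by rw [hF]; fun_prop
  have hpos : ∀ x, (x - v₁) * (x - v₂) * (x - v₃) * (x - v₄) = 0 → x ≠ y₀ → x ≠ y₁ → 0 < F x := by
    intro x hx h h'
    have : c * (x - y₀) * (x - y₁) ≠ 0 :=
      mul_ne_zero (mul_ne_zero hc (sub_ne_zero.2 h)) (sub_ne_zero.2 h')
    simp only [hF, hx, mul_zero, add_zero]; positivity
  have p1 : 0 < F v₁ := hpos _ (by ring) (by linarith) (by linarith)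
  have p2 : 0 < F v₂ := hpos _ (by ring) (by linarith) (by linarith)
  have p3 : 0 < F v₃ := hpos _ (by ring) (by linarith) (by linarith)
  have p4 : 0 < F v₄ := hpos _ (by ring) (by linarith) (by linarith)
  -- At a zero of the quadratic only the quartic term survives, and it is negative between `v₁` and
  -- `v₂`.
  have n0 : F y₀ < 0 := by
    have : 0 < (y₀ - v₁) * (v₂ - y₀) * (v₃ - y₀) * (v₄ - y₀) :=
      mul_pos (mul_pos (mul_pos (by linarith) (by linarith)) (by linarith)) (by linarith)
    simp only [hF]; nlinarith
  have n1 : F y₁ < 0 := by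
    have : 0 < (y₁ - v₁) * (y₁ - v₂) * (y₁ - v₃) * (v₄ - y₁) :=
      mul_pos (mul_pos (mul_pos (by linarith) (by linarith)) (by linarith)) (by linarith)
    simp only [hF]; nlinarith
  obtain ⟨r₁, hr1, e1⟩ := intermediate_value_Ioo' h1.le hFc.continuousOn ⟨n0, p1⟩
  obtain ⟨r₂, hr2, e2⟩ := intermediate_value_Ioo h2.le hFc.continuousOn ⟨n0, p2⟩
  obtain ⟨r₃, hr3, e3⟩ := intermediate_value_Ioo' h3.le hFc.continuousOn ⟨n1, p3⟩
  obtain ⟨r₄, hr4, e4⟩ := intermediate_value_Ioo h4.le hFc.continuousOn ⟨n1, p4⟩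
  refine ⟨r₁, hr1, r₂, hr2, r₃, hr3, r₄, hr4, fun u => ⟨fun hu => ?_, ?_⟩⟩
  · by_contra! hne
    obtain ⟨m1, m2, m3, m4⟩ := hne
    open Polynomial in
    set P : ℂ[X] := (C (c : ℂ) * (X - C (y₀ : ℂ)) * (X - C (y₁ : ℂ))) ^ 2 +
      C (t : ℂ) * ((X - C (v₁ : ℂ)) * (X - C (v₂ : ℂ)) * (X - C (v₃ : ℂ)) * (X - C (v₄ : ℂ))) with hP
    have hev : ∀ w : ℂ, P.eval w = (c * (w - y₀) * (w - y₁)) ^ 2 +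
        t * ((w - v₁) * (w - v₂) * (w - v₃) * (w - v₄)) := by
      intro w; simp [hP]
    have hevr : ∀ x : ℝ, F x = 0 → P.eval (x : ℂ) = 0 := by
      intro x hx
      rw [hev, ← Complex.ofReal_zero, ← hx]; simp [hF]
    have hdeg : P.natDegree ≤ 4 := by rw [hP]; compute_degree
    have o12 : r₁ < r₂ := hr1.2.trans hr2.1
    have o23 : r₂ < r₃ := hr2.2.trans (h23.trans hr3.1)
    have o34 : r₃ < r₄ := hr3.2.trans hr4.1
    -- A fifth root would make a polynomial of degree at most four vanish identically, against its
    -- positive value at `v₁`.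
    have hcard : ({u, (r₁ : ℂ), (r₂ : ℂ), (r₃ : ℂ), (r₄ : ℂ)} : Finset ℂ).card = 5 := by
      rw [Finset.card_insert_of_notMem, Finset.card_insert_of_notMem,
        Finset.card_insert_of_notMem, Finset.card_pair]
      · exact_mod_cast o34.ne
      · simp only [Finset.mem_insert, Finset.mem_singleton, Complex.ofReal_inj, not_or]
        exact ⟨o23.ne, (o23.trans o34).ne⟩
      · simp only [Finset.mem_insert, Finset.mem_singleton, Complex.ofReal_inj, not_or]
        exact ⟨o12.ne, (o12.trans o23).ne, (o12.trans (o23.trans o34)).ne⟩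
      · simp only [Finset.mem_insert, Finset.mem_singleton, not_or]
        exact ⟨m1, m2, m3, m4⟩
    have h0 := Polynomial.eq_zero_of_natDegree_lt_card_of_eval_eq_zero' P
      {u, (r₁ : ℂ), (r₂ : ℂ), (r₃ : ℂ), (r₄ : ℂ)} (by
        intro i hi
        simp only [Finset.mem_insert, Finset.mem_singleton] at hi
        rcases hi with rfl | rfl | rfl | rfl | rfl
        exacts [(hev _).trans hu, hevr _ e1, hevr _ e2, hevr _ e3, hevr _ e4])
      (by rw [hcard]; omega)
    have : P.eval (v₁ : ℂ) = ((F v₁ : ℝ) : ℂ) := by rw [hev]; simp [hF]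
    rw [h0, Polynomial.eval_zero, eq_comm, Complex.ofReal_eq_zero] at this
    linarith
  · have hz : ∀ x : ℝ, F x = 0 → ((c * ((x : ℂ) - y₀) * (x - y₁)) ^ 2 +
        t * (((x : ℂ) - v₁) * (x - v₂) * (x - v₃) * (x - v₄)) = 0) := by
      intro x hx
      rw [← Complex.ofReal_zero, ← hx]; simp [hF]
    rintro (rfl | rfl | rfl | rfl)
    exacts [hz _ e1, hz _ e2, hz _ e3, hz _ e4]

theorem eq_of_hasDerivAt_zero {f : ℝ → ℝ} {a b : ℝ} (hab : a ≤ b) (hf : ContinuousOn f (Icc a b))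
    (hd : ∀ x ∈ Ioo a b, HasDerivAt f 0 x) : f a = f b := by
  rcases hab.lt_or_eq with h | rfl
  · obtain ⟨c, -, hc⟩ := exists_hasDerivAt_eq_slope f (fun _ => 0) h hf hd
    have := sub_ne_zero.2 h.ne'
    field_simp at hc
    linarith
  · rfl

/-! ### The plane with two real segments removed -/

/-- Two real segments on either side of the origin and a monic real quadratic polynomial. -/
structure TwoSlits where
  a₀ : ℝ
  b₀ : ℝ
  a₁ : ℝ
  b₁ : ℝ
  p : ℝ
  q : ℝ
  lt₀ : a₀ < b₀
  neg : b₀ < 0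
  pos : 0 < a₁
  lt₁ : a₁ < b₁

namespace TwoSlits

variable (S : TwoSlits)

/-- The union of the two segments. -/
def slits : Set ℂ := realSeg S.a₀ S.b₀ ∪ realSeg S.a₁ S.b₁

/-- The quadratic polynomial. -/
def E (u : ℂ) : ℂ := u ^ 2 + S.p * u + S.q

/-- The square root of the quartic polynomial with roots at the ends of the segments. -/
def R (u : ℂ) : ℂ := slitSqrt S.a₀ S.b₀ u * slitSqrt S.a₁ S.b₁ u

/-- The integrand. -/
def g (u : ℂ) : ℂ := S.E u / S.R u

/-- The values of `R` on the closed upper half-plane, extended evenly under conjugation. -/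
def Rup (u : ℂ) : ℂ :=
  upperSqrt (u - S.a₀) * upperSqrt (u - S.b₀) * (upperSqrt (u - S.a₁) * upperSqrt (u - S.b₁))

/-- The values of `g` on the closed upper half-plane. -/
def gUp (u : ℂ) : ℂ := S.E u / S.Rup u

/-- The quartic on the real axis. -/
def quartic (x : ℝ) : ℝ := (x - S.a₀) * (x - S.b₀) * ((x - S.a₁) * (x - S.b₁))

/-- The quadratic on the real axis. -/
def Er (x : ℝ) : ℝ := x ^ 2 + S.p * x + S.q

theorem E_ofReal (x : ℝ) : S.E x = (S.Er x : ℝ) := by simp [E, Er]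

theorem E_conj (u : ℂ) : S.E (conj u) = conj (S.E u) := by simp [E]

theorem continuous_E : Continuous S.E := by unfold E; fun_prop

theorem continuous_Rup : Continuous S.Rup := by
  have := continuous_upperSqrt
  unfold Rup; fun_prop

theorem isClosed_slits : IsClosed S.slits := (isClosed_realSeg _ _).union (isClosed_realSeg _ _)

theorem im_eq_zero_of_mem_slits {u : ℂ} (hu : u ∈ S.slits) : u.im = 0 := by
  rcases hu with h | h <;> exact (mem_realSeg.1 h).1

theorem notMem_slits {u : ℂ} (hu : u.im ≠ 0) : u ∉ S.slits := fun h =>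
  hu (S.im_eq_zero_of_mem_slits h)

theorem ofReal_mem_slits {x : ℝ} :
    (x : ℂ) ∈ S.slits ↔ x ∈ Icc S.a₀ S.b₀ ∨ x ∈ Icc S.a₁ S.b₁ := by
  simp [slits, mem_realSeg]

theorem zero_notMem_slits : (0 : ℂ) ∉ S.slits := by
  have := S.ofReal_mem_slits (x := 0)
  rw [Complex.ofReal_zero] at this
  rw [this]; rintro (h | h)
  · linarith [h.2, S.neg]
  · linarith [h.1, S.pos]

theorem conj_notMem_slits {u : ℂ} (hu : u ∉ S.slits) : conj u ∉ S.slits := by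
  simp only [slits, mem_union, not_or] at hu ⊢
  exact ⟨conj_notMem_realSeg hu.1, conj_notMem_realSeg hu.2⟩

theorem isPreconnected_compl_slits : IsPreconnected S.slitsᶜ := by
  have := isPreconnected_diff_of_real (W := univ) (K := S.slits) convex_univ isOpen_univ
    (fun w hw => S.im_eq_zero_of_mem_slits hw) (mem_univ 0) S.zero_notMem_slits rfl
  rwa [← compl_eq_univ_sdiff] at this

theorem R_eq_Rup {u : ℂ} (hu : u ∉ S.slits) (him : 0 ≤ u.im) : S.R u = S.Rup u := by
  simp only [slits, mem_union, not_or] at hu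
  rw [R, Rup, slitSqrt_eq_upper S.lt₀ hu.1 him, slitSqrt_eq_upper S.lt₁ hu.2 him]

theorem R_conj {u : ℂ} (hu : u ∉ S.slits) : S.R (conj u) = conj (S.R u) := by
  simp only [slits, mem_union, not_or] at hu
  rw [R, R, slitSqrt_conj S.lt₀ hu.1, slitSqrt_conj S.lt₁ hu.2, map_mul]

theorem Rup_conj (u : ℂ) : S.Rup (conj u) = S.Rup u := by
  have : ∀ a : ℝ, conj u - a = conj (u - a) := by simp
  simp only [Rup, this, upperSqrt_conj]

theorem R_ne_zero {u : ℂ} (hu : u ∉ S.slits) : S.R u ≠ 0 := by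
  simp only [slits, mem_union, not_or] at hu
  exact mul_ne_zero (slitSqrt_ne_zero S.lt₀.le hu.1) (slitSqrt_ne_zero S.lt₁.le hu.2)

theorem R_sq {u : ℂ} (hu : u ∉ S.slits) :
    S.R u ^ 2 = (u - S.a₀) * (u - S.b₀) * ((u - S.a₁) * (u - S.b₁)) := by
  simp only [slits, mem_union, not_or] at hu
  rw [R, mul_pow, slitSqrt_sq S.lt₀.le hu.1, slitSqrt_sq S.lt₁.le hu.2]

theorem Rup_eq_zero {u : ℂ} :
    S.Rup u = 0 ↔ u = S.a₀ ∨ u = S.b₀ ∨ u = S.a₁ ∨ u = S.b₁ := by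
  simp [Rup, upperSqrt_eq_zero, sub_eq_zero, or_assoc]

theorem Rup_ofReal_ne_zero {x : ℝ} (h : S.quartic x ≠ 0) : S.Rup x ≠ 0 := by
  rw [Ne, Rup_eq_zero]
  norm_cast
  rintro (rfl | rfl | rfl | rfl) <;> simp [quartic] at h

theorem differentiableAt_R {u : ℂ} (hu : u ∉ S.slits) : DifferentiableAt ℂ S.R u := by
  simp only [slits, mem_union, not_or] at hu
  exact (differentiableAt_slitSqrt S.lt₀ hu.1).mul (differentiableAt_slitSqrt S.lt₁ hu.2)

theorem differentiable_E : Differentiable ℂ S.E := by unfold E; fun_prop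

theorem differentiableAt_g {u : ℂ} (hu : u ∉ S.slits) : DifferentiableAt ℂ S.g u :=
  (S.differentiable_E u).div (S.differentiableAt_R hu) (S.R_ne_zero hu)

theorem g_eq_gUp {u : ℂ} (hu : u ∉ S.slits) (him : 0 ≤ u.im) : S.g u = S.gUp u := by
  rw [g, gUp, S.R_eq_Rup hu him]

theorem g_conj {u : ℂ} (hu : u ∉ S.slits) : S.g (conj u) = conj (S.g u) := by
  rw [g, g, S.R_conj hu, S.E_conj, map_div₀]

theorem continuousAt_gUp {x : ℂ} (h : S.Rup x ≠ 0) : ContinuousAt S.gUp x :=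
  S.continuous_E.continuousAt.div S.continuous_Rup.continuousAt h

section RealAxis

variable {x : ℝ}

theorem sqrt_abs_quartic (x : ℝ) :
    √|S.quartic x| = √|x - S.a₀| * √|x - S.b₀| * (√|x - S.a₁| * √|x - S.b₁|) := by
  rw [quartic, abs_mul, abs_mul, abs_mul, Real.sqrt_mul (by positivity),
    Real.sqrt_mul (by positivity), Real.sqrt_mul (by positivity)]

theorem upperSqrt_sub_of_le {v : ℝ} (h : v ≤ x) : upperSqrt ((x : ℂ) - v) = (√|x - v| : ℝ) := by
  rw [← Complex.ofReal_sub, upperSqrt_ofReal_nonneg (by linarith), abs_of_nonneg (by linarith)]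

theorem upperSqrt_sub_of_ge {v : ℝ} (h : x ≤ v) :
    upperSqrt ((x : ℂ) - v) = (√|x - v| : ℝ) * Complex.I := by
  rw [← Complex.ofReal_sub, upperSqrt_ofReal_nonpos (by linarith), abs_of_nonpos (by linarith)]

/-- Each of the four factors contributes `i` when its branch point lies to the right of `x`. So on
the five intervals of the axis, from left to right, `Rup` is `i⁴, i³, i², i, 1` times `√|quartic|`.
-/
theorem Rup_of_le_a₀ (h : x ≤ S.a₀) : S.Rup x = (√|S.quartic x| : ℝ) := by
  have h0 := S.lt₀; have h1 := S.neg; have h2 := S.pos; have h3 := S.lt₁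
  rw [Rup, upperSqrt_sub_of_ge h, upperSqrt_sub_of_ge (by linarith : x ≤ S.b₀),
    upperSqrt_sub_of_ge (by linarith : x ≤ S.a₁), upperSqrt_sub_of_ge (by linarith : x ≤ S.b₁),
    sqrt_abs_quartic]
  push_cast; linear_combination (√|x - S.a₀| * √|x - S.b₀| * (√|x - S.a₁| * √|x - S.b₁|) : ℂ) *
    Complex.I_pow_four

theorem Rup_of_mem_slit₀ (h : x ∈ Icc S.a₀ S.b₀) :
    S.Rup x = -(√|S.quartic x| : ℝ) * Complex.I := by
  have h1 := S.neg; have h2 := S.pos; have h3 := S.lt₁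
  rw [Rup, upperSqrt_sub_of_le h.1, upperSqrt_sub_of_ge h.2,
    upperSqrt_sub_of_ge (by linarith [h.2] : x ≤ S.a₁),
    upperSqrt_sub_of_ge (by linarith [h.2] : x ≤ S.b₁), sqrt_abs_quartic]
  push_cast; linear_combination (√|x - S.a₀| * √|x - S.b₀| * (√|x - S.a₁| * √|x - S.b₁|) : ℂ) *
    Complex.I_pow_three

theorem Rup_of_mem_gap (h : x ∈ Icc S.b₀ S.a₁) : S.Rup x = -(√|S.quartic x| : ℝ) := by
  have h0 := S.lt₀; have h3 := S.lt₁
  rw [Rup, upperSqrt_sub_of_le (by linarith [h.1] : S.a₀ ≤ x), upperSqrt_sub_of_le h.1,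
    upperSqrt_sub_of_ge h.2, upperSqrt_sub_of_ge (by linarith [h.2] : x ≤ S.b₁), sqrt_abs_quartic]
  push_cast; linear_combination (√|x - S.a₀| * √|x - S.b₀| * (√|x - S.a₁| * √|x - S.b₁|) : ℂ) *
    Complex.I_sq

theorem Rup_of_mem_slit₁ (h : x ∈ Icc S.a₁ S.b₁) :
    S.Rup x = (√|S.quartic x| : ℝ) * Complex.I := by
  have h0 := S.lt₀; have h1 := S.neg; have h2 := S.pos
  rw [Rup, upperSqrt_sub_of_le (by linarith [h.1] : S.a₀ ≤ x),
    upperSqrt_sub_of_le (by linarith [h.1] : S.b₀ ≤ x), upperSqrt_sub_of_le h.1,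
    upperSqrt_sub_of_ge h.2, sqrt_abs_quartic]
  push_cast; ring

theorem Rup_of_b₁_le (h : S.b₁ ≤ x) : S.Rup x = (√|S.quartic x| : ℝ) := by
  have h0 := S.lt₀; have h1 := S.neg; have h2 := S.pos; have h3 := S.lt₁
  rw [Rup, upperSqrt_sub_of_le (by linarith : S.a₀ ≤ x),
    upperSqrt_sub_of_le (by linarith : S.b₀ ≤ x), upperSqrt_sub_of_le (by linarith : S.a₁ ≤ x),
    upperSqrt_sub_of_le h, sqrt_abs_quartic]
  push_cast; ring

theorem quartic_ne_zero {x : ℝ} (h0 : x ≠ S.a₀) (h1 : x ≠ S.b₀) (h2 : x ≠ S.a₁) (h3 : x ≠ S.b₁) :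
    S.quartic x ≠ 0 :=
  mul_ne_zero (mul_ne_zero (sub_ne_zero.2 h0) (sub_ne_zero.2 h1))
    (mul_ne_zero (sub_ne_zero.2 h2) (sub_ne_zero.2 h3))

/-- The four ends of the slits cut the real axis into five intervals. -/
theorem real_cases (x : ℝ) : x < S.a₀ ∨ x ∈ Icc S.a₀ S.b₀ ∨ x ∈ Ioo S.b₀ S.a₁ ∨
    x ∈ Icc S.a₁ S.b₁ ∨ S.b₁ < x := by
  have h0 := S.lt₀; have h1 := S.neg; have h2 := S.pos; have h3 := S.lt₁
  simp only [mem_Icc, mem_Ioo]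
  rcases lt_or_ge x S.a₀ with h | h
  · exact Or.inl h
  rcases le_or_gt x S.b₀ with h' | h'
  · exact Or.inr (Or.inl ⟨h, h'⟩)
  rcases lt_or_ge x S.a₁ with h'' | h''
  · exact Or.inr (Or.inr (Or.inl ⟨h', h''⟩))
  rcases le_or_gt x S.b₁ with h3 | h3
  · exact Or.inr (Or.inr (Or.inr (Or.inl ⟨h'', h3⟩)))
  · exact Or.inr (Or.inr (Or.inr (Or.inr h3)))

theorem quartic_ne_zero_of_notMem (h : (x : ℂ) ∉ S.slits) : S.quartic x ≠ 0 := by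
  rw [ofReal_mem_slits] at h
  have h0 := S.lt₀; have h3 := S.lt₁
  apply quartic_ne_zero <;> rintro rfl <;> apply h <;> simp [h0.le, h3.le]

end RealAxis

/-! ### The primitive on the upper half-plane -/

/-- At an end of a slit exactly one of the four root factors vanishes, and its modulus `√‖u - x₀‖`
is at least `√(im u)`. At all other real points `gUp` is continuous, hence locally bounded. -/
theorem gUp_bound (x₀ : ℝ) : ∃ r C : ℝ, 0 < r ∧
    ∀ u ∈ Metric.ball (x₀ : ℂ) r, 0 < u.im → ‖S.gUp u‖ ≤ C / √u.im := by
  have key : ∀ h : ℂ → ℂ, ContinuousAt h x₀ →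
      (∀ u : ℂ, 0 < u.im → S.gUp u * upperSqrt (u - x₀) = h u) → ∃ r C : ℝ, 0 < r ∧
      ∀ u ∈ Metric.ball (x₀ : ℂ) r, 0 < u.im → ‖S.gUp u‖ ≤ C / √u.im := by
    intro h hc he
    have h1 : ∀ᶠ u in 𝓝 (x₀ : ℂ), ‖h u‖ < ‖h x₀‖ + 1 :=
      hc.norm.eventually (gt_mem_nhds (lt_add_one _))
    obtain ⟨r, hr, hball⟩ := Metric.eventually_nhds_iff_ball.1 h1
    refine ⟨r, ‖h x₀‖ + 1, hr, fun u hu him => ?_⟩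
    have hs : √u.im ≤ ‖upperSqrt (u - x₀)‖ := by
      rw [norm_upperSqrt]
      apply Real.sqrt_le_sqrt
      have := Complex.abs_im_le_norm (u - x₀)
      simp at this
      exact (le_abs_self _).trans this
    have hp : 0 < √u.im := Real.sqrt_pos.2 him
    rw [le_div_iff₀ hp]
    calc ‖S.gUp u‖ * √u.im ≤ ‖S.gUp u‖ * ‖upperSqrt (u - x₀)‖ := by gcongr
      _ = ‖h u‖ := by rw [← norm_mul, he u him]
      _ ≤ _ := (hball u hu).le
  have hcE := S.continuous_E
  have hus := continuous_upperSqrt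
  have h0 := S.lt₀; have h1 := S.neg; have h2 := S.pos; have h3 := S.lt₁
  have hne : ∀ a b : ℝ, a ≠ b → upperSqrt ((a : ℂ) - b) ≠ 0 := by
    intro a b hab
    rw [Ne, upperSqrt_eq_zero, sub_eq_zero]; exact_mod_cast hab
  have hne' : ∀ (u : ℂ) (a : ℝ), 0 < u.im → upperSqrt (u - a) ≠ 0 := by
    intro u a hu
    rw [Ne, upperSqrt_eq_zero, sub_eq_zero]; rintro rfl; simp at hu
  by_cases e0 : x₀ = S.a₀
  · subst e0
    refine key (fun u => S.E u / (upperSqrt (u - S.b₀) *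
      (upperSqrt (u - S.a₁) * upperSqrt (u - S.b₁)))) ?_ fun u hu => ?_
    · refine ContinuousAt.div (by fun_prop) (by fun_prop) ?_
      refine mul_ne_zero (hne _ _ ?_) (mul_ne_zero (hne _ _ ?_) (hne _ _ ?_)) <;> linarith
    · have := hne' u S.a₀ hu
      rw [gUp, Rup]; field_simp
  by_cases e1 : x₀ = S.b₀
  · subst e1
    refine key (fun u => S.E u / (upperSqrt (u - S.a₀) *
      (upperSqrt (u - S.a₁) * upperSqrt (u - S.b₁)))) ?_ fun u hu => ?_
    · refine ContinuousAt.div (by fun_prop) (by fun_prop) ?_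
      refine mul_ne_zero (hne _ _ ?_) (mul_ne_zero (hne _ _ ?_) (hne _ _ ?_)) <;> linarith
    · have := hne' u S.b₀ hu
      rw [gUp, Rup]; field_simp
  by_cases e2 : x₀ = S.a₁
  · subst e2
    refine key (fun u => S.E u / (upperSqrt (u - S.a₀) * upperSqrt (u - S.b₀) *
      upperSqrt (u - S.b₁))) ?_ fun u hu => ?_
    · refine ContinuousAt.div (by fun_prop) (by fun_prop) ?_
      refine mul_ne_zero (mul_ne_zero (hne _ _ ?_) (hne _ _ ?_)) (hne _ _ ?_) <;> linarith
    · have := hne' u S.a₁ hu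
      rw [gUp, Rup]; field_simp
  by_cases e3 : x₀ = S.b₁
  · subst e3
    refine key (fun u => S.E u / (upperSqrt (u - S.a₀) * upperSqrt (u - S.b₀) *
      upperSqrt (u - S.a₁))) ?_ fun u hu => ?_
    · refine ContinuousAt.div (by fun_prop) (by fun_prop) ?_
      refine mul_ne_zero (mul_ne_zero (hne _ _ ?_) (hne _ _ ?_)) (hne _ _ ?_) <;> linarith
    · have := hne' u S.b₁ hu
      rw [gUp, Rup]; field_simp
  · have := S.continuousAt_gUp (S.Rup_ofReal_ne_zero (S.quartic_ne_zero e0 e1 e2 e3))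
    exact key (fun u => S.gUp u * upperSqrt (u - x₀)) (by fun_prop) fun u _ => rfl

theorem differentiableOn_gUp : DifferentiableOn ℂ S.gUp upperHalf := by
  intro u hu
  have hu' : 0 < u.im := hu
  refine (DifferentiableAt.congr_of_eventuallyEq (S.differentiableAt_g (S.notMem_slits hu'.ne'))
    ?_).differentiableWithinAt
  filter_upwards [isOpen_upperHalf.mem_nhds hu] with w hw
  have hw' : 0 < w.im := hw
  exact (S.g_eq_gUp (S.notMem_slits hw'.ne') hw'.le).symm

theorem exists_prim : ∃ F : ℂ → ℂ, F 0 = 0 ∧ ContinuousOn F closedUpperHalf ∧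
    ∀ u ∈ upperHalf, HasDerivAt F (S.gUp u) u :=
  exists_primitive_closedUpperHalf S.differentiableOn_gUp S.gUp_bound

/-- The primitive of `g` on the closed upper half-plane. -/
def prim : ℂ → ℂ := S.exists_prim.choose

theorem prim_zero : S.prim 0 = 0 := S.exists_prim.choose_spec.1

theorem continuousOn_prim : ContinuousOn S.prim closedUpperHalf := S.exists_prim.choose_spec.2.1

theorem hasDerivAt_prim {u : ℂ} (hu : 0 < u.im) : HasDerivAt S.prim (S.gUp u) u :=
  S.exists_prim.choose_spec.2.2 u hu

theorem hasDerivWithinAt_prim {x : ℝ} (hx : S.quartic x ≠ 0) :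
    HasDerivWithinAt S.prim (S.gUp x) closedUpperHalf x :=
  hasDerivWithinAt_closedUpperHalf S.continuousOn_prim (fun _ hu => S.hasDerivAt_prim hu)
    ((S.continuousAt_gUp (S.Rup_ofReal_ne_zero hx)).tendsto.mono_left nhdsWithin_le_nhds)

theorem continuous_prim_ofReal : Continuous fun x : ℝ => S.prim x :=
  S.continuousOn_prim.comp_continuous Complex.continuous_ofReal (by simp)

/-- The real part of the primitive on the real axis. -/
def X (x : ℝ) : ℝ := (S.prim x).re

/-- The imaginary part of the primitive on the real axis. -/
def Y (x : ℝ) : ℝ := (S.prim x).im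

theorem continuous_X : Continuous S.X := Complex.continuous_re.comp S.continuous_prim_ofReal

theorem continuous_Y : Continuous S.Y := Complex.continuous_im.comp S.continuous_prim_ofReal

theorem hasDerivAt_prim_ofReal {x : ℝ} (hx : S.quartic x ≠ 0) :
    HasDerivAt (fun x : ℝ => S.prim x) (S.gUp x) x := by
  have h := (S.hasDerivWithinAt_prim hx).scomp_of_eq (t' := closedUpperHalf) x (s := univ)
    (h := fun x : ℝ => (x : ℂ)) (Complex.ofRealCLM.hasDerivAt (x := x)).hasDerivWithinAt
    (fun y _ => by simp) rfl
  simp only [hasDerivWithinAt_univ, Complex.ofRealCLM_apply, Complex.ofReal_one, one_smul] at h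
  exact h

theorem hasDerivAt_X {x : ℝ} (hx : S.quartic x ≠ 0) : HasDerivAt S.X (S.gUp x).re x :=
  Complex.reCLM.hasFDerivAt.comp_hasDerivAt x (S.hasDerivAt_prim_ofReal hx)

theorem hasDerivAt_Y {x : ℝ} (hx : S.quartic x ≠ 0) : HasDerivAt S.Y (S.gUp x).im x :=
  Complex.imCLM.hasFDerivAt.comp_hasDerivAt x (S.hasDerivAt_prim_ofReal hx)

end TwoSlits

/-! ### Boundary values of the primitive on the real axis, and positivity of `Re g` -/

namespace TwoSlits

variable (S : TwoSlits)

theorem gUp_im_of_notMem {x : ℝ} (h : (x : ℂ) ∉ S.slits) : (S.gUp x).im = 0 := by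
  have : ∃ r : ℝ, S.Rup x = r := by
    rw [ofReal_mem_slits, not_or] at h
    rcases S.real_cases x with hx | hx | hx | hx | hx
    · exact ⟨_, S.Rup_of_le_a₀ hx.le⟩
    · exact absurd hx h.1
    · exact ⟨-√|S.quartic x|, by rw [S.Rup_of_mem_gap ⟨hx.1.le, hx.2.le⟩]; simp⟩
    · exact absurd hx h.2
    · exact ⟨_, S.Rup_of_b₁_le hx.le⟩
  obtain ⟨r, hr⟩ := this
  rw [gUp, hr, E_ofReal, ← Complex.ofReal_div, Complex.ofReal_im]

theorem gUp_of_mem_slit₀ {x : ℝ} (h : x ∈ Icc S.a₀ S.b₀) :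
    S.gUp x = (S.Er x / √|S.quartic x| : ℝ) * Complex.I := by
  rw [gUp, E_ofReal, S.Rup_of_mem_slit₀ h]
  rcases eq_or_ne (√|S.quartic x|) 0 with h0 | h0
  · simp [h0]
  · have : ((√|S.quartic x| : ℝ) : ℂ) ≠ 0 := by exact_mod_cast h0
    push_cast
    field_simp
    rw [Complex.I_sq]; ring

theorem gUp_of_mem_slit₁ {x : ℝ} (h : x ∈ Icc S.a₁ S.b₁) :
    S.gUp x = -(S.Er x / √|S.quartic x| : ℝ) * Complex.I := by
  rw [gUp, E_ofReal, S.Rup_of_mem_slit₁ h]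
  rcases eq_or_ne (√|S.quartic x|) 0 with h0 | h0
  · simp [h0]
  · have : ((√|S.quartic x| : ℝ) : ℂ) ≠ 0 := by exact_mod_cast h0
    push_cast
    field_simp
    rw [Complex.I_sq]; ring

theorem gUp_re_of_mem {x : ℝ} (h : (x : ℂ) ∈ S.slits) : (S.gUp x).re = 0 := by
  rcases S.ofReal_mem_slits.1 h with h | h
  · rw [S.gUp_of_mem_slit₀ h, Complex.re_ofReal_mul]; simp
  · rw [S.gUp_of_mem_slit₁ h, ← Complex.ofReal_neg, Complex.re_ofReal_mul]; simp

theorem quartic_ne_zero_of_mem_Ioo {x : ℝ} (h : x ∈ Ioo S.a₀ S.b₀ ∨ x ∈ Ioo S.a₁ S.b₁) :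
    S.quartic x ≠ 0 := by
  have h0 := S.lt₀; have h1 := S.neg; have h2 := S.pos; have h3 := S.lt₁
  rcases h with h | h <;> apply S.quartic_ne_zero <;> intro e <;> subst e <;>
    linarith [h.1, h.2]

/-- The real part of the primitive is constant along each slit. -/
theorem X_const₀ {x : ℝ} (h : x ∈ Icc S.a₀ S.b₀) : S.X x = S.X S.b₀ := by
  refine eq_of_hasDerivAt_zero h.2 S.continuous_X.continuousOn fun y hy => ?_
  have hy' : y ∈ Ioo S.a₀ S.b₀ := ⟨h.1.trans_lt hy.1, hy.2⟩
  have := S.hasDerivAt_X (S.quartic_ne_zero_of_mem_Ioo (Or.inl hy'))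
  rwa [S.gUp_re_of_mem (S.ofReal_mem_slits.2 (Or.inl ⟨hy'.1.le, hy'.2.le⟩))] at this

theorem X_const₁ {x : ℝ} (h : x ∈ Icc S.a₁ S.b₁) : S.X S.a₁ = S.X x := by
  refine eq_of_hasDerivAt_zero h.1 S.continuous_X.continuousOn fun y hy => ?_
  have hy' : y ∈ Ioo S.a₁ S.b₁ := ⟨hy.1, hy.2.trans_le h.2⟩
  have := S.hasDerivAt_X (S.quartic_ne_zero_of_mem_Ioo (Or.inr hy'))
  rwa [S.gUp_re_of_mem (S.ofReal_mem_slits.2 (Or.inr ⟨hy'.1.le, hy'.2.le⟩))] at this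

/-- Off the slits `g` is real on the axis, so the imaginary part of the primitive moves only along
the slits. The periods of `g` are therefore read off from `Y` at the slit ends. -/
theorem Y_eq_of_gap {x y : ℝ} (hxy : x ≤ y) (h : ∀ w ∈ Ioo x y, (w : ℂ) ∉ S.slits) :
    S.Y x = S.Y y := by
  refine eq_of_hasDerivAt_zero hxy S.continuous_Y.continuousOn fun w hw => ?_
  have := S.hasDerivAt_Y (S.quartic_ne_zero_of_notMem (h w hw))
  rwa [S.gUp_im_of_notMem (h w hw)] at this

theorem Y_of_mem_gap {x : ℝ} (h : x ∈ Icc S.b₀ S.a₁) : S.Y x = 0 := by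
  have h0 : S.Y 0 = 0 := by simp [Y, S.prim_zero]
  have key : ∀ w : ℝ, S.b₀ < w → w < S.a₁ → (w : ℂ) ∉ S.slits := by
    intro w hw hw'
    rw [ofReal_mem_slits]
    rintro (h | h)
    · linarith [h.2]
    · linarith [h.1]
  rcases le_total x 0 with hx | hx
  · rw [← h0]
    exact S.Y_eq_of_gap hx fun w hw => key w (h.1.trans_lt hw.1) (hw.2.trans S.pos)
  · rw [← h0, eq_comm]
    exact S.Y_eq_of_gap hx fun w hw => key w (S.neg.trans hw.1) (hw.2.trans_le h.2)

theorem Y_of_b₁_le {x : ℝ} (h : S.b₁ ≤ x) : S.Y x = S.Y S.b₁ := by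
  refine (S.Y_eq_of_gap h fun w hw => ?_).symm
  have := S.lt₀; have := S.neg; have := S.pos; have := S.lt₁
  rw [ofReal_mem_slits]
  rintro (h | h)
  · linarith [h.2, hw.1]
  · linarith [h.2, hw.1]

theorem Y_of_le_a₀ {x : ℝ} (h : x ≤ S.a₀) : S.Y x = S.Y S.a₀ := by
  refine S.Y_eq_of_gap h fun w hw => ?_
  have := S.lt₀; have := S.neg; have := S.pos; have := S.lt₁
  rw [ofReal_mem_slits]
  rintro (h | h)
  · linarith [h.1, hw.2]
  · linarith [h.1, hw.2]

/-- The periods of `g` around both slits vanish. -/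
structure Closed : Prop where
  left : S.Y S.a₀ = 0
  right : S.Y S.b₁ = 0

variable {S}

section Closed

variable (hS : S.Closed)

include hS

theorem Closed.Y_eq_zero {x : ℝ} (h : (x : ℂ) ∉ S.slits) : S.Y x = 0 := by
  rw [ofReal_mem_slits, not_or] at h
  rcases S.real_cases x with hx | hx | hx | hx | hx
  · rw [S.Y_of_le_a₀ hx.le, hS.left]
  · exact absurd hx h.1
  · exact S.Y_of_mem_gap ⟨hx.1.le, hx.2.le⟩
  · exact absurd hx h.2
  · rw [S.Y_of_b₁_le hx.le, hS.right]

/-- Rolle's theorem: `Y` vanishes at both ends of each slit and its derivative is `±Er /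
√|quartic|`. A zero of the quadratic in each slit exhausts its roots. -/
theorem Closed.exists_roots : ∃ y₀ ∈ Ioo S.a₀ S.b₀, ∃ y₁ ∈ Ioo S.a₁ S.b₁,
    (∀ x, S.Er x = (x - y₀) * (x - y₁)) ∧ ∀ u, S.E u = (u - y₀) * (u - y₁) := by
  have hb : S.Y S.b₀ = 0 := S.Y_of_mem_gap ⟨le_rfl, (S.neg.trans S.pos).le⟩
  have ha : S.Y S.a₁ = 0 := S.Y_of_mem_gap ⟨(S.neg.trans S.pos).le, le_rfl⟩
  obtain ⟨y₀, hy₀, e₀⟩ := exists_hasDerivAt_eq_zero S.lt₀ S.continuous_Y.continuousOn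
    (hS.left.trans hb.symm) fun x hx => S.hasDerivAt_Y (S.quartic_ne_zero_of_mem_Ioo (Or.inl hx))
  obtain ⟨y₁, hy₁, e₁⟩ := exists_hasDerivAt_eq_zero S.lt₁ S.continuous_Y.continuousOn
    (ha.trans hS.right.symm) fun x hx => S.hasDerivAt_Y (S.quartic_ne_zero_of_mem_Ioo (Or.inr hx))
  have hq : ∀ {x}, S.quartic x ≠ 0 → √|S.quartic x| ≠ 0 := fun h =>
    (Real.sqrt_pos.2 (abs_pos.2 h)).ne'
  rw [S.gUp_of_mem_slit₀ ⟨hy₀.1.le, hy₀.2.le⟩, Complex.im_ofReal_mul, Complex.I_im, mul_one,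
    div_eq_zero_iff, or_iff_left (hq (S.quartic_ne_zero_of_mem_Ioo (Or.inl hy₀)))] at e₀
  rw [S.gUp_of_mem_slit₁ ⟨hy₁.1.le, hy₁.2.le⟩, ← Complex.ofReal_neg, Complex.im_ofReal_mul,
    Complex.I_im, mul_one, neg_eq_zero,
    div_eq_zero_iff, or_iff_left (hq (S.quartic_ne_zero_of_mem_Ioo (Or.inr hy₁)))] at e₁
  have hne : y₀ - y₁ ≠ 0 := by
    have := S.neg; have := S.pos; linarith [hy₀.2, hy₁.1]
  simp only [Er] at e₀ e₁
  have hp : S.p = -(y₀ + y₁) := by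
    have : (y₀ - y₁) * (S.p + (y₀ + y₁)) = 0 := by linear_combination e₀ - e₁
    rcases mul_eq_zero.1 this with h | h
    · exact absurd h hne
    · linarith
  have hqq : S.q = y₀ * y₁ := by rw [hp] at e₀; linear_combination e₀
  refine ⟨y₀, hy₀, y₁, hy₁, fun x => ?_, fun u => ?_⟩
  · rw [Er, hp, hqq]; ring
  · rw [E, hp, hqq]; push_cast; ring

theorem Closed.E_ne_zero {u : ℂ} (hu : u ∉ S.slits) : S.E u ≠ 0 := by
  obtain ⟨y₀, hy₀, y₁, hy₁, -, hE⟩ := hS.exists_roots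
  rw [hE]
  refine mul_ne_zero (sub_ne_zero.2 ?_) (sub_ne_zero.2 ?_) <;> rintro rfl <;>
    apply hu <;> rw [ofReal_mem_slits]
  · exact Or.inl ⟨hy₀.1.le, hy₀.2.le⟩
  · exact Or.inr ⟨hy₁.1.le, hy₁.2.le⟩

theorem Closed.E_ne_zero_of_Rup {u : ℂ} (h : S.Rup u = 0) : S.E u ≠ 0 := by
  obtain ⟨y₀, hy₀, y₁, hy₁, -, hE⟩ := hS.exists_roots
  have := S.lt₀; have := S.neg; have := S.pos; have := S.lt₁
  rw [hE]
  rcases S.Rup_eq_zero.1 h with rfl | rfl | rfl | rfl <;>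
    refine mul_ne_zero (sub_ne_zero.2 ?_) (sub_ne_zero.2 ?_) <;> norm_cast <;>
    intro h <;> linarith [hy₀.1, hy₀.2, hy₁.1, hy₁.2]

/-- Above the slits the imaginary part of the primitive is positive. -/
theorem Closed.Y_pos {x : ℝ} (h : x ∈ Ioo S.a₀ S.b₀ ∨ x ∈ Ioo S.a₁ S.b₁) : 0 < S.Y x := by
  obtain ⟨y₀, hy₀, y₁, hy₁, hE, -⟩ := hS.exists_roots
  have h1 := S.neg; have h2 := S.pos
  have hq : ∀ {w}, w ∈ Ioo S.a₀ S.b₀ ∨ w ∈ Ioo S.a₁ S.b₁ → 0 < √|S.quartic w| := fun h =>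
    Real.sqrt_pos.2 (abs_pos.2 (S.quartic_ne_zero_of_mem_Ioo h))
  have hb : S.Y S.b₀ = 0 := S.Y_of_mem_gap ⟨le_rfl, (S.neg.trans S.pos).le⟩
  have ha : S.Y S.a₁ = 0 := S.Y_of_mem_gap ⟨(S.neg.trans S.pos).le, le_rfl⟩
  have hd₀ : ∀ w ∈ Ioo S.a₀ S.b₀, HasDerivAt S.Y (S.Er w / √|S.quartic w|) w := by
    intro w hw
    have := S.hasDerivAt_Y (S.quartic_ne_zero_of_mem_Ioo (Or.inl hw))
    rwa [S.gUp_of_mem_slit₀ ⟨hw.1.le, hw.2.le⟩, Complex.im_ofReal_mul, Complex.I_im,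
      mul_one] at this
  have hd₁ : ∀ w ∈ Ioo S.a₁ S.b₁, HasDerivAt S.Y (-(S.Er w / √|S.quartic w|)) w := by
    intro w hw
    have := S.hasDerivAt_Y (S.quartic_ne_zero_of_mem_Ioo (Or.inr hw))
    rwa [S.gUp_of_mem_slit₁ ⟨hw.1.le, hw.2.le⟩, ← Complex.ofReal_neg, Complex.im_ofReal_mul,
      Complex.I_im, mul_one] at this
  have hmono : ∀ {α β : ℝ}, α < β → (∀ w ∈ Ioo α β, ∃ d, 0 < d ∧ HasDerivAt S.Y d w) →
      S.Y α < S.Y β := by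
    intro α β hαβ hd
    refine strictMonoOn_of_deriv_pos (convex_Icc α β) S.continuous_Y.continuousOn (fun w hw => ?_)
      (left_mem_Icc.2 hαβ.le) (right_mem_Icc.2 hαβ.le) hαβ
    rw [interior_Icc] at hw
    obtain ⟨d, h0, hd⟩ := hd w hw
    rwa [hd.deriv]
  have hanti : ∀ {α β : ℝ}, α < β → (∀ w ∈ Ioo α β, ∃ d, d < 0 ∧ HasDerivAt S.Y d w) →
      S.Y β < S.Y α := by
    intro α β hαβ hd
    refine strictAntiOn_of_deriv_neg (convex_Icc α β) S.continuous_Y.continuousOn (fun w hw => ?_)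
      (left_mem_Icc.2 hαβ.le) (right_mem_Icc.2 hαβ.le) hαβ
    rw [interior_Icc] at hw
    obtain ⟨d, h0, hd⟩ := hd w hw
    rwa [hd.deriv]
  rcases h with h | h
  · rcases le_total x y₀ with hxy | hxy
    · rw [← hS.left]
      refine hmono h.1 fun w hw => ⟨_, ?_, hd₀ w ⟨hw.1, hw.2.trans h.2⟩⟩
      refine div_pos ?_ (hq (Or.inl ⟨hw.1, hw.2.trans h.2⟩))
      rw [hE]
      exact mul_pos_of_neg_of_neg (by linarith [hw.2]) (by linarith [hw.2, hy₀.2, hy₁.1])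
    · rw [← hb]
      refine hanti h.2 fun w hw => ⟨_, ?_, hd₀ w ⟨h.1.trans hw.1, hw.2⟩⟩
      refine div_neg_of_neg_of_pos ?_ (hq (Or.inl ⟨h.1.trans hw.1, hw.2⟩))
      rw [hE]
      exact mul_neg_of_pos_of_neg (by linarith [hw.1]) (by linarith [hw.2, hy₀.2, hy₁.1])
  · rcases le_total x y₁ with hxy | hxy
    · rw [← ha]
      refine hmono h.1 fun w hw => ⟨_, ?_, hd₁ w ⟨hw.1, hw.2.trans h.2⟩⟩
      refine neg_pos.2 (div_neg_of_neg_of_pos ?_ (hq (Or.inr ⟨hw.1, hw.2.trans h.2⟩)))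
      rw [hE]
      exact mul_neg_of_pos_of_neg (by linarith [hw.1, hy₀.2]) (by linarith [hw.2])
    · rw [← hS.right]
      refine hanti h.2 fun w hw => ⟨_, ?_, hd₁ w ⟨h.1.trans hw.1, hw.2⟩⟩
      refine neg_neg_of_pos (div_pos ?_ (hq (Or.inr ⟨h.1.trans hw.1, hw.2⟩)))
      rw [hE]
      exact mul_pos (by linarith [hw.1, hy₀.2, hy₁.1]) (by linarith [hw.1])

theorem Closed.Y_nonneg (x : ℝ) : 0 ≤ S.Y x := by
  by_cases h : (x : ℂ) ∈ S.slits
  · have hb : S.Y S.b₀ = 0 := S.Y_of_mem_gap ⟨le_rfl, (S.neg.trans S.pos).le⟩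
    have ha : S.Y S.a₁ = 0 := S.Y_of_mem_gap ⟨(S.neg.trans S.pos).le, le_rfl⟩
    rcases S.ofReal_mem_slits.1 h with h | h
    · rcases h.1.lt_or_eq with h1 | rfl
      · rcases h.2.lt_or_eq with h2 | rfl
        · exact (hS.Y_pos (Or.inl ⟨h1, h2⟩)).le
        · exact hb.ge
      · exact hS.left.ge
    · rcases h.1.lt_or_eq with h1 | rfl
      · rcases h.2.lt_or_eq with h2 | rfl
        · exact (hS.Y_pos (Or.inr ⟨h1, h2⟩)).le
        · exact hS.right.ge
      · exact ha.ge
  · exact (hS.Y_eq_zero h).ge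

/-- `g` maps the complement of the slits into the open right half-plane. -/
theorem Closed.g_re_pos {u : ℂ} (hu : u ∉ S.slits) : 0 < (S.g u).re := by
  obtain ⟨y₀, hy₀, y₁, hy₁, hEr, hE⟩ := hS.exists_roots
  have h0 := S.lt₀; have h1 := S.neg; have h2 := S.pos; have h3 := S.lt₁
  -- If `g w = i t`, then `t ≠ 0` and `E² + t² R² = 0` at `w`. By `exists_quartic_roots` all roots
  -- of this real quartic are on the slits.
  have hne : ∀ w ∈ S.slitsᶜ, (S.g w).re ≠ 0 := by
    intro w hw h
    have hR := S.R_ne_zero hw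
    have hg : S.g w = ((S.g w).im : ℝ) * Complex.I := by
      apply Complex.ext <;> simp [h]
    have him : (S.g w).im ≠ 0 := by
      intro h'
      rw [h', Complex.ofReal_zero, zero_mul, g, div_eq_zero_iff] at hg
      exact hg.elim (hS.E_ne_zero hw) hR
    have hsq : S.E w ^ 2 + (((S.g w).im ^ 2 : ℝ) : ℂ) * S.R w ^ 2 = 0 := by
      have : S.E w = S.g w * S.R w := by rw [g]; field_simp
      rw [this, hg]; push_cast
      simp only [Complex.im_ofReal_mul, Complex.I_im, mul_one]
      linear_combination ((S.g w).im : ℂ) ^ 2 * S.R w ^ 2 * Complex.I_sq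
    obtain ⟨r₁, m1, r₂, m2, r₃, m3, r₄, m4, hr⟩ := exists_quartic_roots (c := 1) hy₀.1 hy₀.2
      (h1.trans h2) hy₁.1 hy₁.2 one_ne_zero (t := (S.g w).im ^ 2) (by positivity)
    rw [S.R_sq hw, hE] at hsq
    have hw' := (hr w).1 (by rw [← hsq]; push_cast; ring)
    apply hw
    rcases hw' with rfl | rfl | rfl | rfl <;> rw [ofReal_mem_slits]
    · exact Or.inl ⟨m1.1.le, (m1.2.trans hy₀.2).le⟩
    · exact Or.inl ⟨(hy₀.1.trans m2.1).le, m2.2.le⟩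
    · exact Or.inr ⟨m3.1.le, (m3.2.trans hy₁.2).le⟩
    · exact Or.inr ⟨(hy₁.1.trans m4.1).le, m4.2.le⟩
  have hcont : ContinuousOn (fun w => (S.g w).re) S.slitsᶜ := fun w hw =>
    (Complex.continuous_re.continuousAt.comp
      (S.differentiableAt_g hw).continuousAt).continuousWithinAt
  have hx : ((S.b₁ + 1 : ℝ) : ℂ) ∈ S.slitsᶜ := by
    rw [mem_compl_iff, ofReal_mem_slits]
    rintro (h | h)
    · linarith [h.2]
    · linarith [h.2]
  -- To the right of both slits `E` and `R` are positive, which fixes the sign on the connected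
  -- complement.
  have hgx : 0 < (S.g (S.b₁ + 1 : ℝ)).re := by
    rw [S.g_eq_gUp hx (by simp), gUp, S.Rup_of_b₁_le (by linarith), E_ofReal, ← Complex.ofReal_div,
      Complex.ofReal_re, hEr]
    refine div_pos (mul_pos ?_ ?_) (Real.sqrt_pos.2 (abs_pos.2 (S.quartic_ne_zero_of_notMem hx)))
    · linarith [hy₀.2]
    · linarith [hy₁.2]
  by_contra! hle
  obtain ⟨w, hw, h⟩ := S.isPreconnected_compl_slits.intermediate_value hu hx hcont ⟨hle, hgx.le⟩
  exact hne w hw h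

end Closed

variable (S)

/-! ### The primitive on the complement of the slits -/

/-- Boundary values of the primitive of `g` on the closed upper (`true`) or lower (`false`)
half-plane. -/
def side : Bool → ℂ → ℂ
  | true, u => S.prim u
  | false, u => conj (S.prim (conj u))

/-- The closed upper or lower half-plane. -/
def closedHalf : Bool → Set ℂ
  | true => {u | 0 ≤ u.im}
  | false => {u | u.im ≤ 0}

/-- The primitive of `g` on the complement of the slits. -/
def H (u : ℂ) : ℂ := if 0 ≤ u.im then S.prim u else conj (S.prim (conj u))

theorem continuousOn_side (s : Bool) : ContinuousOn (S.side s) (closedHalf s) := by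
  cases s
  · exact Complex.continuous_conj.comp_continuousOn (S.continuousOn_prim.comp
      Complex.continuous_conj.continuousOn fun u hu => by
        have : u.im ≤ 0 := hu
        simpa using this)
  · exact S.continuousOn_prim

theorem side_ofReal (s : Bool) (x : ℝ) :
    S.side s x = S.X x + (if s then 1 else -1) * S.Y x * Complex.I := by
  cases s
  · simp only [side, Complex.conj_ofReal]
    apply Complex.ext <;> simp [X, Y]
  · simp only [side]
    apply Complex.ext <;> simp [X, Y]

variable {S}

/-- The primitives on the two half-planes are conjugate to each other, so they agree on the real
axis off the slits exactly because `Y` vanishes there. This is where the vanishing periods enter. -/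
theorem Closed.H_eq_side (hS : S.Closed) {s : Bool} {u : ℂ} (hu : u ∉ S.slits)
    (hs : u ∈ closedHalf s) : S.H u = S.side s u := by
  cases s
  · rcases lt_or_eq_of_le (show u.im ≤ 0 from hs) with h | h
    · simp [H, not_le.2 h, side]
    · obtain ⟨x, rfl⟩ : ∃ x : ℝ, u = x := ⟨u.re, Complex.ext rfl (by simpa using h)⟩
      rw [side_ofReal, hS.Y_eq_zero hu, H, if_pos (by simp)]
      apply Complex.ext
      · simp [X]
      · simp; exact hS.Y_eq_zero hu
  · rw [H, if_pos (show 0 ≤ u.im from hs)]; rfl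

variable (S)

theorem hasDerivWithinAt_side_true {x : ℝ} (hx : S.quartic x ≠ 0) :
    HasDerivWithinAt (S.side true) (S.gUp x) (closedHalf true) x :=
  S.hasDerivWithinAt_prim hx

theorem hasDerivWithinAt_side_false {x : ℝ} (hx : S.quartic x ≠ 0) :
    HasDerivWithinAt (S.side false) (conj (S.gUp x)) (closedHalf false) x := by
  have h := S.hasDerivWithinAt_prim hx
  rw [hasDerivWithinAt_iff_tendsto_slope] at h ⊢
  have hc : Tendsto (fun u : ℂ => conj u) (𝓝[closedHalf false \ {(x : ℂ)}] x)
      (𝓝[closedUpperHalf \ {(x : ℂ)}] x) := by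
    refine tendsto_nhdsWithin_iff.2 ⟨?_, ?_⟩
    · have := Complex.continuous_conj.tendsto (x : ℂ)
      rw [Complex.conj_ofReal] at this
      exact this.mono_left nhdsWithin_le_nhds
    · filter_upwards [self_mem_nhdsWithin] with u hu
      have h1 : u.im ≤ 0 := hu.1
      refine ⟨by simpa using h1, fun h => hu.2 ?_⟩
      have h2 : conj u = x := h
      have := congrArg conj h2
      simpa using this
  refine ((Complex.continuous_conj.tendsto _).comp (h.comp hc)).congr fun u => ?_
  simp [slope_def_field, side]

variable {S}

/-- At a real point the derivatives from the two half-planes coincide because `gUp` is real off the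
slits; the union of the two half-planes is a full neighbourhood. -/
theorem Closed.hasDerivAt_H (hS : S.Closed) {u : ℂ} (hu : u ∉ S.slits) :
    HasDerivAt S.H (S.g u) u := by
  rcases lt_trichotomy u.im 0 with h | h | h
  · have hc : 0 < (conj u).im := by simpa using h
    have h1 := (S.hasDerivAt_prim hc).conj_conj
    rw [Complex.conj_conj, ← S.g_eq_gUp (S.conj_notMem_slits hu) hc.le, S.g_conj hu,
      Complex.conj_conj] at h1
    refine h1.congr_of_eventuallyEq ?_
    filter_upwards [(isOpen_lt Complex.continuous_im continuous_const).mem_nhds h] with w hw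
    have hw' : w.im < 0 := hw
    simp [H, not_le.2 hw']
  · obtain ⟨x, rfl⟩ : ∃ x : ℝ, u = x := ⟨u.re, Complex.ext rfl (by simpa using h)⟩
    have hq := S.quartic_ne_zero_of_notMem hu
    rw [← hasDerivWithinAt_univ, S.g_eq_gUp hu (by simp)]
    have hun : (univ : Set ℂ) = closedHalf true ∪ {w : ℂ | w.im < 0} := by
      ext w
      simpa [closedHalf] using le_or_gt 0 w.im
    rw [hun]
    refine HasDerivWithinAt.union ?_ ?_
    · exact (S.hasDerivWithinAt_side_true hq).congr
        (fun w hw => by rw [H, if_pos (show 0 ≤ w.im from hw)]; rfl) (by simp [H, side])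
    · have h2 := S.hasDerivWithinAt_side_false hq
      have hcg : conj (S.gUp x) = S.gUp x :=
        Complex.conj_eq_iff_im.2 (S.gUp_im_of_notMem hu)
      rw [hcg] at h2
      have hsub : {w : ℂ | w.im < 0} ⊆ closedHalf false := by
        intro w hw
        have hw' : w.im < 0 := hw
        exact hw'.le
      refine (h2.mono hsub).congr (fun w hw => ?_) ?_
      · have hw' : w.im < 0 := hw
        simp [H, not_le.2 hw', side]
      · exact hS.H_eq_side hu (by simp [closedHalf])
  · have h1 := S.hasDerivAt_prim h
    rw [← S.g_eq_gUp hu h.le] at h1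
    refine h1.congr_of_eventuallyEq ?_
    filter_upwards [isOpen_upperHalf.mem_nhds h] with w hw
    have hw' : 0 < w.im := hw
    simp [H, hw'.le]

end TwoSlits

/-- The exterior of the disc is the image under `exp` of the half-plane `re w > log M`. -/
theorem isPreconnected_compl_closedBall {M : ℝ} (hM : 0 < M) :
    IsPreconnected (Metric.closedBall (0 : ℂ) M)ᶜ := by
  have : (Metric.closedBall (0 : ℂ) M)ᶜ = Complex.exp '' {w | Real.log M < w.re} := by
    ext u
    simp only [mem_compl_iff, Metric.mem_closedBall, dist_zero_right, not_le, mem_image]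
    constructor
    · intro h
      have hu : u ≠ 0 := by rintro rfl; simp at h; linarith
      exact ⟨Complex.log u, by
        change Real.log M < (Complex.log u).re
        rw [Complex.log_re]; exact Real.log_lt_log hM h, Complex.exp_log hu⟩
    · rintro ⟨w, hw, rfl⟩
      rw [Complex.norm_exp]
      exact (Real.log_lt_iff_lt_exp hM).1 hw
  rw [this]
  exact (convex_halfSpace_re_gt _).isPreconnected.image _ Complex.continuous_exp.continuousOn

/-! ### Difference quotients of the primitive -/

namespace TwoSlits

variable {S : TwoSlits}

/-- Two points of the same slit. -/
def SameSlit (S : TwoSlits) (u₁ u₂ : ℂ) : Prop :=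
  (u₁ ∈ realSeg S.a₀ S.b₀ ∧ u₂ ∈ realSeg S.a₀ S.b₀) ∨
    (u₁ ∈ realSeg S.a₁ S.b₁ ∧ u₂ ∈ realSeg S.a₁ S.b₁)

section Closed

variable (hS : S.Closed)

include hS

/-- Noshiro-Warschawski: with `w = u₁ - u₂`, the derivative of `Re (prim · conj w)` along the
segment is `|w|² Re g > 0`. The segment meets the real axis at most at an end, where continuity is
enough. -/
theorem Closed.prim_quot_pos {u₁ u₂ : ℂ} (h1 : 0 ≤ u₁.im) (h2 : 0 ≤ u₂.im) (hne : u₁ ≠ u₂)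
    (h : 0 < u₁.im ∨ 0 < u₂.im) : 0 < ((S.prim u₁ - S.prim u₂) * conj (u₁ - u₂)).re := by
  set w := u₁ - u₂ with hw
  have hn : 0 < Complex.normSq w := Complex.normSq_pos.2 (sub_ne_zero.2 hne)
  set γ : ℝ → ℂ := fun t => u₂ + t * w with hγ
  have him : ∀ t, (γ t).im = (1 - t) * u₂.im + t * u₁.im := by
    intro t; simp [hγ, hw]; ring
  have hγd : ∀ t, HasDerivAt γ w t := by
    intro t
    have h := ((Complex.ofRealCLM.hasDerivAt (x := t)).mul_const w).const_add u₂
    rw [Complex.ofRealCLM_apply, Complex.ofReal_one, one_mul] at h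
    exact h
  have hcont : ContinuousOn (fun t : ℝ => (S.prim (γ t) * conj w).re) (Icc 0 1) := by
    refine Complex.continuous_re.comp_continuousOn (ContinuousOn.mul ?_ continuousOn_const)
    refine S.continuousOn_prim.comp (fun t _ => (hγd t).continuousAt.continuousWithinAt) ?_
    intro t ht
    change 0 ≤ (γ t).im
    rw [him]
    have := mul_nonneg (sub_nonneg.2 ht.2) h2
    have := mul_nonneg ht.1 h1
    linarith
  have hmono := strictMonoOn_of_deriv_pos (convex_Icc (0 : ℝ) 1) hcont (by
    intro t ht
    rw [interior_Icc] at ht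
    have hpos : 0 < (γ t).im := by
      rw [him]
      rcases h with h | h
      · have := mul_nonneg (sub_nonneg.2 ht.2.le) h2
        have := mul_pos ht.1 h
        linarith
      · have := mul_pos (sub_pos.2 ht.2) h
        have := mul_nonneg ht.1.le h1
        linarith
    have hd : HasDerivAt (fun t : ℝ => S.prim (γ t) * conj w) (S.gUp (γ t) * w * conj w) t :=
      ((S.hasDerivAt_prim hpos).comp t (hγd t)).mul_const _
    have hd' := Complex.reCLM.hasFDerivAt.comp_hasDerivAt t hd
    have : deriv (fun t : ℝ => (S.prim (γ t) * conj w).re) t = (S.gUp (γ t) * w * conj w).re :=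
      hd'.deriv
    rw [this, mul_assoc, Complex.mul_conj, Complex.re_mul_ofReal]
    have hg := hS.g_re_pos (S.notMem_slits hpos.ne')
    rw [S.g_eq_gUp (S.notMem_slits hpos.ne') hpos.le] at hg
    exact mul_pos hg hn)
  have := hmono (left_mem_Icc.2 zero_le_one) (right_mem_Icc.2 zero_le_one) zero_lt_one
  have e0 : γ 0 = u₂ := by simp [hγ]
  have e1 : γ 1 = u₁ := by simp [hγ, hw]
  rw [sub_mul, Complex.sub_re]
  simp only [e0, e1] at this
  linarith

/-- Limit of the inequality for horizontal segments at height `ε → 0`. -/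
theorem Closed.X_mono : Monotone S.X := by
  intro x₁ x₂ h12
  rcases h12.eq_or_lt with rfl | h12
  · exact le_rfl
  have hlim : ∀ x : ℝ, Tendsto (fun ε : ℝ => (S.prim (x + ε * Complex.I)).re) (𝓝[>] 0) (𝓝 (S.X x)) := by
    intro x
    refine (Complex.continuous_re.tendsto _).comp ((S.continuousOn_prim x (by simp)).tendsto.comp ?_)
    refine tendsto_nhdsWithin_iff.2 ⟨?_, ?_⟩
    · have : Continuous fun ε : ℝ => (x + ε * Complex.I : ℂ) := by fun_prop
      have h := this.tendsto 0
      simp only [Complex.ofReal_zero, zero_mul, add_zero] at h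
      exact h.mono_left nhdsWithin_le_nhds
    · filter_upwards [self_mem_nhdsWithin] with ε hε
      have : 0 < ε := hε
      change 0 ≤ (x + ε * Complex.I : ℂ).im
      simpa using this.le
  refine le_of_tendsto_of_tendsto (hlim x₁) (hlim x₂) ?_
  filter_upwards [self_mem_nhdsWithin] with ε hε
  have hε' : 0 < ε := hε
  have h := hS.prim_quot_pos (u₁ := x₂ + ε * Complex.I) (u₂ := x₁ + ε * Complex.I)
    (by simpa using hε'.le) (by simpa using hε'.le)
    (by
      intro h
      have := congrArg Complex.re h
      simp at this; linarith) (by simpa using hε')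
  have hsub : (x₂ + ε * Complex.I - (x₁ + ε * Complex.I) : ℂ) = ((x₂ - x₁ : ℝ) : ℂ) := by
    push_cast; ring
  rw [hsub, Complex.conj_ofReal, Complex.re_mul_ofReal, Complex.sub_re] at h
  have := (mul_pos_iff_of_pos_right (sub_pos.2 h12)).1 h
  linarith

theorem Closed.X_lt_of_gap {c d : ℝ} (hcd : c < d) (h : ∀ w ∈ Ioo c d, (w : ℂ) ∉ S.slits) :
    S.X c < S.X d := by
  refine strictMonoOn_of_deriv_pos (convex_Icc c d) S.continuous_X.continuousOn (fun w hw => ?_)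
      (left_mem_Icc.2 hcd.le) (right_mem_Icc.2 hcd.le) hcd
  rw [interior_Icc] at hw
  have hw' := h w hw
  rw [(S.hasDerivAt_X (S.quartic_ne_zero_of_notMem hw')).deriv, ← S.g_eq_gUp hw' (by simp)]
  exact hS.g_re_pos hw'

/-- Between two points that are not on one slit there is an open interval free of slits. On it `X`
increases strictly, and it never decreases elsewhere. -/
theorem Closed.X_lt {x₁ x₂ : ℝ} (h12 : x₁ < x₂) (hn : ¬ S.SameSlit x₁ x₂) : S.X x₁ < S.X x₂ := by
  have hopen : IsOpen {x : ℝ | (x : ℂ) ∉ S.slits} :=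
    S.isClosed_slits.isOpen_compl.preimage Complex.continuous_ofReal
  obtain ⟨c, d, hc, hcd, hd, h⟩ : ∃ c d, x₁ ≤ c ∧ c < d ∧ d ≤ x₂ ∧
      ∀ w ∈ Ioo c d, (w : ℂ) ∉ S.slits := by
    by_cases h1 : (x₁ : ℂ) ∈ S.slits
    · by_cases h2 : (x₂ : ℂ) ∈ S.slits
      · have e1 := S.ofReal_mem_slits.1 h1
        have e2 := S.ofReal_mem_slits.1 h2
        have hsm : ∀ {a b x : ℝ}, x ∈ Icc a b → (x : ℂ) ∈ realSeg a b := fun h =>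
          mem_realSeg.2 (by simpa using h)
        have := S.neg; have := S.pos
        rcases e1 with e1 | e1
        · rcases e2 with e2 | e2
          · exact absurd (Or.inl ⟨hsm e1, hsm e2⟩) hn
          · refine ⟨S.b₀, S.a₁, e1.2, by linarith, e2.1, fun w hw => ?_⟩
            rw [ofReal_mem_slits]
            rintro (h | h)
            · linarith [h.2, hw.1]
            · linarith [h.1, hw.2]
        · rcases e2 with e2 | e2
          · linarith [e1.1, e2.2]
          · exact absurd (Or.inr ⟨hsm e1, hsm e2⟩) hn
      · obtain ⟨c, hc, hcs⟩ := mem_nhdsLE_iff_exists_Ioc_subset' h12 |>.1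
          (nhdsWithin_le_nhds (hopen.mem_nhds h2) : {x : ℝ | (x : ℂ) ∉ S.slits} ∈ 𝓝[≤] x₂)
        exact ⟨max c x₁, x₂, le_max_right _ _, max_lt hc h12, le_rfl, fun w hw =>
          hcs ⟨(le_max_left _ _).trans_lt hw.1, hw.2.le⟩⟩
    · obtain ⟨d, hd, hds⟩ := mem_nhdsGE_iff_exists_Ico_subset' h12 |>.1
          (nhdsWithin_le_nhds (hopen.mem_nhds h1) : {x : ℝ | (x : ℂ) ∉ S.slits} ∈ 𝓝[≥] x₁)
      exact ⟨x₁, min d x₂, le_rfl, lt_min hd h12, min_le_right _ _, fun w hw =>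
          hds ⟨hw.1.le, hw.2.trans_le (min_le_left _ _)⟩⟩
  exact ((hS.X_mono hc).trans_lt (hS.X_lt_of_gap hcd h)).trans_le (hS.X_mono hd)

/-- Multiplication by the real number `x₁ - x₂` leaves only the real parts of the boundary values,
which are the same on both sides; what remains is the monotonicity of `X`. -/
theorem Closed.quot_real (s₁ s₂ : Bool) (x₁ x₂ : ℝ) :
    0 ≤ ((S.side s₁ x₁ - S.side s₂ x₂) * conj ((x₁ : ℂ) - x₂)).re ∧
    (x₁ ≠ x₂ → ¬ S.SameSlit x₁ x₂ →
      0 < ((S.side s₁ x₁ - S.side s₂ x₂) * conj ((x₁ : ℂ) - x₂)).re) := by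
  have e : ((S.side s₁ x₁ - S.side s₂ x₂) * conj ((x₁ : ℂ) - x₂)).re =
      (S.X x₁ - S.X x₂) * (x₁ - x₂) := by
    rw [← Complex.ofReal_sub, Complex.conj_ofReal, Complex.re_mul_ofReal, side_ofReal, side_ofReal]
    cases s₁ <;> cases s₂ <;> simp
  rw [e]
  constructor
  · rcases le_total x₁ x₂ with h | h
    · exact mul_nonneg_of_nonpos_of_nonpos (sub_nonpos.2 (hS.X_mono h)) (sub_nonpos.2 h)
    · exact mul_nonneg (sub_nonneg.2 (hS.X_mono h)) (sub_nonneg.2 h)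
  · intro hne hn
    rcases hne.lt_or_gt with h | h
    · exact mul_pos_of_neg_of_neg (sub_neg.2 (hS.X_lt h hn)) (sub_neg.2 h)
    · refine mul_pos (sub_pos.2 (hS.X_lt h fun h' => hn ?_)) (sub_pos.2 h)
      rcases h' with h' | h'
      · exact Or.inl h'.symm
      · exact Or.inr h'.symm

/-- The segment is split where it crosses the real axis. Each piece contributes a nonnegative
amount, at least one of them a positive one, and the jump `2iY(x)` between the sides adds `2 Y(x) ·
im (u₁ - u₂) ≥ 0`. -/
theorem Closed.quot_opposite {u₁ u₂ : ℂ} (h1 : 0 ≤ u₁.im) (h2 : u₂.im ≤ 0)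
    (h : u₁.im - u₂.im ≠ 0) :
    0 < ((S.side true u₁ - S.side false u₂) * conj (u₁ - u₂)).re := by
  set d := u₁.im - u₂.im with hd
  have hd0 : 0 < d := lt_of_le_of_ne (by rw [hd]; linarith) h.symm
  have hdc : (d : ℂ) ≠ 0 := by exact_mod_cast h
  -- The point where the segment from `u₂` to `u₁` meets the real axis.
  set x : ℝ := (u₁.re * (-u₂.im) + u₂.re * u₁.im) / d with hx
  set w := u₁ - u₂ with hw
  have e1 : u₁ - x = ((u₁.im / d : ℝ) : ℂ) * w := by
    apply Complex.ext
    · rw [Complex.re_ofReal_mul, hw, Complex.sub_re, Complex.sub_re, Complex.ofReal_re, hx]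
      field_simp; rw [hd]; ring
    · rw [Complex.im_ofReal_mul, hw, Complex.sub_im, Complex.sub_im, Complex.ofReal_im, ← hd]
      field_simp; ring
  have e2 : x - u₂ = ((-u₂.im / d : ℝ) : ℂ) * w := by
    apply Complex.ext
    · rw [Complex.re_ofReal_mul, hw, Complex.sub_re, Complex.sub_re, Complex.ofReal_re, hx]
      field_simp; rw [hd]; ring
    · rw [Complex.im_ofReal_mul, hw, Complex.sub_im, Complex.sub_im, Complex.ofReal_im, ← hd]
      field_simp; ring
  have t1 : 0 ≤ ((S.prim u₁ - S.prim x) * conj w).re ∧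
      (0 < u₁.im → 0 < ((S.prim u₁ - S.prim x) * conj w).re) := by
    rcases h1.eq_or_lt with h0 | h0
    · rw [← h0, zero_div, Complex.ofReal_zero, zero_mul, sub_eq_zero] at e1
      rw [← e1]; simp [← h0]
    · have hl : 0 < u₁.im / d := div_pos h0 hd0
      have := hS.prim_quot_pos (u₂ := x) h1 (by simp) (by
        intro h; have := congrArg Complex.im h; simp at this; linarith) (Or.inl h0)
      rw [e1, map_mul, Complex.conj_ofReal, mul_left_comm, Complex.re_ofReal_mul] at this
      have := (mul_pos_iff_of_pos_left hl).1 this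
      exact ⟨this.le, fun _ => this⟩
  have t2 : 0 ≤ ((conj (S.prim x) - S.side false u₂) * conj w).re ∧
      (u₂.im < 0 → 0 < ((conj (S.prim x) - S.side false u₂) * conj w).re) := by
    rcases h2.eq_or_lt with h0 | h0
    · rw [h0, neg_zero, zero_div, Complex.ofReal_zero, zero_mul, sub_eq_zero] at e2
      rw [← e2]; simp [side]
    · have hl : 0 < -u₂.im / d := div_pos (by linarith) hd0
      have := hS.prim_quot_pos (u₁ := x) (u₂ := conj u₂) (by simp) (by simpa using h2) (by
        intro h; have := congrArg Complex.im h; simp at this; linarith)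
        (Or.inr (by simpa using h0))
      have hc : (x - conj u₂ : ℂ) = conj (x - u₂) := by simp
      rw [hc, e2, map_mul, Complex.conj_ofReal, map_mul, Complex.conj_ofReal, mul_left_comm,
        Complex.re_ofReal_mul] at this
      have := (mul_pos_iff_of_pos_left hl).1 this
      have hre : ((conj (S.prim x) - S.side false u₂) * conj w).re =
          ((S.prim x - S.prim (conj u₂)) * conj (conj w)).re := by
        rw [← Complex.conj_re]
        simp [side]
      rw [hre]
      exact ⟨this.le, fun _ => this⟩
  have t3 : 0 ≤ ((S.prim x - conj (S.prim x)) * conj w).re := by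
    rw [Complex.sub_conj, mul_assoc, Complex.re_ofReal_mul, Complex.I_mul_re, Complex.conj_im,
      neg_neg]
    have hY : 0 ≤ (S.prim x).im := hS.Y_nonneg x
    have hwi : w.im = d := by rw [hw, hd, Complex.sub_im]
    rw [hwi]; positivity
  have hsum : ((S.side true u₁ - S.side false u₂) * conj w).re =
      ((S.prim u₁ - S.prim x) * conj w).re + ((S.prim x - conj (S.prim x)) * conj w).re +
        ((conj (S.prim x) - S.side false u₂) * conj w).re := by
    rw [← Complex.add_re, ← Complex.add_re]
    congr 1
    simp only [side]; ring
  rw [hsum]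
  rcases h1.eq_or_lt with h0 | h0
  · have : u₂.im < 0 := by rw [hd] at hd0; linarith
    linarith [t1.1, t2.2 this]
  · linarith [t1.2 h0, t2.1]

/-- The difference quotients of the primitive, including its boundary values, lie in the closed
right half-plane, and in the open one except for two points of the same slit. -/
theorem Closed.quot (s₁ s₂ : Bool) {u₁ u₂ : ℂ} (h1 : u₁ ∈ closedHalf s₁)
    (h2 : u₂ ∈ closedHalf s₂) :
    0 ≤ ((S.side s₁ u₁ - S.side s₂ u₂) * conj (u₁ - u₂)).re ∧
    (u₁ ≠ u₂ → ¬ S.SameSlit u₁ u₂ →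
      0 < ((S.side s₁ u₁ - S.side s₂ u₂) * conj (u₁ - u₂)).re) := by
  by_cases hr : u₁.im = 0 ∧ u₂.im = 0
  · obtain ⟨x₁, rfl⟩ : ∃ x : ℝ, u₁ = x := ⟨u₁.re, Complex.ext rfl (by simpa using hr.1)⟩
    obtain ⟨x₂, rfl⟩ : ∃ x : ℝ, u₂ = x := ⟨u₂.re, Complex.ext rfl (by simpa using hr.2)⟩
    have := hS.quot_real s₁ s₂ x₁ x₂
    refine ⟨this.1, fun h => this.2 fun h' => h (by rw [h'])⟩
  rcases eq_or_ne u₁ u₂ with rfl | hne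
  · simp
  suffices 0 < ((S.side s₁ u₁ - S.side s₂ u₂) * conj (u₁ - u₂)).re from
    ⟨this.le, fun _ _ => this⟩
  have hneg : ∀ a b c d : ℂ, ((a - b) * conj (c - d)).re = ((b - a) * conj (d - c)).re := by
    intro a b c d; congr 1; simp only [map_sub]; ring
  cases s₁ <;> cases s₂ <;> simp only [closedHalf, mem_ofPred_eq] at h1 h2
  · have hc : 0 < (conj u₁).im ∨ 0 < (conj u₂).im := by
      simp only [Complex.conj_im]
      by_contra! hcon
      exact hr ⟨by linarith [hcon.1], by linarith [hcon.2]⟩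
    have := hS.prim_quot_pos (u₁ := conj u₁) (u₂ := conj u₂) (by simpa using h1)
      (by simpa using h2) (fun h => hne (by simpa using congrArg conj h)) hc
    rw [← Complex.conj_re]
    simpa [side] using this
  · rw [hneg]
    refine hS.quot_opposite h2 h1 fun h => hr ⟨by linarith, by linarith⟩
  · exact hS.quot_opposite h1 h2 fun h => hr ⟨by linarith, by linarith⟩
  · have hc : 0 < u₁.im ∨ 0 < u₂.im := by
      by_contra! hcon
      exact hr ⟨by linarith [hcon.1], by linarith [hcon.2]⟩
    exact hS.prim_quot_pos h1 h2 hne hc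

end Closed

end TwoSlits

/-! ### The maps `α u + β H + C`: univalence, image and boundary -/

namespace TwoSlits

variable (S : TwoSlits) (α β C : ℂ)

/-- A combination of the identity and the primitive of `g`, on a closed half-plane. -/
def bmap (s : Bool) (u : ℂ) : ℂ := α * u + β * S.side s u + C

/-- A combination of the identity and the primitive of `g`, off the slits. -/
def imap (u : ℂ) : ℂ := α * u + β * S.H u + C

/-- The image of the two sides of a slit. -/
def contourSet (a b : ℝ) : Set ℂ := {w | ∃ s, ∃ x ∈ Icc a b, S.bmap α β C s x = w}

/-- The primitive differs from the identity by a bounded function near infinity. -/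
def AsympId : Prop :=
  ∃ M ρ : ℝ, ∀ s, ∀ u ∈ closedHalf s, ρ ≤ ‖u‖ → ‖S.side s u - u‖ ≤ M

/-- The projection of the plane to a closed half-plane by reflection. -/
def fold (s : Bool) (u : ℂ) : ℂ := u.re + (if s then |u.im| else -|u.im| : ℝ) * Complex.I

theorem continuous_fold (s : Bool) : Continuous (fold s) := by
  cases s
  · have : Continuous fun u : ℂ => (u.re : ℂ) + ((-|u.im| : ℝ) : ℂ) * Complex.I := by fun_prop
    exact this
  · have : Continuous fun u : ℂ => (u.re : ℂ) + ((|u.im| : ℝ) : ℂ) * Complex.I := by fun_prop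
    exact this

theorem fold_mem (s : Bool) (u : ℂ) : fold s u ∈ closedHalf s := by
  cases s <;> simp [fold, closedHalf]

theorem fold_eq {s : Bool} {u : ℂ} (h : u ∈ closedHalf s) : fold s u = u := by
  cases s <;> simp only [closedHalf, mem_ofPred_eq] at h
  · apply Complex.ext <;> simp [fold, abs_of_nonpos h]
  · apply Complex.ext <;> simp [fold, abs_of_nonneg h]

theorem norm_fold (s : Bool) (u : ℂ) : ‖fold s u‖ = ‖u‖ := by
  rw [Complex.norm_def, Complex.norm_def, Complex.normSq_apply, Complex.normSq_apply]
  cases s <;> simp [fold]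

theorem continuousOn_bmap (s : Bool) : ContinuousOn (S.bmap α β C s) (closedHalf s) :=
  ((continuousOn_const.mul continuousOn_id).add
    (continuousOn_const.mul (S.continuousOn_side s))).add continuousOn_const

theorem continuous_bmap_fold (s : Bool) : Continuous fun u => S.bmap α β C s (fold s u) :=
  (S.continuousOn_bmap α β C s).comp_continuous (continuous_fold s) (fold_mem s)

variable {S α β C}

theorem AsympId.norm_bmap (hA : S.AsympId) (s : Bool) :
    ∃ M ρ : ℝ, 0 < M ∧ ∀ u ∈ closedHalf s, ρ ≤ ‖u‖ →
      ‖α + β‖ * ‖u‖ - M ≤ ‖S.bmap α β C s u‖ ∧ ‖S.bmap α β C s u‖ ≤ ‖α + β‖ * ‖u‖ + M := by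
  obtain ⟨M, ρ, h⟩ := hA
  refine ⟨‖β‖ * |M| + ‖C‖ + 1, ρ, by positivity, fun u hu hn => ?_⟩
  have e : S.bmap α β C s u = (α + β) * u + (β * (S.side s u - u) + C) := by rw [bmap]; ring
  have e1 : ‖β * (S.side s u - u) + C‖ ≤ ‖β‖ * |M| + ‖C‖ := by
    refine (norm_add_le _ _).trans ?_
    rw [norm_mul]
    have := (h s u hu hn).trans (le_abs_self M)
    gcongr
  have h1 := norm_add_le ((α + β) * u) (β * (S.side s u - u) + C)
  have h2 := norm_sub_le_norm_add ((α + β) * u) (β * (S.side s u - u) + C)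
  rw [← e] at h1 h2
  rw [norm_mul] at h1 h2
  constructor <;> linarith

theorem AsympId.tendsto_cocompact (hA : S.AsympId) (hαβ : α + β ≠ 0) (s : Bool) :
    Tendsto (fun u => S.bmap α β C s (fold s u)) (cocompact ℂ) (cocompact ℂ) := by
  obtain ⟨M, ρ, hM, h⟩ := hA.norm_bmap (α := α) (β := β) (C := C) s
  refine tendsto_cocompact_cocompact_of_norm fun ε => ?_
  have hp : 0 < ‖α + β‖ := norm_pos_iff.2 hαβ
  refine ⟨max ρ ((M + ε + 1) / ‖α + β‖), fun u hu => ?_⟩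
  have h1 := (h (fold s u) (fold_mem s u) (by
    rw [norm_fold]; exact (le_max_left _ _).trans hu.le)).1
  rw [norm_fold] at h1
  have h2 : (M + ε + 1) / ‖α + β‖ < ‖u‖ := (le_max_right _ _).trans_lt hu
  rw [div_lt_iff₀ hp] at h2
  linarith

/-- On a closed half-plane the map is `(α + β) u + O(1)`, hence proper. Precomposition with `fold`
makes it a map of the whole plane with the same image. -/
theorem AsympId.isClosedMap (hA : S.AsympId) (hαβ : α + β ≠ 0) (s : Bool) :
    IsClosedMap fun u => S.bmap α β C s (fold s u) :=
  (isProperMap_iff_tendsto_cocompact.2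
    ⟨S.continuous_bmap_fold α β C s, hA.tendsto_cocompact hαβ s⟩).isClosedMap

/-- If `α Δu + β Δside = 0`, multiply by `conj β · conj Δu` and take real parts. All injectivity
statements come from the signs of the two resulting terms. -/
theorem bmap_key {s₁ s₂ : Bool} {u₁ u₂ : ℂ}
    (h : S.bmap α β C s₁ u₁ = S.bmap α β C s₂ u₂) :
    (α * conj β).re * Complex.normSq (u₁ - u₂) +
      Complex.normSq β * ((S.side s₁ u₁ - S.side s₂ u₂) * conj (u₁ - u₂)).re = 0 := by
  have e : α * (u₁ - u₂) + β * (S.side s₁ u₁ - S.side s₂ u₂) = 0 := by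
    simp only [bmap] at h; linear_combination h
  have e2 : (α * conj β) * ((u₁ - u₂) * conj (u₁ - u₂)) +
      (β * conj β) * ((S.side s₁ u₁ - S.side s₂ u₂) * conj (u₁ - u₂)) = 0 := by
    linear_combination (conj β * conj (u₁ - u₂)) * e
  rw [Complex.mul_conj, Complex.mul_conj] at e2
  have := congrArg Complex.re e2
  rwa [Complex.add_re, Complex.re_mul_ofReal, Complex.re_ofReal_mul, Complex.zero_re] at this

theorem isCompact_contourSet (a b : ℝ) : IsCompact (S.contourSet α β C a b) := by
  have : S.contourSet α β C a b = (fun x : ℝ => S.bmap α β C true x) '' Icc a b ∪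
      (fun x : ℝ => S.bmap α β C false x) '' Icc a b := by
    ext w
    simp [contourSet, or_comm]
  rw [this]
  refine (isCompact_Icc.image ?_).union (isCompact_Icc.image ?_)
  · exact (S.continuousOn_bmap α β C true).comp_continuous Complex.continuous_ofReal
      (by simp [closedHalf])
  · exact (S.continuousOn_bmap α β C false).comp_continuous Complex.continuous_ofReal
      (by simp [closedHalf])

section Closed

variable (hS : S.Closed)

include hS

theorem Closed.imap_eq_bmap {s : Bool} {u : ℂ} (hu : u ∉ S.slits) (hs : u ∈ closedHalf s) :
    S.imap α β C u = S.bmap α β C s u := by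
  rw [imap, bmap, hS.H_eq_side hu hs]

/-- Both terms of `bmap_key` are nonnegative, and for points that are not on one slit the second is
positive unless `β = 0`. In that case the map is affine with slope `α = α + β ≠ 0`. -/
theorem Closed.bmap_inj (hαβ : α + β ≠ 0) (hre : 0 ≤ (α * conj β).re) {s₁ s₂ : Bool} {u₁ u₂ : ℂ}
    (h1 : u₁ ∈ closedHalf s₁) (h2 : u₂ ∈ closedHalf s₂)
    (h : S.bmap α β C s₁ u₁ = S.bmap α β C s₂ u₂) : u₁ = u₂ ∨ S.SameSlit u₁ u₂ := by
  by_contra! hcon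
  have hk := bmap_key h
  have hq := (hS.quot s₁ s₂ h1 h2).2 hcon.1 hcon.2
  have hn : 0 < Complex.normSq (u₁ - u₂) := Complex.normSq_pos.2 (sub_ne_zero.2 hcon.1)
  have hβ : Complex.normSq β = 0 := by
    by_contra hβ
    have := mul_pos (lt_of_le_of_ne (Complex.normSq_nonneg β) (Ne.symm hβ)) hq
    nlinarith
  rw [Complex.normSq_eq_zero] at hβ
  subst hβ
  simp only [bmap, zero_mul, add_zero] at h hαβ
  exact hcon.1 (mul_left_cancel₀ hαβ (add_right_cancel h))

/-- With `Re (α conj β) > 0` the first term of `bmap_key` alone separates the points, even on a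
common slit. -/
theorem Closed.bmap_inj_of_pos (hre : 0 < (α * conj β).re) {s₁ s₂ : Bool} {u₁ u₂ : ℂ}
    (h1 : u₁ ∈ closedHalf s₁) (h2 : u₂ ∈ closedHalf s₂)
    (h : S.bmap α β C s₁ u₁ = S.bmap α β C s₂ u₂) : u₁ = u₂ := by
  have hk := bmap_key h
  have hq := (hS.quot s₁ s₂ h1 h2).1
  have h3 := mul_nonneg (Complex.normSq_nonneg β) hq
  have h4 := mul_nonneg hre.le (Complex.normSq_nonneg (u₁ - u₂))
  have h5 : (α * conj β).re * Complex.normSq (u₁ - u₂) = 0 := by linarith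
  rcases mul_eq_zero.1 h5 with h | h
  · linarith
  · exact sub_eq_zero.1 (Complex.normSq_eq_zero.1 h)

/-- Over an interior point of a slit the two boundary values differ by `2iβY`, and `Y > 0` there. -/
theorem Closed.bmap_side_ne (hβ : β ≠ 0) {x : ℝ} (hx : x ∈ Ioo S.a₀ S.b₀ ∨ x ∈ Ioo S.a₁ S.b₁)
    {s₁ s₂ : Bool} (h : S.bmap α β C s₁ x = S.bmap α β C s₂ x) : s₁ = s₂ := by
  have h' : S.side s₁ x = S.side s₂ x := by
    simp only [bmap] at h
    exact mul_left_cancel₀ hβ (by linear_combination h)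
  have := hS.Y_pos hx
  rw [side_ofReal, side_ofReal] at h'
  have h'' := congrArg Complex.im h'
  cases s₁ <;> cases s₂ <;> simp at h'' ⊢ <;> linarith

theorem Closed.imap_injOn (hαβ : α + β ≠ 0) (hre : 0 ≤ (α * conj β).re) :
    InjOn (S.imap α β C) S.slitsᶜ := by
  have hmem : ∀ u : ℂ, ∃ s, u ∈ closedHalf s := fun u =>
    (le_total 0 u.im).elim (fun h => ⟨true, h⟩) fun h => ⟨false, h⟩
  intro u₁ h1 u₂ h2 h
  obtain ⟨s₁, m1⟩ := hmem u₁
  obtain ⟨s₂, m2⟩ := hmem u₂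
  rw [hS.imap_eq_bmap h1 m1, hS.imap_eq_bmap h2 m2] at h
  refine (hS.bmap_inj hαβ hre m1 m2 h).resolve_right ?_
  rintro (h | h)
  · exact h1 (Or.inl h.1)
  · exact h1 (Or.inr h.1)

theorem Closed.hasDerivAt_imap {u : ℂ} (hu : u ∉ S.slits) :
    HasDerivAt (S.imap α β C) (α + β * S.g u) u := by
  have := (((hasDerivAt_id u).const_mul α).add ((hS.hasDerivAt_H hu).const_mul β)).add_const C
  rw [mul_one] at this
  exact this

/-- Infinitesimal form of the argument for injectivity: after multiplication by `conj β` the real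
part is `Re (α conj β) + |β|² Re g`. -/
theorem Closed.deriv_ne_zero (hαβ : α + β ≠ 0) (hre : 0 ≤ (α * conj β).re) {u : ℂ}
    (hu : u ∉ S.slits) : α + β * S.g u ≠ 0 := by
  intro h
  have hg := hS.g_re_pos hu
  have e : α * conj β + β * conj β * S.g u = 0 := by linear_combination conj β * h
  rw [Complex.mul_conj] at e
  have e' := congrArg Complex.re e
  rw [Complex.add_re, Complex.re_ofReal_mul, Complex.zero_re] at e'
  have hβ : Complex.normSq β = 0 := by
    by_contra hβ
    have := mul_pos (lt_of_le_of_ne (Complex.normSq_nonneg β) (Ne.symm hβ)) hg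
    linarith
  rw [Complex.normSq_eq_zero] at hβ
  subst hβ
  simp at h hαβ
  exact hαβ h

theorem Closed.hasStrictDerivAt_imap {u : ℂ} (hu : u ∉ S.slits) :
    HasStrictDerivAt (S.imap α β C) (α + β * S.g u) u := by
  have hd : DifferentiableOn ℂ (S.imap α β C) S.slitsᶜ := fun w hw =>
    (hS.hasDerivAt_imap hw).differentiableAt.differentiableWithinAt
  have ha := (hd.analyticAt (S.isClosed_slits.isOpen_compl.mem_nhds hu)).hasStrictDerivAt
  rwa [(hS.hasDerivAt_imap hu).deriv] at ha

theorem Closed.isOpen_image (hαβ : α + β ≠ 0) (hre : 0 ≤ (α * conj β).re) :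
    IsOpen (S.imap α β C '' S.slitsᶜ) := by
  rw [isOpen_iff_mem_nhds]
  rintro _ ⟨u, hu, rfl⟩
  rw [← (hS.hasStrictDerivAt_imap hu).map_nhds_eq (hS.deriv_ne_zero hαβ hre hu)]
  exact image_mem_map (S.isClosed_slits.isOpen_compl.mem_nhds hu)

/-- Image and contours together are the ranges of two closed maps; this is how the closure of the
image is found. -/
theorem Closed.union_eq :
    S.imap α β C '' S.slitsᶜ ∪
      (S.contourSet α β C S.a₀ S.b₀ ∪ S.contourSet α β C S.a₁ S.b₁) =
    range (fun u => S.bmap α β C true (fold true u)) ∪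
      range (fun u => S.bmap α β C false (fold false u)) := by
  apply Subset.antisymm
  · rintro w (⟨u, hu, rfl⟩ | ⟨s, x, hx, rfl⟩ | ⟨s, x, hx, rfl⟩)
    · rcases le_total 0 u.im with h | h
      · refine Or.inl ⟨u, ?_⟩
        have hm : u ∈ closedHalf true := h
        simp only [fold_eq hm, hS.imap_eq_bmap hu hm]
      · refine Or.inr ⟨u, ?_⟩
        have hm : u ∈ closedHalf false := h
        simp only [fold_eq hm, hS.imap_eq_bmap hu hm]
    all_goals
      have hm : (x : ℂ) ∈ closedHalf s := by cases s <;> simp [closedHalf]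
      cases s
      · exact Or.inr ⟨x, by simp only [fold_eq hm]⟩
      · exact Or.inl ⟨x, by simp only [fold_eq hm]⟩
  · have key : ∀ s v, v ∈ closedHalf s → S.bmap α β C s v ∈ S.imap α β C '' S.slitsᶜ ∪
      (S.contourSet α β C S.a₀ S.b₀ ∪ S.contourSet α β C S.a₁ S.b₁) := by
      intro s v hv
      by_cases hvs : v ∈ S.slits
      · rcases hvs with ⟨x, hx, rfl⟩ | ⟨x, hx, rfl⟩
        · exact Or.inr (Or.inl ⟨s, x, hx, rfl⟩)
        · exact Or.inr (Or.inr ⟨s, x, hx, rfl⟩)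
      · exact Or.inl ⟨v, hvs, hS.imap_eq_bmap hvs hv⟩
    rintro w (⟨u, rfl⟩ | ⟨u, rfl⟩)
    · exact key _ _ (fold_mem _ _)
    · exact key _ _ (fold_mem _ _)

theorem Closed.contour_subset_closure (a b : ℝ) :
    S.contourSet α β C a b ⊆ closure (S.imap α β C '' S.slitsᶜ) := by
  rintro w ⟨s, x, hx, rfl⟩
  set e : ℝ → ℂ := fun ε => x + ((if s then ε else -ε : ℝ) : ℂ) * Complex.I with he
  have hec : Tendsto e (𝓝[>] 0) (𝓝 (x : ℂ)) := by
    have : Continuous e := by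
      cases s
      · have : Continuous fun ε : ℝ => (x : ℂ) + ((-ε : ℝ) : ℂ) * Complex.I := by fun_prop
        exact this
      · have : Continuous fun ε : ℝ => (x : ℂ) + ((ε : ℝ) : ℂ) * Complex.I := by fun_prop
        exact this
    have h := this.tendsto 0
    have h0 : e 0 = x := by cases s <;> simp [he]
    rw [h0] at h
    exact h.mono_left nhdsWithin_le_nhds
  have hes : ∀ ε, 0 < ε → e ε ∈ closedHalf s ∧ e ε ∉ S.slits := by
    intro ε hε
    refine ⟨by cases s <;> simp [he, closedHalf, hε.le], S.notMem_slits ?_⟩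
    cases s <;> simp [he, hε.ne']
  have hm : (x : ℂ) ∈ closedHalf s := by cases s <;> simp [closedHalf]
  have ht := (S.continuousOn_bmap α β C s x hm).tendsto.comp (tendsto_nhdsWithin_iff.2
    ⟨hec, by filter_upwards [self_mem_nhdsWithin] with ε hε using (hes ε hε).1⟩)
  refine mem_closure_of_tendsto ht ?_
  filter_upwards [self_mem_nhdsWithin] with ε hε
  exact ⟨e ε, (hes ε hε).2, hS.imap_eq_bmap (hes ε hε).2 (hes ε hε).1⟩

theorem Closed.closure_image (hA : S.AsympId) (hαβ : α + β ≠ 0) :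
    closure (S.imap α β C '' S.slitsᶜ) = S.imap α β C '' S.slitsᶜ ∪
      (S.contourSet α β C S.a₀ S.b₀ ∪ S.contourSet α β C S.a₁ S.b₁) := by
  apply Subset.antisymm
  · refine closure_minimal subset_union_left ?_
    rw [hS.union_eq]
    exact (hA.isClosedMap hαβ true).isClosed_range.union (hA.isClosedMap hαβ false).isClosed_range
  · refine union_subset subset_closure (union_subset ?_ ?_)
    · exact hS.contour_subset_closure _ _
    · exact hS.contour_subset_closure _ _

/-- The map takes the complement of the slits to a domain containing a neighbourhood of infinity
which is bounded by the images of the two slits. -/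
theorem Closed.isExteriorDomain (hA : S.AsympId) (hαβ : α + β ≠ 0)
    (hre : 0 ≤ (α * conj β).re) :
    IsExteriorDomain (S.imap α β C '' S.slitsᶜ) (S.contourSet α β C S.a₀ S.b₀)
      (S.contourSet α β C S.a₁ S.b₁) := by
  have hmem : ∀ u : ℂ, ∃ s, u ∈ closedHalf s := fun u =>
    (le_total 0 u.im).elim (fun h => ⟨true, h⟩) fun h => ⟨false, h⟩
  have hreal : ∀ (s : Bool) (x : ℝ), (x : ℂ) ∈ closedHalf s := by
    intro s x; cases s <;> simp [closedHalf]
  have hopen := hS.isOpen_image (C := C) hαβ hre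
  set U := S.imap α β C '' S.slitsᶜ with hU
  have hdisjU : Disjoint U (S.contourSet α β C S.a₀ S.b₀ ∪ S.contourSet α β C S.a₁ S.b₁) := by
    rw [Set.disjoint_left]
    rintro w ⟨u, hu, rfl⟩ hw
    obtain ⟨t, ht⟩ := hmem u
    rw [hS.imap_eq_bmap hu ht] at hw
    have hkey : ∀ (s : Bool) (x : ℝ), (x : ℂ) ∈ S.slits →
        S.bmap α β C s x = S.bmap α β C t u → False := by
      intro s x hx h
      rcases hS.bmap_inj hαβ hre (hreal s x) ht h with h | h | h
      · exact hu (h ▸ hx)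
      · exact hu (Or.inl h.2)
      · exact hu (Or.inr h.2)
    rcases hw with ⟨s, x, hx, h⟩ | ⟨s, x, hx, h⟩
    · exact hkey s x (S.ofReal_mem_slits.2 (Or.inl hx)) h
    · exact hkey s x (S.ofReal_mem_slits.2 (Or.inr hx)) h
  have hcont : ContinuousOn (S.imap α β C) S.slitsᶜ := fun u hu =>
    (hS.hasDerivAt_imap hu).continuousAt.continuousWithinAt
  refine ⟨hopen, ⟨⟨_, mem_image_of_mem _ S.zero_notMem_slits⟩,
    S.isPreconnected_compl_slits.image _ hcont⟩, ?_, ?_, ?_⟩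
  · obtain ⟨M, hM⟩ := (((isCompact_contourSet S.a₀ S.b₀).union
      (isCompact_contourSet S.a₁ S.b₁)).isBounded).subset_closedBall (0 : ℂ) (s :=
        S.contourSet α β C S.a₀ S.b₀ ∪ S.contourSet α β C S.a₁ S.b₁)
    set M' := max M 1 with hM'
    have hpos : 0 < M' := lt_of_lt_of_le one_pos (le_max_right _ _)
    -- Outside a disc containing both contours the plane is covered by the two disjoint open sets
    -- `U` and the complement of its closure. The exterior of the disc is connected and meets `U`,
    -- as the map tends to infinity.
    have hsub : (Metric.closedBall (0 : ℂ) M')ᶜ ⊆ U := by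
      refine (isPreconnected_compl_closedBall hpos).subset_left_of_subset_union hopen
        isClosed_closure.isOpen_compl (v := (closure U)ᶜ) ?_ ?_ ?_
      · exact (disjoint_compl_right.mono_left subset_closure)
      · intro w hw
        by_cases hwc : w ∈ closure U
        · rw [hU, hS.closure_image hA hαβ] at hwc
          refine hwc.imp id fun h => absurd (hM h) fun h' => hw ?_
          exact Metric.closedBall_subset_closedBall (le_max_left _ _) h'
        · exact Or.inr hwc
      · have hc := hA.tendsto_cocompact (C := C) hαβ true
        have e1 := hc.eventually (isCompact_closedBall (0 : ℂ) M').compl_mem_cocompact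
        have hsl : IsCompact S.slits := (isCompact_Icc.image Complex.continuous_ofReal).union
          (isCompact_Icc.image Complex.continuous_ofReal)
        have e2 : ∀ᶠ u in cocompact ℂ, fold true u ∉ S.slits := by
          have : Tendsto (fold true) (cocompact ℂ) (cocompact ℂ) :=
            tendsto_cocompact_cocompact_of_norm fun ε => ⟨ε, fun u hu => by rwa [norm_fold]⟩
          exact this.eventually hsl.compl_mem_cocompact
        obtain ⟨u, h1, h2⟩ := (e1.and e2).exists
        exact ⟨_, h1, fold true u, h2, hS.imap_eq_bmap h2 (fold_mem _ _)⟩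
    exact mem_of_superset (isCompact_closedBall (0 : ℂ) M').compl_mem_cocompact hsub
  · rw [Set.disjoint_left]
    rintro w ⟨s, x, hx, rfl⟩ ⟨t, y, hy, h⟩
    have h1 := S.neg; have h2 := S.pos
    rcases hS.bmap_inj hαβ hre (hreal t y) (hreal s x) h with h | h | h
    · have : y = x := by exact_mod_cast h
      linarith [hx.2, hy.1]
    · have := (mem_realSeg.1 h.1).2.2
      simp at this; linarith [hy.1]
    · have := (mem_realSeg.1 h.2).2.1
      simp at this; linarith [hx.2]
  · rw [hopen.frontier_eq, hU, hS.closure_image hA hαβ, union_sdiff_left]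
    exact hdisjU.symm.sdiff_eq_left

/-- The two half-plane maps are closed, so a function that is continuous upstairs and constant on
fibres is continuous on each of the two ranges. The ranges are closed and cover the closure of the
image, so the pieces glue. -/
theorem Closed.exists_descend (hA : S.AsympId) (hαβ : α + β ≠ 0) {f : Bool → ℂ → ℂ}
    (hf : ∀ s, ContinuousOn (f s) (closedHalf s))
    (hcomp : ∀ s₁ s₂ u₁ u₂, u₁ ∈ closedHalf s₁ → u₂ ∈ closedHalf s₂ →
      S.bmap α β C s₁ u₁ = S.bmap α β C s₂ u₂ → f s₁ u₁ = f s₂ u₂) :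
    ∃ Ψ : ℂ → ℂ, ContinuousOn Ψ (closure (S.imap α β C '' S.slitsᶜ)) ∧
      ∀ s, ∀ u ∈ closedHalf s, Ψ (S.bmap α β C s u) = f s u := by
  set m : Bool × ℂ → ℂ := fun x => S.bmap α β C x.1 (fold x.1 x.2) with hm
  set F : Bool × ℂ → ℂ := fun x => f x.1 (fold x.1 x.2) with hF
  have hfac : Function.FactorsThrough F m := by
    rintro ⟨s, u⟩ ⟨t, v⟩ h
    exact hcomp s t _ _ (fold_mem _ _) (fold_mem _ _) h
  set Ψ : ℂ → ℂ := Function.extend m F 0 with hΨ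
  have hval : ∀ s u, Ψ (S.bmap α β C s (fold s u)) = f s (fold s u) := fun s u =>
    hfac.extend_apply 0 (s, u)
  have hc : ∀ s, ContinuousOn Ψ (range fun u => S.bmap α β C s (fold s u)) := by
    intro s
    rw [continuousOn_iff_isClosed]
    intro t ht
    have hcl : IsClosed ((fun u => f s (fold s u)) ⁻¹' t) :=
      ht.preimage ((hf s).comp_continuous (continuous_fold s) (fold_mem s))
    refine ⟨_, (hA.isClosedMap (C := C) hαβ s) _ hcl, ?_⟩
    ext w
    constructor
    · rintro ⟨h1, u, rfl⟩
      refine ⟨⟨u, ?_, rfl⟩, u, rfl⟩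
      simpa only [mem_preimage, hval] using h1
    · rintro ⟨⟨u, h1, rfl⟩, h2⟩
      refine ⟨?_, h2⟩
      simpa only [mem_preimage, hval] using h1
  refine ⟨Ψ, ?_, fun s u hu => ?_⟩
  · rw [hS.closure_image hA hαβ, hS.union_eq]
    exact (hc true).union_of_isClosed (hc false) (hA.isClosedMap hαβ true).isClosed_range
      (hA.isClosedMap hαβ false).isClosed_range
  · have := hval s u
    rwa [fold_eq hu] at this

/-- A function on the image of the map is holomorphic if its composition with the map is. -/
theorem Closed.differentiableOn_descend (hαβ : α + β ≠ 0) (hre : 0 ≤ (α * conj β).re)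
    {Ψ f : ℂ → ℂ} (hf : ∀ u ∉ S.slits, DifferentiableAt ℂ f u)
    (hΨ : ∀ u ∉ S.slits, Ψ (S.imap α β C u) = f u) :
    DifferentiableOn ℂ Ψ (S.imap α β C '' S.slitsᶜ) := by
  rintro _ ⟨u, hu, rfl⟩
  have hs := hS.hasStrictDerivAt_imap (α := α) (β := β) (C := C) hu
  have hne := hS.deriv_ne_zero hαβ hre hu
  set inv := hs.localInverse (S.imap α β C) _ u hne with hinv
  have hd := hs.to_localInverse hne
  have h0 : inv (S.imap α β C u) = u := by
    have := (hs.hasStrictFDerivAt_equiv hne).localInverse_apply_image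
    exact this
  have hright : ∀ᶠ w in 𝓝 (S.imap α β C u), S.imap α β C (inv w) = w :=
    (hs.hasStrictFDerivAt_equiv hne).eventually_right_inverse
  have hmem : ∀ᶠ w in 𝓝 (S.imap α β C u), inv w ∉ S.slits := by
    have hc := hd.hasDerivAt.continuousAt
    refine hc.eventually (S.isClosed_slits.isOpen_compl.mem_nhds ?_)
    have : inv (S.imap α β C u) ∉ S.slits := by rw [h0]; exact hu
    exact this
  have hcomp : DifferentiableAt ℂ (fun w => f (inv w)) (S.imap α β C u) := by
    refine DifferentiableAt.comp (S.imap α β C u) ?_ hd.hasDerivAt.differentiableAt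
    have := hf u hu
    rw [← h0] at this
    exact this
  refine (hcomp.congr_of_eventuallyEq ?_).differentiableWithinAt
  filter_upwards [hright, hmem] with w h1 h2
  rw [← hΨ _ h2, h1]

end Closed

end TwoSlits

/-! ### The quartic on the slits and integrals with inverse square root singularities -/

/-- The product of the two linear factors of the quartic with zeros off the slit `l_j`. -/
def rest (k : ℝ) (j : Fin 2) (ξ : ℝ) : ℝ :=
  if j = 0 then (ξ - 1) * (ξ - 1 / k) else (ξ + 1) * (ξ + 1 / k)

section slits

variable {k : ℝ}

theorem one_lt_inv (hk : k ∈ Ioo (0 : ℝ) 1) : 1 < 1 / k := by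
  rw [lt_div_iff₀ hk.1]; linarith [hk.2]

theorem lo_lt_hi (hk : k ∈ Ioo (0 : ℝ) 1) (j : Fin 2) : lo k j < hi k j := by
  have := one_lt_inv hk
  fin_cases j
  · simp only [lo, hi, Fin.zero_eta, if_true]; linarith
  · simpa [lo, hi] using this

theorem continuous_rest (j : Fin 2) : Continuous (rest k j) := by
  fin_cases j
  · have : Continuous fun ξ : ℝ => (ξ - 1) * (ξ - 1 / k) := by fun_prop
    exact this
  · have : Continuous fun ξ : ℝ => (ξ + 1) * (ξ + 1 / k) := by fun_prop
    exact this

theorem rest_pos (hk : k ∈ Ioo (0 : ℝ) 1) (j : Fin 2) {ξ : ℝ} (hξ : ξ ∈ Icc (lo k j) (hi k j)) :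
    0 < rest k j ξ := by
  have h1 := one_lt_inv hk
  fin_cases j
  · simp only [lo, hi, Fin.zero_eta, if_true] at hξ
    simp only [rest, Fin.zero_eta, if_true]
    exact mul_pos_of_neg_of_neg (by linarith [hξ.2]) (by linarith [hξ.2])
  · simp [lo, hi] at hξ
    simp only [rest, Fin.mk_one, one_ne_zero, if_false]
    exact mul_pos (by linarith [hξ.1]) (by linarith [hξ.1])

theorem p2_eq (j : Fin 2) (ξ : ℝ) :
    p2 k ξ = -((ξ - lo k j) * (hi k j - ξ) * rest k j ξ) := by
  have : 1 / k ^ 2 = (1 / k) ^ 2 := by rw [div_pow, one_pow]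
  rw [p2, this]
  fin_cases j
  · simp only [lo, hi, rest, Fin.zero_eta, if_true]; ring
  · simp only [lo, hi, rest, Fin.mk_one, one_ne_zero, if_false]; ring

theorem abs_p2 (hk : k ∈ Ioo (0 : ℝ) 1) (j : Fin 2) {ξ : ℝ} (hξ : ξ ∈ Icc (lo k j) (hi k j)) :
    |p2 k ξ| = (ξ - lo k j) * (hi k j - ξ) * rest k j ξ := by
  rw [p2_eq j, abs_neg, abs_of_nonneg]
  exact mul_nonneg (mul_nonneg (by linarith [hξ.1]) (by linarith [hξ.2])) (rest_pos hk j hξ).le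

theorem p2_neg (hk : k ∈ Ioo (0 : ℝ) 1) (j : Fin 2) {ξ : ℝ} (hξ : ξ ∈ Ioo (lo k j) (hi k j)) :
    p2 k ξ < 0 := by
  rw [p2_eq j, neg_lt_zero]
  exact mul_pos (mul_pos (by linarith [hξ.1]) (by linarith [hξ.2]))
    (rest_pos hk j ⟨hξ.1.le, hξ.2.le⟩)

theorem sqrt_abs_p2_pos (hk : k ∈ Ioo (0 : ℝ) 1) (j : Fin 2) {ξ : ℝ}
    (hξ : ξ ∈ Ioo (lo k j) (hi k j)) : 0 < √|p2 k ξ| :=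
  Real.sqrt_pos.2 (abs_pos.2 (p2_neg hk j hξ).ne)

theorem p2_pos (hk : k ∈ Ioo (0 : ℝ) 1) {z : ℝ} (hz : z ∈ Ioo (-1 : ℝ) 1) : 0 < p2 k z := by
  have h1 := one_lt_inv hk
  have : 1 / k ^ 2 = (1 / k) ^ 2 := by rw [div_pow, one_pow]
  rw [p2, this]
  exact mul_pos_of_neg_of_neg (by nlinarith [hz.1, hz.2]) (by nlinarith [hz.1, hz.2])

/-- The integrand is the nonnegative derivative of `arcsin ((2x - a - b) / (b - a))`, which is
continuous up to the ends. -/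
theorem intervalIntegrable_inv_sqrt {a b : ℝ} (hab : a < b) :
    IntervalIntegrable (fun x => 1 / √((x - a) * (b - x))) volume a b := by
  set F : ℝ → ℝ := fun x => Real.arcsin ((2 * x - a - b) / (b - a)) with hF
  have hd : ∀ x ∈ Ioo a b, HasDerivAt F (1 / √((x - a) * (b - x))) x := by
    intro x hx
    have hba : 0 < b - a := by linarith
    have hpos : 0 < (x - a) * (b - x) := mul_pos (by linarith [hx.1]) (by linarith [hx.2])
    have h1 : (2 * x - a - b) / (b - a) ≠ -1 := by
      rw [Ne, div_eq_iff hba.ne']; intro h; linarith [hx.1]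
    have h2 : (2 * x - a - b) / (b - a) ≠ 1 := by
      rw [Ne, div_eq_iff hba.ne']; intro h; linarith [hx.2]
    have hl : HasDerivAt (fun x => (2 * x - a - b) / (b - a)) (2 / (b - a)) x := by
      have := (((hasDerivAt_id x).const_mul 2).sub_const a).sub_const b |>.div_const (b - a)
      simpa using this
    have h := (Real.hasDerivAt_arcsin h1 h2).comp x hl
    have e : 1 / √((x - a) * (b - x)) =
        1 / √(1 - ((2 * x - a - b) / (b - a)) ^ 2) * (2 / (b - a)) := by
      have e1 : 1 - ((2 * x - a - b) / (b - a)) ^ 2 =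
          (x - a) * (b - x) * (2 / (b - a)) ^ 2 := by
        field_simp; ring
      rw [e1, Real.sqrt_mul hpos.le, Real.sqrt_sq (by positivity)]
      have := (Real.sqrt_pos.2 hpos).ne'
      field_simp
    rw [e]; exact h
  rw [intervalIntegrable_iff_integrableOn_Ioc_of_le hab.le]
  refine intervalIntegral.integrableOn_deriv_of_nonneg (g := F) ?_ hd fun x hx => by positivity
  exact (Real.continuous_arcsin.comp (by fun_prop)).continuousOn

theorem intervalIntegrable_div_sqrt_p2 (hk : k ∈ Ioo (0 : ℝ) 1) (j : Fin 2) {h : ℝ → ℝ}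
    (hh : ContinuousOn h (Icc (lo k j) (hi k j))) :
    IntervalIntegrable (fun ξ => h ξ / √|p2 k ξ|) volume (lo k j) (hi k j) := by
  have hlt := lo_lt_hi hk j
  have h1 := (intervalIntegrable_inv_sqrt hlt).mul_continuousOn
    (g := fun ξ => h ξ / √(rest k j ξ)) (by
      rw [uIcc_of_le hlt.le]
      refine hh.div (Real.continuous_sqrt.comp (continuous_rest j)).continuousOn fun ξ hξ => ?_
      exact (Real.sqrt_pos.2 (rest_pos hk j hξ)).ne')
  refine h1.congr fun ξ hξ => ?_
  rw [uIoc_of_le hlt.le] at hξ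
  have hξ' : ξ ∈ Icc (lo k j) (hi k j) := ⟨hξ.1.le, hξ.2⟩
  rw [abs_p2 hk j hξ', Real.sqrt_mul (mul_nonneg (by linarith [hξ.1]) (by linarith [hξ.2]))]
  ring

theorem intervalIntegrable_div_sqrt_p2_complex (hk : k ∈ Ioo (0 : ℝ) 1) (j : Fin 2) {h : ℝ → ℂ}
    (hh : ContinuousOn h (Icc (lo k j) (hi k j))) :
    IntervalIntegrable (fun ξ => h ξ / (√|p2 k ξ| : ℝ)) volume (lo k j) (hi k j) := by
  have hlt := lo_lt_hi hk j
  have h0 := intervalIntegrable_div_sqrt_p2 hk j (h := fun _ => 1) continuousOn_const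
  have h1 : IntervalIntegrable (fun ξ => ((1 / √|p2 k ξ| : ℝ) : ℂ)) volume (lo k j) (hi k j) := by
    rw [intervalIntegrable_iff_integrableOn_Ioc_of_le hlt.le] at h0 ⊢
    exact h0.ofReal
  refine (h1.mul_continuousOn (g := h) (by rwa [uIcc_of_le hlt.le])).congr fun ξ _ => ?_
  push_cast; ring

end slits

/-! ### The linear system for the coefficients -/

namespace Data

variable {P : Data}

section coefficients

variable (hk : P.k ∈ Ioo (0 : ℝ) 1) (hz : P.zinf ∈ Ioo (-1 : ℝ) 1)

include hk hz

omit hk in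
theorem sq_sub_ne_zero {ξ : ℝ} (hξ : ξ ∈ Icc 1 (1 / P.k)) :
    (ξ - P.zinf) ^ 2 ≠ 0 ∧ (ξ - -P.zinf) ^ 2 ≠ 0 :=
  ⟨pow_ne_zero _ (by linarith [hξ.1, hz.2]), pow_ne_zero _ (by linarith [hξ.1, hz.1])⟩

theorem intervalIntegrable_intI (j : ℕ) :
    IntervalIntegrable (P.intI P.zinf j) volume 1 (1 / P.k) ∧
      IntervalIntegrable (P.intI (-P.zinf) j) volume 1 (1 / P.k) := by
  have key : ∀ x : ℝ, (∀ ξ ∈ Icc (1 : ℝ) (1 / P.k), (ξ - x) ^ 2 ≠ 0) →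
      IntervalIntegrable (P.intI x j) volume 1 (1 / P.k) := by
    intro x hx
    have := intervalIntegrable_div_sqrt_p2 hk 1 (h := fun ξ => ξ ^ j / (ξ - x) ^ 2)
      (ContinuousOn.div (by fun_prop) (by fun_prop) hx)
    refine this.congr fun ξ _ => ?_
    simp only [intI, div_div]
  exact ⟨key _ fun ξ hξ => (sq_sub_ne_zero hz hξ).1,
    key _ fun ξ hξ => (sq_sub_ne_zero hz hξ).2⟩

theorem integral_quad (A₁ A₂ A₃ : ℝ) :
    A₁ * P.IM 0 + A₂ * P.IM 1 + A₃ * P.IM 2 =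
      ∫ ξ in (1 : ℝ)..(1 / P.k),
        (A₁ + A₂ * ξ + A₃ * ξ ^ 2) / ((ξ - P.zinf) ^ 2 * √|p2 P.k ξ|) := by
  have h := fun j => (intervalIntegrable_intI hk hz j).1
  simp only [IM]
  rw [← intervalIntegral.integral_const_mul, ← intervalIntegral.integral_const_mul,
    ← intervalIntegral.integral_const_mul, ← intervalIntegral.integral_add
      ((h 0).const_mul _) ((h 1).const_mul _), ← intervalIntegral.integral_add
      (((h 0).const_mul _).add ((h 1).const_mul _)) ((h 2).const_mul _)]
  refine intervalIntegral.integral_congr fun ξ _ => ?_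
  simp only [intI]; ring

/-- The combination defining `λ₀` has numerator `(ξ - ζ_∞)²`, which cancels the denominator and
leaves `∫ dξ / √|p₂|`. -/
theorem lam0_pos : 0 < P.lam0 := by
  have h : P.lam0 = P.zinf ^ 2 * P.IM 0 + (-2 * P.zinf) * P.IM 1 + 1 * P.IM 2 := by
    rw [lam0]; ring
  have h1 := one_lt_inv hk
  rw [h, integral_quad hk hz]
  have h0 := intervalIntegrable_div_sqrt_p2 hk 1 (h := fun _ => 1) continuousOn_const
  have hpos : 0 < ∫ ξ in (1 : ℝ)..(1 / P.k), 1 / √|p2 P.k ξ| := by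
    refine intervalIntegral.intervalIntegral_pos_of_pos_on h0 (fun ξ hξ => ?_) h1
    exact one_div_pos.2 (sqrt_abs_p2_pos hk 1 hξ)
  convert hpos using 1
  refine intervalIntegral.integral_congr fun ξ hξ => ?_
  rw [uIcc_of_le h1.le] at hξ
  have := (sq_sub_ne_zero hz hξ).1
  rw [← div_div]
  congr 1
  rw [div_eq_one_iff_eq this]; ring

/-- `λ₀` is the determinant of the system: eliminating `A₁` and `A₂` by the equations at `ζ_∞`
leaves a single equation for `A₃ λ₀`. -/
theorem pole_right_iff (d A₁ A₂ A₃ : ℝ) :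
    P.PoleEquations d A₁ A₂ A₃ ∧ P.RightLoopEquation A₁ A₂ A₃ ↔
      A₁ = P.coef1 d ∧ A₂ = P.coef2 d ∧ A₃ = P.coef3 d := by
  have hl := (lam0_pos hk hz).ne'
  have hlam : d * deriv (p2 P.k) P.zinf / (2 * p2 P.k P.zinf) = d * P.lam1 := by
    rw [lam1, mul_div_assoc]
  rw [PoleEquations, RightLoopEquation, hlam, coef1, coef2, coef3]
  constructor
  · rintro ⟨⟨e1, e2⟩, e3⟩
    have a3 : A₃ = -(d / P.lam0) * ((1 - P.lam1 * P.zinf) * P.IM 0 + P.lam1 * P.IM 1) := by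
      have : A₃ * P.lam0 = -d * ((1 - P.lam1 * P.zinf) * P.IM 0 + P.lam1 * P.IM 1) := by
        rw [lam0]
        linear_combination e3 - P.IM 0 * e1 - (P.IM 1 - P.zinf * P.IM 0) * e2
      field_simp; linear_combination this
    have a2 : A₂ = d * P.lam1 - 2 * P.zinf * A₃ := by linarith
    have a1 : A₁ = d - P.zinf * A₂ - P.zinf ^ 2 * A₃ := by linarith
    refine ⟨?_, ?_, a3⟩
    · rw [a1, a2, a3]; field_simp; rw [lam0]; ring
    · rw [a2, a3]; field_simp; rw [lam0]; ring
  · rintro ⟨rfl, rfl, rfl⟩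
    refine ⟨⟨?_, ?_⟩, ?_⟩
    · field_simp; rw [lam0]; ring
    · field_simp; rw [lam0]; ring
    · field_simp; ring

-- The coefficients are linear in `d`, so it is enough to study the single quadratic with `d = 1`.
omit hk hz in
theorem coef_smul (d : ℝ) : P.coef1 d = d * P.coef1 1 ∧ P.coef2 d = d * P.coef2 1 ∧
    P.coef3 d = d * P.coef3 1 := by
  refine ⟨?_, ?_, ?_⟩ <;> simp only [coef1, coef2, coef3] <;> ring

theorem pole_right (d : ℝ) : P.PoleEquations d (P.coef1 d) (P.coef2 d) (P.coef3 d) ∧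
    P.RightLoopEquation (P.coef1 d) (P.coef2 d) (P.coef3 d) :=
  (pole_right_iff hk hz d _ _ _).2 ⟨rfl, rfl, rfl⟩

end coefficients

end Data

/-! ### The branch of the square root -/

section branch

variable {k : ℝ}

/-- The slits of the parametric plane. -/
def zetaSlits (hk : k ∈ Ioo (0 : ℝ) 1) : TwoSlits where
  a₀ := -(1 / k)
  b₀ := -1
  a₁ := 1
  b₁ := 1 / k
  -- The quadratic is immaterial here; only the square root `R` of these slits is used.
  p := 0
  q := 0
  lt₀ := by linarith [one_lt_inv hk]
  neg := by norm_num
  pos := one_pos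
  lt₁ := one_lt_inv hk

variable (hk : k ∈ Ioo (0 : ℝ) 1)

include hk

theorem slitDomain_eq : slitDomain k = (zetaSlits hk).slitsᶜ := by
  simp [slitDomain, TwoSlits.slits, zetaSlits, slit, realSeg, lo, hi]

theorem isOpen_slitDomain : IsOpen (slitDomain k) := by
  rw [slitDomain_eq hk]; exact (zetaSlits hk).isClosed_slits.isOpen_compl

theorem mem_slitDomain_of_im {ζ : ℂ} (h : ζ.im ≠ 0) : ζ ∈ slitDomain k := by
  rw [slitDomain_eq hk]; exact (zetaSlits hk).notMem_slits h

theorem conj_mem_slitDomain {ζ : ℂ} (h : ζ ∈ slitDomain k) : conj ζ ∈ slitDomain k := by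
  rw [slitDomain_eq hk] at h ⊢; exact (zetaSlits hk).conj_notMem_slits h

theorem ofReal_mem_slitDomain {x : ℝ} :
    (x : ℂ) ∈ slitDomain k ↔ ∀ j, x ∉ Icc (lo k j) (hi k j) := by
  rw [slitDomain_eq hk, mem_compl_iff, TwoSlits.ofReal_mem_slits, not_or, Fin.forall_fin_two]
  simp [zetaSlits, lo, hi]

theorem isPreconnected_slitDomain : IsPreconnected (slitDomain k) := by
  rw [slitDomain_eq hk]; exact (zetaSlits hk).isPreconnected_compl_slits

/-- Squaring pulls the segment `[1, 1/k²]` back to the two slits, so `branch` is a root with a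
single cut composed with `ζ²`. -/
theorem sq_notMem_realSeg {ζ : ℂ} (h : ζ ∈ slitDomain k) : ζ ^ 2 ∉ realSeg 1 (1 / k ^ 2) := by
  have h1 := one_lt_inv hk
  intro hm
  obtain ⟨hi, h2, h3⟩ := mem_realSeg.1 hm
  rw [pow_two, Complex.mul_im] at hi
  rw [pow_two, Complex.mul_re] at h2 h3
  have him : ζ.im = 0 := by
    by_contra hne
    have : ζ.re = 0 := by
      have : ζ.re * ζ.im = 0 := by linarith
      exact (mul_eq_zero.1 this).resolve_right hne
    rw [this] at h2; nlinarith [mul_self_nonneg ζ.im]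
  obtain ⟨x, rfl⟩ : ∃ x : ℝ, ζ = x := ⟨ζ.re, Complex.ext rfl (by simpa using him)⟩
  have e : 1 / k ^ 2 = (1 / k) ^ 2 := by rw [div_pow, one_pow]
  rw [slitDomain_eq hk, mem_compl_iff, TwoSlits.ofReal_mem_slits] at h
  apply h
  simp only [Complex.ofReal_re, Complex.ofReal_im, mul_zero, sub_zero] at h2 h3
  rw [e] at h3
  have ha : |x| ≤ 1 / k := abs_le_of_sq_le_sq (by nlinarith) (by linarith)
  have hb : 1 ≤ |x| := by
    rw [← abs_one]; exact sq_le_sq.1 (by nlinarith)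
  rcases le_abs.1 hb with hx | hx
  · exact Or.inr ⟨hx, (abs_le.1 ha).2⟩
  · exact Or.inl ⟨(abs_le.1 ha).1, by
      change x ≤ -1
      linarith⟩

omit hk in
theorem branch_eq_slitSqrt (ζ : ℂ) : branch k ζ = slitSqrt 1 (1 / k ^ 2) (ζ ^ 2) := by
  simp [branch, slitSqrt]

theorem one_lt_inv_sq : 1 < 1 / k ^ 2 := by
  have h1 := one_lt_inv hk
  have e : 1 / k ^ 2 = (1 / k) ^ 2 := by rw [div_pow, one_pow]
  rw [e]; nlinarith

theorem differentiableAt_branch {ζ : ℂ} (h : ζ ∈ slitDomain k) :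
    DifferentiableAt ℂ (branch k) ζ := by
  have : branch k = fun ζ => slitSqrt 1 (1 / k ^ 2) (ζ ^ 2) := funext branch_eq_slitSqrt
  rw [this]
  exact DifferentiableAt.comp (g := slitSqrt 1 (1 / k ^ 2)) (f := fun w : ℂ => w ^ 2) ζ
    (differentiableAt_slitSqrt (one_lt_inv_sq hk) (sq_notMem_realSeg hk h)) (by fun_prop)

theorem branch_ne_zero {ζ : ℂ} (h : ζ ∈ slitDomain k) : branch k ζ ≠ 0 := by
  rw [branch_eq_slitSqrt]
  exact slitSqrt_ne_zero (one_lt_inv_sq hk).le (sq_notMem_realSeg hk h)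

omit hk in
/-- The quartic as a complex polynomial function. -/
theorem p2_ofReal (x : ℝ) :
    ((p2 k x : ℝ) : ℂ) = ((x : ℂ) ^ 2 - 1) * ((x : ℂ) ^ 2 - 1 / (k : ℂ) ^ 2) := by
  simp [p2]

theorem branch_sq_of_mem {ζ : ℂ} (h : ζ ∈ slitDomain k) :
    branch k ζ ^ 2 = (ζ ^ 2 - 1) * (ζ ^ 2 - 1 / (k : ℂ) ^ 2) := by
  apply branch_sq
  have := (ne_of_notMem_realSeg (one_lt_inv_sq hk).le (sq_notMem_realSeg hk h)).2
  simpa using this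

/-- Two nonvanishing continuous roots of the same function on a connected set agree once they agree
at one point; at `0` both equal `-1/k`. -/
theorem branch_eq_R {ζ : ℂ} (h : ζ ∈ slitDomain k) : branch k ζ = (zetaSlits hk).R ζ := by
  have h1 := one_lt_inv hk
  set S := zetaSlits hk with hS
  have hcb : ContinuousOn (branch k) (slitDomain k) := fun w hw =>
    (differentiableAt_branch hk hw).continuousAt.continuousWithinAt
  have hcR : ContinuousOn S.R (slitDomain k) := fun w hw => by
    rw [slitDomain_eq hk] at hw
    exact (S.differentiableAt_R hw).continuousAt.continuousWithinAt
  have h0 : (0 : ℂ) ∈ slitDomain k := by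
    rw [slitDomain_eq hk]; exact S.zero_notMem_slits
  refine (isPreconnected_slitDomain hk).eq_of_sq_eq hcb hcR (fun w hw => ?_)
    (fun {w} hw => ?_) h0 ?_ h
  · change branch k w ^ 2 = S.R w ^ 2
    rw [branch_sq_of_mem hk hw]
    rw [slitDomain_eq hk] at hw
    rw [S.R_sq hw]
    simp only [hS, zetaSlits]
    push_cast; ring
  · rw [slitDomain_eq hk] at hw; exact S.R_ne_zero hw
  · rw [slitDomain_eq hk] at h0
    rw [S.R_eq_Rup h0 (by simp)]
    have hu := S.Rup_of_mem_gap (x := 0) ⟨S.neg.le, S.pos.le⟩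
    rw [Complex.ofReal_zero] at hu
    rw [hu, branch]
    have e : (((0 : ℂ) ^ 2 - 1) / (0 ^ 2 - 1 / (k : ℂ) ^ 2)) = ((k ^ 2 : ℝ) : ℂ) := by
      have : (k : ℂ) ≠ 0 := by exact_mod_cast hk.1.ne'
      push_cast; field_simp
      ring
    rw [e, half_cpow_ofReal (by positivity), Real.sqrt_sq hk.1.le]
    have e2 : |S.quartic 0| = (1 / k) ^ 2 := by
      have : S.quartic 0 = (1 / k) ^ 2 := by
        simp only [TwoSlits.quartic, hS, zetaSlits]; ring
      rw [this, abs_of_nonneg (by positivity)]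
    rw [e2, Real.sqrt_sq (by linarith)]
    have : (k : ℂ) ≠ 0 := by exact_mod_cast hk.1.ne'
    push_cast; field_simp; ring

theorem quartic_zetaSlits (x : ℝ) : (zetaSlits hk).quartic x = p2 k x := by
  have : 1 / k ^ 2 = (1 / k) ^ 2 := by rw [div_pow, one_pow]
  rw [p2, this]
  simp only [TwoSlits.quartic, zetaSlits]; ring

theorem branch_conj {ζ : ℂ} (h : ζ ∈ slitDomain k) : branch k (conj ζ) = conj (branch k ζ) := by
  rw [branch_eq_R hk h, branch_eq_R hk (conj_mem_slitDomain hk h)]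
  rw [slitDomain_eq hk] at h
  exact (zetaSlits hk).R_conj h

/-- Between the slits the factor is `i² = -1`. This sign is the reason for `G(ζ_∞) = -1` and for `G
= -g`. -/
theorem branch_of_mem_Ioo {x : ℝ} (h : x ∈ Ioo (-1 : ℝ) 1) : branch k x = -(√|p2 k x| : ℝ) := by
  have hx : (x : ℂ) ∈ slitDomain k := by
    rw [slitDomain_eq hk, mem_compl_iff, TwoSlits.ofReal_mem_slits]
    simp only [zetaSlits, mem_Icc]
    rintro (h' | h') <;> linarith [h.1, h.2, h'.1, h'.2]
  rw [branch_eq_R hk hx]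
  rw [slitDomain_eq hk] at hx
  rw [TwoSlits.R_eq_Rup _ hx (by simp), TwoSlits.Rup_of_mem_gap _ ⟨h.1.le, h.2.le⟩,
    quartic_zetaSlits]

omit hk in
/-- The sign of the boundary value of the branch on the upper side of the slit `l_j`. -/
def slitSign (j : Fin 2) : ℝ := if j = 0 then -1 else 1

/-- The boundary value of the branch on the upper (`true`) or lower (`false`) side of `l_j`. -/
def branchSide (k : ℝ) (j : Fin 2) (s : Bool) (ξ : ℝ) : ℂ :=
  (((if s then 1 else -1) * slitSign j * √|p2 k ξ| : ℝ) : ℂ) * Complex.I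

theorem Rup_zetaSlits (j : Fin 2) {ξ : ℝ} (h : ξ ∈ Icc (lo k j) (hi k j)) :
    (zetaSlits hk).Rup ξ = branchSide k j true ξ := by
  fin_cases j
  · have h' : ξ ∈ Icc (zetaSlits hk).a₀ (zetaSlits hk).b₀ := by simpa [lo, hi, zetaSlits] using h
    rw [TwoSlits.Rup_of_mem_slit₀ _ h', quartic_zetaSlits]
    simp [branchSide, slitSign]
  · have h' : ξ ∈ Icc (zetaSlits hk).a₁ (zetaSlits hk).b₁ := by simpa [lo, hi, zetaSlits] using h
    rw [TwoSlits.Rup_of_mem_slit₁ _ h', quartic_zetaSlits]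
    simp [branchSide, slitSign]

omit hk in
theorem conj_branchSide (j : Fin 2) (s : Bool) (ξ : ℝ) :
    conj (branchSide k j s ξ) = branchSide k j (!s) ξ := by
  cases s <;> simp [branchSide]

omit hk in
theorem branchSide_not (j : Fin 2) (s : Bool) (ξ : ℝ) :
    branchSide k j (!s) ξ = -branchSide k j s ξ := by
  cases s <;> simp [branchSide]

theorem branchSide_ne_zero (j : Fin 2) (s : Bool) {ξ : ℝ} (h : ξ ∈ Ioo (lo k j) (hi k j)) :
    branchSide k j s ξ ≠ 0 := by
  have := (sqrt_abs_p2_pos hk j h).ne'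
  refine mul_ne_zero ?_ Complex.I_ne_zero
  fin_cases j <;> cases s <;> simp [slitSign] <;> simpa using this

theorem tendsto_branch (j : Fin 2) (s : Bool) {ξ : ℝ} (h : ξ ∈ Icc (lo k j) (hi k j)) :
    Tendsto (branch k) (𝓝[halfPlane s] (ξ : ℂ)) (𝓝 (branchSide k j s ξ)) := by
  have hup : Tendsto (branch k) (𝓝[halfPlane true] (ξ : ℂ)) (𝓝 (branchSide k j true ξ)) := by
    rw [← Rup_zetaSlits hk j h]
    refine ((zetaSlits hk).continuous_Rup.tendsto (ξ : ℂ) |>.mono_left nhdsWithin_le_nhds).congr' ?_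
    filter_upwards [self_mem_nhdsWithin] with ζ hζ
    have hζ' : 0 < ζ.im := hζ
    rw [branch_eq_R hk (mem_slitDomain_of_im hk hζ'.ne'),
      TwoSlits.R_eq_Rup _ (TwoSlits.notMem_slits _ hζ'.ne') hζ'.le]
  cases s
  · have hc : Tendsto (fun u : ℂ => conj u) (𝓝[halfPlane false] (ξ : ℂ))
        (𝓝[halfPlane true] (ξ : ℂ)) := by
      refine tendsto_nhdsWithin_iff.2 ⟨?_, ?_⟩
      · have := Complex.continuous_conj.tendsto (ξ : ℂ)
        rw [Complex.conj_ofReal] at this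
        exact this.mono_left nhdsWithin_le_nhds
      · filter_upwards [self_mem_nhdsWithin] with u hu
        have h1 : u.im < 0 := hu
        change 0 < (conj u).im
        simpa using h1
    have := (Complex.continuous_conj.tendsto _).comp (hup.comp hc)
    rw [conj_branchSide] at this
    refine this.congr' ?_
    filter_upwards [self_mem_nhdsWithin] with u hu
    have h1 : u.im < 0 := hu
    simp only [Function.comp]
    rw [branch_conj hk (mem_slitDomain_of_im hk h1.ne), Complex.conj_conj]
  · exact hup

omit hk in
theorem halfPlane_neBot (s : Bool) (x : ℝ) : (𝓝[halfPlane s] (x : ℂ)).NeBot := by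
  rw [← mem_closure_iff_nhdsWithin_neBot]
  cases s
  · change (x : ℂ) ∈ closure {ζ : ℂ | ζ.im < 0}
    rw [Complex.closure_setOfPred_im_lt]; simp
  · change (x : ℂ) ∈ closure {ζ : ℂ | 0 < ζ.im}
    rw [Complex.closure_setOfPred_lt_im]; simp

end branch

namespace Data

variable {P : Data}

/-! ### The imaginary function on the slits -/

variable (P) in
/-- The normalized quadratic polynomial in the numerator of `ω'`. -/
def quad (ζ : ℂ) : ℂ := P.coef1 1 + P.coef2 1 * ζ + P.coef3 1 * ζ ^ 2

variable (P) in
/-- The normalized quadratic polynomial on the real axis. -/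
def quadR (x : ℝ) : ℝ := P.coef1 1 + P.coef2 1 * x + P.coef3 1 * x ^ 2

variable (P) in
/-- The normalizing constant `√|p₂(ζ_∞)|`. -/
def scale : ℝ := √|p2 P.k P.zinf|

variable (P) in
/-- The normalized quotient of the quadratic polynomial and the branch. -/
def G (ζ : ℂ) : ℂ := P.scale * P.quad ζ / branch P.k ζ

theorem quad_ofReal (x : ℝ) : P.quad x = P.quadR x := by simp [quad, quadR]

theorem continuous_quad : Continuous P.quad := by unfold quad; fun_prop

theorem differentiable_quad : Differentiable ℂ P.quad := by unfold quad; fun_prop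

variable (hk : P.k ∈ Ioo (0 : ℝ) 1) (hz : P.zinf ∈ Ioo (-1 : ℝ) 1)

include hk hz

theorem scale_pos : 0 < P.scale := Real.sqrt_pos.2 (abs_pos.2 (p2_pos hk hz).ne')

theorem scale_sq : P.scale ^ 2 = p2 P.k P.zinf := by
  rw [scale, Real.sq_sqrt (abs_nonneg _), abs_of_pos (p2_pos hk hz)]

theorem zinf_mem : (P.zinf : ℂ) ∈ slitDomain P.k := by
  rw [slitDomain_eq hk, mem_compl_iff, TwoSlits.ofReal_mem_slits]
  simp only [zetaSlits, mem_Icc]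
  rintro (h' | h') <;> linarith [hz.1, hz.2, h'.1, h'.2]

theorem quadR_zinf : P.quadR P.zinf = 1 := by
  have := (pole_right hk hz 1).1.1
  rw [quadR]; linarith

theorem quad_zinf : P.quad P.zinf = 1 := by
  rw [quad_ofReal, quadR_zinf hk hz, Complex.ofReal_one]

theorem quad_deriv_zinf : P.coef2 1 + 2 * P.zinf * P.coef3 1 = P.lam1 := by
  have := (pole_right hk hz 1).1.2
  rw [this, lam1, one_mul]

theorem branch_zinf : branch P.k P.zinf = -P.scale := branch_of_mem_Ioo hk hz

omit hz in
theorem differentiableAt_G {ζ : ℂ} (h : ζ ∈ slitDomain P.k) : DifferentiableAt ℂ P.G ζ :=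
  ((differentiable_quad ζ).const_mul _).div (differentiableAt_branch hk h) (branch_ne_zero hk h)

theorem G_zinf : P.G P.zinf = -1 := by
  have : (P.scale : ℂ) ≠ 0 := by exact_mod_cast (scale_pos hk hz).ne'
  rw [G, quad_zinf hk hz, branch_zinf hk hz]; field_simp

omit hk hz in
theorem deriv_p2 (x : ℝ) : deriv (p2 P.k) x = 2 * x * (2 * x ^ 2 - 1 - 1 / P.k ^ 2) := by
  have h : HasDerivAt (p2 P.k) ((2 * x) * (x ^ 2 - 1 / P.k ^ 2) + (x ^ 2 - 1) * (2 * x)) x := by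
    have h1 : HasDerivAt (fun x : ℝ => x ^ 2 - 1) (2 * x) x := by
      simpa using (hasDerivAt_pow 2 x).sub_const 1
    have h2 : HasDerivAt (fun x : ℝ => x ^ 2 - 1 / P.k ^ 2) (2 * x) x := by
      simpa using (hasDerivAt_pow 2 x).sub_const (1 / P.k ^ 2)
    exact h1.mul h2
  rw [h.deriv]; ring

/-- By the second equation at `ζ_∞` the logarithmic derivative of `quad` there is `p₂' / (2p₂)`,
which is that of `branch`; so the quotient is stationary and `G / (ζ - ζ_∞)²` has no residue. -/
theorem deriv_G_zinf : deriv P.G (P.zinf : ℂ) = 0 := by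
  have hmem := zinf_mem hk hz
  set z : ℂ := (P.zinf : ℂ) with hzdef
  set s : ℂ := (P.scale : ℂ) with hs
  have hs0 : s ≠ 0 := by rw [hs]; exact_mod_cast (scale_pos hk hz).ne'
  have hb := (differentiableAt_branch hk hmem).hasDerivAt
  have hq : HasDerivAt P.quad (P.coef2 1 + 2 * z * P.coef3 1) z := by
    have h1 := ((hasDerivAt_id z).const_mul (P.coef2 1 : ℂ)).const_add (P.coef1 1 : ℂ)
    have h2 := (hasDerivAt_pow 2 z).const_mul (P.coef3 1 : ℂ)
    have h := h1.add h2
    refine HasDerivAt.congr_deriv (f := P.quad) h ?_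
    rw [show (2 - 1 : ℕ) = 1 from rfl, pow_one]
    push_cast; ring
  have hfd : 2 * branch P.k z * deriv (branch P.k) z =
      ((deriv (p2 P.k) P.zinf : ℝ) : ℂ) := by
    have h1 := hb.pow 2
    have h2 : HasDerivAt (fun w : ℂ => (w ^ 2 - 1) * (w ^ 2 - 1 / (P.k : ℂ) ^ 2))
        ((2 * z) * (z ^ 2 - 1 / (P.k : ℂ) ^ 2) + (z ^ 2 - 1) * (2 * z)) z := by
      have h1 : HasDerivAt (fun x : ℂ => x ^ 2 - 1) (2 * z) z := by
        simpa using (hasDerivAt_pow 2 z).sub_const 1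
      have h2 : HasDerivAt (fun x : ℂ => x ^ 2 - 1 / (P.k : ℂ) ^ 2) (2 * z) z := by
        simpa using (hasDerivAt_pow 2 z).sub_const (1 / (P.k : ℂ) ^ 2)
      exact h1.mul h2
    have heq : (branch P.k ^ 2) =ᶠ[𝓝 z]
        (fun w : ℂ => (w ^ 2 - 1) * (w ^ 2 - 1 / (P.k : ℂ) ^ 2)) := by
      filter_upwards [(isOpen_slitDomain hk).mem_nhds hmem] with w hw
      exact branch_sq_of_mem hk hw
    have h3 := (h2.congr_of_eventuallyEq heq).unique h1
    rw [deriv_p2]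
    push_cast
    simp only [Nat.cast_ofNat] at h3
    rw [show (2 - 1 : ℕ) = 1 from rfl, pow_one] at h3
    rw [← h3, ← hzdef]; ring
  have hbz : branch P.k z = -s := branch_zinf hk hz
  have hqz : P.quad z = 1 := quad_zinf hk hz
  have hG := (hq.const_mul s).div hb (branch_ne_zero hk hmem)
  have hGd : deriv P.G z = _ := hG.deriv
  rw [hGd, hbz, hqz]
  have hlam : (P.coef2 1 + 2 * z * P.coef3 1 : ℂ) = P.lam1 := by
    rw [← quad_deriv_zinf hk hz]; push_cast; rfl
  have hl1 : (P.lam1 : ℂ) * (2 * s ^ 2) = ((deriv (p2 P.k) P.zinf : ℝ) : ℂ) := by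
    have h0 := (p2_pos hk hz).ne'
    have : P.lam1 * (2 * P.scale ^ 2) = deriv (p2 P.k) P.zinf := by
      rw [scale_sq hk hz, lam1]; field_simp
    rw [← this]; push_cast; rfl
  rw [hbz] at hfd
  rw [hlam, div_eq_zero_iff]
  left
  linear_combination (-1 / 2 : ℂ) * (hl1 - hfd)

/-- Near `ζ_∞` the function `(G + 1) / (ζ - ζ_∞)²` is analytic. -/
theorem exists_G_expansion : ∃ h : ℂ → ℂ, DifferentiableOn ℂ h (slitDomain P.k) ∧
    ∀ ζ : ℂ, ζ ≠ P.zinf → h ζ = (P.G ζ + 1) / (ζ - P.zinf) ^ 2 := by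
  have hmem := zinf_mem hk hz
  have hn := (isOpen_slitDomain hk).mem_nhds hmem
  have hG : DifferentiableOn ℂ P.G (slitDomain P.k) := fun w hw =>
    (differentiableAt_G hk hw).differentiableWithinAt
  -- The value `-1` and the vanishing derivative at `ζ_∞` make the second divided difference equal
  -- to `(G + 1) / (ζ - ζ_∞)²`.
  refine ⟨dslope (dslope P.G P.zinf) P.zinf, ?_, fun ζ hζ => ?_⟩
  · exact (Complex.differentiableOn_dslope hn).2 ((Complex.differentiableOn_dslope hn).2 hG)
  · rw [dslope_of_ne _ hζ, slope_def_field, dslope_same, deriv_G_zinf hk hz,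
      dslope_of_ne _ hζ, slope_def_field, G_zinf hk hz]
    have := sub_ne_zero.2 hζ
    field_simp; ring

end Data

/-! ### The inversion `u = 1 / (ζ - ζ_∞)` -/

namespace Data

variable {P : Data}

section inverse

variable (hk : P.k ∈ Ioo (0 : ℝ) 1) (hz : P.zinf ∈ Ioo (-1 : ℝ) 1)

include hk hz in
theorem zinf_cases (j : Fin 2) : hi P.k j < P.zinf ∨ P.zinf < lo P.k j := by
  have := one_lt_inv hk
  fin_cases j
  · left; simpa [hi] using hz.1
  · right; simpa [lo] using hz.2

/-- The slits in the plane of the variable `u = 1 / (ζ - ζ_∞)`. -/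
def inverseSlits : TwoSlits where
  -- The inversion is decreasing on each side of `ζ_∞`, so the right end of a slit becomes a left
  -- end.
  a₀ := 1 / (hi P.k 0 - P.zinf)
  b₀ := 1 / (lo P.k 0 - P.zinf)
  a₁ := 1 / (hi P.k 1 - P.zinf)
  b₁ := 1 / (lo P.k 1 - P.zinf)
  -- These are the coefficients of `u² quad(ζ_∞ + 1/u)`: the leading one is `quad(ζ_∞) = 1`, the
  -- next is `quad'(ζ_∞) = λ₁`.
  p := P.lam1
  q := P.coef3 1
  lt₀ := by
    have h1 := lo_lt_hi hk 0
    have h2 : hi P.k 0 < P.zinf := by simpa [hi] using hz.1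
    exact one_div_lt_one_div_of_neg_of_lt (by linarith) (by linarith)
  neg := by
    have h1 := lo_lt_hi hk 0
    have h2 : hi P.k 0 < P.zinf := by simpa [hi] using hz.1
    exact one_div_neg.2 (by linarith)
  pos := by
    have h1 := lo_lt_hi hk 1
    have h2 : P.zinf < lo P.k 1 := by simpa [lo] using hz.2
    exact one_div_pos.2 (by linarith)
  lt₁ := by
    have h1 := lo_lt_hi hk 1
    have h2 : P.zinf < lo P.k 1 := by simpa [lo] using hz.2
    exact one_div_lt_one_div_of_lt (by linarith) (by linarith)

local notation "S" => inverseSlits hk hz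

include hk hz in
theorem inv_mem_Icc_iff (j : Fin 2) {ξ : ℝ} (hξ : ξ ≠ P.zinf) :
    1 / (ξ - P.zinf) ∈ Icc (1 / (hi P.k j - P.zinf)) (1 / (lo P.k j - P.zinf)) ↔
      ξ ∈ Icc (lo P.k j) (hi P.k j) := by
  have h1 := lo_lt_hi hk j
  rcases zinf_cases hk hz j with h2 | h2
  · rcases lt_or_gt_of_ne hξ with h | h
    · rw [mem_Icc, one_div_le_one_div_of_neg (by linarith) (by linarith),
        one_div_le_one_div_of_neg (by linarith) (by linarith)]
      simp only [mem_Icc, sub_le_sub_iff_right]; tauto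
    · have h3 : 0 < 1 / (ξ - P.zinf) := one_div_pos.2 (by linarith)
      have h4 : 1 / (lo P.k j - P.zinf) < 0 := one_div_neg.2 (by linarith)
      constructor
      · intro h5; linarith [h5.2]
      · intro h5; linarith [h5.2]
  · rcases lt_or_gt_of_ne hξ with h | h
    · have h3 : 1 / (ξ - P.zinf) < 0 := one_div_neg.2 (by linarith)
      have h4 : 0 < 1 / (hi P.k j - P.zinf) := one_div_pos.2 (by linarith)
      constructor
      · intro h5; linarith [h5.1]
      · intro h5; linarith [h5.1]
    · rw [mem_Icc, one_div_le_one_div (by linarith) (by linarith),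
        one_div_le_one_div (by linarith) (by linarith)]
      simp only [mem_Icc, sub_le_sub_iff_right]; tauto

theorem inv_sub_im (ζ : ℂ) (z : ℝ) :
    (1 / (ζ - z)).im = -ζ.im / Complex.normSq (ζ - z) := by
  simp [Complex.inv_im]

theorem inv_mem_slits_iff {ζ : ℂ} (h : ζ ≠ P.zinf) :
    1 / (ζ - P.zinf) ∈ (S).slits ↔ ζ ∉ slitDomain P.k := by
  have hn : Complex.normSq (ζ - P.zinf) ≠ 0 := by
    rw [ne_eq, Complex.normSq_eq_zero, sub_eq_zero]; exact h
  by_cases him : ζ.im = 0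
  · obtain ⟨x, rfl⟩ : ∃ x : ℝ, ζ = x := ⟨ζ.re, Complex.ext rfl (by simpa using him)⟩
    have hx : x ≠ P.zinf := by exact_mod_cast h
    have e : (1 / ((x : ℂ) - P.zinf)) = ((1 / (x - P.zinf) : ℝ) : ℂ) := by push_cast; rfl
    rw [e, TwoSlits.ofReal_mem_slits, ofReal_mem_slitDomain hk, not_forall]
    simp only [not_not, Fin.exists_fin_two]
    exact or_congr (inv_mem_Icc_iff hk hz 0 hx) (inv_mem_Icc_iff hk hz 1 hx)
  · have h1 := mem_slitDomain_of_im hk him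
    have h2 : (1 / (ζ - P.zinf)).im ≠ 0 := by
      rw [inv_sub_im]; exact div_ne_zero (neg_ne_zero.2 him) hn
    exact ⟨fun h3 => absurd h3 (TwoSlits.notMem_slits _ h2), fun h3 => absurd h1 h3⟩

theorem inv_notMem_slits {ζ : ℂ} (h : ζ ∈ P.punctured) : 1 / (ζ - P.zinf) ∉ (S).slits := by
  rw [inv_mem_slits_iff hk hz h.2]; exact fun hn => hn h.1

/-- The inverse of the change of variable. -/
theorem add_inv_mem_punctured {u : ℂ} (h : u ∉ (S).slits) (h0 : u ≠ 0) :
    (P.zinf : ℂ) + 1 / u ∈ P.punctured := by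
  have hne : (P.zinf : ℂ) + 1 / u ≠ P.zinf := by simpa using h0
  refine ⟨?_, hne⟩
  by_contra h'
  rw [← inv_mem_slits_iff hk hz hne] at h'
  apply h
  simpa using h'

theorem quad_inv {u : ℂ} (h0 : u ≠ 0) : P.quad (P.zinf + 1 / u) * u ^ 2 = (S).E u := by
  have h1 := quad_zinf hk hz
  have h2 : (P.coef2 1 + 2 * P.zinf * P.coef3 1 : ℂ) = P.lam1 := by
    rw [← quad_deriv_zinf hk hz]; push_cast; rfl
  simp only [TwoSlits.E, inverseSlits]
  rw [← h2]
  rw [quad] at h1 ⊢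
  field_simp
  linear_combination u ^ 2 * h1

-- The left side is a quartic in `u` that vanishes at the inverted slit ends; its leading
-- coefficient is `p₂(ζ_∞) = scale²`.
include hk in
theorem p2_inv {u : ℂ} (h0 : u ≠ 0) :
    (((P.zinf + 1 / u) ^ 2 - 1) * ((P.zinf + 1 / u) ^ 2 - 1 / (P.k : ℂ) ^ 2)) * u ^ 4 =
      P.scale ^ 2 * ((u - (S).a₀) * (u - (S).b₀) * ((u - (S).a₁) * (u - (S).b₁))) := by
  have hs : (P.scale : ℂ) ^ 2 = ((P.zinf : ℂ) ^ 2 - 1) * ((P.zinf : ℂ) ^ 2 - 1 / (P.k : ℂ) ^ 2) := by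
    rw [← p2_ofReal, ← scale_sq hk hz]; push_cast; rfl
  have hk0 : (P.k : ℂ) ≠ 0 := by exact_mod_cast hk.1.ne'
  have h1 := one_lt_inv hk
  have n0 : (-1 - P.zinf : ℂ) ≠ 0 := by
    have : -1 - P.zinf ≠ 0 := by linarith [hz.1]
    exact_mod_cast this
  have n1 : (1 - P.zinf : ℂ) ≠ 0 := by
    have : 1 - P.zinf ≠ 0 := by linarith [hz.2]
    exact_mod_cast this
  have m0 : (1 / P.k - P.zinf : ℂ) ≠ 0 := by
    have : 1 / P.k - P.zinf ≠ 0 := by linarith [hz.2]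
    exact_mod_cast this
  have m1 : (-(1 / P.k) - P.zinf : ℂ) ≠ 0 := by
    have : -(1 / P.k) - P.zinf ≠ 0 := by linarith [hz.1]
    exact_mod_cast this
  rw [hs]
  simp only [inverseSlits, lo, hi]
  push_cast
  generalize hK : (1 / (P.k : ℂ)) = K at *
  have : 1 / (P.k : ℂ) ^ 2 = K ^ 2 := by rw [← hK]; simp
  rw [this]
  field_simp
  ring

/-- The squares agree by `p2_inv` and nothing vanishes on a connected set. The sign is compared at
`u = b₁ + 1`, which corresponds to a point between the slits, where `branch` is negative while `R`
is positive. -/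
theorem branch_inv {u : ℂ} (h : u ∉ (S).slits) (h0 : u ≠ 0) :
    branch P.k (P.zinf + 1 / u) * u ^ 2 = -(P.scale * (S).R u) := by
  have hsp := scale_pos hk hz
  set T := S with hT
  have hb1 : 0 < T.b₁ := T.pos.trans T.lt₁
  have hreal : ∀ w ∈ T.slits ∪ {0}, w.im = 0 := by
    rintro w (hw | rfl)
    · exact T.im_eq_zero_of_mem_slits hw
    · rfl
  have hx0 : ((T.b₁ + 1 : ℝ) : ℂ) ∉ T.slits ∪ {0} := by
    rintro (hw | hw)
    · rw [TwoSlits.ofReal_mem_slits] at hw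
      rcases hw with hw | hw
      · linarith [hw.2, T.neg]
      · linarith [hw.2]
    · have hw := mem_singleton_iff.1 hw
      have : T.b₁ + 1 = 0 := by exact_mod_cast hw
      linarith
  have hpre := isPreconnected_diff_of_real (W := univ) (K := T.slits ∪ {0}) convex_univ isOpen_univ
    hreal (mem_univ _) hx0 (Complex.ofReal_im _)
  rw [← compl_eq_univ_sdiff] at hpre
  have hmem : ∀ w ∈ (T.slits ∪ {0})ᶜ, w ∉ T.slits ∧ w ≠ 0 := fun w hw =>
    ⟨fun h => hw (Or.inl h), fun h => hw (Or.inr h)⟩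
  refine hpre.eq_of_sq_eq (f := fun u => branch P.k (P.zinf + 1 / u) * u ^ 2)
    (g := fun u => -(P.scale * T.R u)) (fun w hw => ?_) (fun w hw => ?_) (fun w hw => ?_)
    (fun {w} hw => ?_) hx0 ?_ (x := u) ?_
  · obtain ⟨h1, h2⟩ := hmem w hw
    have h3 := (differentiableAt_branch hk (add_inv_mem_punctured hk hz h1 h2).1).continuousAt
    have h4 : ContinuousAt (fun u : ℂ => (P.zinf : ℂ) + 1 / u) w := by fun_prop (disch := assumption)
    exact ((ContinuousAt.comp (f := fun u : ℂ => (P.zinf : ℂ) + 1 / u) h3 h4).mul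
      (continuousAt_id.pow 2)).continuousWithinAt
  · obtain ⟨h1, h2⟩ := hmem w hw
    exact ((T.differentiableAt_R h1).continuousAt.const_mul _).neg.continuousWithinAt
  · obtain ⟨h1, h2⟩ := hmem w hw
    change (branch P.k (P.zinf + 1 / w) * w ^ 2) ^ 2 = (-(P.scale * T.R w)) ^ 2
    rw [mul_pow, branch_sq_of_mem hk (add_inv_mem_punctured hk hz h1 h2).1, neg_sq, mul_pow,
      T.R_sq h1, ← pow_mul]
    exact p2_inv hk hz h2
  · obtain ⟨h1, h2⟩ := hmem w hw
    exact neg_ne_zero.2 (mul_ne_zero (by exact_mod_cast hsp.ne') (T.R_ne_zero h1))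
  · set x := T.b₁ + 1 with hx
    have hxp : 0 < x := by linarith
    obtain ⟨h1, h2⟩ := hmem _ hx0
    have hxi : P.zinf + 1 / x ∈ Ioo (-1 : ℝ) 1 := by
      refine ⟨by linarith [hz.1, one_div_pos.2 hxp], ?_⟩
      have h3 : 1 / x < 1 - P.zinf := by
        rw [div_lt_comm₀ hxp (by linarith [hz.2])]
        have : T.b₁ = 1 / (1 - P.zinf) := by rw [hT]; simp [inverseSlits, lo]
        rw [← this]; linarith
      linarith
    have e : (P.zinf : ℂ) + 1 / (x : ℂ) = ((P.zinf + 1 / x : ℝ) : ℂ) := by push_cast; rfl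
    have e3 : branch P.k ((P.zinf : ℂ) + 1 / (x : ℂ)) = -(√|p2 P.k (P.zinf + 1 / x)| : ℝ) := by
      rw [e, branch_of_mem_Ioo hk hxi]
    have e4 : T.R x = (√|T.quartic x| : ℝ) := by
      rw [T.R_eq_Rup h1 (by simp), T.Rup_of_b₁_le (by linarith)]
    change branch P.k ((P.zinf : ℂ) + 1 / (x : ℂ)) * (x : ℂ) ^ 2 = -(P.scale * T.R x)
    rw [e3, e4]
    have key : p2 P.k (P.zinf + 1 / x) * x ^ 4 = P.scale ^ 2 * T.quartic x := by
      have := p2_inv hk hz h2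
      rw [← hT] at this
      simp only [p2, TwoSlits.quartic]
      exact_mod_cast this
    have : √|p2 P.k (P.zinf + 1 / x)| * x ^ 2 = P.scale * √|T.quartic x| := by
      rw [← Real.sqrt_sq (by positivity : 0 ≤ x ^ 2), ← Real.sqrt_mul (abs_nonneg _),
        ← Real.sqrt_sq hsp.le, ← Real.sqrt_mul (sq_nonneg _), ← pow_mul,
        ← abs_of_nonneg (by positivity : 0 ≤ x ^ (2 * 2)), ← abs_mul, key, abs_mul,
        abs_of_nonneg (sq_nonneg P.scale)]
    rw [neg_mul]
    congr 1
    exact_mod_cast this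
  · rintro (hr | hr)
    exacts [h hr, h0 hr]

/-- In the variable `u` the function `G` becomes `-g`. -/
theorem G_add_inv {u : ℂ} (h : u ∉ (S).slits) (h0 : u ≠ 0) :
    P.G (P.zinf + 1 / u) = -(S).g u := by
  have h1 := branch_inv hk hz h h0
  have h2 := quad_inv hk hz h0
  have h3 : branch P.k (P.zinf + 1 / u) ≠ 0 :=
    branch_ne_zero hk (add_inv_mem_punctured hk hz h h0).1
  have h4 := (S).R_ne_zero h
  rw [G, TwoSlits.g, ← h2, div_eq_iff h3]
  generalize P.quad (P.zinf + 1 / u) = Q at *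
  generalize branch P.k (P.zinf + 1 / u) = B at *
  field_simp
  linear_combination Q * h1

theorem G_eq {ζ : ℂ} (h : ζ ∈ P.punctured) : P.G ζ = -(S).g (1 / (ζ - P.zinf)) := by
  have h1 := G_add_inv hk hz (inv_notMem_slits hk hz h) (one_div_ne_zero (sub_ne_zero.2 h.2))
  simpa using h1

/-! ### Vanishing of the two loop integrals -/

theorem quadR_inv {ξ : ℝ} (h : ξ ≠ P.zinf) :
    (S).Er (1 / (ξ - P.zinf)) = P.quadR ξ * (1 / (ξ - P.zinf)) ^ 2 := by
  have h0 := sub_ne_zero.2 h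
  have hu : (((1 / (ξ - P.zinf) : ℝ)) : ℂ) ≠ 0 := by
    exact_mod_cast one_div_ne_zero h0
  have := quad_inv hk hz hu
  rw [TwoSlits.E_ofReal, show (P.zinf : ℂ) + 1 / ((1 / (ξ - P.zinf) : ℝ) : ℂ) = (ξ : ℂ) by
    push_cast; simp, quad_ofReal] at this
  exact_mod_cast this.symm

theorem quartic_inv {ξ : ℝ} (h : ξ ≠ P.zinf) :
    P.scale ^ 2 * (S).quartic (1 / (ξ - P.zinf)) = p2 P.k ξ * (1 / (ξ - P.zinf)) ^ 4 := by
  have h0 := sub_ne_zero.2 h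
  have hu : (((1 / (ξ - P.zinf) : ℝ)) : ℂ) ≠ 0 := by
    exact_mod_cast one_div_ne_zero h0
  have := p2_inv hk hz hu
  rw [show (P.zinf : ℂ) + 1 / ((1 / (ξ - P.zinf) : ℝ) : ℂ) = (ξ : ℂ) by
    push_cast; simp, ← p2_ofReal] at this
  simp only [TwoSlits.quartic]
  exact_mod_cast this.symm

theorem sqrt_quartic_inv {ξ : ℝ} (h : ξ ≠ P.zinf) :
    P.scale * √|(S).quartic (1 / (ξ - P.zinf))| = √|p2 P.k ξ| * (1 / (ξ - P.zinf)) ^ 2 := by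
  have hsp := scale_pos hk hz
  rw [← Real.sqrt_sq (by positivity : 0 ≤ (1 / (ξ - P.zinf)) ^ 2), ← Real.sqrt_mul (abs_nonneg _),
    ← Real.sqrt_sq hsp.le, ← Real.sqrt_mul (sq_nonneg _),
    ← abs_of_nonneg (show 0 ≤ ((1 / (ξ - P.zinf)) ^ 2) ^ 2 from sq_nonneg _), ← abs_mul,
    show ((1 / (ξ - P.zinf)) ^ 2) ^ 2 = (1 / (ξ - P.zinf)) ^ 4 by ring,
    ← quartic_inv hk hz h, abs_mul, abs_of_nonneg (sq_nonneg P.scale)]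

include hk hz in
theorem ne_zinf_of_mem (j : Fin 2) {ξ : ℝ} (h : ξ ∈ Icc (lo P.k j) (hi P.k j)) : ξ ≠ P.zinf := by
  rintro rfl
  rcases zinf_cases hk hz j with h1 | h1
  · linarith [h.2]
  · linarith [h.1]

theorem hasDerivAt_inv_sub {z ξ : ℝ} (h : ξ ≠ z) :
    HasDerivAt (fun ξ : ℝ => 1 / (ξ - z)) (-(1 / (ξ - z)) ^ 2) ξ := by
  have h1 := ((hasDerivAt_id ξ).sub_const z).inv (sub_ne_zero.2 h)
  simp only [one_div]
  refine h1.congr_deriv ?_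
  rw [inv_pow]; simp only [id]; ring

theorem gUp_im_inv (j : Fin 2) {ξ : ℝ} (h : ξ ∈ Ioo (lo P.k j) (hi P.k j)) :
    (S).quartic (1 / (ξ - P.zinf)) ≠ 0 ∧
    ((S).gUp ((1 / (ξ - P.zinf) : ℝ) : ℂ)).im =
      -(slitSign j * P.scale * P.quadR ξ / √|p2 P.k ξ|) := by
  have hne := ne_zinf_of_mem hk hz j (Ioo_subset_Icc_self h)
  have h0 := sub_ne_zero.2 hne
  have hq := quartic_inv hk hz hne
  have hs := sqrt_quartic_inv hk hz hne
  have hE := quadR_inv hk hz hne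
  have hsp := scale_pos hk hz
  have hp := sqrt_abs_p2_pos hk j h
  have hneg := p2_neg hk j h
  have hm := (inv_mem_Icc_iff hk hz j hne).2 (Ioo_subset_Icc_self h)
  have hu : 0 < (1 / (ξ - P.zinf)) ^ 2 := by positivity
  refine ⟨fun h' => ?_, ?_⟩
  · rw [h', mul_zero] at hq
    exact mul_ne_zero hneg.ne (by positivity) hq.symm
  have key : (S).Er (1 / (ξ - P.zinf)) / √|(S).quartic (1 / (ξ - P.zinf))| =
      P.scale * P.quadR ξ / √|p2 P.k ξ| := by
    have : 0 < √|(S).quartic (1 / (ξ - P.zinf))| := by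
      by_contra hc
      have : √|(S).quartic (1 / (ξ - P.zinf))| = 0 := le_antisymm (not_lt.1 hc) (Real.sqrt_nonneg _)
      rw [this, mul_zero] at hs
      exact (mul_pos hp hu).ne hs
    rw [div_eq_div_iff this.ne' hp.ne', hE]
    linear_combination (-P.quadR ξ) * hs
  fin_cases j
  · rw [TwoSlits.gUp_of_mem_slit₀ _ hm, key]
    simp [slitSign, neg_div]
  · rw [TwoSlits.gUp_of_mem_slit₁ _ hm, key]
    simp [slitSign]

include hk hz in
theorem intervalIntegrable_quad (j : Fin 2) :
    IntervalIntegrable (fun ξ => P.quadR ξ / ((ξ - P.zinf) ^ 2 * √|p2 P.k ξ|)) volume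
      (lo P.k j) (hi P.k j) := by
  have : ContinuousOn (fun ξ => P.quadR ξ / (ξ - P.zinf) ^ 2) (Icc (lo P.k j) (hi P.k j)) := by
    unfold quadR
    refine ContinuousOn.div (by fun_prop) (by fun_prop) fun ξ hξ => ?_
    exact pow_ne_zero _ (sub_ne_zero.2 (ne_zinf_of_mem hk hz j hξ))
  refine (intervalIntegrable_div_sqrt_p2 hk j this).congr fun ξ _ => ?_
  simp only [div_div]

/-- The function `Y(1 / (ξ - ζ_∞))` is a primitive of the integrand up to the constant factor, so an
integral over a slit becomes a difference of values of `Y` at its ends. -/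
theorem integral_slit (j : Fin 2) :
    slitSign j * P.scale * ∫ ξ in lo P.k j..hi P.k j,
        P.quadR ξ / ((ξ - P.zinf) ^ 2 * √|p2 P.k ξ|) =
      (S).Y (1 / (hi P.k j - P.zinf)) - (S).Y (1 / (lo P.k j - P.zinf)) := by
  rw [← intervalIntegral.integral_const_mul]
  refine intervalIntegral.integral_eq_sub_of_hasDerivAt_of_le
    (f := fun ξ => (S).Y (1 / (ξ - P.zinf))) (lo_lt_hi hk j).le ?_ (fun ξ hξ => ?_)
    ((intervalIntegrable_quad hk hz j).const_mul _)
  · refine (S).continuous_Y.comp_continuousOn (ContinuousOn.div (by fun_prop) (by fun_prop) ?_)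
    exact fun ξ hξ => sub_ne_zero.2 (ne_zinf_of_mem hk hz j hξ)
  · have hne := ne_zinf_of_mem hk hz j (Ioo_subset_Icc_self hξ)
    have h0 := sub_ne_zero.2 hne
    obtain ⟨h1, h2⟩ := gUp_im_inv hk hz j hξ
    have h3 := ((S).hasDerivAt_Y h1).comp ξ (hasDerivAt_inv_sub hne)
    refine h3.congr_deriv ?_
    rw [h2]
    have := (sqrt_abs_p2_pos hk j hξ).ne'
    field_simp

/-- The third linear equation, read through `integral_slit`; at the other end `Y` vanishes because
it adjoins the gap that contains `0`. -/
theorem Y_b₁ : (S).Y (S).b₁ = 0 := by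
  have h1 := integral_slit hk hz 1
  have h2 : (S).Y (S).a₁ = 0 :=
    (S).Y_of_mem_gap ⟨((S).neg.trans (S).pos).le, le_rfl⟩
  have h3 := (pole_right hk hz 1).2
  rw [RightLoopEquation, integral_quad hk hz] at h3
  have h4 : ∫ ξ in lo P.k 1..hi P.k 1, P.quadR ξ / ((ξ - P.zinf) ^ 2 * √|p2 P.k ξ|) = 0 := by
    simpa [lo, hi, quadR] using h3
  rw [h4, mul_zero] at h1
  have h5 : (S).Y (S).a₁ - (S).Y (S).b₁ = 0 := h1.symm
  linarith

theorem hasDerivAt_one_div_sub {z ζ : ℂ} (h : ζ ≠ z) :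
    HasDerivAt (fun ζ : ℂ => 1 / (ζ - z)) (-(1 / (ζ - z)) ^ 2) ζ := by
  have h1 := ((hasDerivAt_id ζ).sub_const z).inv (sub_ne_zero.2 h)
  simp only [one_div]
  refine h1.congr_deriv ?_
  rw [inv_pow]; simp only [id]; ring

include hk hz in
/-- A primitive of `(G + 1) / (ζ - ζ_∞)²` near `ζ_∞`. -/
theorem exists_local_primitive : ∃ δ : ℝ, 0 < δ ∧ ∃ K : ℂ → ℂ,
    Metric.ball (P.zinf : ℂ) δ ⊆ slitDomain P.k ∧ ContinuousAt K P.zinf ∧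
    AnalyticAt ℂ K P.zinf ∧
    ∀ ζ ∈ Metric.ball (P.zinf : ℂ) δ, ζ ≠ P.zinf →
      HasDerivAt K ((P.G ζ + 1) / (ζ - P.zinf) ^ 2) ζ := by
  obtain ⟨δ, hδ, hb⟩ := Metric.isOpen_iff.1 (isOpen_slitDomain hk) _ (zinf_mem hk hz)
  obtain ⟨h, hd, he⟩ := exists_G_expansion hk hz
  obtain ⟨K, hK⟩ := (hd.mono hb).isExactOn_ball
  have hKd : DifferentiableOn ℂ K (Metric.ball (P.zinf : ℂ) δ) := fun ζ hζ =>
    (hK ζ hζ).differentiableAt.differentiableWithinAt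
  have hnb := Metric.ball_mem_nhds (P.zinf : ℂ) hδ
  exact ⟨δ, hδ, K, hb, (hKd.differentiableAt hnb).continuousAt, hKd.analyticAt hnb,
    fun ζ hζ hne => he ζ hne ▸ hK ζ hζ⟩

/-- Near `ζ_∞` the primitive at `1 / (ζ - ζ_∞)` equals `1 / (ζ - ζ_∞)` plus a function analytic at
`ζ_∞`, because `g` has no residue at infinity. So its imaginary part has the same limit along the
real axis from the left and from the right of `ζ_∞`. These limits are `Y(a₀)` and `Y(b₁) = 0`. -/
theorem Y_a₀ : (S).Y (S).a₀ = 0 := by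
  obtain ⟨δ, hδ, K, hb, hKc, -, hK⟩ := exists_local_primitive hk hz
  have hB := Y_b₁ hk hz
  set T := S with hT
  set z : ℂ := (P.zinf : ℂ) with hzdef
  -- the comparison function on the lower half of the ball
  have hconst : ∃ c₀ : ℂ, ∀ ζ ∈ Metric.ball z δ ∩ {ζ | ζ.im < 0},
      T.prim (1 / (ζ - z)) - 1 / (ζ - z) - K ζ = c₀ := by
    have hopen : IsOpen (Metric.ball z δ ∩ {ζ | ζ.im < 0}) :=
      Metric.isOpen_ball.inter (isOpen_lt Complex.continuous_im continuous_const)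
    have hconv : Convex ℝ (Metric.ball z δ ∩ {ζ | ζ.im < 0}) :=
      (convex_ball z δ).inter (convex_halfSpace_im_lt 0)
    have hder : ∀ ζ ∈ Metric.ball z δ ∩ {ζ | ζ.im < 0},
        HasDerivAt (fun ζ => T.prim (1 / (ζ - z)) - 1 / (ζ - z) - K ζ) 0 ζ := by
      rintro ζ ⟨h1, h2⟩
      have h2 : ζ.im < 0 := h2
      have hne : ζ ≠ z := by rintro rfl; simp [hzdef] at h2
      have hpos : 0 < (1 / (ζ - z)).im := by
        rw [hzdef, inv_sub_im]
        exact div_pos (by linarith) (Complex.normSq_pos.2 (sub_ne_zero.2 hne))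
      have hns := T.notMem_slits hpos.ne'
      have hG : P.G ζ = -T.gUp (1 / (ζ - z)) := by
        rw [← T.g_eq_gUp hns hpos.le]
        exact G_eq hk hz ⟨hb h1, hne⟩
      have h3 := (T.hasDerivAt_prim hpos).comp ζ (hasDerivAt_one_div_sub hne)
      refine ((h3.sub (hasDerivAt_one_div_sub hne)).sub (hK ζ h1 hne)).congr_deriv ?_
      rw [hG]
      have := sub_ne_zero.2 hne
      field_simp; ring
    have hdo : DifferentiableOn ℂ (fun ζ => T.prim (1 / (ζ - z)) - 1 / (ζ - z) - K ζ)
        (Metric.ball z δ ∩ {ζ | ζ.im < 0}) := fun ζ hζ =>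
      (hder ζ hζ).differentiableAt.differentiableWithinAt
    exact hopen.exists_is_const_of_deriv_eq_zero hconv.isPreconnected hdo
      fun ζ hζ => (hder ζ hζ).deriv
  obtain ⟨c₀, hc₀⟩ := hconst
  -- its boundary values
  have hbd : ∀ t : ℝ, t ≠ 0 → |t| < δ →
      T.prim (1 / t : ℝ) - (1 / t : ℝ) - K ((P.zinf + t : ℝ) : ℂ) = c₀ := by
    intro t ht htδ
    have hne : ((P.zinf + t : ℝ) : ℂ) ≠ z := by
      rw [hzdef]; intro h
      have : P.zinf + t = P.zinf := by exact_mod_cast h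
      exact ht (by linarith)
    have hball : ((P.zinf + t : ℝ) : ℂ) ∈ Metric.ball z δ := by
      rw [mem_ball_iff_norm, hzdef, ← Complex.ofReal_sub, Complex.norm_real]
      simpa using htδ
    have hnb := halfPlane_neBot false (P.zinf + t)
    have he : (1 / (((P.zinf + t : ℝ) : ℂ) - z)) = ((1 / t : ℝ) : ℂ) := by
      rw [hzdef]; push_cast; congr 1; ring
    have hcs : Tendsto (fun ζ => 1 / (ζ - z)) (𝓝[halfPlane false] ((P.zinf + t : ℝ) : ℂ))
        (𝓝 ((1 / t : ℝ) : ℂ)) := by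
      rw [← he]
      exact (hasDerivAt_one_div_sub hne).continuousAt.tendsto.mono_left nhdsWithin_le_nhds
    have hcs' : Tendsto (fun ζ => 1 / (ζ - z)) (𝓝[halfPlane false] ((P.zinf + t : ℝ) : ℂ))
        (𝓝[closedUpperHalf] ((1 / t : ℝ) : ℂ)) := by
      refine tendsto_nhdsWithin_iff.2 ⟨hcs, ?_⟩
      filter_upwards [self_mem_nhdsWithin] with ζ hζ
      have h2 : ζ.im < 0 := hζ
      change 0 ≤ (1 / (ζ - z)).im
      rw [hzdef, inv_sub_im]
      exact div_nonneg (by linarith) (Complex.normSq_nonneg _)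
    have h1 : Tendsto (fun ζ => T.prim (1 / (ζ - z)) - 1 / (ζ - z) - K ζ)
        (𝓝[halfPlane false] ((P.zinf + t : ℝ) : ℂ))
        (𝓝 (T.prim (1 / t : ℝ) - (1 / t : ℝ) - K ((P.zinf + t : ℝ) : ℂ))) := by
      refine Tendsto.sub (Tendsto.sub ?_ hcs) ?_
      · have hm : ((1 / t : ℝ) : ℂ) ∈ closedUpperHalf := by
          change (0 : ℝ) ≤ ((1 / t : ℝ) : ℂ).im
          rw [Complex.ofReal_im]
        exact (T.continuousOn_prim _ hm).tendsto.comp hcs'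
      · exact (hK _ hball hne).continuousAt.tendsto.mono_left nhdsWithin_le_nhds
    refine tendsto_nhds_unique_of_eventuallyEq h1 tendsto_const_nhds ?_
    filter_upwards [self_mem_nhdsWithin,
      mem_nhdsWithin_of_mem_nhds (Metric.isOpen_ball.mem_nhds hball)] with ζ h2 h3
    exact hc₀ ζ ⟨h3, h2⟩
  -- the limit of the difference of the boundary values
  have hlim : Tendsto (fun t : ℝ => (K ((P.zinf + t : ℝ) : ℂ)).im - (K ((P.zinf + -t : ℝ) : ℂ)).im)
      (𝓝[>] 0) (𝓝 0) := by
    have h1 : ∀ f : ℝ → ℝ, Continuous f → f 0 = 0 →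
        Tendsto (fun t : ℝ => (K ((P.zinf + f t : ℝ) : ℂ)).im) (𝓝[>] 0) (𝓝 (K z).im) := by
      intro f hf hf0
      have h2 : Tendsto (fun t : ℝ => ((P.zinf + f t : ℝ) : ℂ)) (𝓝[>] 0) (𝓝 z) := by
        have : Continuous fun t : ℝ => ((P.zinf + f t : ℝ) : ℂ) := by fun_prop
        have h3 := this.tendsto 0
        rw [hf0, add_zero] at h3
        exact h3.mono_left nhdsWithin_le_nhds
      exact (Complex.continuous_im.tendsto _).comp (hKc.tendsto.comp h2)
    have := (h1 id continuous_id rfl).sub (h1 (fun t => -t) continuous_neg neg_zero)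
    rw [sub_self] at this
    exact this
  have hev : ∀ᶠ t : ℝ in 𝓝[>] 0,
      (K ((P.zinf + t : ℝ) : ℂ)).im - (K ((P.zinf + -t : ℝ) : ℂ)).im = -T.Y T.a₀ := by
    have hb1 : 0 < T.b₁ := T.pos.trans T.lt₁
    have ha0 : T.a₀ < 0 := T.lt₀.trans T.neg
    have hm : 0 < min δ (min (1 / T.b₁) (1 / -T.a₀)) :=
      lt_min hδ (lt_min (one_div_pos.2 hb1) (one_div_pos.2 (by linarith)))
    filter_upwards [Ioo_mem_nhdsGT hm] with t ht
    have ht1 := ht.2.trans_le (min_le_left _ _)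
    have ht2 := ht.2.trans_le ((min_le_right _ _).trans (min_le_left _ _))
    have ht3 := ht.2.trans_le ((min_le_right _ _).trans (min_le_right _ _))
    have e1 := congrArg Complex.im (hbd t ht.1.ne' (by rwa [abs_of_pos ht.1]))
    have e2 := congrArg Complex.im (hbd (-t) (by linarith [ht.1]) (by
      rwa [abs_neg, abs_of_pos ht.1]))
    simp only [Complex.sub_im, Complex.ofReal_im, sub_zero] at e1 e2
    have e3 : T.Y (1 / t) = 0 := by
      rw [T.Y_of_b₁_le, hB]
      rw [le_div_iff₀ ht.1]
      rw [lt_div_iff₀ hb1] at ht2; linarith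
    have e4 : T.Y (1 / -t) = T.Y T.a₀ := by
      apply T.Y_of_le_a₀
      rw [div_neg, neg_le, le_div_iff₀ ht.1]
      rw [lt_div_iff₀ (by linarith)] at ht3; linarith
    change T.Y (1 / t) - _ = _ at e1
    change T.Y (1 / -t) - _ = _ at e2
    rw [e3] at e1; rw [e4] at e2
    linarith
  have := tendsto_nhds_unique (hlim.congr' hev) tendsto_const_nhds
  linarith

theorem closed : (S).Closed := ⟨Y_a₀ hk hz, Y_b₁ hk hz⟩

-- The substitution `ξ ↦ -ξ` carries the left slit to the right one. Since `p₂` is even, it turns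
-- the vanishing integral over `l₀` into the `I_j⁺` with alternating signs.
include hk hz in
theorem left_loop : P.LeftLoopEquation (P.coef1 1) (P.coef2 1) (P.coef3 1) := by
  have h1 := integral_slit hk hz 0
  have h2 : (S).Y (1 / (hi P.k 0 - P.zinf)) = 0 := Y_a₀ hk hz
  have h3 : (S).Y (1 / (lo P.k 0 - P.zinf)) = 0 :=
    (S).Y_of_mem_gap ⟨le_rfl, ((S).neg.trans (S).pos).le⟩
  have hs := (scale_pos hk hz).ne'
  rw [h2, h3, sub_zero] at h1
  have h4 : ∫ ξ in lo P.k 0..hi P.k 0, P.quadR ξ / ((ξ - P.zinf) ^ 2 * √|p2 P.k ξ|) = 0 := by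
    refine (mul_eq_zero.1 h1).resolve_left (mul_ne_zero ?_ hs)
    simp [slitSign]
  have h5 := intervalIntegral.integral_comp_neg (a := 1) (b := 1 / P.k)
    (fun ξ => P.quadR ξ / ((ξ - P.zinf) ^ 2 * √|p2 P.k ξ|))
  have h6 : lo P.k 0 = -(1 / P.k) := by simp [lo]
  have h7 : hi P.k 0 = -1 := by simp [hi]
  rw [h6, h7] at h4
  rw [h4] at h5
  have hi' := fun j => (intervalIntegrable_intI hk hz j).2
  rw [LeftLoopEquation, ← h5]
  simp only [IP]
  rw [← intervalIntegral.integral_const_mul, ← intervalIntegral.integral_const_mul,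
    ← intervalIntegral.integral_const_mul, ← intervalIntegral.integral_sub
      ((hi' 0).const_mul _) ((hi' 1).const_mul _), ← intervalIntegral.integral_add
      (((hi' 0).const_mul _).sub ((hi' 1).const_mul _)) ((hi' 2).const_mul _)]
  refine intervalIntegral.integral_congr fun ξ _ => ?_
  have e1 : p2 P.k (-ξ) = p2 P.k ξ := by simp [p2]
  simp only [intI, quadR, e1]
  rw [show (-ξ - P.zinf) ^ 2 = (ξ - -P.zinf) ^ 2 by ring]
  ring

/-- Once both periods vanish, `H` is single-valued and can be compared with the local primitive on
the whole punctured disc, which is connected, instead of on a half-disc. -/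
theorem exists_H_expansion : ∃ δ : ℝ, 0 < δ ∧ ∃ K : ℂ → ℂ,
    Metric.ball (P.zinf : ℂ) δ ⊆ slitDomain P.k ∧ AnalyticAt ℂ K P.zinf ∧
    ∀ ζ ∈ Metric.ball (P.zinf : ℂ) δ, ζ ≠ P.zinf →
      (S).H (1 / (ζ - P.zinf)) = 1 / (ζ - P.zinf) + K ζ := by
  obtain ⟨δ, hδ, K, hb, -, hKa, hK⟩ := exists_local_primitive hk hz
  have hS := closed hk hz
  set T := S with hT
  set z : ℂ := (P.zinf : ℂ) with hzdef
  have hpre := isPreconnected_diff_of_real (W := Metric.ball z δ) (K := {z})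
    (x₀ := ((P.zinf + δ / 2 : ℝ) : ℂ)) (convex_ball z δ)
    Metric.isOpen_ball (by rintro w rfl; simp [hzdef]) (by
      rw [mem_ball_iff_norm, hzdef, ← Complex.ofReal_sub, Complex.norm_real]
      simp [abs_of_pos hδ, hδ]) (by
      rw [mem_singleton_iff, hzdef, Complex.ofReal_inj]; linarith) (Complex.ofReal_im _)
  have hopen : IsOpen (Metric.ball z δ \ {z}) := Metric.isOpen_ball.sdiff isClosed_singleton
  have hder : ∀ ζ ∈ Metric.ball z δ \ {z},
      HasDerivAt (fun ζ => T.H (1 / (ζ - z)) - 1 / (ζ - z) - K ζ) 0 ζ := by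
    rintro ζ ⟨h1, hne⟩
    have hne : ζ ≠ z := hne
    have hp : ζ ∈ P.punctured := ⟨hb h1, hne⟩
    have h3 := (hS.hasDerivAt_H (inv_notMem_slits hk hz hp)).comp ζ (hasDerivAt_one_div_sub hne)
    refine ((h3.sub (hasDerivAt_one_div_sub hne)).sub (hK ζ h1 hne)).congr_deriv ?_
    rw [G_eq hk hz hp]
    have := sub_ne_zero.2 hne
    field_simp; ring
  have hdo : DifferentiableOn ℂ (fun ζ => T.H (1 / (ζ - z)) - 1 / (ζ - z) - K ζ)
      (Metric.ball z δ \ {z}) := fun ζ hζ => (hder ζ hζ).differentiableAt.differentiableWithinAt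
  obtain ⟨c₀, hc₀⟩ := hopen.exists_is_const_of_deriv_eq_zero hpre hdo
    fun ζ hζ => (hder ζ hζ).deriv
  refine ⟨δ, hδ, fun ζ => K ζ + c₀, hb, hKa.add analyticAt_const, fun ζ h1 h2 => ?_⟩
  rw [← hc₀ ζ ⟨h1, h2⟩]; ring

theorem asympId : (S).AsympId := by
  obtain ⟨δ, hδ, K, hb, hKa, hK⟩ := exists_H_expansion hk hz
  obtain ⟨ε, hε, hKb⟩ := Metric.continuousAt_iff.1 hKa.continuousAt 1 one_pos
  have hm : 0 < min δ ε := lt_min hδ hε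
  refine ⟨‖K P.zinf‖ + 1, 1 / (min δ ε) + 1, fun s u hs hu => ?_⟩
  have hupos : 1 / min δ ε < ‖u‖ := by linarith
  have hu0 : u ≠ 0 := norm_pos_iff.1 ((one_div_pos.2 hm).trans hupos)
  have hn : ‖1 / u‖ < min δ ε := by
    rw [norm_div, norm_one]
    exact (div_lt_comm₀ hm (norm_pos_iff.2 hu0)).1 hupos
  have hne : (P.zinf : ℂ) + 1 / u ≠ P.zinf := by simpa using hu0
  have hball : (P.zinf : ℂ) + 1 / u ∈ Metric.ball (P.zinf : ℂ) δ := by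
    rw [mem_ball_iff_norm, add_sub_cancel_left]; exact hn.trans_le (min_le_left _ _)
  have h1 := hK _ hball hne
  rw [add_sub_cancel_left, one_div_one_div] at h1
  have hns : u ∉ (S).slits := by
    have := inv_notMem_slits hk hz ⟨hb hball, hne⟩
    simpa using this
  rw [← (closed hk hz).H_eq_side hns hs, h1, add_sub_cancel_left]
  have h2 : dist (K (P.zinf + 1 / u)) (K P.zinf) < 1 := hKb (by
    rw [dist_eq_norm, add_sub_cancel_left]; exact hn.trans_le (min_le_right _ _))
  rw [dist_eq_norm] at h2
  calc ‖K (P.zinf + 1 / u)‖ = ‖K (P.zinf + 1 / u) - K P.zinf + K P.zinf‖ := by simp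
    _ ≤ _ := by linarith [norm_add_le (K (P.zinf + 1 / u) - K P.zinf) (K P.zinf)]

end inverse

end Data

/-! ### The explicit functions as combinations of `1` and `G` -/

namespace Data

variable {P : Data}

variable (P) in
/-- A combination of `1` and `G` with a double pole at `ζ_∞`. -/
def comb (A B ζ : ℂ) : ℂ := 1 / (ζ - P.zinf) ^ 2 * (A + B * P.G ζ)

variable (P) in
/-- The product `\bar c \bar b`. -/
def mb : ℂ := conj P.c * conj P.b

variable (P) in
/-- The product `c \bar a`. -/
def na : ℂ := P.c * conj P.a

variable (P) in
/-- The denominator of `ψ`. -/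
def den (ζ : ℂ) : ℂ := P.mb * (1 + P.G ζ) - P.na * (1 - P.G ζ)

variable (P) in
/-- The boundary value of `G` on a side of a slit. -/
def Gside (j : Fin 2) (s : Bool) (ξ : ℝ) : ℂ := P.scale * P.quad ξ / branchSide P.k j s ξ

theorem a_re : P.a.re = (P.sigma1 + P.sigma2) / 2 - P.p := by
  rw [Loading.a, Complex.add_re, Complex.ofReal_re]
  simp [Loading.sigma]; ring

theorem a_im : P.a.im = P.tau := by simp [Loading.a, -Complex.ofReal_div]

theorem b_re : P.b.re = (P.sigma2 - P.sigma1) / 2 := by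
  rw [Loading.b, Complex.add_re, Complex.ofReal_re]; simp

theorem b_im : P.b.im = P.tauInf := by simp [Loading.b, -Complex.ofReal_div]

theorem A0_eq : P.A0 = P.mb - P.na := by
  apply Complex.ext
  · simp [A0, mb, na, A0P, A0M, a_re, a_im, b_re, b_im, alphaP, alphaM, betaP, betaM]; ring
  · simp [A0, mb, na, A0P, A0M, a_re, a_im, b_re, b_im, alphaP, alphaM, betaP, betaM]; ring

theorem dP_sub_dM : (P.dP : ℂ) - Complex.I * P.dM = P.scale * (P.mb + P.na) := by
  apply Complex.ext
  · simp [dP, dM, scale, mb, na, a_re, a_im, b_re, b_im, alphaP, alphaM, betaP, betaM]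
    left; ring
  · simp [dP, dM, scale, mb, na, a_re, a_im, b_re, b_im, alphaP, alphaM, betaP, betaM]
    ring

theorem conj_na_mul : conj P.a * conj P.na - P.b * P.mb =
    conj P.c * ((Complex.normSq P.a - Complex.normSq P.b : ℝ) : ℂ) := by
  rw [na, mb]; push_cast
  rw [Complex.normSq_eq_conj_mul_self, Complex.normSq_eq_conj_mul_self, map_mul, Complex.conj_conj]
  ring

theorem A_quad (ζ : ℂ) : P.A1 + P.A2 * ζ + P.A3 * ζ ^ 2 =
    (P.dP - Complex.I * P.dM) * P.quad ζ := by
  have h1 := coef_smul (P := P) P.dP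
  have h2 := coef_smul (P := P) P.dM
  rw [A1, A2, A3, quad, h1.1, h1.2.1, h1.2.2, h2.1, h2.2.1, h2.2.2]
  push_cast; ring

variable (hk : P.k ∈ Ioo (0 : ℝ) 1) (hz : P.zinf ∈ Ioo (-1 : ℝ) 1)

include hk hz

theorem quad_div_branch (ζ : ℂ) : P.quad ζ / branch P.k ζ = P.G ζ / P.scale := by
  have : (P.scale : ℂ) ≠ 0 := by exact_mod_cast (scale_pos hk hz).ne'
  rw [G]; field_simp

theorem Fplus_eq : P.Fplus = P.comb (Complex.I * P.A0P) (P.dP / P.scale) := by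
  funext ζ
  have h1 := coef_smul (P := P) P.dP
  have h2 := quad_div_branch hk hz ζ
  have : (P.coef1 P.dP + P.coef2 P.dP * ζ + P.coef3 P.dP * ζ ^ 2 : ℂ) = P.dP * P.quad ζ := by
    rw [h1.1, h1.2.1, h1.2.2, quad]; push_cast; ring
  rw [Fplus, comb, this, mul_div_assoc, h2]
  ring

theorem Fminus_eq : P.Fminus = P.comb P.A0M (Complex.I * P.dM / P.scale) := by
  funext ζ
  have h1 := coef_smul (P := P) P.dM
  have h2 := quad_div_branch hk hz ζ
  have : (P.coef1 P.dM + P.coef2 P.dM * ζ + P.coef3 P.dM * ζ ^ 2 : ℂ) = P.dM * P.quad ζ := by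
    rw [h1.1, h1.2.1, h1.2.2, quad]; push_cast; ring
  rw [Fminus, comb, this, mul_div_assoc, mul_div_assoc, h2]
  ring

theorem omegaDeriv_eq : P.omegaDeriv =
    P.comb (P.A0 / (2 * conj P.a)) ((P.mb + P.na) / (2 * conj P.a)) := by
  funext ζ
  have h2 := quad_div_branch hk hz ζ
  have : (P.scale : ℂ) ≠ 0 := by exact_mod_cast (scale_pos hk hz).ne'
  rw [omegaDeriv, comb, A_quad, dP_sub_dM, mul_div_assoc, h2]
  field_simp

/-- Away from `ζ_∞` the zeros of `ω'` are the zeros of `den`, so they are governed by the values of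
`G` and the ratio of `mb` to `na`. -/
theorem omegaDeriv_den (ζ : ℂ) :
    P.omegaDeriv ζ = 1 / (2 * conj P.a * (ζ - P.zinf) ^ 2) * P.den ζ := by
  rw [omegaDeriv_eq hk hz, comb, den, A0_eq]
  by_cases h : conj P.a = 0
  · simp [h]
  · field_simp; ring

theorem Fplus_sub_Fminus (ζ : ℂ) :
    P.Fplus ζ - P.Fminus ζ = P.comb P.A0 (P.mb + P.na) ζ := by
  have : (P.scale : ℂ) ≠ 0 := by exact_mod_cast (scale_pos hk hz).ne'
  have h : (P.mb + P.na) = ((P.dP : ℂ) - Complex.I * P.dM) / P.scale := by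
    rw [dP_sub_dM]; field_simp
  rw [Fplus_eq hk hz, Fminus_eq hk hz, h]
  simp only [comb, A0]
  field_simp; ring

theorem Fplus_add_Fminus (ζ : ℂ) : P.Fplus ζ + P.Fminus ζ =
    1 / (ζ - P.zinf) ^ 2 * (conj P.na * (1 + P.G ζ) - conj P.mb * (1 - P.G ζ)) := by
  have hs : (P.scale : ℂ) ≠ 0 := by exact_mod_cast (scale_pos hk hz).ne'
  have h1 : (P.dP : ℂ) + Complex.I * P.dM = P.scale * (conj P.mb + conj P.na) := by
    have := congrArg conj (dP_sub_dM (P := P))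
    simp only [map_sub, map_mul, map_add, Complex.conj_ofReal, Complex.conj_I] at this
    rw [← this]; ring
  have h2 : Complex.I * P.A0P + P.A0M = conj P.na - conj P.mb := by
    have := congrArg conj (A0_eq (P := P))
    simp only [A0, map_sub, map_mul, Complex.conj_ofReal, Complex.conj_I] at this
    linear_combination -this
  rw [Fplus_eq hk hz, Fminus_eq hk hz]
  simp only [comb]
  have e : Complex.I * P.A0P + P.dP / P.scale * P.G ζ + (P.A0M + Complex.I * P.dM / P.scale * P.G ζ)
      = conj P.na * (1 + P.G ζ) - conj P.mb * (1 - P.G ζ) := by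
    have h3 : (conj P.mb + conj P.na) = ((P.dP : ℂ) + Complex.I * P.dM) / P.scale := by
      rw [h1]; field_simp
    linear_combination h2 - P.G ζ * h3
  rw [← e]; ring

/-- `ψ` in terms of `G`. -/
theorem psi_eq (ha : P.a ≠ 0) {ζ : ℂ} (hζ : ζ ≠ P.zinf) (hd : P.den ζ ≠ 0) :
    P.psi ζ = P.b +
      conj P.c * ((Complex.normSq P.a - Complex.normSq P.b : ℝ) : ℂ) * (1 + P.G ζ) / P.den ζ := by
  have ha' : conj P.a ≠ 0 := (map_ne_zero _).2 ha
  have h0 := sub_ne_zero.2 hζ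
  rw [psi, Fplus_add_Fminus hk hz, omegaDeriv_den hk hz, ← conj_na_mul]
  have hm : conj P.a * conj P.mb = P.b * P.na := by
    rw [mb, na]; simp; ring
  field_simp
  rw [den]
  linear_combination (P.G ζ - 1) * hm

/-! ### Values of `G` -/

omit hk hz in
theorem conj_Gside (j : Fin 2) (s : Bool) (ξ : ℝ) : conj (P.Gside j s ξ) = -P.Gside j s ξ := by
  rw [Gside, map_div₀, conj_branchSide, branchSide_not, quad_ofReal]
  simp [div_neg]

omit hk hz in
theorem Gside_not (j : Fin 2) (s : Bool) (ξ : ℝ) : P.Gside j (!s) ξ = -P.Gside j s ξ := by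
  rw [Gside, branchSide_not, div_neg, Gside]

omit hk hz in
theorem Gside_true (j : Fin 2) (ξ : ℝ) : P.Gside j true ξ =
    ((-(slitSign j * P.scale * P.quadR ξ) / √|p2 P.k ξ| : ℝ) : ℂ) * Complex.I := by
  rw [Gside, branchSide, quad_ofReal]
  have hI : (1 : ℂ) / Complex.I = -Complex.I := by rw [one_div, Complex.inv_I]
  have : (1 : ℂ) / slitSign j = slitSign j := by fin_cases j <;> simp [slitSign]
  rw [← div_div]
  simp only [if_true, one_mul]
  push_cast
  rw [div_eq_mul_one_div _ Complex.I, hI, ← div_div, div_eq_mul_one_div _ (slitSign j : ℂ), this]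
  ring

omit hk hz in
theorem Gside_re (j : Fin 2) (s : Bool) (ξ : ℝ) : (P.Gside j s ξ).re = 0 := by
  have := congrArg Complex.re (conj_Gside (P := P) j s ξ)
  simp only [Complex.conj_re, Complex.neg_re] at this
  linarith

omit hz in
theorem hasSides_G (j : Fin 2) : HasSides P.k j P.G (P.Gside j) := fun s ξ hξ =>
  ((continuous_quad.tendsto (ξ : ℂ)).const_mul (P.scale : ℂ) |>.mono_left nhdsWithin_le_nhds).div
    (tendsto_branch hk j s (Ioo_subset_Icc_self hξ)) (branchSide_ne_zero hk j s hξ)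

theorem tendsto_inv_sq (j : Fin 2) (s : Bool) {ξ : ℝ} (h : ξ ∈ Ioo (lo P.k j) (hi P.k j)) :
    Tendsto (fun ζ : ℂ => 1 / (ζ - P.zinf) ^ 2) (𝓝[halfPlane s] (ξ : ℂ))
      (𝓝 (1 / ((ξ : ℂ) - P.zinf) ^ 2)) := by
  have hne : ((ξ : ℂ) - P.zinf) ≠ 0 := by
    have := sub_ne_zero.2 (ne_zinf_of_mem hk hz j (Ioo_subset_Icc_self h))
    exact_mod_cast this
  have : ContinuousAt (fun ζ : ℂ => 1 / (ζ - P.zinf) ^ 2) (ξ : ℂ) := by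
    fun_prop (disch := exact pow_ne_zero _ hne)
  exact this.tendsto.mono_left nhdsWithin_le_nhds

theorem hasSides_comb (A B : ℂ) (j : Fin 2) : HasSides P.k j (P.comb A B)
    fun s ξ => 1 / ((ξ : ℂ) - P.zinf) ^ 2 * (A + B * P.Gside j s ξ) := fun s ξ hξ =>
  (tendsto_inv_sq hk hz j s hξ).mul (((hasSides_G hk j s ξ hξ).const_mul B).const_add A)

theorem integral_quad_eq_zero (j : Fin 2) :
    ∫ ξ in lo P.k j..hi P.k j, P.quadR ξ / ((ξ - P.zinf) ^ 2 * √|p2 P.k ξ|) = 0 := by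
  have h1 := integral_slit hk hz j
  have hs := (scale_pos hk hz).ne'
  have hY : ∀ ξ, ξ = lo P.k j ∨ ξ = hi P.k j →
      (inverseSlits hk hz).Y (1 / (ξ - P.zinf)) = 0 := by
    set T := inverseSlits hk hz
    have h0 : T.Y T.b₀ = 0 := T.Y_of_mem_gap ⟨le_rfl, (T.neg.trans T.pos).le⟩
    have h2 : T.Y T.a₁ = 0 := T.Y_of_mem_gap ⟨(T.neg.trans T.pos).le, le_rfl⟩
    have h3 := (closed hk hz).left
    have h4 := (closed hk hz).right
    fin_cases j
    · rintro ξ (rfl | rfl)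
      exacts [h0, h3]
    · rintro ξ (rfl | rfl)
      exacts [h4, h2]
  rw [hY _ (Or.inl rfl), hY _ (Or.inr rfl), sub_zero] at h1
  refine (mul_eq_zero.1 h1).resolve_left (mul_ne_zero ?_ hs)
  fin_cases j <;> simp [slitSign]

/-- The constant part takes the same values on both sides and cancels; the part with `G` changes
sign, but its integral over the slit is already zero. -/
theorem loopIntegralVanishes_comb (A B : ℂ) (j : Fin 2) :
    LoopIntegralVanishes P.k j (P.comb A B) := by
  have hle := (lo_lt_hi hk j).le
  have hG : ∀ ξ : ℝ, 1 / ((ξ : ℂ) - P.zinf) ^ 2 * (B * P.Gside j true ξ) =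
      (B * (-(slitSign j * P.scale : ℝ) * Complex.I)) *
        ((P.quadR ξ / ((ξ - P.zinf) ^ 2 * √|p2 P.k ξ|) : ℝ) : ℂ) := fun ξ => by
    rw [Gside_true, ← div_div (P.quadR ξ)]; push_cast; ring
  have hi1 : IntervalIntegrable (fun ξ : ℝ => 1 / ((ξ : ℂ) - P.zinf) ^ 2 * A) volume
      (lo P.k j) (hi P.k j) := by
    apply ContinuousOn.intervalIntegrable
    rw [uIcc_of_le hle]
    refine ContinuousOn.mul (ContinuousOn.div continuousOn_const (by fun_prop) fun ξ hξ => ?_)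
      continuousOn_const
    have := pow_ne_zero 2 (sub_ne_zero.2 (ne_zinf_of_mem hk hz j hξ))
    exact_mod_cast this
  have hi2 : IntervalIntegrable (fun ξ : ℝ => 1 / ((ξ : ℂ) - P.zinf) ^ 2 * (B * P.Gside j true ξ))
      volume (lo P.k j) (hi P.k j) := by
    simp only [hG]
    have h := (intervalIntegrable_quad hk hz j)
    have h' : IntervalIntegrable (fun ξ : ℝ =>
      ((P.quadR ξ / ((ξ - P.zinf) ^ 2 * √|p2 P.k ξ|) : ℝ) : ℂ)) volume _ _ :=
      ⟨h.1.ofReal, h.2.ofReal⟩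
    exact h'.const_mul _
  have hsplit : ∫ ξ in lo P.k j..hi P.k j, 1 / ((ξ : ℂ) - P.zinf) ^ 2 * (B * P.Gside j true ξ) = 0 := by
    simp only [hG]
    rw [intervalIntegral.integral_const_mul, intervalIntegral.integral_ofReal,
      integral_quad_eq_zero hk hz j]
    simp
  have e1 : ∀ ξ : ℝ, 1 / ((ξ : ℂ) - P.zinf) ^ 2 * (A + B * P.Gside j true ξ) =
      1 / ((ξ : ℂ) - P.zinf) ^ 2 * A + 1 / ((ξ : ℂ) - P.zinf) ^ 2 * (B * P.Gside j true ξ) :=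
    fun ξ => by ring
  have e2 : ∀ ξ : ℝ, 1 / ((ξ : ℂ) - P.zinf) ^ 2 * (A + B * P.Gside j false ξ) =
      1 / ((ξ : ℂ) - P.zinf) ^ 2 * A - 1 / ((ξ : ℂ) - P.zinf) ^ 2 * (B * P.Gside j true ξ) :=
    fun ξ => by
      have := Gside_not (P := P) j true ξ
      simp only [Bool.not_true] at this
      rw [this]; ring
  refine ⟨_, hasSides_comb hk hz A B j, fun s => ?_, ?_⟩
  · cases s
    · simp only [e2]; exact hi1.sub hi2
    · simp only [e1]; exact hi1.add hi2
  · simp only [e1, e2]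
    rw [intervalIntegral.integral_add hi1 hi2, intervalIntegral.integral_sub hi1 hi2, hsplit]
    simp

theorem G_re_neg {ζ : ℂ} (h : ζ ∈ slitDomain P.k) : (P.G ζ).re < 0 := by
  by_cases hne : ζ = P.zinf
  · rw [hne, G_zinf hk hz]; simp
  · rw [G_eq hk hz ⟨h, hne⟩, Complex.neg_re, neg_lt_zero]
    exact (closed hk hz).g_re_pos (inv_notMem_slits hk hz ⟨h, hne⟩)

-- The sign of `re w` compares `‖1 + w‖` with `‖1 - w‖`. At a zero of `den` one has `‖mb‖ ‖1 + G‖ =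
-- ‖na‖ ‖1 - G‖`, which relates the sign of `re G` to the position of `γ` relative to `1`.
omit hk hz in
theorem norm_one_add_sq (w : ℂ) : ‖1 + w‖ ^ 2 = ‖1 - w‖ ^ 2 + 4 * w.re := by
  rw [← Complex.normSq_eq_norm_sq, ← Complex.normSq_eq_norm_sq, Complex.normSq_apply,
    Complex.normSq_apply]
  simp; ring

omit hk hz in
/-- A zero of the denominator of `ψ` at a value of `G` in the left half-plane. -/
theorem norm_na_lt (hn : P.na ≠ 0) {w : ℂ} (hw : w.re < 0)
    (h : P.mb * (1 + w) - P.na * (1 - w) = 0) : ‖P.na‖ < ‖P.mb‖ := by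
  have h1 : ‖P.mb‖ * ‖1 + w‖ = ‖P.na‖ * ‖1 - w‖ := by
    rw [← norm_mul, ← norm_mul, sub_eq_zero.1 h]
  have h2 := norm_one_add_sq w
  have h3 : 0 < ‖P.na‖ := norm_pos_iff.2 hn
  have h4 := norm_nonneg (1 + w)
  have h5 : ‖1 + w‖ < ‖1 - w‖ := by
    refine lt_of_pow_lt_pow_left₀ 2 (norm_nonneg _) (by linarith)
  by_contra hc
  have h6 := not_lt.1 hc
  nlinarith

omit hk hz in
theorem norm_na_eq {w : ℂ} (hw : w.re = 0)
    (h : P.mb * (1 + w) - P.na * (1 - w) = 0) : ‖P.na‖ = ‖P.mb‖ := by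
  have h1 : ‖P.mb‖ * ‖1 + w‖ = ‖P.na‖ * ‖1 - w‖ := by
    rw [← norm_mul, ← norm_mul, sub_eq_zero.1 h]
  have h2 := norm_one_add_sq w
  rw [hw, mul_zero, add_zero] at h2
  have h5 : ‖1 + w‖ = ‖1 - w‖ := (pow_left_inj₀ (norm_nonneg _) (norm_nonneg _) two_ne_zero).1 h2
  have h6 : ‖1 - w‖ ≠ 0 := by
    rw [norm_ne_zero_iff, sub_ne_zero]
    rintro rfl
    simp at hw
  rw [h5] at h1
  exact (mul_right_cancel₀ h6 h1).symm

omit hk hz in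
theorem na_ne_zero (hc : P.c ≠ 0) (ha : P.a ≠ 0) : P.na ≠ 0 :=
  mul_ne_zero hc ((map_ne_zero _).2 ha)

omit hk hz in
theorem norm_mb : ‖P.mb‖ = ‖P.c‖ * ‖P.b‖ := by simp [mb]

omit hk hz in
theorem norm_na : ‖P.na‖ = ‖P.c‖ * ‖P.a‖ := by simp [na]

omit hk hz in
theorem gam_eq : P.gam = ‖P.b‖ / ‖P.a‖ := by rw [Loading.gam, norm_div]

omit hk hz in
theorem gam_lt_one_iff (hc : P.c ≠ 0) (ha : P.a ≠ 0) : P.gam < 1 ↔ ‖P.mb‖ < ‖P.na‖ := by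
  have h1 := norm_pos_iff.2 hc
  rw [gam_eq, div_lt_one (norm_pos_iff.2 ha), norm_mb, norm_na, mul_lt_mul_iff_right₀ h1]

omit hk hz in
theorem gam_le_one_iff (hc : P.c ≠ 0) (ha : P.a ≠ 0) : P.gam ≤ 1 ↔ ‖P.mb‖ ≤ ‖P.na‖ := by
  have h1 := norm_pos_iff.2 hc
  rw [gam_eq, div_le_one (norm_pos_iff.2 ha), norm_mb, norm_na, mul_le_mul_iff_right₀ h1]

omit hk hz in
theorem gam_eq_one_iff (hc : P.c ≠ 0) (ha : P.a ≠ 0) : P.gam = 1 ↔ ‖P.mb‖ = ‖P.na‖ := by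
  constructor
  · intro h
    exact le_antisymm ((gam_le_one_iff hc ha).1 h.le)
      (not_lt.1 fun h' => absurd ((gam_lt_one_iff hc ha).2 h') h.not_lt)
  · intro h
    exact le_antisymm ((gam_le_one_iff hc ha).2 h.le)
      (not_lt.1 fun h' => absurd ((gam_lt_one_iff hc ha).1 h') h.not_lt)

theorem den_ne_zero (hc : P.c ≠ 0) (ha : P.a ≠ 0) (hg : P.gam ≤ 1) {ζ : ℂ}
    (h : ζ ∈ slitDomain P.k) : P.den ζ ≠ 0 := fun h0 =>
  ((gam_le_one_iff hc ha).1 hg).not_gt (norm_na_lt (na_ne_zero hc ha) (G_re_neg hk hz h) h0)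

/-- A zero of the boundary value forces `‖na‖ = ‖mb‖`, because `G` is imaginary on the slits. But
then `γ = 1`, and `den` has no zeros at all off the slits. -/
theorem eventually_den_ne_zero (hc : P.c ≠ 0) (ha : P.a ≠ 0) (j : Fin 2) (s : Bool) {ξ : ℝ}
    (hξ : ξ ∈ Ioo (lo P.k j) (hi P.k j)) :
    ∀ᶠ ζ in 𝓝[halfPlane s] (ξ : ℂ), P.den ζ ≠ 0 := by
  have hG := hasSides_G hk j s ξ hξ
  have ht : Tendsto P.den (𝓝[halfPlane s] (ξ : ℂ))
      (𝓝 (P.mb * (1 + P.Gside j s ξ) - P.na * (1 - P.Gside j s ξ))) :=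
    ((hG.const_add 1).const_mul _).sub ((hG.const_sub 1).const_mul _)
  by_cases h0 : P.mb * (1 + P.Gside j s ξ) - P.na * (1 - P.Gside j s ξ) = 0
  · have h1 := norm_na_eq (Gside_re j s ξ) h0
    filter_upwards [self_mem_nhdsWithin] with ζ hζ
    have him : ζ.im ≠ 0 := by
      cases s
      · exact (show ζ.im < 0 from hζ).ne
      · exact (show 0 < ζ.im from hζ).ne'
    exact den_ne_zero hk hz hc ha ((gam_le_one_iff hc ha).2 h1.ge) (mem_slitDomain_of_im hk him)
  · exact ht.eventually_ne h0

/-- The numerator of `ψ ω'` is `conj na (1 + G) - conj mb (1 - G)`. Since `conj G = -G` on the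
slits, it is there the negative of `conj den`, so the two terms cancel. The statement is about a
limit of the sum, since boundary values of `ψ` alone would involve division by a possibly vanishing
`den`. -/
theorem tendsto_psi_boundary (hc : P.c ≠ 0) (ha : P.a ≠ 0) (j : Fin 2) (s : Bool) {ξ : ℝ}
    (hξ : ξ ∈ Ioo (lo P.k j) (hi P.k j)) :
    Tendsto (fun ζ => P.psi ζ * P.omegaDeriv ζ + P.a * conj (P.omegaDeriv ζ))
      (𝓝[halfPlane s] (ξ : ℂ)) (𝓝 0) := by
  have ha' : conj P.a ≠ 0 := (map_ne_zero _).2 ha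
  have h1 := hasSides_G hk j s ξ hξ
  have h2 := tendsto_inv_sq hk hz j s hξ
  have h3 : Tendsto (fun ζ : ℂ => conj (1 / (ζ - P.zinf) ^ 2 * P.den ζ)) (𝓝[halfPlane s] (ξ : ℂ))
      (𝓝 (conj (1 / ((ξ : ℂ) - P.zinf) ^ 2 *
        (P.mb * (1 + P.Gside j s ξ) - P.na * (1 - P.Gside j s ξ))))) :=
    (Complex.continuous_conj.tendsto _).comp
      (h2.mul (((h1.const_add 1).const_mul _).sub ((h1.const_sub 1).const_mul _)))
  have h4 := h2.mul (((h1.const_add 1).const_mul (conj P.na)).sub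
    ((h1.const_sub 1).const_mul (conj P.mb)))
  have h5 := (h4.add h3).const_mul (1 / 2 : ℂ)
  have e : (1 / 2 : ℂ) * (1 / ((ξ : ℂ) - P.zinf) ^ 2 *
        (conj P.na * (1 + P.Gside j s ξ) - conj P.mb * (1 - P.Gside j s ξ)) +
      conj (1 / ((ξ : ℂ) - P.zinf) ^ 2 *
        (P.mb * (1 + P.Gside j s ξ) - P.na * (1 - P.Gside j s ξ)))) = 0 := by
    have h6 := conj_Gside (P := P) j s ξ
    simp only [map_mul, map_sub, map_add, map_one, map_div₀, map_pow, Complex.conj_ofReal, h6]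
    ring
  rw [e] at h5
  refine h5.congr' ?_
  filter_upwards [eventually_den_ne_zero hk hz hc ha j s hξ, self_mem_nhdsWithin] with ζ hd hζ
  have him : ζ.im ≠ 0 := by
    cases s
    · exact (show ζ.im < 0 from hζ).ne
    · exact (show 0 < ζ.im from hζ).ne'
  have hne : ζ ≠ P.zinf := by rintro rfl; simp at him
  have h0 := sub_ne_zero.2 hne
  have hw : P.omegaDeriv ζ ≠ 0 := by
    rw [omegaDeriv_den hk hz]
    exact mul_ne_zero (by simp [ha, h0]) hd
  have e1 : P.psi ζ * P.omegaDeriv ζ = (P.Fplus ζ + P.Fminus ζ) / 2 := by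
    rw [psi]; field_simp
  rw [e1, Fplus_add_Fminus hk hz, omegaDeriv_den hk hz]
  have e2 : conj (1 / (2 * conj P.a * (ζ - P.zinf) ^ 2) * P.den ζ) =
      1 / (2 * P.a) * conj (1 / (ζ - P.zinf) ^ 2 * P.den ζ) := by
    simp only [map_mul, map_div₀, map_one, Complex.conj_conj, map_ofNat]
    ring
  rw [e2]
  field_simp

/-! ### Asymptotics at the poles, at infinity and at the ends of the slits -/

theorem isBigO_G_zinf : (fun ζ => (P.G ζ + 1) / (ζ - P.zinf) ^ 2) =O[𝓝[≠] (P.zinf : ℂ)]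
    fun _ => (1 : ℝ) := by
  obtain ⟨h, hd, he⟩ := exists_G_expansion hk hz
  have hc : ContinuousAt h P.zinf :=
    (hd.differentiableAt ((isOpen_slitDomain hk).mem_nhds (zinf_mem hk hz))).continuousAt
  refine ((hc.tendsto.mono_left nhdsWithin_le_nhds).isBigO_one ℝ).congr' ?_ EventuallyEq.rfl
  filter_upwards [self_mem_nhdsWithin] with ζ hζ
  exact he ζ hζ

theorem isBigO_comb_zinf {A B v : ℂ} (h : A - B = -v) :
    (fun ζ => P.comb A B ζ + v / (ζ - P.zinf) ^ 2) =O[𝓝[≠] (P.zinf : ℂ)] fun _ => (1 : ℝ) := by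
  refine ((isBigO_G_zinf hk hz).const_mul_left B).congr' ?_ EventuallyEq.rfl
  filter_upwards with ζ
  rw [comb]
  rw [show v = B - A by linear_combination h]
  ring

/-- By `psi_eq` the difference `ψ - b` is a constant times `(1 + G) / den`, where `1 + G` has a
double zero at `ζ_∞` and `den(ζ_∞) = -2 na ≠ 0`. -/
theorem isBigO_psi_zinf (hc : P.c ≠ 0) (ha : P.a ≠ 0) :
    (fun ζ => P.psi ζ - P.b) =O[𝓝[≠] (P.zinf : ℂ)] (fun ζ => ‖ζ - P.zinf‖ ^ 2) := by
  have hG : ContinuousAt P.G P.zinf := (differentiableAt_G hk (zinf_mem hk hz)).continuousAt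
  have hden : ContinuousAt P.den P.zinf := by
    unfold den; fun_prop
  have hd0 : P.den P.zinf ≠ 0 := by
    rw [den, G_zinf hk hz]
    have := na_ne_zero hc ha
    simp only [add_neg_cancel, mul_zero, zero_sub, sub_neg_eq_add]
    exact neg_ne_zero.2 (mul_ne_zero this (by norm_num))
  have h1 : (fun ζ => conj P.c * ((Complex.normSq P.a - Complex.normSq P.b : ℝ) : ℂ) / P.den ζ)
      =O[𝓝[≠] (P.zinf : ℂ)] fun _ => (1 : ℝ) :=
    ((continuousAt_const.div hden hd0).tendsto.mono_left nhdsWithin_le_nhds).isBigO_one ℝ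
  have h2 := (h1.mul (isBigO_G_zinf hk hz)).mul
    (isBigO_refl (fun ζ : ℂ => ((ζ - P.zinf) ^ 2)) (𝓝[≠] (P.zinf : ℂ))).norm_right
  refine h2.congr' ?_ ?_
  · filter_upwards [self_mem_nhdsWithin, (hden.eventually_ne hd0).filter_mono nhdsWithin_le_nhds]
      with ζ hζ hd
    rw [psi_eq hk hz ha hζ hd]
    have := sub_ne_zero.2 hζ
    field_simp; ring
  · filter_upwards with ζ
    rw [norm_pow]; ring

omit hk hz in
theorem tendsto_inv_sub_cocompact (z : ℂ) :
    Tendsto (fun ζ : ℂ => 1 / (ζ - z)) (cocompact ℂ) (𝓝 0) := by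
  have h1 : Tendsto (fun ζ : ℂ => ζ - z) (cocompact ℂ) (cocompact ℂ) :=
    (Homeomorph.subRight z).isClosedEmbedding.tendsto_cocompact
  rw [← Metric.cobounded_eq_cocompact] at h1 ⊢
  simpa [Function.comp_def] using tendsto_inv₀_cobounded.comp h1

omit hk hz in
theorem tendsto_sq_div_cocompact (z : ℂ) :
    Tendsto (fun ζ : ℂ => ζ ^ 2 * (1 / (ζ - z) ^ 2)) (cocompact ℂ) (𝓝 1) := by
  have h1 : Tendsto (fun ζ : ℂ => (1 + z * (1 / (ζ - z))) ^ 2) (cocompact ℂ) (𝓝 1) := by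
    have := (((tendsto_inv_sub_cocompact z).const_mul z).const_add 1).pow 2
    simpa using this
  refine h1.congr' ?_
  filter_upwards [(isCompact_singleton (x := z)).compl_mem_cocompact] with ζ hζ
  have : ζ - z ≠ 0 := sub_ne_zero.2 hζ
  field_simp; ring

omit hk hz in
theorem eventually_punctured_cocompact : ∀ᶠ ζ in cocompact ℂ, ζ ∈ P.punctured := by
  have h1 : IsCompact (slit P.k 0 ∪ slit P.k 1 ∪ {(P.zinf : ℂ)}) :=
    ((isCompact_Icc.image Complex.continuous_ofReal).union
      (isCompact_Icc.image Complex.continuous_ofReal)).union isCompact_singleton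
  filter_upwards [h1.compl_mem_cocompact] with ζ hζ
  exact ⟨fun h => hζ (Or.inl h), fun h => hζ (Or.inr h)⟩

variable (P) in
/-- The value of `G` at infinity. -/
def Ginf : ℂ := -(inverseSlits hk hz).g 0

theorem tendsto_G_cocompact : Tendsto P.G (cocompact ℂ) (𝓝 (P.Ginf hk hz)) := by
  have h0 := (inverseSlits hk hz).zero_notMem_slits
  have h1 := ((inverseSlits hk hz).differentiableAt_g h0).continuousAt
  have h2 := (h1.tendsto.comp (tendsto_inv_sub_cocompact P.zinf)).neg
  refine h2.congr' ?_
  filter_upwards [eventually_punctured_cocompact] with ζ hζ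
  rw [G_eq hk hz hζ]; rfl

theorem Ginf_re_neg : (P.Ginf hk hz).re < 0 := by
  rw [Ginf, Complex.neg_re, neg_lt_zero]
  exact (closed hk hz).g_re_pos (inverseSlits hk hz).zero_notMem_slits

theorem tendsto_sq_mul_comb (A B : ℂ) : Tendsto (fun ζ => ζ ^ 2 * P.comb A B ζ) (cocompact ℂ)
    (𝓝 (A + B * P.Ginf hk hz)) := by
  have := (tendsto_sq_div_cocompact P.zinf).mul
    (((tendsto_G_cocompact hk hz).const_mul B).const_add A)
  rw [one_mul] at this
  refine this.congr fun ζ => ?_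
  rw [comb]; ring

omit hk hz in
theorem isBigO_of_tendsto_sq_mul {F : ℂ → ℂ} {d : ℂ}
    (h : Tendsto (fun ζ => ζ ^ 2 * F ζ) (cocompact ℂ) (𝓝 d)) :
    F =O[cocompact ℂ] fun ζ => (‖ζ‖ ^ 2)⁻¹ := by
  have h1 := (h.isBigO_one ℝ).mul
    (isBigO_refl (fun ζ : ℂ => (ζ ^ 2)⁻¹) (cocompact ℂ)).norm_right
  refine h1.congr' ?_ ?_
  · filter_upwards [(isCompact_singleton (x := (0 : ℂ))).compl_mem_cocompact] with ζ hζ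
    have : ζ ≠ 0 := hζ
    field_simp
  · filter_upwards with ζ
    rw [one_mul, norm_inv, norm_pow]

omit hz in
/-- The branch at the ends of the slits. -/
theorem eventually_inv_branch_le {e : ℝ} (he : e ^ 2 = 1 ∨ e ^ 2 = 1 / P.k ^ 2) :
    ∃ C : ℝ, 0 ≤ C ∧ ∀ᶠ ζ in 𝓝[slitDomain P.k] (e : ℂ),
      ‖1 / branch P.k ζ‖ ≤ C * ‖ζ - e‖ ^ (-(1 / 2 : ℝ)) := by
  have h1 := one_lt_inv_sq hk
  have he0 : e ≠ 0 := by
    rintro rfl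
    rcases he with h | h
    · norm_num at h
    · rw [← h] at h1; norm_num at h1
  obtain ⟨f, hf, hf0, hfe⟩ : ∃ f : ℂ → ℂ, Continuous f ∧ f e ≠ 0 ∧ ∀ ζ : ℂ,
      (ζ ^ 2 - 1) * (ζ ^ 2 - 1 / (P.k : ℂ) ^ 2) = (ζ - e) * f ζ := by
    have hk2 : (1 / (P.k : ℂ) ^ 2) = ((1 / P.k ^ 2 : ℝ) : ℂ) := by push_cast; rfl
    have h2e : (e : ℂ) + e ≠ 0 := by
      have : e + e ≠ 0 := by intro h; apply he0; linarith
      exact_mod_cast this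
    rw [hk2]
    rcases he with h | h
    · refine ⟨fun ζ => (ζ + e) * (ζ ^ 2 - ((1 / P.k ^ 2 : ℝ) : ℂ)), by fun_prop, ?_, fun ζ => ?_⟩
      · refine mul_ne_zero h2e ?_
        have : e ^ 2 - 1 / P.k ^ 2 ≠ 0 := by rw [h]; linarith
        exact_mod_cast this
      · have : (e : ℂ) ^ 2 = 1 := by exact_mod_cast h
        linear_combination (ζ ^ 2 - ((1 / P.k ^ 2 : ℝ) : ℂ)) * this
    · refine ⟨fun ζ => (ζ + e) * (ζ ^ 2 - 1), by fun_prop, ?_, fun ζ => ?_⟩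
      · refine mul_ne_zero h2e ?_
        have : e ^ 2 - 1 ≠ 0 := by rw [h]; linarith
        exact_mod_cast this
      · have : (e : ℂ) ^ 2 = ((1 / P.k ^ 2 : ℝ) : ℂ) := by exact_mod_cast h
        linear_combination (ζ ^ 2 - 1) * this
  set c := ‖f e‖ / 2 with hc
  have hcpos : 0 < c := half_pos (norm_pos_iff.2 hf0)
  refine ⟨c ^ (-(1 / 2 : ℝ)), by positivity, ?_⟩
  have hev : ∀ᶠ ζ in 𝓝 (e : ℂ), c < ‖f ζ‖ :=
    (hf.norm.tendsto (e : ℂ)).eventually (lt_mem_nhds (half_lt_self (norm_pos_iff.2 hf0)))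
  filter_upwards [self_mem_nhdsWithin, mem_nhdsWithin_of_mem_nhds hev] with ζ hζ hfζ
  have hb := branch_sq_of_mem hk hζ
  rw [hfe] at hb
  have hb0 := branch_ne_zero hk hζ
  have hne : 0 < ‖ζ - e‖ := by
    rw [norm_pos_iff]; intro h
    rw [h, zero_mul] at hb
    exact pow_ne_zero 2 hb0 hb
  have h2 : ‖branch P.k ζ‖ ^ 2 = ‖ζ - e‖ * ‖f ζ‖ := by rw [← norm_pow, hb, norm_mul]
  have h3 : ‖branch P.k ζ‖ = (‖ζ - e‖ * ‖f ζ‖) ^ (1 / 2 : ℝ) := by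
    rw [← h2, ← Real.sqrt_eq_rpow, Real.sqrt_sq (norm_nonneg _)]
  rw [norm_div, norm_one, h3, one_div, ← Real.rpow_neg (by positivity),
    Real.mul_rpow (norm_nonneg _) (norm_nonneg _), mul_comm]
  gcongr ?_ * _
  exact Real.rpow_le_rpow_of_nonpos hcpos hfζ.le (by norm_num)

omit hk hz in
theorem end_sq {j : Fin 2} {e : ℝ} (he : e = lo P.k j ∨ e = hi P.k j) :
    e ^ 2 = 1 ∨ e ^ 2 = 1 / P.k ^ 2 := by
  have h : (1 / P.k) ^ 2 = 1 / P.k ^ 2 := by rw [div_pow, one_pow]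
  fin_cases j
  · rcases he with rfl | rfl
    · right; simp [lo]
    · left; simp [hi]
  · rcases he with rfl | rfl
    · left; simp [lo]
    · right; simp [hi]

theorem comb_endpoint (A B : ℂ) {j : Fin 2} {e : ℝ} (he : e = lo P.k j ∨ e = hi P.k j) :
    ∃ C μ : ℝ, μ < 1 ∧
      ∀ᶠ ζ in 𝓝[slitDomain P.k] (e : ℂ), ‖P.comb A B ζ‖ ≤ C * ‖ζ - e‖ ^ (-μ) := by
  obtain ⟨C, hC, hev⟩ := eventually_inv_branch_le hk (end_sq he)
  have hez : e ≠ P.zinf := by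
    refine ne_zinf_of_mem hk hz j ?_
    have := (lo_lt_hi hk j).le
    rcases he with rfl | rfl
    exacts [left_mem_Icc.2 this, right_mem_Icc.2 this]
  have hne : ((e : ℂ) - P.zinf) ^ 2 ≠ 0 := pow_ne_zero _ (by
    have := sub_ne_zero.2 hez
    exact_mod_cast this)
  have hc1 : ContinuousAt (fun ζ : ℂ => 1 / (ζ - P.zinf) ^ 2) (e : ℂ) := by
    fun_prop (disch := exact hne)
  have hq := continuous_quad (P := P)
  have hc2 : ContinuousAt (fun ζ : ℂ => B * (P.scale * P.quad ζ)) (e : ℂ) := by fun_prop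
  set M₁ := ‖1 / ((e : ℂ) - P.zinf) ^ 2‖ + 1
  set M₂ := ‖B * (P.scale * P.quad e)‖ + 1
  refine ⟨M₁ * (‖A‖ + M₂ * C), 1 / 2, by norm_num, ?_⟩
  have hb1 : ∀ᶠ ζ : ℂ in 𝓝 (e : ℂ), ‖1 / (ζ - P.zinf) ^ 2‖ < M₁ :=
    hc1.norm.tendsto.eventually (gt_mem_nhds (lt_add_one _))
  have hb2 : ∀ᶠ ζ : ℂ in 𝓝 (e : ℂ), ‖B * (P.scale * P.quad ζ)‖ < M₂ :=
    hc2.norm.tendsto.eventually (gt_mem_nhds (lt_add_one _))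
  filter_upwards [hev, mem_nhdsWithin_of_mem_nhds hb1, mem_nhdsWithin_of_mem_nhds hb2,
    mem_nhdsWithin_of_mem_nhds (Metric.ball_mem_nhds (e : ℂ) one_pos), self_mem_nhdsWithin]
    with ζ h1 h2 h3 h4 h5
  have hne' : ζ - e ≠ 0 := by
    rw [sub_ne_zero]; rintro rfl
    rw [ofReal_mem_slitDomain hk] at h5
    have hle := (lo_lt_hi hk j).le
    rcases he with rfl | rfl
    exacts [h5 j (left_mem_Icc.2 hle), h5 j (right_mem_Icc.2 hle)]
  have hr : 1 ≤ ‖ζ - e‖ ^ (-(1 / 2 : ℝ)) := by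
    refine Real.one_le_rpow_of_pos_of_le_one_of_nonpos (norm_pos_iff.2 hne') ?_ (by norm_num)
    rw [mem_ball_iff_norm] at h4; exact h4.le
  have hG : P.G ζ * B = B * (P.scale * P.quad ζ) * (1 / branch P.k ζ) := by rw [G]; ring
  calc ‖P.comb A B ζ‖ = ‖1 / (ζ - P.zinf) ^ 2‖ * ‖A + B * P.G ζ‖ := by rw [comb, norm_mul]
    _ ≤ M₁ * (‖A‖ * ‖ζ - e‖ ^ (-(1 / 2 : ℝ)) + M₂ * (C * ‖ζ - e‖ ^ (-(1 / 2 : ℝ)))) := by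
      refine mul_le_mul h2.le ?_ (norm_nonneg _) ((norm_nonneg _).trans h2.le)
      refine (norm_add_le _ _).trans (add_le_add (le_mul_of_one_le_right (norm_nonneg _) hr) ?_)
      rw [mul_comm, hG, norm_mul]
      exact mul_le_mul h3.le h1 (norm_nonneg _) ((norm_nonneg _).trans h3.le)
    _ = _ := by ring

omit hz in
theorem differentiableOn_comb (A B : ℂ) : DifferentiableOn ℂ (P.comb A B) P.punctured := by
  intro ζ hζ
  have h1 := differentiableAt_G hk hζ.1
  have h2 : (ζ - P.zinf) ^ 2 ≠ 0 := pow_ne_zero _ (sub_ne_zero.2 hζ.2)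
  have : DifferentiableAt ℂ (P.comb A B) ζ := by
    unfold comb
    fun_prop (disch := exact h2)
  exact this.differentiableWithinAt

theorem isSchwarz_comb {part : ℂ → ℝ} {m A B : ℂ} (hAB : A - B = -(P.c * m))
    (hpart : ∀ j s (ξ : ℝ), part (1 / ((ξ : ℂ) - P.zinf) ^ 2 * (A + B * P.Gside j s ξ)) = 0) :
    P.IsSchwarz part m (P.comb A B) where
  analytic := differentiableOn_comb hk A B
  boundary j := ⟨_, hasSides_comb hk hz A B j, fun s ξ _ => hpart j s ξ⟩
  endpoints _ _ he := comb_endpoint hk hz A B he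
  pole := isBigO_comb_zinf hk hz hAB
  infinity := isBigO_of_tendsto_sq_mul (tendsto_sq_mul_comb hk hz A B)

omit hk hz in
theorem re_part (A r : ℝ) (j : Fin 2) (s : Bool) (ξ : ℝ) :
    (1 / ((ξ : ℂ) - P.zinf) ^ 2 * (Complex.I * A + r * P.Gside j s ξ)).re = 0 := by
  have h1 : (1 / ((ξ : ℂ) - P.zinf) ^ 2) = ((1 / (ξ - P.zinf) ^ 2 : ℝ) : ℂ) := by push_cast; rfl
  rw [h1, Complex.re_ofReal_mul]
  simp [Gside_re]

theorem isSchwarzPair : P.IsSchwarzPair P.Fplus P.Fminus where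
  plus := by
    have hs : (P.scale : ℂ) ≠ 0 := by exact_mod_cast (scale_pos hk hz).ne'
    rw [Fplus_eq hk hz]
    refine isSchwarz_comb hk hz ?_ fun j s ξ => ?_
    · have h : (P.dP : ℂ) / P.scale = ((P.c.re * P.alphaP - P.c.im * P.betaP : ℝ) : ℂ) := by
        rw [div_eq_iff hs, dP, scale]; push_cast; ring
      rw [h]
      apply Complex.ext
      · simp [A0P, a_re, a_im, b_re, b_im, alphaP, betaP]; ring
      · simp [A0P, a_re, a_im, b_re, b_im, alphaP, betaP]; ring
    · rw [← Complex.ofReal_div]; exact re_part _ _ j s ξ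
  minus := by
    have hs : (P.scale : ℂ) ≠ 0 := by exact_mod_cast (scale_pos hk hz).ne'
    rw [Fminus_eq hk hz]
    refine isSchwarz_comb hk hz ?_ fun j s ξ => ?_
    · have h : Complex.I * P.dM / P.scale =
          Complex.I * ((P.c.re * P.betaM + P.c.im * P.alphaM : ℝ) : ℂ) := by
        rw [div_eq_iff hs, dM, scale]; push_cast; ring
      rw [h]
      apply Complex.ext
      · simp [A0M, a_re, a_im, b_re, b_im, alphaM, betaM]; ring
      · simp [A0M, a_re, a_im, b_re, b_im, alphaM, betaM, mul_comm]; ring_nf; simp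
    · have h := re_part (P := P) (-P.A0M) (P.dM / P.scale) j s ξ
      rw [← Complex.I_mul_im] at h
      rw [← h]; congr 1
      push_cast
      linear_combination (1 / ((ξ : ℂ) - P.zinf) ^ 2 * P.A0M) * Complex.I_mul_I
  loops j := by
    have : (fun ζ => P.Fplus ζ - P.Fminus ζ) = P.comb P.A0 (P.mb + P.na) :=
      funext (Fplus_sub_Fminus hk hz)
    rw [this]; exact loopIntegralVanishes_comb hk hz _ _ j

end Data

/-! ### Removable real segments -/

/-- A continuous function that is analytic off the real axis is analytic. -/
theorem differentiableOn_of_differentiableAt_of_im_ne_zero {O : Set ℂ} (hO : IsOpen O) {f : ℂ → ℂ}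
    (hc : ContinuousOn f O) (hd : ∀ ζ ∈ O, ζ.im ≠ 0 → DifferentiableAt ℂ f ζ) :
    DifferentiableOn ℂ f O := by
  rw [← Complex.isConservativeOn_and_continuousOn_iff_isDifferentiableOn hO]
  refine ⟨fun z w hzw => ?_, hc⟩
  rw [← add_eq_zero_iff_eq_neg, Complex.wedgeIntegral_add_wedgeIntegral_eq]
  -- rectangles on one side of the axis
  have key : ∀ z w : ℂ, Complex.Rectangle z w ⊆ O →
      (∀ y ∈ Ioo (min z.im w.im) (max z.im w.im), y ≠ 0) →
      (∫ x : ℝ in z.re..w.re, f (x + z.im * Complex.I)) -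
      (∫ x : ℝ in z.re..w.re, f (x + w.im * Complex.I)) +
      Complex.I • (∫ y : ℝ in z.im..w.im, f (w.re + y * Complex.I)) -
      Complex.I • (∫ y : ℝ in z.im..w.im, f (z.re + y * Complex.I)) = 0 := by
    intro z w hzw hne
    refine Complex.integral_boundary_rect_eq_zero_of_continuousOn_of_differentiableOn f z w
      (hc.mono hzw) fun ζ hζ => ?_
    rw [Complex.mem_reProdIm] at hζ
    refine (hd ζ (hzw ?_) (hne _ hζ.2)).differentiableWithinAt
    exact ⟨Ioo_subset_Icc_self hζ.1, Ioo_subset_Icc_self hζ.2⟩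
  -- Morera: a rectangle that crosses the axis is cut along it, and the two contributions of the cut
  -- cancel.
  by_cases h0 : (0 : ℝ) ∈ Ioo (min z.im w.im) (max z.im w.im)
  · have h0' : (0 : ℝ) ∈ uIcc z.im w.im := Ioo_subset_Icc_self h0
    have hsub : ∀ a b : ℝ, a ∈ uIcc z.im w.im → b ∈ uIcc z.im w.im → ∀ x ∈ uIcc z.re w.re,
        IntervalIntegrable (fun y : ℝ => f (x + y * Complex.I)) volume a b := by
      intro a b ha hb x hx
      refine ContinuousOn.intervalIntegrable ?_
      refine hc.comp (by fun_prop) fun y hy => hzw ?_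
      have hy' := uIcc_subset_uIcc ha hb hy
      exact ⟨by simpa using hx, by simpa using hy'⟩
    have e1 := key z ⟨w.re, 0⟩ (fun ζ hζ => hzw ⟨hζ.1, uIcc_subset_uIcc_left h0' hζ.2⟩) (by
      intro y hy
      rcases lt_or_ge z.im w.im with h | h
      · rw [min_eq_left h.le, max_eq_right h.le] at h0
        simp only [min_eq_left h0.1.le, max_eq_right h0.1.le] at hy
        exact hy.2.ne
      · rw [min_eq_right h, max_eq_left h] at h0
        simp only [min_eq_right h0.2.le, max_eq_left h0.2.le] at hy
        exact hy.1.ne')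
    have e2 := key ⟨z.re, 0⟩ w (fun ζ hζ => hzw ⟨hζ.1, uIcc_subset_uIcc_right h0' hζ.2⟩) (by
      intro y hy
      rcases lt_or_ge z.im w.im with h | h
      · rw [min_eq_left h.le, max_eq_right h.le] at h0
        simp only [min_eq_left h0.2.le, max_eq_right h0.2.le] at hy
        exact hy.1.ne'
      · rw [min_eq_right h, max_eq_left h] at h0
        simp only [min_eq_right h0.1.le, max_eq_left h0.1.le] at hy
        exact hy.2.ne)
    have s1 := intervalIntegral.integral_add_adjacent_intervals
      (hsub z.im 0 left_mem_uIcc h0' w.re right_mem_uIcc)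
      (hsub 0 w.im h0' right_mem_uIcc w.re right_mem_uIcc)
    have s2 := intervalIntegral.integral_add_adjacent_intervals
      (hsub z.im 0 left_mem_uIcc h0' z.re left_mem_uIcc)
      (hsub 0 w.im h0' right_mem_uIcc z.re left_mem_uIcc)
    simp only [smul_eq_mul] at e1 e2 ⊢
    rw [← s1, ← s2]
    linear_combination e1 + e2
  · exact key z w hzw fun y hy hy0 => h0 (hy0 ▸ hy)

/-- A function analytic off finitely many points, where the singularities are weaker than poles,
and bounded at infinity is constant. -/
theorem exists_eq_const_of_differentiableOn_compl {T : Set ℂ} (hT : T.Finite) {f : ℂ → ℂ}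
    (hd : DifferentiableOn ℂ f Tᶜ)
    (hs : ∀ t ∈ T, Tendsto (fun ζ => (ζ - t) * f ζ) (𝓝[≠] t) (𝓝 0)) {M : ℝ}
    (hb : ∀ᶠ ζ in cocompact ℂ, ‖f ζ‖ ≤ M) : ∃ C : ℂ, ∀ ζ ∈ Tᶜ, f ζ = C := by
  classical
  have hTo : IsOpen Tᶜ := hT.isClosed.isOpen_compl
  set F : ℂ → ℂ := fun ζ => if ζ ∈ T then limUnder (𝓝[≠] ζ) f else f ζ with hF
  have hFf : ∀ ζ ∈ Tᶜ, F ζ = f ζ := fun ζ hζ => if_neg hζ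
  have hdiff : Differentiable ℂ F := by
    intro ζ
    by_cases hζ : ζ ∈ T
    · have hopen : IsOpen (T \ {ζ})ᶜ := (hT.subset sdiff_subset).isClosed.isOpen_compl
      have hmem : (T \ {ζ})ᶜ ∈ 𝓝 ζ := hopen.mem_nhds fun h => h.2 rfl
      have h1 : DifferentiableOn ℂ f ((T \ {ζ})ᶜ \ {ζ}) := hd.mono fun w hw hwT =>
        hw.1 ⟨hwT, hw.2⟩
      -- The value of `f` at the exceptional point is arbitrary but only a constant, so it does not
      -- disturb the estimate `o(1/(w - ζ))` for a removable singularity.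
      have h2 : (fun w => f w - f ζ) =o[𝓝[≠] ζ] fun w => (w - ζ)⁻¹ := by
        rw [isLittleO_iff_tendsto']
        · have h3 : Tendsto (fun w => (w - ζ) * f ζ) (𝓝[≠] ζ) (𝓝 0) := by
            have : Continuous fun w : ℂ => (w - ζ) * f ζ := by fun_prop
            have h4 := this.tendsto ζ
            rw [sub_self, zero_mul] at h4
            exact h4.mono_left nhdsWithin_le_nhds
          have := (hs ζ hζ).sub h3
          rw [sub_zero] at this
          refine this.congr fun w => ?_
          rw [div_inv_eq_mul]; ring
        · filter_upwards [self_mem_nhdsWithin] with w hw h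
          exact absurd (inv_eq_zero.1 h) (sub_ne_zero.2 hw)
      have h3 := (Complex.differentiableOn_update_limUnder_of_isLittleO hmem h1 h2).differentiableAt
        hmem
      refine h3.congr_of_eventuallyEq ?_
      filter_upwards [hmem] with w hw
      by_cases hwζ : w = ζ
      · subst hwζ; rw [Function.update_self, hF]; exact if_pos hζ
      · rw [Function.update_of_ne hwζ]
        exact hFf w fun hwT => hw ⟨hwT, hwζ⟩
    · refine (hd.differentiableAt (hTo.mem_nhds hζ)).congr_of_eventuallyEq ?_
      filter_upwards [hTo.mem_nhds hζ] with w hw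
      exact hFf w hw
  have hbd : Bornology.IsBounded (range F) := by
    have h1 : ∀ᶠ ζ in cocompact ℂ, ‖F ζ‖ ≤ M := by
      filter_upwards [hb, hT.isCompact.compl_mem_cocompact] with ζ h1 h2
      rwa [hFf ζ h2]
    obtain ⟨K, hK, hKs⟩ := mem_cocompact.1 h1
    refine ((hK.image hdiff.continuous).isBounded.union
      (Metric.isBounded_closedBall (x := (0 : ℂ)) (r := M))).subset ?_
    rintro _ ⟨ζ, rfl⟩
    by_cases hζ : ζ ∈ K
    · exact Or.inl ⟨ζ, hζ, rfl⟩
    · right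
      rw [mem_closedBall_zero_iff]; exact hKs hζ
  exact ⟨F 0, fun ζ hζ => by rw [← hFf ζ hζ]; exact hdiff.apply_eq_apply_of_bounded hbd ζ 0⟩

/-- A function analytic off a part of the real axis, with limits at all but finitely many points of
it, is constant if it is bounded at infinity and its singularities are weaker than poles. -/
theorem exists_eq_const_of_tendsto {A T : Set ℂ} (hA : IsOpen A) (hT : T.Finite) {h : ℂ → ℂ}
    (him : ∀ ζ : ℂ, ζ.im ≠ 0 → ζ ∈ A ∪ T) (hAT : Disjoint A T)
    (hTr : ∀ t ∈ T, t.im = 0) (hd : DifferentiableOn ℂ h A)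
    (hl : ∀ x ∉ A ∪ T, ∃ v, Tendsto h (𝓝[A] x) (𝓝 v))
    (hs : ∀ t ∈ T, Tendsto (fun ζ => (ζ - t) * h ζ) (𝓝[A] t) (𝓝 0)) {M : ℝ}
    (hAc : A ∈ cocompact ℂ) (hb : ∀ᶠ ζ in cocompact ℂ, ‖h ζ‖ ≤ M) :
    ∃ C : ℂ, ∀ ζ ∈ A, h ζ = C := by
  have hsub : A ⊆ Tᶜ := fun ζ h1 h2 => hAT.notMem_of_mem_left h1 h2
  have himA : ∀ ζ : ℂ, ζ.im ≠ 0 → ζ ∈ A := fun ζ hζ =>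
    (him ζ hζ).resolve_right fun ht => hζ (hTr ζ ht)
  have hdense : ∀ x : ℂ, x ∈ closure A := by
    intro x
    have h1 : x ∈ closure {ζ : ℂ | ζ.im ≠ 0} := by
      have : Dense {ζ : ℂ | ζ.im ≠ 0} := by
        have : {ζ : ℂ | ζ.im ≠ 0} = Complex.im ⁻¹' {0}ᶜ := rfl
        rw [this]
        exact (dense_compl_singleton (0 : ℝ)).preimage Complex.isOpenMap_im
      exact this x
    exact closure_mono (fun ζ hζ => himA ζ hζ) h1
  have hlim : ∀ x ∈ Tᶜ, ∃ v, Tendsto h (𝓝[A] x) (𝓝 v) := by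
    intro x hx
    by_cases hxA : x ∈ A
    · exact ⟨h x, (hd.continuousOn x hxA)⟩
    · exact hl x fun h' => h'.elim hxA hx
  -- The continuous extension across the missing part of the axis is analytic by Morera, which
  -- leaves only the finitely many points of `T`. The bounds known on `A` pass to `F` because `A` is
  -- dense.
  set F := extendFrom A h with hF
  have hFA : ∀ ζ ∈ A, F ζ = h ζ := fun ζ hζ =>
    extendFrom_eq (hdense ζ) (hd.continuousOn ζ hζ)
  have hTo : IsOpen Tᶜ := hT.isClosed.isOpen_compl
  have hFc : ContinuousOn F Tᶜ := continuousOn_extendFrom (fun x _ => hdense x) hlim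
  have hFd : DifferentiableOn ℂ F Tᶜ := by
    refine differentiableOn_of_differentiableAt_of_im_ne_zero hTo hFc fun ζ _ hζ => ?_
    refine (hd.differentiableAt (hA.mem_nhds (himA ζ hζ))).congr_of_eventuallyEq ?_
    filter_upwards [hA.mem_nhds (himA ζ hζ)] with w hw
    exact hFA w hw
  have hsing : ∀ t ∈ T, Tendsto (fun ζ => (ζ - t) * F ζ) (𝓝[≠] t) (𝓝 0) := by
    intro t ht
    have h1 := hs t ht
    rw [Metric.tendsto_nhds] at h1 ⊢
    intro ε hε
    have h2 := h1 (ε / 2) (half_pos hε)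
    obtain ⟨V, hV, hVo, htV⟩ := eventually_nhds_iff.1 (eventually_nhdsWithin_iff.1 h2)
    have hTt : IsOpen (T \ {t})ᶜ := (hT.subset sdiff_subset).isClosed.isOpen_compl
    rw [eventually_nhdsWithin_iff]
    filter_upwards [hVo.mem_nhds htV, hTt.mem_nhds (fun h => h.2 rfl)] with ζ hζV hζT hζt
    have hζ : ζ ∈ Tᶜ := fun h => hζT ⟨h, hζt⟩
    have hnb : (𝓝[A] ζ).NeBot := mem_closure_iff_nhdsWithin_neBot.1 (hdense ζ)
    have h3 : Tendsto (fun w => dist ((w - t) * h w) 0) (𝓝[A] ζ) (𝓝 (dist ((ζ - t) * F ζ) 0)) := by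
      refine Tendsto.dist (Tendsto.mul ?_ (tendsto_extendFrom (hlim ζ hζ))) tendsto_const_nhds
      exact (continuous_id.sub continuous_const).continuousWithinAt
    refine lt_of_le_of_lt (le_of_tendsto h3 ?_) (half_lt_self hε)
    filter_upwards [self_mem_nhdsWithin, mem_nhdsWithin_of_mem_nhds (hVo.mem_nhds hζV)] with w h4 h5
    exact (hV w h5 h4).le
  obtain ⟨C, hC⟩ := exists_eq_const_of_differentiableOn_compl (M := M) hT hFd hsing (by
    filter_upwards [hb, hAc] with ζ h1 h2
    rwa [hFA ζ h2])
  exact ⟨C, fun ζ hζ => by rw [← hFA ζ hζ, hC ζ (hsub hζ)]⟩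

/-! ### Uniqueness for the Schwarz problem -/

section unique

variable {k : ℝ}

/-- Limits from both sides of a slit. -/
theorem tendsto_slitDomain_of_sides {j : Fin 2} {ξ : ℝ} (hξ : ξ ∈ Ioo (lo k j) (hi k j))
    {h : ℂ → ℂ} {v : ℂ} (hv : ∀ s, Tendsto h (𝓝[halfPlane s] (ξ : ℂ)) (𝓝 v)) :
    Tendsto h (𝓝[slitDomain k] (ξ : ℂ)) (𝓝 v) := by
  have h1 : Tendsto h (𝓝[halfPlane true ∪ halfPlane false] (ξ : ℂ)) (𝓝 v) := by
    rw [nhdsWithin_union]; exact (hv true).sup (hv false)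
  refine h1.mono_left ?_
  have hN : Complex.re ⁻¹' Ioo (lo k j) (hi k j) ∈ 𝓝 (ξ : ℂ) :=
    (isOpen_Ioo.preimage Complex.continuous_re).mem_nhds (by simpa using hξ)
  rw [← nhdsWithin_inter_of_mem (mem_nhdsWithin_of_mem_nhds hN)]
  refine nhdsWithin_mono _ ?_
  rintro ζ ⟨h2, h3⟩
  rcases lt_trichotomy ζ.im 0 with h | h | h
  · exact Or.inr h
  · exfalso
    apply h3
    have : ζ ∈ slit k j := ⟨ζ.re, Ioo_subset_Icc_self h2, Complex.ext rfl (by simp [h])⟩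
    fin_cases j
    exacts [Or.inl this, Or.inr this]
  · exact Or.inl h

theorem tendsto_conj_halfPlane (s : Bool) (ξ : ℝ) :
    Tendsto (fun u : ℂ => conj u) (𝓝[halfPlane s] (ξ : ℂ)) (𝓝[halfPlane (!s)] (ξ : ℂ)) := by
  refine tendsto_nhdsWithin_iff.2 ⟨?_, ?_⟩
  · have := Complex.continuous_conj.tendsto (ξ : ℂ)
    rw [Complex.conj_ofReal] at this
    exact this.mono_left nhdsWithin_le_nhds
  · filter_upwards [self_mem_nhdsWithin] with u hu
    cases s
    · have h1 : u.im < 0 := hu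
      change 0 < (conj u).im
      simpa using h1
    · have h1 : 0 < u.im := hu
      change (conj u).im < 0
      simpa using h1

end unique

namespace Data

variable {P : Data}

variable (P) in
/-- A solution of the homogeneous Schwarz problem. -/
structure IsHomogeneous (U : ℂ → ℂ) : Prop where
  analytic : DifferentiableOn ℂ U P.punctured
  boundary : ∀ j, ∃ g : Bool → ℝ → ℂ, HasSides P.k j U g ∧
    ∀ s, ∀ ξ ∈ Ioo (lo P.k j) (hi P.k j), (g s ξ).re = 0
  endpoints : ∀ j, ∀ e : ℝ, e = lo P.k j ∨ e = hi P.k j →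
    Tendsto (fun ζ => (ζ - e) * U ζ) (𝓝[slitDomain P.k] (e : ℂ)) (𝓝 0)
  pole : U =O[𝓝[≠] (P.zinf : ℂ)] fun _ => (1 : ℝ)
  infinity : U =O[cocompact ℂ] fun ζ => (‖ζ‖ ^ 2)⁻¹

variable (hk : P.k ∈ Ioo (0 : ℝ) 1) (hz : P.zinf ∈ Ioo (-1 : ℝ) 1)

variable (P) in
/-- The ends of the slits and `ζ_∞`. -/
def exceptional : Set ℂ :=
  {((lo P.k 0 : ℝ) : ℂ), ((hi P.k 0 : ℝ) : ℂ), ((lo P.k 1 : ℝ) : ℂ), ((hi P.k 1 : ℝ) : ℂ),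
    (P.zinf : ℂ)}

theorem mem_exceptional {ζ : ℂ} : ζ ∈ P.exceptional ↔
    (∃ j, ∃ e : ℝ, (e = lo P.k j ∨ e = hi P.k j) ∧ ζ = e) ∨ ζ = P.zinf := by
  simp only [exceptional, mem_insert_iff, mem_singleton_iff, Fin.exists_fin_two]
  constructor
  · rintro (h | h | h | h | h)
    exacts [Or.inl (Or.inl ⟨_, Or.inl rfl, h⟩), Or.inl (Or.inl ⟨_, Or.inr rfl, h⟩),
      Or.inl (Or.inr ⟨_, Or.inl rfl, h⟩), Or.inl (Or.inr ⟨_, Or.inr rfl, h⟩), Or.inr h]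
  · rintro ((⟨e, rfl | rfl, h⟩ | ⟨e, rfl | rfl, h⟩) | h) <;> tauto

include hk in
theorem end_notMem {j : Fin 2} {e : ℝ} (he : e = lo P.k j ∨ e = hi P.k j) :
    (e : ℂ) ∉ slitDomain P.k := by
  rw [ofReal_mem_slitDomain hk]
  have hle := (lo_lt_hi hk j).le
  intro h
  rcases he with rfl | rfl
  exacts [h j (left_mem_Icc.2 hle), h j (right_mem_Icc.2 hle)]

theorem slitDomain_mem_cocompact : slitDomain P.k ∈ cocompact ℂ := by
  filter_upwards [eventually_punctured_cocompact (P := P)] with ζ hζ using hζ.1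

include hk hz in
/-- Functions on the slit domain that extend continuously to the open slits. -/
theorem exists_eq_const {h : ℂ → ℂ} (hd : DifferentiableOn ℂ h P.punctured)
    (hl : ∀ j, ∀ ξ ∈ Ioo (lo P.k j) (hi P.k j), ∃ v, ∀ s,
      Tendsto h (𝓝[halfPlane s] (ξ : ℂ)) (𝓝 v))
    (he : ∀ j, ∀ e : ℝ, e = lo P.k j ∨ e = hi P.k j →
      Tendsto (fun ζ => (ζ - e) * h ζ) (𝓝[slitDomain P.k] (e : ℂ)) (𝓝 0))
    (hp : h =O[𝓝[≠] (P.zinf : ℂ)] fun _ => (1 : ℝ)) {M : ℝ}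
    (hb : ∀ᶠ ζ in cocompact ℂ, ‖h ζ‖ ≤ M) : ∃ C : ℂ, ∀ ζ ∈ P.punctured, h ζ = C := by
  have hz' := zinf_mem hk hz
  refine exists_eq_const_of_tendsto (T := P.exceptional) (M := M)
    ((isOpen_slitDomain hk).sdiff isClosed_singleton) (by simp [exceptional])
    (fun ζ hζ => Or.inl ⟨mem_slitDomain_of_im hk hζ, by rintro rfl; simp at hζ⟩) ?_ ?_ hd ?_ ?_
    eventually_punctured_cocompact hb
  · rw [disjoint_left]
    intro ζ h1 h2
    rcases mem_exceptional.1 h2 with ⟨j, e, h3, rfl⟩ | rfl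
    · exact end_notMem hk h3 h1.1
    · exact h1.2 rfl
  · intro t ht
    rcases mem_exceptional.1 ht with ⟨j, e, h3, rfl⟩ | rfl <;> simp
  · intro x hx
    have hx1 : x ∉ slitDomain P.k := fun h' => by
      by_cases hxz : x = P.zinf
      · exact hx (Or.inr (mem_exceptional.2 (Or.inr hxz)))
      · exact hx (Or.inl ⟨h', hxz⟩)
    have hx2 : ∃ j, ∃ ξ ∈ Icc (lo P.k j) (hi P.k j), (ξ : ℂ) = x := by
      rw [slitDomain, notMem_compl_iff] at hx1
      rcases hx1 with h' | h'
      exacts [⟨0, h'⟩, ⟨1, h'⟩]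
    obtain ⟨j, ξ, hξ, rfl⟩ := hx2
    have hne : ∀ e : ℝ, (e = lo P.k j ∨ e = hi P.k j) → ξ ≠ e := by
      rintro e he' rfl
      exact hx (Or.inr (mem_exceptional.2 (Or.inl ⟨j, _, he', rfl⟩)))
    have hξ' : ξ ∈ Ioo (lo P.k j) (hi P.k j) :=
      ⟨lt_of_le_of_ne hξ.1 (hne _ (Or.inl rfl)).symm, lt_of_le_of_ne hξ.2 (hne _ (Or.inr rfl))⟩
    obtain ⟨v, hv⟩ := hl j ξ hξ'
    exact ⟨v, (tendsto_slitDomain_of_sides hξ' hv).mono_left (nhdsWithin_mono _ fun ζ hζ => hζ.1)⟩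
  · intro t ht
    rcases mem_exceptional.1 ht with ⟨j, e, h3, rfl⟩ | rfl
    · exact (he j e h3).mono_left (nhdsWithin_mono _ fun ζ hζ => hζ.1)
    · have h1 : Tendsto (fun ζ : ℂ => ζ - P.zinf) (𝓝[≠] (P.zinf : ℂ)) (𝓝 0) := by
        have : Continuous fun ζ : ℂ => ζ - P.zinf := by fun_prop
        have h2 := this.tendsto (P.zinf : ℂ)
        rw [sub_self] at h2
        exact h2.mono_left nhdsWithin_le_nhds
      have h2 : (fun ζ : ℂ => (ζ - P.zinf) * h ζ) =O[𝓝[≠] (P.zinf : ℂ)] fun ζ => ζ - P.zinf := by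
        have := (isBigO_refl (fun ζ : ℂ => ζ - P.zinf) (𝓝[≠] (P.zinf : ℂ))).norm_right.mul hp
        simp only [mul_one] at this
        exact this.of_norm_right
      exact (h2.trans_tendsto h1).mono_left (nhdsWithin_mono _ fun ζ hζ => hζ.2)

include hk in
theorem conj_mem_punctured {ζ : ℂ} (h : ζ ∈ P.punctured) : conj ζ ∈ P.punctured := by
  refine ⟨conj_mem_slitDomain hk h.1, fun h' => h.2 ?_⟩
  have h' : conj ζ = P.zinf := h'
  have := congrArg conj h'
  rwa [Complex.conj_conj, Complex.conj_ofReal] at this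

include hk in
theorem norm_branch_le {ζ : ℂ} (h : ζ ∈ slitDomain P.k) (h1 : 1 / P.k ≤ ‖ζ‖) :
    ‖branch P.k ζ‖ ≤ 2 * ‖ζ‖ ^ 2 := by
  have h2 := one_lt_inv hk
  have hb := congrArg norm (branch_sq_of_mem hk h)
  rw [norm_pow, norm_mul] at hb
  have h3 : ‖ζ ^ 2 - 1‖ ≤ 2 * ‖ζ‖ ^ 2 := by
    refine (norm_sub_le _ _).trans ?_
    rw [norm_pow, norm_one]; nlinarith
  have h4 : ‖ζ ^ 2 - 1 / (P.k : ℂ) ^ 2‖ ≤ 2 * ‖ζ‖ ^ 2 := by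
    refine (norm_sub_le _ _).trans ?_
    have : ‖(1 / (P.k : ℂ) ^ 2)‖ = (1 / P.k) ^ 2 := by
      rw [norm_div, norm_one, norm_pow, Complex.norm_real, Real.norm_of_nonneg hk.1.le]
      rw [div_pow, one_pow]
    rw [this, norm_pow]; nlinarith
  refine (pow_le_pow_iff_left₀ (norm_nonneg _) (by positivity) two_ne_zero).1 ?_
  rw [hb, pow_two (2 * ‖ζ‖ ^ 2)]
  exact mul_le_mul h3 h4 (norm_nonneg _) (by positivity)

include hk in
theorem isBigO_branch (x : ℂ) : branch P.k =O[𝓝[slitDomain P.k] x] fun _ => (1 : ℝ) := by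
  have hc : Continuous fun ζ : ℂ => (ζ ^ 2 - 1) * (ζ ^ 2 - 1 / (P.k : ℂ) ^ 2) := by fun_prop
  have h1 := (hc.tendsto x).isBigO_one ℝ
  have h2 : (fun ζ => branch P.k ζ ^ 2) =O[𝓝[slitDomain P.k] x] fun _ => (1 : ℝ) ^ 2 := by
    simp only [one_pow]
    refine (h1.mono nhdsWithin_le_nhds).congr' ?_ EventuallyEq.rfl
    filter_upwards [self_mem_nhdsWithin] with ζ hζ
    exact (branch_sq_of_mem hk hζ).symm
  exact h2.of_pow two_ne_zero

-- Reflection: let `U*(ζ) = conj (U (conj ζ))`. Since `Re U = 0` on the slits, `U - U*` has equal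
-- boundary values on the two sides and `U + U*` has opposite ones, so `(U + U*) · branch` has equal
-- ones as well. By Liouville both are constant, the first one zero because of its decay at
-- infinity.
include hk hz in
theorem IsHomogeneous.exists_eq {U : ℂ → ℂ} (hU : P.IsHomogeneous U) :
    ∃ C : ℝ, ∀ ζ ∈ P.punctured, U ζ = C / branch P.k ζ := by
  have hopen : IsOpen P.punctured := (isOpen_slitDomain hk).sdiff isClosed_singleton
  set Uc : ℂ → ℂ := fun ζ => conj (U (conj ζ)) with hUc
  have hconj : ∀ x : ℝ, Tendsto (fun ζ : ℂ => conj ζ) (𝓝 (x : ℂ)) (𝓝 (x : ℂ)) := fun x => by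
    have := Complex.continuous_conj.tendsto (x : ℂ)
    rwa [Complex.conj_ofReal] at this
  have hconjS : ∀ x : ℝ, Tendsto (fun ζ : ℂ => conj ζ) (𝓝[slitDomain P.k] (x : ℂ))
      (𝓝[slitDomain P.k] (x : ℂ)) := fun x => by
    refine tendsto_nhdsWithin_iff.2 ⟨(hconj x).mono_left nhdsWithin_le_nhds, ?_⟩
    filter_upwards [self_mem_nhdsWithin] with ζ hζ
    exact conj_mem_slitDomain hk hζ
  have hUcd : DifferentiableOn ℂ Uc P.punctured := fun ζ hζ => by
    have h1 := hU.analytic.differentiableAt (hopen.mem_nhds (conj_mem_punctured hk hζ))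
    have h2 := h1.conj_conj
    rw [Complex.conj_conj] at h2
    exact h2.differentiableWithinAt
  have hUcs : ∀ j, ∀ g : Bool → ℝ → ℂ, HasSides P.k j U g →
      (∀ s, ∀ ξ ∈ Ioo (lo P.k j) (hi P.k j), (g s ξ).re = 0) →
      HasSides P.k j Uc fun s ξ => -g (!s) ξ := by
    intro j g hg hre s ξ hξ
    have h1 := (Complex.continuous_conj.tendsto _).comp
      ((hg (!s) ξ hξ).comp (tendsto_conj_halfPlane s ξ))
    have h2 : conj (g (!s) ξ) = -g (!s) ξ :=
      Complex.ext (by simp [hre (!s) ξ hξ]) (by simp)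
    rw [h2] at h1
    exact h1
  have hUce : ∀ j, ∀ e : ℝ, e = lo P.k j ∨ e = hi P.k j →
      Tendsto (fun ζ => (ζ - e) * Uc ζ) (𝓝[slitDomain P.k] (e : ℂ)) (𝓝 0) := by
    intro j e he
    have h1 := (Complex.continuous_conj.tendsto _).comp ((hU.endpoints j e he).comp (hconjS e))
    rw [map_zero] at h1
    refine h1.congr fun ζ => ?_
    simp [hUc, Function.comp]
  have hUcp : Uc =O[𝓝[≠] (P.zinf : ℂ)] fun _ => (1 : ℝ) := by
    have h1 : Tendsto (fun ζ : ℂ => conj ζ) (𝓝[≠] (P.zinf : ℂ)) (𝓝[≠] (P.zinf : ℂ)) := by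
      refine tendsto_nhdsWithin_iff.2 ⟨(hconj _).mono_left nhdsWithin_le_nhds, ?_⟩
      filter_upwards [self_mem_nhdsWithin] with ζ hζ h'
      have := congrArg conj (show conj ζ = P.zinf from h')
      rw [Complex.conj_conj, Complex.conj_ofReal] at this
      exact hζ this
    have h2 := (hU.pole.comp_tendsto h1).norm_left
    refine IsBigO.of_norm_left (h2.congr_left fun ζ => ?_)
    simp [hUc]
  have hUci : Uc =O[cocompact ℂ] fun ζ => (‖ζ‖ ^ 2)⁻¹ := by
    have h1 : Tendsto (fun ζ : ℂ => conj ζ) (cocompact ℂ) (cocompact ℂ) :=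
      Complex.conjLIE.toHomeomorph.isClosedEmbedding.tendsto_cocompact
    have h2 := (hU.infinity.comp_tendsto h1).norm_left
    refine IsBigO.of_norm_left (h2.congr (fun ζ => ?_) fun ζ => ?_)
    · simp [hUc]
    · simp
  have hinf : ∀ V : ℂ → ℂ, V =O[cocompact ℂ] (fun ζ => (‖ζ‖ ^ 2)⁻¹) →
      Tendsto V (cocompact ℂ) (𝓝 0) := by
    intro V hV
    refine hV.trans_tendsto ?_
    have h1 := (tendsto_norm_cocompact_atTop (E := ℂ))
    exact tendsto_inv_atTop_zero.comp ((tendsto_pow_atTop two_ne_zero).comp h1)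
  -- the symmetric part
  have hW : ∀ ζ ∈ P.punctured, U ζ - Uc ζ = 0 := by
    have hW0 : Tendsto (fun ζ => U ζ - Uc ζ) (cocompact ℂ) (𝓝 0) := by
      have := (hinf _ hU.infinity).sub (hinf _ hUci)
      rwa [sub_zero] at this
    obtain ⟨C, hC⟩ := exists_eq_const hk hz (h := fun ζ => U ζ - Uc ζ) (M := 1)
      (hU.analytic.sub hUcd) (fun j ξ hξ => by
        obtain ⟨g, hg, hre⟩ := hU.boundary j
        refine ⟨g true ξ + g false ξ, fun s => ?_⟩
        have h1 := (hg s ξ hξ).sub (hUcs j g hg hre s ξ hξ)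
        cases s
        · simp only [Bool.not_false, sub_neg_eq_add] at h1
          rwa [add_comm] at h1
        · simpa using h1)
      (fun j e he => by
        have := (hU.endpoints j e he).sub (hUce j e he)
        rw [sub_zero] at this
        refine this.congr fun ζ => ?_
        ring)
      (hU.pole.sub hUcp) (by
        filter_upwards [hW0.norm.eventually (gt_mem_nhds (show ‖(0 : ℂ)‖ < 1 by simp))] with ζ hζ
        exact hζ.le)
    have hC0 : C = 0 := by
      refine tendsto_nhds_unique ?_ hW0
      refine tendsto_const_nhds.congr' ?_
      filter_upwards [eventually_punctured_cocompact] with ζ hζ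
      exact (hC ζ hζ).symm
    intro ζ hζ
    rw [← hC0]; exact hC ζ hζ
  -- the antisymmetric part
  have hzb : branch P.k =O[𝓝[≠] (P.zinf : ℂ)] fun _ => (1 : ℝ) :=
    (((differentiableAt_branch hk (zinf_mem hk hz)).continuousAt.tendsto.isBigO_one ℝ).mono
      nhdsWithin_le_nhds)
  have hsum := hU.infinity.add hUci
  obtain ⟨K, hK⟩ := hsum.bound
  obtain ⟨C, hC⟩ := exists_eq_const hk hz (h := fun ζ => (U ζ + Uc ζ) * branch P.k ζ)
    (M := K * 2)
    ((hU.analytic.add hUcd).mul fun ζ hζ =>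
      (differentiableAt_branch hk hζ.1).differentiableWithinAt)
    (fun j ξ hξ => by
      obtain ⟨g, hg, hre⟩ := hU.boundary j
      refine ⟨(g true ξ - g false ξ) * branchSide P.k j true ξ, fun s => ?_⟩
      have h1 := ((hg s ξ hξ).add (hUcs j g hg hre s ξ hξ)).mul
        (tendsto_branch hk j s (Ioo_subset_Icc_self hξ))
      cases s
      · have h2 := branchSide_not (k := P.k) j true ξ
        simp only [Bool.not_true] at h2
        rw [h2] at h1
        simp only [Bool.not_false] at h1
        convert h1 using 2
        ring
      · simpa [sub_eq_add_neg] using h1)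
    (fun j e he => by
      have h1 := (hU.endpoints j e he).add (hUce j e he)
      rw [add_zero] at h1
      have h2 : (fun ζ => ((ζ - e) * U ζ + (ζ - e) * Uc ζ) * branch P.k ζ)
          =O[𝓝[slitDomain P.k] (e : ℂ)] fun ζ => ((ζ - e) * U ζ + (ζ - e) * Uc ζ) := by
        have := (isBigO_refl (fun ζ => (ζ - e) * U ζ + (ζ - e) * Uc ζ)
          (𝓝[slitDomain P.k] (e : ℂ))).norm_right.mul (isBigO_branch hk (e : ℂ))
        simp only [mul_one] at this
        exact this.of_norm_right
      refine (h2.trans_tendsto h1).congr fun ζ => ?_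
      ring)
    (by simpa using (hU.pole.add hUcp).mul hzb)
    (by
      have hfar : ∀ᶠ ζ : ℂ in cocompact ℂ, 1 / P.k ≤ ‖ζ‖ :=
        tendsto_norm_cocompact_atTop.eventually_ge_atTop _
      filter_upwards [hK, hfar, slitDomain_mem_cocompact (P := P)] with ζ h1 h2 h3
      have h4 : 0 < ‖ζ‖ := lt_of_lt_of_le (by linarith [one_lt_inv hk]) h2
      rw [Real.norm_of_nonneg (by positivity)] at h1
      have hK0 : 0 ≤ K * (‖ζ‖ ^ 2)⁻¹ := (norm_nonneg _).trans h1
      calc ‖(U ζ + Uc ζ) * branch P.k ζ‖ = ‖U ζ + Uc ζ‖ * ‖branch P.k ζ‖ := norm_mul _ _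
        _ ≤ (K * (‖ζ‖ ^ 2)⁻¹) * (2 * ‖ζ‖ ^ 2) :=
          mul_le_mul h1 (norm_branch_le hk h3 h2) (norm_nonneg _) hK0
        _ = K * 2 := by field_simp)
  have hUeq : ∀ ζ ∈ P.punctured, U ζ = (C / 2) / branch P.k ζ := by
    intro ζ hζ
    have h1 := hC ζ hζ
    have h2 := hW ζ hζ
    have h3 := branch_ne_zero hk hζ.1
    rw [eq_div_iff h3, ← h1]
    linear_combination (branch P.k ζ / 2) * h2
  -- `U + U*` and `branch` are both symmetric under conjugation, so the constant is real.
  have hCr : conj C = C := by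
    obtain ⟨ζ, hζ⟩ : P.punctured.Nonempty := by
      obtain ⟨ζ, hζ⟩ := (eventually_punctured_cocompact (P := P)).exists
      exact ⟨ζ, hζ⟩
    have h1 := hC ζ hζ
    have h2 := hC _ (conj_mem_punctured hk hζ)
    have h3 := congrArg conj h1
    simp only [hUc, map_mul, map_add, Complex.conj_conj] at h3 h2
    rw [branch_conj hk hζ.1] at h2
    rw [← h3, ← h2]; ring
  obtain ⟨r, hr⟩ := Complex.conj_eq_iff_real.1 hCr
  refine ⟨r / 2, fun ζ hζ => ?_⟩
  rw [hUeq ζ hζ, hr]; push_cast; ring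

include hk in
theorem IsSchwarz.tendsto_endpoint {part : ℂ → ℝ} {m : ℂ} {F : ℂ → ℂ} (hF : P.IsSchwarz part m F)
    {j : Fin 2} {e : ℝ} (he : e = lo P.k j ∨ e = hi P.k j) :
    Tendsto (fun ζ => (ζ - e) * F ζ) (𝓝[slitDomain P.k] (e : ℂ)) (𝓝 0) := by
  obtain ⟨C, μ, hμ, hev⟩ := hF.endpoints j e he
  have h1 : Tendsto (fun ζ : ℂ => C * ‖ζ - e‖ ^ (1 - μ)) (𝓝[slitDomain P.k] (e : ℂ)) (𝓝 0) := by
    have h2 : Tendsto (fun ζ : ℂ => ‖ζ - e‖) (𝓝[slitDomain P.k] (e : ℂ)) (𝓝 0) := by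
      have : Continuous fun ζ : ℂ => ‖ζ - e‖ := by fun_prop
      have h2 := this.tendsto (e : ℂ)
      rw [sub_self, norm_zero] at h2
      exact h2.mono_left nhdsWithin_le_nhds
    have h3 := (h2.rpow_const (p := 1 - μ) (Or.inr (by linarith))).const_mul C
    rwa [Real.zero_rpow (by linarith), mul_zero] at h3
  refine squeeze_zero_norm' ?_ h1
  filter_upwards [hev, self_mem_nhdsWithin] with ζ h2 h3
  have hne : 0 < ‖ζ - e‖ := by
    rw [norm_pos_iff, sub_ne_zero]; rintro rfl
    exact end_notMem hk he h3
  rw [norm_mul]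
  calc ‖ζ - e‖ * ‖F ζ‖ ≤ ‖ζ - e‖ * (C * ‖ζ - e‖ ^ (-μ)) := by gcongr
    _ = C * (‖ζ - e‖ ^ (1 : ℝ) * ‖ζ - e‖ ^ (-μ)) := by rw [Real.rpow_one]; ring
    _ = C * ‖ζ - e‖ ^ (1 - μ) := by rw [← Real.rpow_add hne, ← sub_eq_add_neg]

include hk in
/-- The difference of two solutions of a Schwarz problem. -/
theorem IsSchwarz.sub_homogeneous {part : ℂ → ℝ} {m κ : ℂ} {F F₀ : ℂ → ℂ}
    (hpart : ∀ x y, part x = 0 → part y = 0 → (κ * (x - y)).re = 0)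
    (hF : P.IsSchwarz part m F) (hF₀ : P.IsSchwarz part m F₀) :
    P.IsHomogeneous fun ζ => κ * (F ζ - F₀ ζ) where
  analytic := (hF.analytic.sub hF₀.analytic).const_mul κ
  boundary j := by
    obtain ⟨g, hg, hg0⟩ := hF.boundary j
    obtain ⟨g', hg', hg0'⟩ := hF₀.boundary j
    exact ⟨fun s ξ => κ * (g s ξ - g' s ξ), fun s ξ hξ =>
      ((hg s ξ hξ).sub (hg' s ξ hξ)).const_mul κ, fun s ξ hξ =>
      hpart _ _ (hg0 s ξ hξ) (hg0' s ξ hξ)⟩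
  endpoints j e he := by
    have := ((hF.tendsto_endpoint hk he).sub (hF₀.tendsto_endpoint hk he)).const_mul κ
    rw [sub_zero, mul_zero] at this
    refine this.congr fun ζ => ?_
    ring
  pole := by
    refine ((hF.pole.sub hF₀.pole).const_mul_left κ).congr_left fun ζ => ?_
    ring
  infinity := (hF.infinity.sub hF₀.infinity).const_mul_left κ

-- The differences of two solutions are `C₁ / f` for `F₊` and, after multiplication by `i`, `C₂ / f`
-- for `F₋`, with real constants. So `F₊ - F₋` changes by `(C₁ + iC₂) / f`, whose integral over the
-- loop `l₁` is a nonzero multiple of `C₁ + iC₂`. One loop suffices.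
include hk hz in
theorem schwarzPair_unique {Fp Fm : ℂ → ℂ} (h : P.IsSchwarzPair Fp Fm) :
    EqOn Fp P.Fplus P.punctured ∧ EqOn Fm P.Fminus P.punctured := by
  have h0 := isSchwarzPair hk hz
  obtain ⟨C₁, h1⟩ := (h.plus.sub_homogeneous (κ := 1) hk (fun x y hx hy => by
    simp [hx, hy]) h0.plus).exists_eq hk hz
  obtain ⟨C₂, h2⟩ := (h.minus.sub_homogeneous (κ := Complex.I) hk (fun x y hx hy => by
    simp [hx, hy]) h0.minus).exists_eq hk hz
  have hdiff : ∀ ζ ∈ P.punctured, (Fp ζ - Fm ζ) - (P.Fplus ζ - P.Fminus ζ) =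
      (C₁ + Complex.I * C₂) / branch P.k ζ := by
    intro ζ hζ
    have e1 := h1 ζ hζ
    have e2 := h2 ζ hζ
    rw [add_div, mul_div_assoc, ← e1, ← e2]
    linear_combination (-(Fm ζ - P.Fminus ζ)) * Complex.I_mul_I
  obtain ⟨g, hg, hgi, hg0⟩ := h.loops 1
  obtain ⟨g', hg', hgi', hg0'⟩ := h0.loops 1
  have hside : ∀ s, ∀ ξ ∈ Ioo (lo P.k 1) (hi P.k 1),
      g s ξ - g' s ξ = (C₁ + Complex.I * C₂) / branchSide P.k 1 s ξ := by
    intro s ξ hξ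
    have hnb := halfPlane_neBot s ξ
    have e1 := (hg s ξ hξ).sub (hg' s ξ hξ)
    have e2 : Tendsto (fun ζ => (C₁ + Complex.I * C₂) / branch P.k ζ) (𝓝[halfPlane s] (ξ : ℂ))
        (𝓝 ((C₁ + Complex.I * C₂) / branchSide P.k 1 s ξ)) :=
      tendsto_const_nhds.div (tendsto_branch hk 1 s (Ioo_subset_Icc_self hξ))
        (branchSide_ne_zero hk 1 s hξ)
    refine tendsto_nhds_unique e1 (e2.congr' ?_)
    filter_upwards [self_mem_nhdsWithin] with ζ hζ
    have him : ζ.im ≠ 0 := by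
      cases s
      · exact (show ζ.im < 0 from hζ).ne
      · exact (show 0 < ζ.im from hζ).ne'
    exact (hdiff ζ ⟨mem_slitDomain_of_im hk him, by rintro rfl; simp at him⟩).symm
  have hle := (lo_lt_hi hk 1).le
  have hsplit : ∀ s, (∫ ξ in lo P.k 1..hi P.k 1, g s ξ) - (∫ ξ in lo P.k 1..hi P.k 1, g' s ξ) =
      (C₁ + Complex.I * C₂) * ((if s then 1 else -1) * -Complex.I) *
        ∫ ξ in lo P.k 1..hi P.k 1, ((1 / √|p2 P.k ξ| : ℝ) : ℂ) := by
    intro s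
    rw [← intervalIntegral.integral_sub (hgi s) (hgi' s), ← intervalIntegral.integral_const_mul,
      intervalIntegral.integral_of_le hle, intervalIntegral.integral_of_le hle,
      integral_Ioc_eq_integral_Ioo, integral_Ioc_eq_integral_Ioo]
    refine setIntegral_congr_fun measurableSet_Ioo fun ξ hξ => ?_
    have h3 : ((√|p2 P.k ξ| : ℝ) : ℂ) ≠ 0 := by exact_mod_cast (sqrt_abs_p2_pos hk 1 hξ).ne'
    rw [hside s ξ hξ, branchSide]
    cases s
    · simp only [slitSign]
      push_cast
      field_simp
      simp
    · simp only [slitSign]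
      push_cast
      field_simp
      simp
  have hI : ∫ ξ in lo P.k 1..hi P.k 1, ((1 / √|p2 P.k ξ| : ℝ) : ℂ) ≠ 0 := by
    rw [intervalIntegral.integral_ofReal]
    have : 0 < ∫ ξ in lo P.k 1..hi P.k 1, 1 / √|p2 P.k ξ| :=
      intervalIntegral.intervalIntegral_pos_of_pos_on
        (intervalIntegrable_div_sqrt_p2 hk 1 continuousOn_const)
        (fun ξ hξ => one_div_pos.2 (sqrt_abs_p2_pos hk 1 hξ)) (lo_lt_hi hk 1)
    exact_mod_cast this.ne'
  have hC : (C₁ + Complex.I * C₂ : ℂ) = 0 := by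
    have e1 := hsplit true
    have e2 := hsplit false
    simp only [if_true, Bool.false_eq_true, if_false] at e1 e2
    have e3 : (C₁ + Complex.I * C₂) * Complex.I *
        (∫ ξ in lo P.k 1..hi P.k 1, ((1 / √|p2 P.k ξ| : ℝ) : ℂ)) = 0 := by
      linear_combination (1 / 2 : ℂ) * e1 - (1 / 2 : ℂ) * e2 - (1 / 2 : ℂ) * hg0 +
        (1 / 2 : ℂ) * hg0'
    have e4 := (mul_eq_zero.1 e3).resolve_right hI
    exact (mul_eq_zero.1 e4).resolve_right Complex.I_ne_zero
  have hC1 : C₁ = 0 := by simpa using congrArg Complex.re hC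
  have hC2 : C₂ = 0 := by simpa using congrArg Complex.im hC
  refine ⟨fun ζ hζ => ?_, fun ζ hζ => ?_⟩
  · have := h1 ζ hζ
    rw [hC1, Complex.ofReal_zero, zero_div, one_mul, sub_eq_zero] at this
    exact this
  · have := h2 ζ hζ
    rw [hC2, Complex.ofReal_zero, zero_div, mul_eq_zero, sub_eq_zero] at this
    exact this.resolve_left Complex.I_ne_zero

end Data

open Polynomial in
theorem meromorphicOrderAt_eval {Q : ℂ[X]} (hQ : Q ≠ 0) (a : ℂ) :
    meromorphicOrderAt (fun ζ => Q.eval ζ) a = (Q.rootMultiplicity a : ℤ) := by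
  have han : ∀ q : ℂ[X], AnalyticAt ℂ (fun ζ => q.eval ζ) a := fun q =>
    q.differentiable.analyticAt a
  obtain ⟨q, hq, hnd⟩ := Polynomial.exists_eq_pow_rootMultiplicity_mul_and_not_dvd Q hQ a
  rw [meromorphicOrderAt_eq_int_iff (han Q).meromorphicAt]
  refine ⟨fun ζ => q.eval ζ, han q, fun h => hnd (dvd_iff_isRoot.2 h), Eventually.of_forall
    fun ζ => ?_⟩
  have := congrArg (eval ζ) hq
  simp only [eval_mul, eval_pow, eval_sub, eval_X, eval_C] at this
  rw [this, zpow_natCast, smul_eq_mul]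

theorem meromorphicOrderAt_eq_zero_of_ne {f : ℂ → ℂ} {x : ℂ} (hf : AnalyticAt ℂ f x)
    (h : f x ≠ 0) : meromorphicOrderAt f x = 0 := by
  rw [hf.meromorphicOrderAt_eq, hf.analyticOrderAt_eq_zero.2 h]; rfl

namespace Data

variable {P : Data}

/-! ### Poles of `ψ` and zeros of `ω'` -/

/-- A local statement in a coordinate in which `G` becomes `g`; it serves finite points and infinity
alike. Numerator and denominator of `ψ` have no common zero: such a zero gives `(|mb|² - |na|²)(1 +
g) = 0`, while a zero of the denominator with `re g < 0` requires `‖na‖ < ‖mb‖`, and `g = -1` is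
excluded by `na ≠ 0`. -/
theorem order_aux (hc : P.c ≠ 0) (ha : P.a ≠ 0) {g ω ψ κ : ℂ → ℂ} {x : ℂ}
    (hg : AnalyticAt ℂ g x) (hlt : (g x).re < 0) (hκ : AnalyticAt ℂ κ x) (hκ0 : κ x ≠ 0)
    (hω : ω =ᶠ[𝓝[≠] x] fun t => κ t * (P.mb * (1 + g t) - P.na * (1 - g t)))
    (hψ : ψ =ᶠ[𝓝[≠] x] fun t => conj P.a * (conj P.na * (1 + g t) - conj P.mb * (1 - g t)) /
      (P.mb * (1 + g t) - P.na * (1 - g t))) :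
    MeromorphicAt ω x ∧ MeromorphicAt ψ x ∧
      meromorphicOrderAt ω x = meromorphicOrderAt
        (fun t => P.mb * (1 + g t) - P.na * (1 - g t)) x ∧
      (-(meromorphicOrderAt ψ x).untop₀).toNat = (meromorphicOrderAt ω x).untop₀.toNat := by
  have ha' : conj P.a ≠ 0 := (map_ne_zero _).2 ha
  set d : ℂ → ℂ := fun t => P.mb * (1 + g t) - P.na * (1 - g t) with hd
  set n : ℂ → ℂ := fun t => conj P.a * (conj P.na * (1 + g t) - conj P.mb * (1 - g t)) with hn
  have hda : AnalyticAt ℂ d x := by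
    exact (analyticAt_const.mul (analyticAt_const.add hg)).sub
      (analyticAt_const.mul (analyticAt_const.sub hg))
  have hna : AnalyticAt ℂ n x := by
    exact analyticAt_const.mul ((analyticAt_const.mul (analyticAt_const.add hg)).sub
      (analyticAt_const.mul (analyticAt_const.sub hg)))
  have hωo : meromorphicOrderAt ω x = meromorphicOrderAt d x := by
    rw [meromorphicOrderAt_congr hω]
    exact meromorphicOrderAt_mul_of_ne_zero (f := d) hκ hκ0
  have hψm : MeromorphicAt ψ x := (hna.meromorphicAt.div hda.meromorphicAt).congr hψ.symm
  refine ⟨(hκ.mul hda).meromorphicAt.congr hω.symm, hψm, hωo, ?_⟩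
  rw [hωo]
  by_cases h0 : d x = 0
  · have h1 := norm_na_lt (na_ne_zero hc ha) hlt h0
    have hnx : n x ≠ 0 := by
      intro h2
      have h3 : conj P.a * P.mb * (conj P.na * (1 + g x) - conj P.mb * (1 - g x)) = 0 := by
        linear_combination P.mb * h2
      have h4 : (1 + g x) ≠ 0 := by
        intro h5
        have h6 : g x = -1 := by linear_combination h5
        have h7 : d x = 0 := h0
        rw [hd] at h7
        simp only [h6] at h7
        have : P.na = 0 := by linear_combination (-1 / 2 : ℂ) * h7
        exact na_ne_zero hc ha this
      have h5 := (mul_eq_zero.1 h2).resolve_left ha'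
      have h8 : (P.mb * conj P.mb - P.na * conj P.na) * (1 + g x) = 0 := by
        have h9 : P.mb * (1 + g x) - P.na * (1 - g x) = 0 := h0
        linear_combination (conj P.mb) * h9 - P.na * h5
      have h9 := (mul_eq_zero.1 h8).resolve_right h4
      rw [Complex.mul_conj, Complex.mul_conj, Complex.normSq_eq_norm_sq,
        Complex.normSq_eq_norm_sq, ← Complex.ofReal_sub] at h9
      have h10 : ‖P.mb‖ ^ 2 - ‖P.na‖ ^ 2 = 0 := by exact_mod_cast h9
      nlinarith [norm_nonneg P.na]
    have h2 : meromorphicOrderAt ψ x = -meromorphicOrderAt d x := by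
      rw [meromorphicOrderAt_congr hψ]
      have h3 : (fun t => n t / d t) = n * d⁻¹ := by
        funext t; simp [div_eq_mul_inv]
      rw [h3, meromorphicOrderAt_mul_of_ne_zero hna hnx, meromorphicOrderAt_inv]
    rw [h2, WithTop.untop₀_neg, neg_neg]
  · have h1 : 0 ≤ meromorphicOrderAt ψ x := by
      rw [meromorphicOrderAt_congr hψ]
      exact (hna.div hda h0).meromorphicOrderAt_nonneg
    rw [meromorphicOrderAt_eq_zero_of_ne hda h0]
    have h2 : 0 ≤ (meromorphicOrderAt ψ x).untop₀ := by
      cases h : meromorphicOrderAt ψ x with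
      | top => simp
      | coe m => rw [h] at h1; simpa using h1
    simp [h2]

variable (hk : P.k ∈ Ioo (0 : ℝ) 1) (hz : P.zinf ∈ Ioo (-1 : ℝ) 1)

include hk hz in
theorem psi_eq_div (ha : P.a ≠ 0) {ζ : ℂ} (hζ : ζ ≠ P.zinf) :
    P.psi ζ = conj P.a * (conj P.na * (1 + P.G ζ) - conj P.mb * (1 - P.G ζ)) / P.den ζ := by
  have ha' : conj P.a ≠ 0 := (map_ne_zero _).2 ha
  have h0 := sub_ne_zero.2 hζ
  rw [psi, Fplus_add_Fminus hk hz, omegaDeriv_den hk hz]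
  by_cases h : P.den ζ = 0
  · simp [h]
  · field_simp

include hk in
theorem analyticAt_G {ζ : ℂ} (h : ζ ∈ slitDomain P.k) : AnalyticAt ℂ P.G ζ :=
  DifferentiableOn.analyticAt (s := slitDomain P.k)
    (fun _ hw => (differentiableAt_G hk hw).differentiableWithinAt)
    ((isOpen_slitDomain hk).mem_nhds h)

include hk hz in
theorem order_punctured (hc : P.c ≠ 0) (ha : P.a ≠ 0) {ζ : ℂ} (h : ζ ∈ P.punctured) :
    MeromorphicAt P.omegaDeriv ζ ∧ MeromorphicAt P.psi ζ ∧
      meromorphicOrderAt P.omegaDeriv ζ = meromorphicOrderAt P.den ζ ∧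
      P.poleOrder ζ = P.zeroOrder ζ := by
  have h0 := sub_ne_zero.2 h.2
  have hne : 2 * conj P.a * (ζ - P.zinf) ^ 2 ≠ 0 := by simp [ha, h0]
  refine order_aux hc ha (κ := fun ζ => 1 / (2 * conj P.a * (ζ - P.zinf) ^ 2))
    (analyticAt_G hk h.1) (G_re_neg hk hz h.1) ?_ (one_div_ne_zero hne)
    (Eventually.of_forall fun t => omegaDeriv_den hk hz t) ?_
  · fun_prop (disch := exact hne)
  · filter_upwards [mem_nhdsWithin_of_mem_nhds (isClosed_singleton.isOpen_compl.mem_nhds h.2)]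
      with t ht
    exact psi_eq_div hk hz ha ht

include hk hz in
theorem order_zinf (hc : P.c ≠ 0) (ha : P.a ≠ 0) :
    MeromorphicAt P.omegaDeriv P.zinf ∧ MeromorphicAt P.psi P.zinf ∧
      P.poleOrder P.zinf = 0 ∧ P.zeroOrder P.zinf = 0 := by
  have hG := analyticAt_G hk (zinf_mem hk hz)
  have hd : AnalyticAt ℂ P.den P.zinf :=
    (analyticAt_const.mul (analyticAt_const.add hG)).sub
      (analyticAt_const.mul (analyticAt_const.sub hG))
  have hd0 : P.den P.zinf ≠ 0 := by
    rw [den, G_zinf hk hz]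
    have := na_ne_zero hc ha
    simp only [add_neg_cancel, mul_zero, zero_sub, sub_neg_eq_add]
    exact neg_ne_zero.2 (mul_ne_zero this (by norm_num))
  have hn : AnalyticAt ℂ (fun ζ => conj P.a *
      (conj P.na * (1 + P.G ζ) - conj P.mb * (1 - P.G ζ))) P.zinf :=
    analyticAt_const.mul ((analyticAt_const.mul (analyticAt_const.add hG)).sub
      (analyticAt_const.mul (analyticAt_const.sub hG)))
  have hψ : P.psi =ᶠ[𝓝[≠] (P.zinf : ℂ)] fun ζ => conj P.a *
      (conj P.na * (1 + P.G ζ) - conj P.mb * (1 - P.G ζ)) / P.den ζ := by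
    filter_upwards [self_mem_nhdsWithin] with ζ hζ
    exact psi_eq_div hk hz ha hζ
  have hω : P.omegaDeriv =ᶠ[𝓝[≠] (P.zinf : ℂ)]
      fun ζ => (ζ - P.zinf) ^ (-2 : ℤ) • (1 / (2 * conj P.a) * P.den ζ) := by
    filter_upwards [self_mem_nhdsWithin] with ζ hζ
    rw [omegaDeriv_den hk hz, smul_eq_mul, zpow_neg]
    have : (ζ - P.zinf) ^ (2 : ℤ) = (ζ - P.zinf) ^ 2 := by norm_cast
    rw [this, mul_comm (2 * conj P.a), ← one_div, ← one_div_mul_one_div]; ring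
  have hg : AnalyticAt ℂ (fun ζ => 1 / (2 * conj P.a) * P.den ζ) P.zinf :=
    analyticAt_const.mul hd
  have hωm : MeromorphicAt P.omegaDeriv P.zinf := by
    refine MeromorphicAt.congr ?_ hω.symm
    have : MeromorphicAt (fun ζ : ℂ => ζ - P.zinf) (P.zinf : ℂ) := by
      have : AnalyticAt ℂ (fun ζ : ℂ => ζ - P.zinf) (P.zinf : ℂ) := by fun_prop
      exact this.meromorphicAt
    exact (this.zpow _).smul hg.meromorphicAt
  refine ⟨hωm, (hn.meromorphicAt.div hd.meromorphicAt).congr hψ.symm, ?_, ?_⟩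
  · have h1 : 0 ≤ meromorphicOrderAt P.psi P.zinf := by
      rw [meromorphicOrderAt_congr hψ]
      exact (hn.div hd hd0).meromorphicOrderAt_nonneg
    have h2 : 0 ≤ (meromorphicOrderAt P.psi P.zinf).untop₀ := by
      cases h : meromorphicOrderAt P.psi P.zinf with
      | top => simp
      | coe m => rw [h] at h1; simpa using h1
    simp [poleOrder, h2]
  -- The order `-2` is truncated to zero by `toNat`, so the pole of `ω'` does not contribute to the
  -- count.
  · have h1 : meromorphicOrderAt P.omegaDeriv P.zinf = ((-2 : ℤ) : WithTop ℤ) := by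
      rw [meromorphicOrderAt_eq_int_iff hωm]
      exact ⟨_, hg, mul_ne_zero (one_div_ne_zero (by simp [ha])) hd0, hω⟩
    rw [zeroOrder, h1]; rfl

variable (P) in
/-- The function `G` in the local coordinate at infinity. -/
def Ghat (t : ℂ) : ℂ := -(inverseSlits hk hz).g (t / (1 - P.zinf * t))

theorem Ghat_zero : P.Ghat hk hz 0 = P.Ginf hk hz := by simp [Ghat, Ginf]

theorem analyticAt_Ghat : AnalyticAt ℂ (P.Ghat hk hz) 0 := by
  have h1 : AnalyticAt ℂ (inverseSlits hk hz).g 0 :=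
    DifferentiableOn.analyticAt (s := (inverseSlits hk hz).slitsᶜ)
      (fun _ hw => ((inverseSlits hk hz).differentiableAt_g hw).differentiableWithinAt)
      ((inverseSlits hk hz).isClosed_slits.isOpen_compl.mem_nhds
        (inverseSlits hk hz).zero_notMem_slits)
  have h2 : AnalyticAt ℂ (fun t : ℂ => t / (1 - P.zinf * t)) 0 := by
    fun_prop (disch := simp)
  exact (AnalyticAt.fun_comp (by simpa using h1) h2).neg

theorem eventually_inv_punctured : ∀ᶠ t : ℂ in 𝓝[≠] 0, t⁻¹ ∈ P.punctured := by
  have h1 := eventually_punctured_cocompact (P := P)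
  rw [← Metric.cobounded_eq_cocompact] at h1
  exact tendsto_inv₀_nhdsNE_zero.eventually h1

theorem eventually_Ghat : ∀ᶠ t : ℂ in 𝓝[≠] 0, P.G t⁻¹ = P.Ghat hk hz t := by
  filter_upwards [eventually_inv_punctured (P := P), self_mem_nhdsWithin] with t h1 h2
  have h2 : t ≠ 0 := h2
  rw [G_eq hk hz h1, Ghat]
  have h3 : 1 / (t⁻¹ - P.zinf) = t / (1 - P.zinf * t) := by
    have h4 : t⁻¹ - P.zinf ≠ 0 := sub_ne_zero.2 h1.2
    have h5 : 1 - P.zinf * t ≠ 0 := by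
      intro h; apply h4
      field_simp; linear_combination h
    rw [div_eq_div_iff h4 h5]
    field_simp
  rw [h3]

/-- The factor `t⁻²` of the change of coordinate turns `(t⁻¹ - ζ_∞)⁻²` into `(1 - ζ_∞ t)⁻²`, which
does not vanish at `t = 0`; what is left is `den` in the new coordinate. -/
theorem order_infinity (hc : P.c ≠ 0) (ha : P.a ≠ 0) :
    meromorphicOrderAt (fun t : ℂ => -P.omegaDeriv t⁻¹ / t ^ 2) 0 = meromorphicOrderAt
        (fun t => P.mb * (1 + P.Ghat hk hz t) - P.na * (1 - P.Ghat hk hz t)) 0 ∧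
      P.poleOrderInf = P.zeroOrderInf := by
  have h := order_aux (P := P) hc ha (ω := fun t : ℂ => -P.omegaDeriv t⁻¹ / t ^ 2)
    (ψ := fun t : ℂ => P.psi t⁻¹)
    (κ := fun t => -(1 / (2 * conj P.a * (1 - P.zinf * t) ^ 2)))
    (analyticAt_Ghat hk hz) (by rw [Ghat_zero]; exact Ginf_re_neg hk hz)
    (by fun_prop (disch := simp [ha])) (by simp [ha]) ?_ ?_
  · exact ⟨h.2.2.1, h.2.2.2⟩
  · filter_upwards [eventually_Ghat hk hz, self_mem_nhdsWithin] with t h1 h2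
    have h2 : t ≠ 0 := h2
    rw [omegaDeriv_den hk hz, den, h1]
    have h3 : 1 / (2 * conj P.a * (t⁻¹ - P.zinf) ^ 2) / t ^ 2 =
        1 / (2 * conj P.a * (1 - P.zinf * t) ^ 2) := by
      rw [div_div]; congr 1
      field_simp
    rw [← h3]; ring
  · filter_upwards [eventually_Ghat hk hz, eventually_inv_punctured (P := P)] with t h1 h2
    rw [psi_eq_div hk hz ha h2.2, den, h1]

/-! ### The numbers of zeros -/

include hk hz in
theorem zeroOrder_of_gam_le_one (hc : P.c ≠ 0) (ha : P.a ≠ 0) (hg : P.gam ≤ 1) {ζ : ℂ}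
    (h : ζ ∈ slitDomain P.k) : P.zeroOrder ζ = 0 := by
  by_cases hζ : ζ = P.zinf
  · rw [hζ]; exact (order_zinf hk hz hc ha).2.2.2
  · have hG := analyticAt_G hk h
    have hd : AnalyticAt ℂ P.den ζ :=
      (analyticAt_const.mul (analyticAt_const.add hG)).sub
        (analyticAt_const.mul (analyticAt_const.sub hG))
    rw [zeroOrder, (order_punctured hk hz hc ha ⟨h, hζ⟩).2.2.1,
      meromorphicOrderAt_eq_zero_of_ne hd (den_ne_zero hk hz hc ha hg h)]
    rfl

include hk hz in
theorem Z_of_gam_le_one (hc : P.c ≠ 0) (ha : P.a ≠ 0) (hg : P.gam ≤ 1) : P.Z = 0 := by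
  have h1 : P.zeroOrderInf = 0 := by
    have hG := analyticAt_Ghat hk hz
    have h0 : meromorphicOrderAt
        (fun t => P.mb * (1 + P.Ghat hk hz t) - P.na * (1 - P.Ghat hk hz t)) 0 = 0 := by
      refine meromorphicOrderAt_eq_zero_of_ne ((analyticAt_const.mul (analyticAt_const.add hG)).sub
        (analyticAt_const.mul (analyticAt_const.sub hG))) fun h => ?_
      rw [Ghat_zero] at h
      exact ((gam_le_one_iff hc ha).1 hg).not_gt
        (norm_na_lt (na_ne_zero hc ha) (Ginf_re_neg hk hz) h)
    rw [zeroOrderInf, (order_infinity hk hz hc ha).1, h0]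
    rfl
  rw [Z, h1, add_zero]
  exact finsum_mem_eq_zero_of_forall_eq_zero fun ζ hζ =>
    zeroOrder_of_gam_le_one hk hz hc ha hg hζ

variable (P) in
/-- The critical value of `G`. -/
def crit : ℂ := -((P.mb - P.na) / (P.mb + P.na))

theorem mb_add_na_ne_zero (h : ‖P.mb‖ ≠ ‖P.na‖) : P.mb + P.na ≠ 0 := fun h0 => by
  apply h
  rw [eq_neg_of_add_eq_zero_left h0, norm_neg]

/-- Multiply `crit = (na - mb) / (mb + na)` by the squared modulus of its denominator: the sign of
`re crit` is that of `1 - γ`. The product form also covers `mb + na = 0`. -/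
theorem crit_re : P.crit.re * Complex.normSq (P.mb + P.na) = ‖P.na‖ ^ 2 - ‖P.mb‖ ^ 2 := by
  by_cases h : P.mb + P.na = 0
  · rw [h, eq_neg_of_add_eq_zero_left h, norm_neg]; simp
  · have h1 : Complex.normSq (P.mb + P.na) ≠ 0 := by rwa [ne_eq, Complex.normSq_eq_zero]
    rw [crit, Complex.neg_re, Complex.div_re, ← Complex.normSq_eq_norm_sq,
      ← Complex.normSq_eq_norm_sq, Complex.normSq_apply P.na, Complex.normSq_apply P.mb]
    field_simp
    simp
    ring

theorem crit_re_neg (hc : P.c ≠ 0) (ha : P.a ≠ 0) (hg : 1 < P.gam) : P.crit.re < 0 := by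
  have h1 : ‖P.na‖ < ‖P.mb‖ := not_le.1 fun h => hg.not_ge ((gam_le_one_iff hc ha).2 h)
  have h2 := crit_re (P := P)
  have h3 : 0 < Complex.normSq (P.mb + P.na) := Complex.normSq_pos.2 (mb_add_na_ne_zero h1.ne')
  by_contra h
  nlinarith [mul_nonneg (not_lt.1 h) h3.le, norm_nonneg P.na]

theorem crit_re_pos (hc : P.c ≠ 0) (ha : P.a ≠ 0) (hg : P.gam < 1) : 0 < P.crit.re := by
  have h1 := (gam_lt_one_iff hc ha).1 hg
  have h2 := crit_re (P := P)
  have h3 : 0 < Complex.normSq (P.mb + P.na) := Complex.normSq_pos.2 (mb_add_na_ne_zero h1.ne)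
  by_contra h
  nlinarith [mul_nonneg (neg_nonneg.2 (not_lt.1 h)) h3.le, norm_nonneg P.mb]

theorem den_eq_crit (h : P.mb + P.na ≠ 0) (w : ℂ) :
    P.mb * (1 + w) - P.na * (1 - w) = (P.mb + P.na) * (w - P.crit) := by
  rw [crit]; field_simp; ring

open Polynomial in
variable (P) in
/-- The polynomial whose zeros are the zeros of `G² - v²`. -/
def zeroPoly (v : ℂ) : ℂ[X] :=
  C ((P.scale : ℂ) ^ 2) * (C (P.coef1 1 : ℂ) + C (P.coef2 1 : ℂ) * X + C (P.coef3 1 : ℂ) * X ^ 2) ^ 2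
    - C (v ^ 2) * ((X ^ 2 - C 1) * (X ^ 2 - C (1 / (P.k : ℂ) ^ 2)))

theorem eval_zeroPoly (v ζ : ℂ) : (P.zeroPoly v).eval ζ =
    P.scale ^ 2 * P.quad ζ ^ 2 - v ^ 2 * ((ζ ^ 2 - 1) * (ζ ^ 2 - 1 / (P.k : ℂ) ^ 2)) := by
  simp [zeroPoly, quad]

theorem natDegree_zeroPoly (v : ℂ) : (P.zeroPoly v).natDegree ≤ 4 := by
  rw [zeroPoly]; compute_degree

-- Squaring removes the root: `p₂ (G² - v²)` is a polynomial. For `re v < 0` the additional factor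
-- `G + v` has no zeros, since `re G < 0` too, so no spurious roots arise.
include hk in
theorem eval_zeroPoly_eq (v : ℂ) {ζ : ℂ} (h : ζ ∈ slitDomain P.k) : (P.zeroPoly v).eval ζ =
    (branch P.k ζ ^ 2 * (P.G ζ + v)) * (P.G ζ - v) := by
  rw [eval_zeroPoly, ← branch_sq_of_mem hk h, G]
  have := branch_ne_zero hk h
  field_simp; ring

include hk hz in
theorem zeroPoly_ne_zero {v : ℂ} (h1 : v ≠ 1) (h2 : v ≠ -1) :
    (P.zeroPoly v).eval (P.zinf : ℂ) ≠ 0 := by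
  have hb := branch_ne_zero hk (zinf_mem hk hz)
  rw [eval_zeroPoly_eq hk v (zinf_mem hk hz), G_zinf hk hz]
  refine mul_ne_zero (mul_ne_zero (pow_ne_zero _ hb) ?_) ?_
  · intro h; apply h1; linear_combination h
  · intro h; apply h2; linear_combination -h

/-! ### The quadratic polynomial on the slits -/

-- The roots of `E` found by Rolle's theorem, carried back by the inversion; the leading coefficient
-- is the product `y₀ y₁` of a negative and a positive number.
include hk hz in
theorem exists_quad_roots : ∃ x₀ ∈ Ioo (lo P.k 0) (hi P.k 0), ∃ x₁ ∈ Ioo (lo P.k 1) (hi P.k 1),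
    P.coef3 1 < 0 ∧ ∀ ξ : ℝ, P.quadR ξ = P.coef3 1 * (ξ - x₀) * (ξ - x₁) := by
  obtain ⟨y₀, hy₀, y₁, hy₁, hr, -⟩ := (closed hk hz).exists_roots
  set T := inverseSlits hk hz with hT
  have h0 : y₀ < 0 := hy₀.2.trans T.neg
  have h1 : 0 < y₁ := T.pos.trans hy₁.1
  have hq : P.coef3 1 = y₀ * y₁ := by
    have := hr 0
    simp only [TwoSlits.Er, hT, inverseSlits] at this
    linarith
  have key : ∀ j : Fin 2, ∀ y : ℝ, y ≠ 0 → y ∈ Ioo (1 / (hi P.k j - P.zinf)) (1 / (lo P.k j - P.zinf)) →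
      P.zinf + 1 / y ∈ Ioo (lo P.k j) (hi P.k j) := by
    intro j y hy0 hy
    have hne : P.zinf + 1 / y ≠ P.zinf := by simpa using hy0
    have e : 1 / (P.zinf + 1 / y - P.zinf) = y := by rw [add_sub_cancel_left, one_div_one_div]
    have h2 := (inv_mem_Icc_iff hk hz j hne).1 (by rw [e]; exact Ioo_subset_Icc_self hy)
    refine ⟨lt_of_le_of_ne h2.1 fun h => ?_, lt_of_le_of_ne h2.2 fun h => ?_⟩
    · rw [h, e] at hy; exact lt_irrefl _ hy.2
    · rw [← h, e] at hy; exact lt_irrefl _ hy.1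
  refine ⟨_, key 0 y₀ h0.ne hy₀, _, key 1 y₁ h1.ne' hy₁, by rw [hq]; exact mul_neg_of_neg_of_pos h0 h1,
    fun ξ => ?_⟩
  rw [hq]
  have h0' := h0.ne
  have h1' := h1.ne'
  by_cases hξ : ξ = P.zinf
  · rw [hξ, quadR_zinf hk hz]; field_simp; ring
  · have h2 := quadR_inv hk hz hξ
    rw [hr] at h2
    have h3 := sub_ne_zero.2 hξ
    have h4 : P.quadR ξ = (1 / (ξ - P.zinf) - y₀) * (1 / (ξ - P.zinf) - y₁) * (ξ - P.zinf) ^ 2 := by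
      rw [h2]; field_simp
    rw [h4]; field_simp; ring

-- `quad` is positive exactly between its roots `x₀` in `l₀` and `x₁` in `l₁`, so it changes sign
-- once across each slit. These signs decide the end values of the logarithms in the integral
-- formula.
include hk hz in
theorem quadR_ends (j : Fin 2) :
    0 < slitSign j * P.quadR (lo P.k j) ∧ slitSign j * P.quadR (hi P.k j) < 0 := by
  obtain ⟨x₀, h0, x₁, h1, hc, hq⟩ := exists_quad_roots hk hz
  have h2 : hi P.k 0 < P.zinf := by simpa [hi] using hz.1
  have h3 : P.zinf < lo P.k 1 := by simpa [lo] using hz.2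
  rw [hq, hq]
  fin_cases j
  · simp only [slitSign, Fin.zero_eta, if_true]
    have l0 := h0.1
    have l1 : lo P.k 0 < x₁ := by linarith [h0.1, h0.2, h1.1]
    have l2 := h0.2
    have l3 : hi P.k 0 < x₁ := by linarith [h1.1]
    have e1 := mul_pos (sub_pos.2 l0) (sub_pos.2 l1)
    have e2 := mul_pos (sub_pos.2 l2) (sub_pos.2 l3)
    constructor
    · nlinarith [mul_pos (neg_pos.2 hc) e1]
    · nlinarith [mul_pos (neg_pos.2 hc) e2]
  · simp only [slitSign, Fin.mk_one, one_ne_zero, if_false, one_mul]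
    have l0 := h1.1
    have l1 : x₀ < lo P.k 1 := by linarith [h0.2]
    have l2 := h1.2
    have l3 : x₀ < hi P.k 1 := by linarith [h1.1, h1.2]
    have e1 := mul_pos (sub_pos.2 l0) (sub_pos.2 l1)
    have e2 := mul_pos (sub_pos.2 l2) (sub_pos.2 l3)
    constructor
    · nlinarith [mul_pos (neg_pos.2 hc) e1]
    · nlinarith [mul_pos (neg_pos.2 hc) e2]

include hk hz in
theorem quadR_ne_zero_of_p2 {j : Fin 2} {ξ : ℝ} (h : ξ ∈ Icc (lo P.k j) (hi P.k j))
    (h0 : √|p2 P.k ξ| = 0) : P.quadR ξ ≠ 0 := by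
  have h1 := quadR_ends hk hz j
  intro h2
  have h3 : ξ ∉ Ioo (lo P.k j) (hi P.k j) := fun h' => (sqrt_abs_p2_pos hk j h').ne' h0
  rcases h.1.lt_or_eq with h4 | h4
  · rcases h.2.lt_or_eq with h5 | h5
    · exact h3 ⟨h4, h5⟩
    · rw [← h5, h2, mul_zero] at h1; exact lt_irrefl _ h1.2
  · rw [h4, h2, mul_zero] at h1; exact lt_irrefl _ h1.1

/-- The boundary values of the factors of the polynomial, rotated into the slit plane. -/
theorem rotated_mem_slitPlane {x r δ σ : ℝ} {v : ℂ} (hr : 0 ≤ r) (hv : δ * v.re < 0)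
    (hσ : σ ≠ 0) (hx : r = 0 → x ≠ 0) :
    (σ * δ * Complex.I * (x + σ * Complex.I * v * r) : ℂ) ∈ Complex.slitPlane := by
  have hδ : δ ≠ 0 := by rintro rfl; simp at hv
  rw [Complex.mem_slitPlane_iff]
  rcases hr.lt_or_eq with h | h
  · left
    have : ((σ * δ * Complex.I * (x + σ * Complex.I * v * r) : ℂ)).re = σ ^ 2 * (-(δ * v.re)) * r := by
      simp; ring
    rw [this]
    exact mul_pos (mul_pos (by positivity) (by linarith)) h
  · right
    rw [← h]
    have : ((σ * δ * Complex.I * (x + σ * Complex.I * v * (0 : ℝ)) : ℂ)).im = σ * δ * x := by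
      simp
    rw [this]
    exact mul_ne_zero (mul_ne_zero hσ hδ) (hx h.symm)

include hk hz in
/-- The polynomial has no zeros on the slits. -/
theorem root_mem_punctured {v : ℂ} (hv : v.re < 0) (h1 : v ≠ -1) {ζ : ℂ}
    (h : (P.zeroPoly v).eval ζ = 0) : ζ ∈ P.punctured := by
  refine ⟨?_, ?_⟩
  · by_contra hζ
    rw [slitDomain, notMem_compl_iff] at hζ
    obtain ⟨j, ξ, hξ, rfl⟩ : ∃ j, ∃ ξ ∈ Icc (lo P.k j) (hi P.k j), (ξ : ℂ) = ζ := by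
      rcases hζ with h' | h'
      exacts [⟨0, h'⟩, ⟨1, h'⟩]
    -- On a slit, with `q = quad` and `r = √|p₂|`, one has `p₂ = -r²` and the polynomial splits as
    -- `(scale·q + ivr)(scale·q - ivr)`. Each factor, suitably rotated, lies in the slit plane.
    have hfac : ∀ σ : ℝ, σ ≠ 0 →
        ((P.scale * P.quadR ξ : ℝ) + σ * Complex.I * v * (√|p2 P.k ξ| : ℝ) : ℂ) ≠ 0 := by
      intro σ hσ h0
      have := rotated_mem_slitPlane (x := P.scale * P.quadR ξ) (r := √|p2 P.k ξ|) (δ := 1) (σ := σ)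
        (v := v) (Real.sqrt_nonneg _) (by linarith) hσ fun hr =>
          mul_ne_zero (scale_pos hk hz).ne' (quadR_ne_zero_of_p2 hk hz hξ hr)
      rw [h0, mul_zero] at this
      exact Complex.zero_notMem_slitPlane this
    refine mul_ne_zero (hfac 1 one_ne_zero) (hfac (-1) (by norm_num)) ?_
    rw [eval_zeroPoly, quad_ofReal, ← p2_ofReal] at h
    have hs : ((√|p2 P.k ξ| : ℝ) : ℂ) ^ 2 = -((p2 P.k ξ : ℝ) : ℂ) := by
      have : √|p2 P.k ξ| ^ 2 = -p2 P.k ξ := by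
        rw [Real.sq_sqrt (abs_nonneg _), abs_of_nonpos]
        rw [p2_eq j]
        have := rest_pos hk j hξ
        exact neg_nonpos.2 (mul_nonneg (mul_nonneg (by linarith [hξ.1]) (by linarith [hξ.2])) this.le)
      exact_mod_cast this
    push_cast
    linear_combination h - Complex.I ^ 2 * v ^ 2 * hs + v ^ 2 * ((p2 P.k ξ : ℝ) : ℂ) * Complex.I_sq
  · intro h'
    have h' : ζ = P.zinf := h'
    rw [h'] at h
    refine zeroPoly_ne_zero hk hz ?_ h1 h
    rintro rfl; simp at hv; linarith

theorem crit_ne (hc : P.c ≠ 0) (ha : P.a ≠ 0) (h : P.mb + P.na ≠ 0) : P.crit ≠ -1 := by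
  intro h1
  rw [crit, neg_inj, div_eq_one_iff_eq h] at h1
  exact na_ne_zero hc ha (by linear_combination (-1 / 2 : ℂ) * h1)

include hk hz in
theorem zeroOrder_eq (hc : P.c ≠ 0) (ha : P.a ≠ 0) (hg : 1 < P.gam) {ζ : ℂ}
    (h : ζ ∈ slitDomain P.k) : P.zeroOrder ζ = (P.zeroPoly P.crit).rootMultiplicity ζ := by
  have hv := crit_re_neg hc ha hg
  have h1 : ‖P.na‖ < ‖P.mb‖ := not_le.1 fun h => hg.not_ge ((gam_le_one_iff hc ha).2 h)
  have hmn := mb_add_na_ne_zero h1.ne'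
  have hne := zeroPoly_ne_zero hk hz (v := P.crit) (by
    intro h'; rw [h'] at hv; simp at hv; linarith) (crit_ne hc ha hmn)
  have hQ : P.zeroPoly P.crit ≠ 0 := by rintro h'; rw [h'] at hne; simp at hne
  by_cases hζ : ζ = P.zinf
  · rw [hζ, (order_zinf hk hz hc ha).2.2.2, Polynomial.rootMultiplicity_eq_zero hne]
  · have hG := analyticAt_G hk h
    have hb : AnalyticAt ℂ (branch P.k) ζ :=
      DifferentiableOn.analyticAt (s := slitDomain P.k)
        (fun _ hw => (differentiableAt_branch hk hw).differentiableWithinAt)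
        ((isOpen_slitDomain hk).mem_nhds h)
    have e1 : meromorphicOrderAt P.den ζ = meromorphicOrderAt (fun w => P.G w - P.crit) ζ := by
      have : P.den = (fun _ => P.mb + P.na) * fun w => P.G w - P.crit := by
        funext w; exact den_eq_crit hmn _
      rw [this]
      exact meromorphicOrderAt_mul_of_ne_zero analyticAt_const hmn
    have e2 : meromorphicOrderAt (fun w => (P.zeroPoly P.crit).eval w) ζ =
        meromorphicOrderAt (fun w => P.G w - P.crit) ζ := by
      have : (fun w => (P.zeroPoly P.crit).eval w) =ᶠ[𝓝[≠] ζ]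
          ((fun w => branch P.k w ^ 2 * (P.G w + P.crit)) * fun w => P.G w - P.crit) := by
        filter_upwards [mem_nhdsWithin_of_mem_nhds ((isOpen_slitDomain hk).mem_nhds h)] with w hw
        exact eval_zeroPoly_eq hk _ hw
      rw [meromorphicOrderAt_congr this]
      refine meromorphicOrderAt_mul_of_ne_zero ((hb.pow 2).mul (hG.add analyticAt_const)) ?_
      refine mul_ne_zero (pow_ne_zero _ (branch_ne_zero hk h)) fun h0 => ?_
      have := congrArg Complex.re h0
      simp only [Complex.add_re, Complex.zero_re] at this
      linarith [G_re_neg hk hz h]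
    rw [zeroOrder, (order_punctured hk hz hc ha ⟨h, hζ⟩).2.2.1, e1, ← e2, meromorphicOrderAt_eval hQ]
    simp

open Polynomial in
theorem eval_inv_mul_pow {Q : ℂ[X]} {t : ℂ} (ht : t ≠ 0) :
    Q.eval t⁻¹ * t ^ Q.natDegree = Q.reverse.eval t := by
  have := invertibleOfNonzero (inv_ne_zero ht)
  have h := eval₂_reverse_mul_pow (RingHom.id ℂ) t⁻¹ Q
  rw [invOf_eq_inv, inv_inv] at h
  rw [← eval₂_id, ← eval₂_id, ← h, inv_pow]
  have := pow_ne_zero Q.natDegree ht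
  field_simp

-- In the coordinate `t = 1/ζ` the polynomial becomes `t^(4 - deg)` times the reversed polynomial,
-- which does not vanish at `0`: the order at infinity is the defect of the degree.
include hk hz in
theorem zeroOrderInf_eq (hc : P.c ≠ 0) (ha : P.a ≠ 0) (hg : 1 < P.gam) :
    P.zeroOrderInf = 4 - (P.zeroPoly P.crit).natDegree := by
  have hv := crit_re_neg hc ha hg
  have h1 : ‖P.na‖ < ‖P.mb‖ := not_le.1 fun h => hg.not_ge ((gam_le_one_iff hc ha).2 h)
  have hmn := mb_add_na_ne_zero h1.ne'
  have hne := zeroPoly_ne_zero hk hz (v := P.crit) (by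
    intro h'; rw [h'] at hv; simp at hv; linarith) (crit_ne hc ha hmn)
  have hQ : P.zeroPoly P.crit ≠ 0 := by rintro h'; rw [h'] at hne; simp at hne
  set Q := P.zeroPoly P.crit with hQd
  have hdeg : Q.natDegree ≤ 4 := natDegree_zeroPoly _
  have hG := analyticAt_Ghat hk hz
  have e1 : meromorphicOrderAt (fun t => P.mb * (1 + P.Ghat hk hz t) - P.na * (1 - P.Ghat hk hz t)) 0
      = meromorphicOrderAt (fun t => P.Ghat hk hz t - P.crit) 0 := by
    have : (fun t => P.mb * (1 + P.Ghat hk hz t) - P.na * (1 - P.Ghat hk hz t)) =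
        (fun _ => P.mb + P.na) * fun t => P.Ghat hk hz t - P.crit := by
      funext w; exact den_eq_crit hmn _
    rw [this]
    exact meromorphicOrderAt_mul_of_ne_zero analyticAt_const hmn
  have e2 : meromorphicOrderAt (fun t : ℂ => t ^ (4 - Q.natDegree) * Q.reverse.eval t) 0 =
      meromorphicOrderAt (fun t => P.Ghat hk hz t - P.crit) 0 := by
    have : (fun t : ℂ => t ^ (4 - Q.natDegree) * Q.reverse.eval t) =ᶠ[𝓝[≠] 0]
        ((fun t => (1 - t ^ 2) * (1 - t ^ 2 / (P.k : ℂ) ^ 2) * (P.Ghat hk hz t + P.crit)) *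
          fun t => P.Ghat hk hz t - P.crit) := by
      filter_upwards [eventually_Ghat hk hz, eventually_inv_punctured (P := P), self_mem_nhdsWithin]
        with t h2 h3 h4
      have h4 : t ≠ 0 := h4
      have h5 := eval_zeroPoly_eq hk P.crit h3.1
      rw [branch_sq_of_mem hk h3.1, h2] at h5
      have hk0 : (P.k : ℂ) ≠ 0 := by exact_mod_cast hk.1.ne'
      change t ^ (4 - Q.natDegree) * Q.reverse.eval t =
        (1 - t ^ 2) * (1 - t ^ 2 / (P.k : ℂ) ^ 2) * (P.Ghat hk hz t + P.crit) *
          (P.Ghat hk hz t - P.crit)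
      rw [← eval_inv_mul_pow h4, h5]
      have h6 : t ^ 4 = t ^ (4 - Q.natDegree) * t ^ Q.natDegree := by
        rw [← pow_add]; congr 1; omega
      have h7 : (((t⁻¹ ^ 2 - 1) * (t⁻¹ ^ 2 - 1 / (P.k : ℂ) ^ 2))) * t ^ 4 =
          (1 - t ^ 2) * (1 - t ^ 2 / (P.k : ℂ) ^ 2) := by
        field_simp
      rw [← h7, h6]; ring
    rw [meromorphicOrderAt_congr this]
    refine meromorphicOrderAt_mul_of_ne_zero ?_ ?_
    · have h2 : AnalyticAt ℂ (fun t : ℂ => (1 - t ^ 2) * (1 - t ^ 2 / (P.k : ℂ) ^ 2)) 0 := by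
        have hk0 : (P.k : ℂ) ^ 2 ≠ 0 := pow_ne_zero _ (by exact_mod_cast hk.1.ne')
        fun_prop (disch := exact hk0)
      exact h2.mul (hG.add analyticAt_const)
    · simp only [ne_eq, OfNat.ofNat_ne_zero, not_false_eq_true, zero_pow, sub_zero, zero_div,
        mul_one, one_mul, Ghat_zero]
      intro h0
      have := congrArg Complex.re h0
      simp only [Complex.add_re, Complex.zero_re] at this
      linarith [Ginf_re_neg hk hz]
  have e3 : meromorphicOrderAt (fun t : ℂ => t ^ (4 - Q.natDegree) * Q.reverse.eval t) 0 =
      ((4 - Q.natDegree : ℕ) : ℤ) := by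
    have han : AnalyticAt ℂ (fun t : ℂ => Q.reverse.eval t) 0 := Q.reverse.differentiable.analyticAt 0
    rw [meromorphicOrderAt_eq_int_iff]
    · refine ⟨_, han, ?_, Eventually.of_forall fun t => ?_⟩
      · rw [← Polynomial.coeff_zero_eq_eval_zero, Polynomial.coeff_zero_reverse]
        exact Polynomial.leadingCoeff_ne_zero.2 hQ
      · rw [sub_zero, zpow_natCast, smul_eq_mul]
    · have h2 : AnalyticAt ℂ (fun t : ℂ => t ^ (4 - Q.natDegree)) 0 := by fun_prop
      exact (h2.mul han).meromorphicAt
  rw [zeroOrderInf, (order_infinity hk hz hc ha).1, e1, ← e2, e3]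
  simp

-- All roots of the polynomial lie in the slit domain, and the defect `4 - deg` is the multiplicity
-- at infinity; the total is four whatever the degree.
include hk hz in
theorem Z_of_one_lt_gam (hc : P.c ≠ 0) (ha : P.a ≠ 0) (hg : 1 < P.gam) :
    {ζ ∈ slitDomain P.k | P.zeroOrder ζ ≠ 0}.Finite ∧ P.Z = 4 := by
  classical
  have hv := crit_re_neg hc ha hg
  have h1 : ‖P.na‖ < ‖P.mb‖ := not_le.1 fun h => hg.not_ge ((gam_le_one_iff hc ha).2 h)
  have hmn := mb_add_na_ne_zero h1.ne'
  have hne := zeroPoly_ne_zero hk hz (v := P.crit) (by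
    intro h'; rw [h'] at hv; simp at hv; linarith) (crit_ne hc ha hmn)
  have hinf := zeroOrderInf_eq hk hz hc ha hg
  have hzo : ∀ ζ ∈ slitDomain P.k, P.zeroOrder ζ = (P.zeroPoly P.crit).rootMultiplicity ζ :=
    fun ζ hζ => zeroOrder_eq hk hz hc ha hg hζ
  have hdeg : (P.zeroPoly P.crit).natDegree ≤ 4 := natDegree_zeroPoly _
  have hroot : ∀ ζ, (P.zeroPoly P.crit).eval ζ = 0 → ζ ∈ P.punctured := fun ζ =>
    root_mem_punctured hk hz hv (crit_ne hc ha hmn)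
  set Q := P.zeroPoly P.crit with hQd
  have hQ : Q ≠ 0 := by rintro h'; rw [h'] at hne; simp at hne
  have hmem : ∀ ζ, ζ ∈ Q.roots.toFinset ↔ Q.rootMultiplicity ζ ≠ 0 := by
    intro ζ
    rw [Multiset.mem_toFinset, ← Multiset.count_ne_zero, Polynomial.count_roots]
  have hsub : ∀ ζ ∈ Q.roots.toFinset, ζ ∈ slitDomain P.k := by
    intro ζ hζ
    rw [Multiset.mem_toFinset, Polynomial.mem_roots hQ] at hζ
    exact (hroot ζ hζ).1
  refine ⟨Q.roots.toFinset.finite_toSet.subset ?_, ?_⟩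
  · rintro ζ ⟨h2, h3⟩
    rw [hzo ζ h2] at h3
    exact (hmem ζ).2 h3
  · have hsum : ∑ᶠ ζ ∈ slitDomain P.k, P.zeroOrder ζ = Q.natDegree := by
      rw [finsum_mem_congr rfl hzo]
      rw [finsum_mem_eq_sum_of_inter_support_eq (t := Q.roots.toFinset)]
      · rw [← IsAlgClosed.card_roots_eq_natDegree (p := Q),
          ← Multiset.toFinset_sum_count_eq Q.roots]
        exact Finset.sum_congr rfl fun ζ _ => (Polynomial.count_roots Q).symm
      · ext ζ
        simp only [mem_inter_iff, Function.mem_support, Finset.mem_coe]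
        exact ⟨fun h => ⟨(hmem ζ).2 h.2, h.2⟩, fun h => ⟨hsub ζ h.1, h.2⟩⟩
    rw [Z, hsum, hinf]
    omega

include hk hz in
/-- Solvability without zeros. -/
theorem noZeros_iff (hc : P.c ≠ 0) (ha : P.a ≠ 0) :
    (∃ Fp Fm : ℂ → ℂ, P.IsSchwarzPair Fp Fm ∧ P.NoZeros fun ζ => Fp ζ - Fm ζ) ↔ P.gam ≤ 1 := by
  have hlim := tendsto_sq_mul_comb hk hz P.A0 (P.mb + P.na)
  have hden : ∀ w, P.A0 + (P.mb + P.na) * w = P.mb * (1 + w) - P.na * (1 - w) := fun w => by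
    rw [A0_eq]; ring
  constructor
  · rintro ⟨Fp, Fm, hpair, hnz, d, hd, hlim'⟩
    by_contra hg
    have hg := not_le.1 hg
    have hv := crit_re_neg hc ha hg
    have h1 : ‖P.na‖ < ‖P.mb‖ := not_le.1 fun h => hg.not_ge ((gam_le_one_iff hc ha).2 h)
    have hmn := mb_add_na_ne_zero h1.ne'
    -- By uniqueness the given pair is the explicit one. A pair without zeros would then give `Z =
    -- 0`, while `Z = 4` for `γ > 1`.
    obtain ⟨hp, hm⟩ := schwarzPair_unique hk hz hpair
    have heq : ∀ ζ ∈ P.punctured, Fp ζ - Fm ζ = P.comb P.A0 (P.mb + P.na) ζ := fun ζ hζ => by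
      rw [hp hζ, hm hζ, Fplus_sub_Fminus hk hz]
    have hGne : ∀ ζ ∈ P.punctured, P.G ζ ≠ P.crit := by
      intro ζ hζ h2
      apply hnz ζ hζ
      change Fp ζ - Fm ζ = 0
      rw [heq ζ hζ, comb, hden, den_eq_crit hmn, h2, sub_self, mul_zero, mul_zero]
    have hGinf : P.Ginf hk hz ≠ P.crit := by
      intro h2
      apply hd
      refine tendsto_nhds_unique (hlim'.congr' ?_) (hlim.trans (by
        rw [hden, den_eq_crit hmn, h2, sub_self, mul_zero]))
      filter_upwards [eventually_punctured_cocompact] with ζ hζ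
      rw [heq ζ hζ]
    have hZ := (Z_of_one_lt_gam hk hz hc ha hg).2
    have h3 : P.zeroOrderInf = 0 := by
      have hG := analyticAt_Ghat hk hz
      have h0 : meromorphicOrderAt
          (fun t => P.mb * (1 + P.Ghat hk hz t) - P.na * (1 - P.Ghat hk hz t)) 0 = 0 := by
        refine meromorphicOrderAt_eq_zero_of_ne
          ((analyticAt_const.mul (analyticAt_const.add hG)).sub
            (analyticAt_const.mul (analyticAt_const.sub hG))) ?_
        rw [Ghat_zero, den_eq_crit hmn]
        exact mul_ne_zero hmn (sub_ne_zero.2 hGinf)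
      rw [zeroOrderInf, (order_infinity hk hz hc ha).1, h0]
      rfl
    have h4 : ∀ ζ ∈ slitDomain P.k, P.zeroOrder ζ = 0 := by
      intro ζ hζ
      by_cases hζz : ζ = P.zinf
      · rw [hζz]; exact (order_zinf hk hz hc ha).2.2.2
      · have hG := analyticAt_G hk hζ
        rw [zeroOrder, (order_punctured hk hz hc ha ⟨hζ, hζz⟩).2.2.1]
        have : meromorphicOrderAt P.den ζ = 0 := by
          refine meromorphicOrderAt_eq_zero_of_ne
            ((analyticAt_const.mul (analyticAt_const.add hG)).sub
              (analyticAt_const.mul (analyticAt_const.sub hG))) ?_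
          rw [den, den_eq_crit hmn]
          exact mul_ne_zero hmn (sub_ne_zero.2 (hGne ζ ⟨hζ, hζz⟩))
        rw [this]; rfl
    rw [Z, h3, finsum_mem_eq_zero_of_forall_eq_zero h4] at hZ
    norm_num at hZ
  · intro hg
    refine ⟨P.Fplus, P.Fminus, isSchwarzPair hk hz, fun ζ hζ => ?_,
      P.A0 + (P.mb + P.na) * P.Ginf hk hz, ?_, ?_⟩
    · change P.Fplus ζ - P.Fminus ζ ≠ 0
      rw [Fplus_sub_Fminus hk hz, comb, hden]
      exact mul_ne_zero (one_div_ne_zero (pow_ne_zero _ (sub_ne_zero.2 hζ.2)))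
        (den_ne_zero hk hz hc ha hg hζ.1)
    · rw [hden]
      intro h
      exact ((gam_le_one_iff hc ha).1 hg).not_gt
        (norm_na_lt (na_ne_zero hc ha) (Ginf_re_neg hk hz) h)
    · simp only [Fplus_sub_Fminus hk hz]
      exact hlim

end Data

/-! ### The integral formula for the number of zeros -/

theorem log_mul_I_sub {x : ℝ} (hx : 0 < x) :
    Complex.log (x * Complex.I) - Complex.log (-(x * Complex.I)) = π * Complex.I := by
  have h1 := Complex.log_ofReal_mul hx Complex.I_ne_zero
  have h2 := Complex.log_ofReal_mul hx (neg_ne_zero.2 Complex.I_ne_zero)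
  rw [← mul_neg, h1, h2, Complex.log_I, Complex.log_neg_I]
  ring

namespace Data

variable {P : Data}

theorem etaSide_eq (σ ξ : ℝ) : P.etaSide σ ξ = σ * Complex.I * (√|p2 P.k ξ| : ℝ) * P.A0 +
    P.scale * (P.mb + P.na) * P.quadR ξ := by
  rw [etaSide, ← quad_ofReal, ← dP_sub_dM, ← A_quad]
  ring

theorem etaSide_eq_crit (h : P.mb + P.na ≠ 0) (σ ξ : ℝ) : P.etaSide σ ξ =
    (P.mb + P.na) * (P.scale * P.quadR ξ - σ * Complex.I * P.crit * (√|p2 P.k ξ| : ℝ)) := by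
  have : P.A0 = -(P.crit * (P.mb + P.na)) := by
    rw [A0_eq, crit]; field_simp
  rw [etaSide_eq, this]; ring

theorem continuous_etaSide (σ : ℝ) : Continuous (P.etaSide σ) := by
  unfold etaSide p2; fun_prop

theorem continuous_eta0Side (σ : ℝ) : Continuous (P.eta0Side σ) := by
  unfold eta0Side p2; fun_prop

variable (hk : P.k ∈ Ioo (0 : ℝ) 1) (hz : P.zinf ∈ Ioo (-1 : ℝ) 1)

include hk in
theorem hasDerivAt_sqrt_abs_p2 (j : Fin 2) {ξ : ℝ} (h : ξ ∈ Ioo (lo P.k j) (hi P.k j)) :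
    HasDerivAt (fun x => √|p2 P.k x|) (-(ξ * (2 * ξ ^ 2 - 1 - 1 / P.k ^ 2)) / √|p2 P.k ξ|) ξ := by
  have hn := p2_neg hk j h
  have h1 : HasDerivAt (fun x => -p2 P.k x) (-(2 * ξ * (2 * ξ ^ 2 - 1 - 1 / P.k ^ 2))) ξ := by
    have : HasDerivAt (fun x => -((x ^ 2 - 1) * (x ^ 2 - 1 / P.k ^ 2)))
        (-((2 * ξ) * (ξ ^ 2 - 1 / P.k ^ 2) + (ξ ^ 2 - 1) * (2 * ξ))) ξ := by
      have e1 : HasDerivAt (fun x : ℝ => x ^ 2) (2 * ξ) ξ := by simpa using hasDerivAt_pow 2 ξ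
      exact ((e1.sub_const 1).mul (e1.sub_const (1 / P.k ^ 2))).neg
    convert this using 1
    · rfl
    · ring
  have h2 := h1.sqrt (by linarith)
  have h3 : -(ξ * (2 * ξ ^ 2 - 1 - 1 / P.k ^ 2)) / √|p2 P.k ξ| =
      -(2 * ξ * (2 * ξ ^ 2 - 1 - 1 / P.k ^ 2)) / (2 * √(-p2 P.k ξ)) := by
    rw [abs_of_neg hn, ← mul_div_mul_left _ (√(-p2 P.k ξ)) two_ne_zero]; ring
  rw [h3]
  refine h2.congr_of_eventuallyEq ?_
  filter_upwards [isOpen_Ioo.mem_nhds h] with x hx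
  rw [abs_of_neg (p2_neg hk j hx)]

include hk in
theorem hasDerivAt_etaSide (σ : ℝ) (j : Fin 2) {ξ : ℝ} (h : ξ ∈ Ioo (lo P.k j) (hi P.k j)) :
    HasDerivAt (P.etaSide σ) (P.eta0Side σ ξ / (√|p2 P.k ξ| : ℝ)) ξ := by
  have h1 := (hasDerivAt_sqrt_abs_p2 hk j h).ofReal_comp
  have hr : ((√|p2 P.k ξ| : ℝ) : ℂ) ≠ 0 := by exact_mod_cast (sqrt_abs_p2_pos hk j h).ne'
  have h2 : HasDerivAt (fun x : ℝ => (x : ℂ)) 1 ξ := Complex.ofRealCLM.hasDerivAt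
  have h3 := (((h1.const_mul (σ * Complex.I)).mul_const P.A0).add_const P.A1).add
    (h2.const_mul P.A2) |>.add ((h2.pow 2).const_mul P.A3)
  refine (show HasDerivAt (P.etaSide σ) _ ξ from h3).congr_deriv (Eq.symm ?_)
  rw [eta0Side, div_eq_iff hr]
  push_cast
  field_simp
  ring

include hk hz in
/-- The integrals of the counting integrand over the slits. -/
theorem integral_countIntegrand {δ : ℝ} (hδ : δ = 1 ∨ δ = -1) (hmn : P.mb + P.na ≠ 0)
    (hv : δ * P.crit.re < 0) (j : Fin 2) :
    IntervalIntegrable P.countIntegrand volume (lo P.k j) (hi P.k j) ∧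
      ∫ ξ in lo P.k j..hi P.k j, P.countIntegrand ξ = -(2 * π * Complex.I * δ * slitSign j) := by
  have hlt := lo_lt_hi hk j
  have hs := scale_pos hk hz
  have hends := quadR_ends hk hz j
  -- These factors rotate `η^±` into the slit plane along the whole closed slit, where `δ` is the
  -- sign with `δ · re crit < 0`. So the principal logarithm is continuous up to the ends.
  set K : ℝ → ℂ := fun σ => σ * δ * Complex.I / (P.mb + P.na) with hK
  have hKe : ∀ σ ξ : ℝ, K σ * P.etaSide (-σ) ξ = σ * δ * Complex.I *
      ((P.scale * P.quadR ξ : ℝ) + σ * Complex.I * P.crit * (√|p2 P.k ξ| : ℝ)) := by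
    intro σ ξ
    rw [etaSide_eq_crit hmn, hK]
    push_cast
    field_simp
    ring
  have hmem : ∀ σ : ℝ, σ ≠ 0 → ∀ ξ ∈ Icc (lo P.k j) (hi P.k j),
      K σ * P.etaSide (-σ) ξ ∈ Complex.slitPlane := by
    intro σ hσ ξ hξ
    rw [hKe]
    exact rotated_mem_slitPlane (Real.sqrt_nonneg _) hv hσ fun h =>
      mul_ne_zero hs.ne' (quadR_ne_zero_of_p2 hk hz hξ h)
  have hne : ∀ σ : ℝ, σ ≠ 0 → ∀ ξ ∈ Icc (lo P.k j) (hi P.k j), P.etaSide (-σ) ξ ≠ 0 := by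
    intro σ hσ ξ hξ h
    have := Complex.slitPlane_ne_zero (hmem σ hσ ξ hξ)
    rw [h, mul_zero] at this
    exact this rfl
  have hne1 := hne 1 one_ne_zero
  have hne2 := hne (-1) (neg_ne_zero.2 one_ne_zero)
  rw [neg_neg] at hne2
  have hsplit : IntervalIntegrable P.countIntegrand volume (lo P.k j) (hi P.k j) := by
    refine intervalIntegrable_div_sqrt_p2_complex hk j ?_
    exact ((continuous_eta0Side _).continuousOn.div (continuous_etaSide _).continuousOn hne1).sub
      ((continuous_eta0Side _).continuousOn.div (continuous_etaSide _).continuousOn hne2)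
  refine ⟨hsplit, ?_⟩
  set F : ℝ → ℂ := fun ξ => Complex.log (K 1 * P.etaSide (-1) ξ) -
    Complex.log (K (-1) * P.etaSide 1 ξ) with hF
  have hm1 := hmem 1 one_ne_zero
  have hm2 := hmem (-1) (neg_ne_zero.2 one_ne_zero)
  rw [neg_neg] at hm2
  have hcont : ContinuousOn F (Icc (lo P.k j) (hi P.k j)) :=
    (((continuous_etaSide _).continuousOn.const_mul _).clog hm1).sub
      (((continuous_etaSide _).continuousOn.const_mul _).clog hm2)
  have hder : ∀ ξ ∈ Ioo (lo P.k j) (hi P.k j), HasDerivAt F (P.countIntegrand ξ) ξ := by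
    intro ξ hξ
    have hξ' := Ioo_subset_Icc_self hξ
    have d1 := ((hasDerivAt_etaSide hk (-1) j hξ).const_mul (K 1)).clog_real (hm1 ξ hξ')
    have d2 := ((hasDerivAt_etaSide hk 1 j hξ).const_mul (K (-1))).clog_real (hm2 ξ hξ')
    refine (d1.sub d2).congr_deriv (Eq.symm ?_)
    have hK1 := left_ne_zero_of_mul (Complex.slitPlane_ne_zero (hm1 ξ hξ'))
    have hK2 := left_ne_zero_of_mul (Complex.slitPlane_ne_zero (hm2 ξ hξ'))
    rw [mul_div_mul_left _ _ hK1, mul_div_mul_left _ _ hK2, countIntegrand, sub_div, div_div,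
      div_div, div_div, div_div, mul_comm, mul_comm (P.etaSide 1 ξ)]
  -- At the ends of a slit `η⁺ = η⁻`, and the two rotated values are opposite imaginary numbers, so
  -- their logarithms differ by `±πi`.
  have hend : ∀ ξ : ℝ, √|p2 P.k ξ| = 0 → F ξ =
      Complex.log (((δ * (P.scale * P.quadR ξ) : ℝ) : ℂ) * Complex.I) -
        Complex.log (-(((δ * (P.scale * P.quadR ξ) : ℝ) : ℂ) * Complex.I)) := by
    intro ξ h
    have e1 := hKe 1 ξ
    have e2 := hKe (-1) ξ
    rw [neg_neg] at e2
    simp only [hF]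
    rw [e1, e2, h]
    congr 2 <;> push_cast <;> ring
  have hval : ∀ ξ : ℝ, √|p2 P.k ξ| = 0 → ∀ τ : ℝ, (τ = 1 ∨ τ = -1) →
      0 < τ * (δ * P.quadR ξ) → F ξ = τ * π * Complex.I := by
    intro ξ h τ hτ hp
    rw [hend ξ h]
    rcases hτ with rfl | rfl
    · rw [log_mul_I_sub (by nlinarith [mul_pos hs hp])]; push_cast; ring
    · have := log_mul_I_sub (x := -(δ * (P.scale * P.quadR ξ))) (by nlinarith [mul_pos hs hp])
      push_cast at this ⊢
      rw [neg_mul, neg_neg] at this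
      rw [← neg_sub, this]; ring
  have hr : √|p2 P.k (lo P.k j)| = 0 ∧ √|p2 P.k (hi P.k j)| = 0 := by
    constructor <;> rw [p2_eq j] <;> simp
  rw [intervalIntegral.integral_eq_sub_of_hasDerivAt_of_le hlt.le hcont hder hsplit]
  have hsg : slitSign j = 1 ∨ slitSign j = -1 := by
    unfold slitSign; split_ifs <;> simp
  have hδ2 : δ * δ = 1 := by rcases hδ with rfl | rfl <;> norm_num
  have hds : δ * slitSign j = 1 ∨ δ * slitSign j = -1 := by
    rcases hδ with h | h <;> rcases hsg with h' | h' <;> rw [h, h'] <;> norm_num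
  have hds' : -(δ * slitSign j) = 1 ∨ -(δ * slitSign j) = -1 := by
    rcases hds with h | h <;> rw [h] <;> norm_num
  rw [hval _ hr.1 _ hds (by
      have : δ * slitSign j * (δ * P.quadR (lo P.k j)) =
        δ * δ * (slitSign j * P.quadR (lo P.k j)) := by ring
      rw [this, hδ2, one_mul]; exact hends.1),
    hval _ hr.2 _ hds' (by
      have : -(δ * slitSign j) * (δ * P.quadR (hi P.k j)) =
        -(δ * δ) * (slitSign j * P.quadR (hi P.k j)) := by ring
      rw [this, hδ2]; linarith [hends.2])]
  push_cast
  ring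

include hk hz in
/-- The number of zeros as an integral over the slits. -/
theorem Z_eq_integral (hc : P.c ≠ 0) (ha : P.a ≠ 0) (hg : P.gam ≠ 1) :
    (∀ j, IntervalIntegrable P.countIntegrand volume (lo P.k j) (hi P.k j)) ∧
      (P.Z : ℂ) = 2 + 1 / (2 * π * Complex.I) *
        ((∫ ξ in -(1 / P.k)..(-1 : ℝ), P.countIntegrand ξ) -
          ∫ ξ in (1 : ℝ)..(1 / P.k), P.countIntegrand ξ) := by
  have hmn : P.mb + P.na ≠ 0 :=
    mb_add_na_ne_zero fun h => hg ((gam_eq_one_iff hc ha).2 h)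
  have hπ : (π : ℂ) ≠ 0 := by exact_mod_cast Real.pi_ne_zero
  -- The two slits contribute `-2πiδ` times their signs, so the right side is `2 + 2δ`: zero for `δ
  -- = -1`, where `γ < 1`, and four for `δ = 1`, where `γ > 1`.
  have main : ∀ δ : ℝ, (δ = 1 ∨ δ = -1) → δ * P.crit.re < 0 → (P.Z : ℂ) = 2 + 2 * δ →
      (∀ j, IntervalIntegrable P.countIntegrand volume (lo P.k j) (hi P.k j)) ∧
      (P.Z : ℂ) = 2 + 1 / (2 * π * Complex.I) *
        ((∫ ξ in -(1 / P.k)..(-1 : ℝ), P.countIntegrand ξ) -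
          ∫ ξ in (1 : ℝ)..(1 / P.k), P.countIntegrand ξ) := by
    intro δ hδ hv hZ
    refine ⟨fun j => (integral_countIntegrand hk hz hδ hmn hv j).1, ?_⟩
    have h0 := (integral_countIntegrand hk hz hδ hmn hv 0).2
    have h1 := (integral_countIntegrand hk hz hδ hmn hv 1).2
    simp only [lo, hi, slitSign, if_true, one_ne_zero, if_false] at h0 h1
    rw [h0, h1, hZ]
    have := Complex.I_ne_zero
    push_cast
    field_simp
    ring
  rcases hg.lt_or_gt with h | h
  · refine main (-1) (Or.inr rfl) (by linarith [crit_re_pos hc ha h]) ?_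
    rw [Z_of_gam_le_one hk hz hc ha h.le]; norm_num
  · refine main 1 (Or.inl rfl) (by linarith [crit_re_neg hc ha h]) ?_
    rw [(Z_of_one_lt_gam hk hz hc ha h).2]; norm_num

/-! ### The degenerate case -/

include hk hz in
theorem psi_eq_of_gam_eq_one (hc : P.c ≠ 0) (ha : P.a ≠ 0) (hg : P.gam = 1) {ζ : ℂ}
    (h : ζ ∈ P.punctured) : P.psi ζ = P.b := by
  have h1 := (gam_eq_one_iff hc ha).1 hg
  rw [norm_mb, norm_na] at h1
  have h2 : ‖P.b‖ = ‖P.a‖ := mul_left_cancel₀ (norm_ne_zero_iff.2 hc) h1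
  rw [psi_eq hk hz ha h.2 (den_ne_zero hk hz hc ha hg.le h.1), Complex.normSq_eq_norm_sq,
    Complex.normSq_eq_norm_sq, h2]
  simp

-- For `γ = 1` and `mb + na ≠ 0` the number `crit = iρ` is imaginary, so `η^±` is a constant times
-- the real function `scale·quad ± ρ√|p₂|`. The product of the two signs is the quartic of
-- `exists_quartic_roots` with `t = ρ²`, which has two roots on each slit. If `ρ = 0`, the root of
-- `quad` on the slit is counted once on either side. If `mb + na = 0`, both `η^±` vanish exactly at
-- the two ends, which the open interval in the second set keeps from being counted twice.
include hk hz in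
theorem ncard_etaSide (hc : P.c ≠ 0) (ha : P.a ≠ 0) (hg : P.gam = 1) (j : Fin 2) :
    {ξ ∈ Icc (lo P.k j) (hi P.k j) | P.etaSide 1 ξ = 0}.ncard +
      {ξ ∈ Ioo (lo P.k j) (hi P.k j) | P.etaSide (-1) ξ = 0}.ncard = 2 := by
  have hlt := lo_lt_hi hk j
  have hs := scale_pos hk hz
  have hnorm := (gam_eq_one_iff hc ha).1 hg
  have hr : √|p2 P.k (lo P.k j)| = 0 ∧ √|p2 P.k (hi P.k j)| = 0 := by
    constructor <;> rw [p2_eq j] <;> simp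
  have hmem : ∀ ξ ∈ Icc (lo P.k j) (hi P.k j), ξ ∈ Ioo (lo P.k j) (hi P.k j) ∨
      ξ = lo P.k j ∨ ξ = hi P.k j := by
    intro ξ hξ
    rcases hξ.1.lt_or_eq with h1 | h1
    · rcases hξ.2.lt_or_eq with h2 | h2
      · exact Or.inl ⟨h1, h2⟩
      · exact Or.inr (Or.inr h2)
    · exact Or.inr (Or.inl h1.symm)
  by_cases hmn : P.mb + P.na = 0
  · have hA : P.A0 ≠ 0 := by
      rw [A0_eq, eq_neg_of_add_eq_zero_left hmn]
      intro h
      have : P.na = 0 := by linear_combination -h / 2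
      exact na_ne_zero hc ha this
    have e : ∀ σ ξ : ℝ, P.etaSide σ ξ = σ * Complex.I * (√|p2 P.k ξ| : ℝ) * P.A0 := by
      intro σ ξ; rw [etaSide_eq, hmn]; ring
    have h1 : {ξ ∈ Icc (lo P.k j) (hi P.k j) | P.etaSide 1 ξ = 0} = {lo P.k j, hi P.k j} := by
      ext ξ
      simp only [mem_ofPred_eq, mem_insert_iff, mem_singleton_iff]
      constructor
      · rintro ⟨hξ, h0⟩
        refine (hmem ξ hξ).resolve_left fun hξ' => ?_
        have h2 : ((√|p2 P.k ξ| : ℝ) : ℂ) ≠ 0 := by exact_mod_cast (sqrt_abs_p2_pos hk j hξ').ne'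
        rw [e] at h0
        refine mul_ne_zero (mul_ne_zero (mul_ne_zero ?_ Complex.I_ne_zero) h2) hA h0
        norm_num
      · rintro (rfl | rfl)
        · exact ⟨left_mem_Icc.2 hlt.le, by rw [e, hr.1]; simp⟩
        · exact ⟨right_mem_Icc.2 hlt.le, by rw [e, hr.2]; simp⟩
    have h2 : {ξ ∈ Ioo (lo P.k j) (hi P.k j) | P.etaSide (-1) ξ = 0} = ∅ := by
      refine eq_empty_of_forall_notMem fun ξ ⟨hξ', h0⟩ => ?_
      have h2 : ((√|p2 P.k ξ| : ℝ) : ℂ) ≠ 0 := by exact_mod_cast (sqrt_abs_p2_pos hk j hξ').ne'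
      rw [e] at h0
      refine mul_ne_zero (mul_ne_zero (mul_ne_zero ?_ Complex.I_ne_zero) h2) hA h0
      norm_num
    rw [h1, h2, ncard_pair hlt.ne, ncard_empty]
  · have hre : P.crit.re = 0 := by
      have h1 := crit_re (P := P)
      rw [hnorm, sub_self] at h1
      exact (mul_eq_zero.1 h1).resolve_right (by rwa [Complex.normSq_eq_zero])
    set ρ : ℝ := P.crit.im with hρ
    have hcrit : P.crit = ρ * Complex.I := by apply Complex.ext <;> simp [hre, hρ]
    have e : ∀ σ ξ : ℝ, P.etaSide σ ξ = 0 ↔ P.scale * P.quadR ξ + σ * ρ * √|p2 P.k ξ| = 0 := by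
      intro σ ξ
      rw [etaSide_eq_crit hmn, mul_eq_zero, or_iff_right hmn, hcrit]
      have : (P.scale : ℂ) * P.quadR ξ - σ * Complex.I * (ρ * Complex.I) * (√|p2 P.k ξ| : ℝ) =
          ((P.scale * P.quadR ξ + σ * ρ * √|p2 P.k ξ| : ℝ) : ℂ) := by
        push_cast
        linear_combination -(σ : ℂ) * ρ * (√|p2 P.k ξ| : ℝ) * Complex.I_sq
      rw [this, Complex.ofReal_eq_zero]
    have hset : {ξ ∈ Icc (lo P.k j) (hi P.k j) | P.etaSide 1 ξ = 0} =
        {ξ ∈ Ioo (lo P.k j) (hi P.k j) | P.etaSide 1 ξ = 0} := by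
      ext ξ
      simp only [mem_ofPred_eq]
      refine ⟨fun ⟨hξ, h0⟩ => ⟨(hmem ξ hξ).resolve_right fun h => ?_, h0⟩,
        fun h => ⟨Ioo_subset_Icc_self h.1, h.2⟩⟩
      have hr0 : √|p2 P.k ξ| = 0 := by rcases h with rfl | rfl; exacts [hr.1, hr.2]
      rw [e, hr0, mul_zero, add_zero] at h0
      exact mul_ne_zero hs.ne' (quadR_ne_zero_of_p2 hk hz hξ hr0) h0
    rw [hset]
    obtain ⟨x₀, h0, x₁, h1, hc3, hq⟩ := exists_quad_roots hk hz
    have hk1 := one_lt_inv hk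
    simp only [lo, hi, if_true, one_ne_zero, if_false] at h0 h1
    have hx : ∃ x ∈ Ioo (lo P.k j) (hi P.k j), ∀ ξ ∈ Ioo (lo P.k j) (hi P.k j),
        P.quadR ξ = 0 ↔ ξ = x := by
      have hgen : ∀ ξ, P.quadR ξ = 0 ↔ ξ = x₀ ∨ ξ = x₁ := by
        intro ξ
        rw [hq, mul_eq_zero, mul_eq_zero, or_iff_right hc3.ne, sub_eq_zero, sub_eq_zero]
      fin_cases j
      · refine ⟨x₀, by simpa [lo, hi] using h0, fun ξ hξ => ?_⟩
        have hξ : ξ < -1 := by simpa [hi] using hξ.2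
        rw [hgen, or_iff_left (by linarith [h1.1])]
      · refine ⟨x₁, by simpa [lo, hi] using h1, fun ξ hξ => ?_⟩
        have hξ : 1 < ξ := by simpa [lo] using hξ.1
        rw [hgen, or_iff_right (by linarith [h0.2])]
    by_cases hρ0 : ρ = 0
    · obtain ⟨x, hx, hxq⟩ := hx
      have h2 : ∀ σ : ℝ, {ξ ∈ Ioo (lo P.k j) (hi P.k j) | P.etaSide σ ξ = 0} = {x} := by
        intro σ
        ext ξ
        simp only [mem_ofPred_eq, mem_singleton_iff, e, hρ0, mul_zero, zero_mul, add_zero,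
          mul_eq_zero, hs.ne', false_or]
        exact ⟨fun h => (hxq ξ h.1).1 h.2, fun h => ⟨h ▸ hx, (hxq ξ (h ▸ hx)).2 h⟩⟩
      rw [h2, h2, ncard_singleton]
    · obtain ⟨r₁, m1, r₂, m2, r₃, m3, r₄, m4, hroots⟩ := exists_quartic_roots
        (c := P.scale * P.coef3 1) (t := ρ ^ 2) h0.1 h0.2 (by norm_num : (-1 : ℝ) < 1) h1.1 h1.2
        (mul_ne_zero hs.ne' hc3.ne) (by positivity)
      have hroot : ∀ ξ : ℝ, (P.scale * P.quadR ξ) ^ 2 + ρ ^ 2 * p2 P.k ξ = 0 ↔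
          ξ = r₁ ∨ ξ = r₂ ∨ ξ = r₃ ∨ ξ = r₄ := by
        intro ξ
        have h2 := hroots ξ
        norm_cast at h2
        rw [show ((Int.negSucc 0 : ℤ) : ℝ) = -1 by norm_num] at h2
        rw [← h2, hq]
        have e : (P.scale * (P.coef3 1 * (ξ - x₀) * (ξ - x₁))) ^ 2 + ρ ^ 2 * p2 P.k ξ =
          (P.scale * P.coef3 1 * (ξ - x₀) * (ξ - x₁)) ^ 2 +
            ρ ^ 2 * ((ξ - -(1 / P.k)) * (ξ - -1) * (ξ - 1) * (ξ - 1 / P.k)) := by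
          rw [p2]; ring
        rw [e]
      have hfin : ∀ σ : ℝ, {ξ ∈ Ioo (lo P.k j) (hi P.k j) | P.etaSide σ ξ = 0} ⊆
          Ioo (lo P.k j) (hi P.k j) := fun σ ξ h => h.1
      have hfac : ∀ ξ ∈ Ioo (lo P.k j) (hi P.k j),
          (P.etaSide 1 ξ = 0 ∨ P.etaSide (-1) ξ = 0) ↔ ξ = r₁ ∨ ξ = r₂ ∨ ξ = r₃ ∨ ξ = r₄ := by
        intro ξ hξ
        rw [← hroot, e, e, ← mul_eq_zero]
        have h3 : √|p2 P.k ξ| ^ 2 = -p2 P.k ξ := by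
          rw [Real.sq_sqrt (abs_nonneg _), abs_of_neg (p2_neg hk j hξ)]
        have h4 : (P.scale * P.quadR ξ + 1 * ρ * √|p2 P.k ξ|) *
            (P.scale * P.quadR ξ + -1 * ρ * √|p2 P.k ξ|) =
            (P.scale * P.quadR ξ) ^ 2 + ρ ^ 2 * p2 P.k ξ := by
          linear_combination -ρ ^ 2 * h3
        rw [h4]
      have hpair : ∃ y₁ y₂ : ℝ, y₁ ≠ y₂ ∧
          {ξ ∈ Ioo (lo P.k j) (hi P.k j) | P.etaSide 1 ξ = 0} ∪
            {ξ ∈ Ioo (lo P.k j) (hi P.k j) | P.etaSide (-1) ξ = 0} = {y₁, y₂} := by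
        have hu : {ξ ∈ Ioo (lo P.k j) (hi P.k j) | P.etaSide 1 ξ = 0} ∪
            {ξ ∈ Ioo (lo P.k j) (hi P.k j) | P.etaSide (-1) ξ = 0} =
            {ξ ∈ Ioo (lo P.k j) (hi P.k j) | ξ = r₁ ∨ ξ = r₂ ∨ ξ = r₃ ∨ ξ = r₄} := by
          ext ξ
          simp only [mem_union, mem_ofPred_eq, ← and_or_left]
          exact ⟨fun h => ⟨h.1, (hfac ξ h.1).1 h.2⟩, fun h => ⟨h.1, (hfac ξ h.1).2 h.2⟩⟩
        rw [hu]
        fin_cases j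
        · refine ⟨r₁, r₂, (m1.2.trans m2.1).ne, ?_⟩
          ext ξ
          simp only [lo, hi, Fin.zero_eta, if_true, mem_ofPred_eq, mem_insert_iff,
            mem_singleton_iff, mem_Ioo]
          constructor
          · rintro ⟨hξ, h | h | h | h⟩
            · exact Or.inl h
            · exact Or.inr h
            · linarith [m3.1]
            · linarith [m4.1, h1.1]
          · rintro (h | h)
            · exact ⟨⟨by linarith [m1.1], by linarith [m1.2, h0.2]⟩, Or.inl h⟩
            · exact ⟨⟨by linarith [m2.1, h0.1], by linarith [m2.2]⟩, Or.inr (Or.inl h)⟩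
        · refine ⟨r₃, r₄, (m3.2.trans m4.1).ne, ?_⟩
          ext ξ
          simp only [lo, hi, Fin.mk_one, one_ne_zero, if_false, mem_ofPred_eq, mem_insert_iff,
            mem_singleton_iff, mem_Ioo]
          constructor
          · rintro ⟨hξ, h | h | h | h⟩
            · linarith [m1.2, h0.2]
            · linarith [m2.2]
            · exact Or.inl h
            · exact Or.inr h
          · rintro (h | h)
            · exact ⟨⟨by linarith [m3.1], by linarith [m3.2, h1.2]⟩, Or.inr (Or.inr (Or.inl h))⟩
            · exact ⟨⟨by linarith [m4.1, h1.1], by linarith [m4.2]⟩,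
                Or.inr (Or.inr (Or.inr h))⟩
      obtain ⟨y₁, y₂, hy, hU⟩ := hpair
      have hUf : ({y₁, y₂} : Set ℝ).Finite := by simp
      rw [← ncard_union_eq ?_ (hUf.subset (hU ▸ subset_union_left))
        (hUf.subset (hU ▸ subset_union_right)), hU, ncard_pair hy]
      refine Set.disjoint_left.2 fun ξ h2 h3 => ?_
      have h4 := (e _ _).1 h2.2
      have h5 := (e _ _).1 h3.2
      exact mul_ne_zero hρ0 (sqrt_abs_p2_pos hk j h2.1).ne' (by linarith)

end Data

/-! ### Smooth paths -/

/-- Two points of a connected open set are the ends of a `C¹` path in the set which is constant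
outside the unit interval. -/
theorem exists_contDiff_path {U : Set ℂ} (hU : IsOpen U) (hc : IsPreconnected U) {x y : ℂ}
    (hx : x ∈ U) (hy : y ∈ U) : ∃ q : ℝ → ℂ, ContDiff ℝ 1 q ∧ (∀ t, q t ∈ U) ∧
      (∀ t ≤ 0, q t = x) ∧ ∀ t, 1 ≤ t → q t = y := by
  refine hc.induction₂ (fun x y => ∃ q : ℝ → ℂ, ContDiff ℝ 1 q ∧ (∀ t, q t ∈ U) ∧
      (∀ t ≤ 0, q t = x) ∧ ∀ t, 1 ≤ t → q t = y) ?_ ?_ ?_ hx hy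
  · intro x hx
    obtain ⟨ε, hε, hb⟩ := Metric.isOpen_iff.1 hU x hx
    filter_upwards [mem_nhdsWithin_of_mem_nhds (Metric.ball_mem_nhds x hε)] with y hy
    refine ⟨fun t => x + (Real.smoothTransition t : ℝ) * (y - x), ?_, fun t => hb ?_,
      fun t ht => ?_, fun t ht => ?_⟩
    · exact contDiff_const.add
        ((Complex.ofRealCLM.contDiff.comp (Real.smoothTransition.contDiff (n := 1))).mul
          contDiff_const)
    · rw [Metric.mem_ball, dist_eq_norm] at hy ⊢
      rw [add_sub_cancel_left, norm_mul, Complex.norm_real, Real.norm_of_nonneg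
        (Real.smoothTransition.nonneg t)]
      exact (mul_le_of_le_one_left (norm_nonneg _) (Real.smoothTransition.le_one t)).trans_lt hy
    · simp [Real.smoothTransition.zero_of_nonpos ht]
    · simp [Real.smoothTransition.one_of_one_le ht]
  · rintro x y z - - - ⟨q₁, c₁, m₁, a₁, b₁⟩ ⟨q₂, c₂, m₂, a₂, b₂⟩
    -- At every `t` one of the two paths rests at the common point `y`, so the sum is a smooth
    -- concatenation and no gluing is needed.
    refine ⟨fun t => q₁ (2 * t) + q₂ (2 * t - 1) - y, ?_, fun t => ?_, fun t ht => ?_,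
      fun t ht => ?_⟩
    · exact ((c₁.comp (contDiff_const.mul contDiff_id)).add
        (c₂.comp ((contDiff_const.mul contDiff_id).sub contDiff_const))).sub contDiff_const
    · beta_reduce
      rcases le_total t (1 / 2) with h | h
      · rw [a₂ (2 * t - 1) (by linarith), add_sub_cancel_right]; exact m₁ _
      · rw [b₁ (2 * t) (by linarith), add_sub_cancel_left]; exact m₂ _
    · simp only
      rw [a₁ _ (by linarith), a₂ _ (by linarith), add_sub_cancel_right]
    · simp only
      rw [b₁ _ (by linarith), b₂ _ (by linarith), add_sub_cancel_left]
  · rintro x y - - ⟨q, c, m, a, b⟩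
    exact ⟨fun t => q (1 - t), c.comp (contDiff_const.sub contDiff_id), fun t => m _,
      fun t ht => b _ (by linarith), fun t ht => a _ (by linarith)⟩

/-! ### The elliptic map as `α u + β H + C` -/

namespace Data

variable {P : Data}

variable (P) in
/-- The coefficient of `u` in the map. -/
def alph : ℂ := (P.na - P.mb) / (2 * conj P.a)

variable (P) in
/-- The coefficient of the primitive of `g` in the map. -/
def bet : ℂ := (P.mb + P.na) / (2 * conj P.a)

theorem conj_a_ne_zero (ha : P.a ≠ 0) : conj P.a ≠ 0 := by simpa using ha

theorem alph_add_bet (ha : P.a ≠ 0) : P.alph + P.bet = P.c := by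
  have := conj_a_ne_zero ha
  rw [alph, bet, na]; field_simp; ring

/-- This is where `γ` enters the geometry of the map: the sign of the right side is that of `1 - γ`.
-/
theorem re_alph_mul_conj_bet : (P.alph * conj P.bet).re =
    (‖P.na‖ ^ 2 - ‖P.mb‖ ^ 2) / (4 * Complex.normSq P.a) := by
  have h : P.alph * conj P.bet = ((P.na - P.mb) * conj (P.mb + P.na)) /
      ((4 * Complex.normSq P.a : ℝ) : ℂ) := by
    rw [alph, bet, map_div₀, div_mul_div_comm]
    congr 1
    have := Complex.mul_conj P.a
    push_cast
    rw [← this]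
    simp only [map_mul, Complex.conj_conj, Complex.conj_ofNat]
    ring
  rw [h, Complex.div_ofReal_re, ← Complex.normSq_eq_norm_sq, ← Complex.normSq_eq_norm_sq]
  congr 1
  simp [Complex.normSq_apply]; ring

theorem re_alph_nonneg (hc : P.c ≠ 0) (ha : P.a ≠ 0) (hg : P.gam ≤ 1) :
    0 ≤ (P.alph * conj P.bet).re := by
  have h := (gam_le_one_iff hc ha).1 hg
  rw [re_alph_mul_conj_bet]
  have h1 := Complex.normSq_nonneg P.a
  exact div_nonneg (sub_nonneg.2 (pow_le_pow_left₀ (norm_nonneg _) h 2)) (by positivity)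

theorem re_alph_pos (hc : P.c ≠ 0) (ha : P.a ≠ 0) (hg : P.gam < 1) :
    0 < (P.alph * conj P.bet).re := by
  have h := (gam_lt_one_iff hc ha).1 hg
  rw [re_alph_mul_conj_bet]
  have h1 := Complex.normSq_pos.2 ha
  exact div_pos (sub_pos.2 (pow_lt_pow_left₀ h (norm_nonneg _) two_ne_zero)) (by positivity)

variable (hk : P.k ∈ Ioo (0 : ℝ) 1) (hz : P.zinf ∈ Ioo (-1 : ℝ) 1)

local notation "S" => inverseSlits hk hz

variable (P) in
/-- The map with additive constant `C`. -/
def wmap (C ζ : ℂ) : ℂ := (S).imap P.alph P.bet C (1 / (ζ - P.zinf))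

include hk in
theorem isOpen_punctured : IsOpen P.punctured :=
  (isOpen_slitDomain hk).sdiff isClosed_singleton

include hk hz in
theorem isPreconnected_punctured : IsPreconnected P.punctured := by
  obtain ⟨x, h1, h2⟩ := exists_between hz.1
  have hk1 := one_lt_inv hk
  have : P.punctured = univ \ (slit P.k 0 ∪ slit P.k 1 ∪ {(P.zinf : ℂ)}) := by
    ext ζ; simp [punctured, slitDomain, not_or, and_assoc]; tauto
  rw [this]
  refine isPreconnected_diff_of_real convex_univ isOpen_univ ?_ (x₀ := (x : ℂ)) (mem_univ _) ?_
    (by simp)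
  · rintro w ((⟨ξ, -, rfl⟩ | ⟨ξ, -, rfl⟩) | h)
    · simp
    · simp
    · rw [mem_singleton_iff.1 h]; simp
  · rintro ((⟨ξ, hξ, h⟩ | ⟨ξ, hξ, h⟩) | h)
    · have h : ξ = x := Complex.ofReal_injective h
      have := hξ.2
      simp only [hi, if_true] at this; linarith
    · have h : ξ = x := Complex.ofReal_injective h
      have := hξ.1
      simp only [lo, one_ne_zero, if_false] at this; linarith [hz.2]
    · have h : x = P.zinf := by exact_mod_cast mem_singleton_iff.1 h
      linarith

theorem hasDerivAt_wmap (C : ℂ) {ζ : ℂ} (h : ζ ∈ P.punctured) :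
    HasDerivAt (P.wmap hk hz C) (P.omegaDeriv ζ) ζ := by
  have h1 := (closed hk hz).hasDerivAt_imap (α := P.alph) (β := P.bet) (C := C)
    (inv_notMem_slits hk hz h)
  have h2 := h1.comp ζ (hasDerivAt_one_div_sub h.2)
  refine h2.congr_deriv ?_
  rw [omegaDeriv_eq hk hz, comb, G_eq hk hz h, A0_eq, alph, bet]
  generalize (S).g (1 / (ζ - P.zinf)) = w
  rw [one_div_pow]
  ring

theorem integral_ellipticIntegrand (C : ℂ) (ha : P.a ≠ 0) {q : ℝ → ℂ} (hq : ContDiff ℝ 1 q)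
    (hm : ∀ t ∈ Icc (0 : ℝ) 1, q t ∈ P.punctured) :
    ∫ t in (0 : ℝ)..1, P.ellipticIntegrand (q t) * deriv q t =
      (2 * conj P.a * P.wmap hk hz C (q 1) + P.A0 / (q 1 - P.zinf)) -
        (2 * conj P.a * P.wmap hk hz C (q 0) + P.A0 / (q 0 - P.zinf)) := by
  have ha' := conj_a_ne_zero ha
  have hder : ∀ ζ ∈ P.punctured, HasDerivAt
      (fun ζ => 2 * conj P.a * P.wmap hk hz C ζ + P.A0 / (ζ - P.zinf)) (P.ellipticIntegrand ζ) ζ := by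
    intro ζ hζ
    have h1 := ((hasDerivAt_wmap hk hz C hζ).const_mul (2 * conj P.a)).add
      ((hasDerivAt_one_div_sub hζ.2).const_mul P.A0)
    have hne : ζ - P.zinf ≠ 0 := sub_ne_zero.2 hζ.2
    have hb := branch_ne_zero hk hζ.1
    refine (h1.congr_deriv ?_).congr_of_eventuallyEq (Eventually.of_forall fun w => ?_)
    · rw [omegaDeriv, ellipticIntegrand]
      field_simp
      ring
    · simp only [Pi.add_apply]
      rw [mul_one_div]
  have hcont : ContinuousOn (fun t => P.ellipticIntegrand (q t) * deriv q t) (Icc (0 : ℝ) 1) := by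
    have h0 : ContinuousOn P.ellipticIntegrand P.punctured := by
      intro ζ hζ
      have hb := (differentiableAt_branch hk hζ.1).continuousAt
      have hne : (ζ - P.zinf) ^ 2 * branch P.k ζ ≠ 0 :=
        mul_ne_zero (pow_ne_zero _ (sub_ne_zero.2 hζ.2)) (branch_ne_zero hk hζ.1)
      have h1 : ContinuousAt (fun ζ : ℂ => (P.A1 + P.A2 * ζ + P.A3 * ζ ^ 2) /
          ((ζ - P.zinf) ^ 2 * branch P.k ζ)) ζ := ContinuousAt.div (by fun_prop) (by fun_prop) hne
      exact h1.continuousWithinAt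
    exact (h0.comp hq.continuous.continuousOn hm).mul (hq.continuous_deriv le_rfl).continuousOn
  rw [← intervalIntegral.integral_eq_sub_of_hasDerivAt (f := fun t =>
    2 * conj P.a * P.wmap hk hz C (q t) + P.A0 / (q t - P.zinf))]
  · intro t ht
    rw [uIcc_of_le zero_le_one] at ht
    exact (hder _ (hm t ht)).comp_of_eq t ((hq.differentiable one_ne_zero) t).hasDerivAt rfl
  · rw [← uIcc_of_le (zero_le_one' ℝ)] at hcont
    exact hcont.intervalIntegrable

/-- The map is given by the elliptic integral. -/
theorem exists_isEllipticMap (ha : P.a ≠ 0) (ζ₀ B : ℂ) :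
    ∃ C : ℂ, P.IsEllipticMap ζ₀ B (P.wmap hk hz C) := by
  have ha' := conj_a_ne_zero ha
  refine ⟨B - P.wmap hk hz 0 ζ₀ - P.A0 / (ζ₀ - P.zinf) / (2 * conj P.a), fun q hq hm h0 => ?_⟩
  have hC : ∀ C ζ, P.wmap hk hz C ζ = P.wmap hk hz 0 ζ + C := by
    intro C ζ; simp [wmap, TwoSlits.imap]
  rw [integral_ellipticIntegrand hk hz 0 ha hq hm, hC, h0]
  generalize P.A0 / (ζ₀ - P.zinf) = r
  generalize P.A0 / (q 1 - P.zinf) = r'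
  field_simp
  ring

include hk hz in
theorem IsEllipticMap.eqOn {ζ₀ B : ℂ} {ω ω' : ℂ → ℂ} (h : P.IsEllipticMap ζ₀ B ω)
    (h' : P.IsEllipticMap ζ₀ B ω') (h0 : ζ₀ ∈ P.punctured) : EqOn ω' ω P.punctured := by
  intro ζ hζ
  obtain ⟨q, c, m, a, b⟩ := exists_contDiff_path (isOpen_punctured hk)
    (isPreconnected_punctured hk hz) h0 hζ
  have e := h q c (fun t _ => m t) (a 0 le_rfl)
  have e' := h' q c (fun t _ => m t) (a 0 le_rfl)
  rw [← b 1 le_rfl, e, e']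

theorem wmap_expansion (ha : P.a ≠ 0) (C : ℂ) : ∃ g : ℂ → ℂ, AnalyticAt ℂ g P.zinf ∧
    ∀ᶠ ζ in 𝓝[≠] (P.zinf : ℂ), P.wmap hk hz C ζ = P.c / (ζ - P.zinf) + g ζ := by
  obtain ⟨δ, hδ, K, -, hK, h⟩ := exists_H_expansion hk hz
  refine ⟨fun ζ => P.bet * K ζ + C, (analyticAt_const.mul hK).add analyticAt_const, ?_⟩
  filter_upwards [mem_nhdsWithin_of_mem_nhds (Metric.ball_mem_nhds _ hδ), self_mem_nhdsWithin]
    with ζ h1 h2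
  rw [wmap, TwoSlits.imap, h ζ h1 h2, ← alph_add_bet ha]
  ring

theorem tendsto_wmap_cocompact (C : ℂ) :
    Tendsto (P.wmap hk hz C) (cocompact ℂ) (𝓝 ((S).imap P.alph P.bet C 0)) :=
  ((closed hk hz).hasDerivAt_imap (S).zero_notMem_slits).continuousAt.tendsto.comp
    (tendsto_inv_sub_cocompact _)

theorem elasticDomain_wmap (C : ℂ) : P.elasticDomain (P.wmap hk hz C)
    ((S).imap P.alph P.bet C 0) = (S).imap P.alph P.bet C '' (S).slitsᶜ := by
  ext w
  constructor
  · rintro (rfl | ⟨ζ, hζ, rfl⟩)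
    · exact ⟨0, (S).zero_notMem_slits, rfl⟩
    · exact ⟨_, inv_notMem_slits hk hz hζ, rfl⟩
  · rintro ⟨u, hu, rfl⟩
    by_cases h0 : u = 0
    · left; rw [h0]
    · refine Or.inr ⟨_, add_inv_mem_punctured hk hz hu h0, ?_⟩
      rw [wmap, add_sub_cancel_left, one_div_one_div]

theorem wmap_injOn (hc : P.c ≠ 0) (ha : P.a ≠ 0) (hg : P.gam ≤ 1) (C : ℂ) :
    InjOn (P.wmap hk hz C) P.punctured ∧
      (S).imap P.alph P.bet C 0 ∉ P.wmap hk hz C '' P.punctured := by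
  have hinj := (closed hk hz).imap_injOn (C := C) (by rwa [alph_add_bet ha])
    (re_alph_nonneg hc ha hg)
  constructor
  · intro ζ₁ h1 ζ₂ h2 h
    have := hinj (inv_notMem_slits hk hz h1) (inv_notMem_slits hk hz h2) h
    rw [one_div, one_div, inv_inj] at this
    linear_combination this
  · rintro ⟨ζ, hζ, h⟩
    have := hinj (inv_notMem_slits hk hz hζ) (S).zero_notMem_slits h
    exact one_div_ne_zero (sub_ne_zero.2 hζ.2) this

/-! ### The contours -/

theorem slit_interval (j : Fin 2) : (j = 0 ∧ 1 / (hi P.k j - P.zinf) = (S).a₀ ∧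
      1 / (lo P.k j - P.zinf) = (S).b₀) ∨
    (j = 1 ∧ 1 / (hi P.k j - P.zinf) = (S).a₁ ∧ 1 / (lo P.k j - P.zinf) = (S).b₁) := by
  fin_cases j
  · exact Or.inl ⟨rfl, rfl, rfl⟩
  · exact Or.inr ⟨rfl, rfl, rfl⟩

include hk in
theorem loopPoint_mem (j : Fin 2) (θ : ℝ) : loopPoint P.k j θ ∈ Icc (lo P.k j) (hi P.k j) := by
  have h := lo_lt_hi hk j
  have h1 := Real.neg_one_le_cos θ
  have h2 := Real.cos_le_one θ
  rw [loopPoint]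
  constructor <;> nlinarith

include hk in
theorem loopPoint_mem_Ioo (j : Fin 2) {θ : ℝ} (hθ : Real.sin θ ≠ 0) :
    loopPoint P.k j θ ∈ Ioo (lo P.k j) (hi P.k j) := by
  have h := lo_lt_hi hk j
  have h3 := Real.sin_sq_add_cos_sq θ
  have h4 : 0 < Real.sin θ ^ 2 := by positivity
  have h1 : -1 < Real.cos θ := by nlinarith [Real.neg_one_le_cos θ]
  have h2 : Real.cos θ < 1 := by nlinarith [Real.cos_le_one θ]
  rw [loopPoint]
  constructor <;> nlinarith

theorem loopPoint_end (j : Fin 2) {θ : ℝ} (hθ : Real.sin θ = 0) :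
    loopPoint P.k j θ = lo P.k j ∨ loopPoint P.k j θ = hi P.k j := by
  have h3 := Real.sin_sq_add_cos_sq θ
  rw [hθ] at h3
  have : (Real.cos θ - 1) * (Real.cos θ + 1) = 0 := by nlinarith
  rcases mul_eq_zero.1 this with h | h
  · right; rw [loopPoint, sub_eq_zero.1 h]; ring
  · left; rw [loopPoint, eq_neg_of_add_eq_zero_left h]; ring

variable (P) in
/-- The point of the loop in the plane of `u = 1 / (ζ - ζ_∞)`. -/
def loopU (j : Fin 2) (θ : ℝ) : ℝ := 1 / (loopPoint P.k j θ - P.zinf)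

/-- The side of the real axis in the plane of `u` which corresponds to the point of the loop. -/
def loopSide (θ : ℝ) : Bool := decide (Real.sin θ < 0)

variable (P) in
/-- The contour. -/
def contour (C : ℂ) (j : Fin 2) (θ : ℝ) : ℂ :=
  (S).bmap P.alph P.bet C (loopSide θ) (P.loopU j θ)

theorem loopU_mem (j : Fin 2) (θ : ℝ) :
    (j = 0 ∧ P.loopU j θ ∈ Icc (S).a₀ (S).b₀) ∨ (j = 1 ∧ P.loopU j θ ∈ Icc (S).a₁ (S).b₁) := by
  have h := (inv_mem_Icc_iff hk hz j (ne_zinf_of_mem hk hz j (loopPoint_mem hk j θ))).2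
    (loopPoint_mem hk j θ)
  rcases slit_interval hk hz j with ⟨h1, h2, h3⟩ | ⟨h1, h2, h3⟩
  · rw [h2, h3] at h; exact Or.inl ⟨h1, h⟩
  · rw [h2, h3] at h; exact Or.inr ⟨h1, h⟩

theorem quartic_loopU {j : Fin 2} {θ : ℝ} (hθ : Real.sin θ ≠ 0) :
    (S).quartic (P.loopU j θ) ≠ 0 := (gUp_im_inv hk hz j (loopPoint_mem_Ioo hk j hθ)).1

theorem loopU_mem_Ioo {j : Fin 2} {θ : ℝ} (hθ : Real.sin θ ≠ 0) :
    P.loopU j θ ∈ Ioo (S).a₀ (S).b₀ ∨ P.loopU j θ ∈ Ioo (S).a₁ (S).b₁ := by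
  have hq := quartic_loopU hk hz (j := j) hθ
  have hI : ∀ a b x : ℝ, x ∈ Icc a b → x ≠ a → x ≠ b → x ∈ Ioo a b := fun a b x h h1 h2 =>
    ⟨lt_of_le_of_ne h.1 (Ne.symm h1), lt_of_le_of_ne h.2 h2⟩
  rcases loopU_mem hk hz j θ with h | h
  · refine Or.inl (hI _ _ _ h.2 ?_ ?_) <;> intro e <;> apply hq <;> simp [TwoSlits.quartic, e]
  · refine Or.inr (hI _ _ _ h.2 ?_ ?_) <;> intro e <;> apply hq <;> simp [TwoSlits.quartic, e]

theorem Y_end {j : Fin 2} {θ : ℝ} (hθ : Real.sin θ = 0) : (S).Y (P.loopU j θ) = 0 := by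
  have hb : (S).Y (S).b₀ = 0 := (S).Y_of_mem_gap ⟨le_rfl, ((S).neg.trans (S).pos).le⟩
  have ha : (S).Y (S).a₁ = 0 := (S).Y_of_mem_gap ⟨((S).neg.trans (S).pos).le, le_rfl⟩
  rw [loopU]
  rcases loopPoint_end (P := P) j hθ with h | h <;> rw [h] <;>
    rcases slit_interval hk hz j with ⟨-, h2, h3⟩ | ⟨-, h2, h3⟩
  · rw [h3, hb]
  · rw [h3, Y_b₁]
  · rw [h2, Y_a₀]
  · rw [h2, ha]

theorem ofReal_mem_closedHalf (s : Bool) (x : ℝ) : (x : ℂ) ∈ TwoSlits.closedHalf s := by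
  cases s <;> simp [TwoSlits.closedHalf]

/-- At the ends of a slit `Y = 0`, so there either side gives the same point; elsewhere the upper
side of the slit corresponds to the lower half-plane of `u`. -/
theorem contour_eq (C : ℂ) {j : Fin 2} {θ : ℝ} {s : Bool} (h1 : 0 < Real.sin θ → s = false)
    (h2 : Real.sin θ < 0 → s = true) :
    P.contour hk hz C j θ = (S).bmap P.alph P.bet C s (P.loopU j θ) := by
  rcases lt_trichotomy (Real.sin θ) 0 with h | h | h
  · rw [contour, loopSide, decide_eq_true h, h2 h]
  · rw [contour, TwoSlits.bmap, TwoSlits.bmap, TwoSlits.side_ofReal, TwoSlits.side_ofReal,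
      Y_end hk hz h]
    simp
  · rw [contour, loopSide, decide_eq_false h.not_gt, h1 h]

theorem isContour (C : ℂ) (j : Fin 2) : IsContour P.k j (P.wmap hk hz C) (P.contour hk hz C j) := by
  intro θ
  set x := loopPoint P.k j θ with hx
  have hxz : x ≠ P.zinf := ne_zinf_of_mem hk hz j (loopPoint_mem hk j θ)
  have hxz' : (x : ℂ) ≠ P.zinf := by exact_mod_cast hxz
  have hinv : ContinuousAt (fun ζ : ℂ => 1 / (ζ - P.zinf)) x :=
    (hasDerivAt_one_div_sub hxz').continuousAt
  have hval : (1 / ((x : ℂ) - P.zinf)) = (P.loopU j θ : ℝ) := by rw [loopU]; push_cast; rfl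
  have key : ∀ s : Bool, (0 < Real.sin θ → s = false) → (Real.sin θ < 0 → s = true) →
      Tendsto (P.wmap hk hz C)
        (𝓝[{ζ | ζ ∈ slitDomain P.k ∧ 1 / (ζ - P.zinf) ∈ TwoSlits.closedHalf s}] (x : ℂ))
        (𝓝 (P.contour hk hz C j θ)) := by
    intro s h1 h2
    rw [contour_eq hk hz C h1 h2]
    have hb := (S).continuousOn_bmap P.alph P.bet C s (P.loopU j θ) (ofReal_mem_closedHalf s _)
    have ht : Tendsto (fun ζ : ℂ => 1 / (ζ - P.zinf))
        (𝓝[{ζ | ζ ∈ slitDomain P.k ∧ 1 / (ζ - P.zinf) ∈ TwoSlits.closedHalf s}] (x : ℂ))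
        (𝓝[TwoSlits.closedHalf s] (P.loopU j θ : ℂ)) := by
      refine tendsto_nhdsWithin_iff.2 ⟨?_, ?_⟩
      · rw [← hval]; exact hinv.tendsto.mono_left nhdsWithin_le_nhds
      · filter_upwards [self_mem_nhdsWithin] with ζ hζ using hζ.2
    refine (hb.tendsto.comp ht).congr' ?_
    filter_upwards [self_mem_nhdsWithin,
      mem_nhdsWithin_of_mem_nhds (isOpen_ne.mem_nhds hxz')] with ζ hζ hne
    exact ((closed hk hz).imap_eq_bmap (inv_notMem_slits hk hz ⟨hζ.1, hne⟩) hζ.2).symm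
  have him : ∀ ζ : ℂ, 0 ≤ ζ.im → 1 / (ζ - P.zinf) ∈ TwoSlits.closedHalf false := by
    intro ζ h
    change (1 / (ζ - P.zinf)).im ≤ 0
    rw [inv_sub_im]
    exact div_nonpos_of_nonpos_of_nonneg (by linarith) (Complex.normSq_nonneg _)
  have him' : ∀ ζ : ℂ, ζ.im ≤ 0 → 1 / (ζ - P.zinf) ∈ TwoSlits.closedHalf true := by
    intro ζ h
    change 0 ≤ (1 / (ζ - P.zinf)).im
    rw [inv_sub_im]
    exact div_nonneg (by linarith) (Complex.normSq_nonneg _)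
  rcases lt_trichotomy (Real.sin θ) 0 with h | h | h
  · refine (key true (fun h' => absurd h h'.not_gt) fun _ => rfl).mono_left
      (nhdsWithin_mono _ fun ζ hζ => ⟨hζ.1, him' ζ ?_⟩)
    have := hζ.2 h.ne
    nlinarith
  · have h1 := key true (fun h' => absurd h h'.ne') fun _ => rfl
    have h2 := key false (fun _ => rfl) fun h' => absurd h h'.ne
    refine (h1.sup h2).mono_left ?_
    rw [← nhdsWithin_union]
    refine nhdsWithin_mono _ fun ζ hζ => ?_
    rcases le_total 0 ζ.im with h3 | h3
    · exact Or.inr ⟨hζ.1, him ζ h3⟩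
    · exact Or.inl ⟨hζ.1, him' ζ h3⟩
  · refine (key false (fun _ => rfl) fun h' => absurd h h'.not_gt).mono_left
      (nhdsWithin_mono _ fun ζ hζ => ⟨hζ.1, him ζ ?_⟩)
    have := hζ.2 h.ne'
    nlinarith

theorem range_contour (C : ℂ) (j : Fin 2) : range (P.contour hk hz C j) =
    (S).contourSet P.alph P.bet C (1 / (hi P.k j - P.zinf)) (1 / (lo P.k j - P.zinf)) := by
  ext w
  constructor
  · rintro ⟨θ, rfl⟩
    exact ⟨_, _, (inv_mem_Icc_iff hk hz j (ne_zinf_of_mem hk hz j (loopPoint_mem hk j θ))).2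
      (loopPoint_mem hk j θ), rfl⟩
  · rintro ⟨s, x, hx, rfl⟩
    have hlt := lo_lt_hi hk j
    have hx0 : x ≠ 0 := by
      rintro rfl
      rcases zinf_cases hk hz j with h | h
      · have : 1 / (lo P.k j - P.zinf) < 0 := one_div_neg.2 (by linarith)
        linarith [hx.2]
      · have : 0 < 1 / (hi P.k j - P.zinf) := one_div_pos.2 (by linarith)
        linarith [hx.1]
    set ξ := P.zinf + 1 / x with hξ
    have hξz : ξ ≠ P.zinf := by simpa [hξ] using hx0
    have hxe : x = 1 / (ξ - P.zinf) := by rw [hξ, add_sub_cancel_left, one_div_one_div]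
    rw [hxe, inv_mem_Icc_iff hk hz j hξz] at hx
    set r := (2 * ξ - lo P.k j - hi P.k j) / (hi P.k j - lo P.k j) with hr
    have hd : 0 < hi P.k j - lo P.k j := by linarith
    have hr1 : -1 ≤ r := by rw [hr, le_div_iff₀ hd]; linarith [hx.1]
    have hr2 : r ≤ 1 := by rw [hr, div_le_one hd]; linarith [hx.2]
    have hlp : ∀ θ, Real.cos θ = r → P.loopU j θ = x := by
      intro θ hθ
      rw [loopU, loopPoint, hθ, hxe, hr]
      congr 2
      field_simp
      ring
    have hsin : 0 ≤ Real.sin (Real.arccos r) := by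
      rw [Real.sin_arccos]; exact Real.sqrt_nonneg _
    cases s
    · refine ⟨Real.arccos r, ?_⟩
      rw [contour_eq hk hz C (s := false) (fun _ => rfl) (fun h => absurd h hsin.not_gt),
        hlp _ (Real.cos_arccos hr1 hr2)]
    · refine ⟨-Real.arccos r, ?_⟩
      rw [contour_eq hk hz C (s := true)
        (fun h => by rw [Real.sin_neg] at h; linarith) (fun _ => rfl),
        hlp _ (by rw [Real.cos_neg, Real.cos_arccos hr1 hr2])]

theorem isExteriorDomain_wmap (hc : P.c ≠ 0) (ha : P.a ≠ 0) (hg : P.gam ≤ 1) (C : ℂ) :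
    IsExteriorDomain (P.elasticDomain (P.wmap hk hz C) ((S).imap P.alph P.bet C 0))
      (range (P.contour hk hz C 0)) (range (P.contour hk hz C 1)) := by
  rw [elasticDomain_wmap, range_contour, range_contour]
  exact (closed hk hz).isExteriorDomain (asympId hk hz) (by rwa [alph_add_bet ha])
    (re_alph_nonneg hc ha hg)

end Data

namespace Data

variable {P : Data}

variable (hk : P.k ∈ Ioo (0 : ℝ) 1) (hz : P.zinf ∈ Ioo (-1 : ℝ) 1)

local notation "S" => inverseSlits hk hz

/-! ### Smoothness of the contours -/

-- In the angular parameter the root singularity at the slit ends becomes `|sin θ|`. It cancels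
-- against the factor `sin θ` in the derivative of `loopU`, and the change of side absorbs the sign;
-- this is why the contour is `C¹` through the slit ends.
include hk in
theorem sqrt_abs_p2_loopPoint (j : Fin 2) (θ : ℝ) : √|p2 P.k (loopPoint P.k j θ)| =
    (hi P.k j - lo P.k j) / 2 * |Real.sin θ| * √(rest P.k j (loopPoint P.k j θ)) := by
  have h := lo_lt_hi hk j
  have e : (loopPoint P.k j θ - lo P.k j) * (hi P.k j - loopPoint P.k j θ) =
      ((hi P.k j - lo P.k j) / 2 * |Real.sin θ|) ^ 2 := by
    rw [mul_pow, sq_abs, Real.sin_sq, loopPoint]; ring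
  rw [abs_p2 hk j (loopPoint_mem hk j θ), e, Real.sqrt_mul (sq_nonneg _), Real.sqrt_sq]
  exact mul_nonneg (by linarith) (abs_nonneg _)

theorem continuous_loopPoint (j : Fin 2) : Continuous (loopPoint P.k j) := by
  unfold loopPoint; fun_prop

include hk in
theorem sqrt_rest_pos (j : Fin 2) (θ : ℝ) : 0 < √(rest P.k j (loopPoint P.k j θ)) :=
  Real.sqrt_pos.2 (rest_pos hk j (loopPoint_mem hk j θ))

include hk hz in
theorem hasDerivAt_loopU (j : Fin 2) (θ : ℝ) : HasDerivAt (P.loopU j)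
    (P.loopU j θ ^ 2 * ((hi P.k j - lo P.k j) / 2 * Real.sin θ)) θ := by
  have h1 : HasDerivAt (loopPoint P.k j) ((hi P.k j - lo P.k j) / 2 * -Real.sin θ) θ :=
    ((Real.hasDerivAt_cos θ).const_mul _).const_add _
  have h2 := (hasDerivAt_inv_sub (ne_zinf_of_mem hk hz j (loopPoint_mem hk j θ))).comp θ h1
  refine h2.congr_deriv ?_
  rw [loopU]; ring

theorem eventually_loopSide {θ : ℝ} (hθ : Real.sin θ ≠ 0) :
    ∀ᶠ t in 𝓝 θ, loopSide t = loopSide θ := by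
  rcases hθ.lt_or_gt with h | h
  · filter_upwards [Real.continuous_sin.continuousAt.eventually_lt_const h] with t ht
    simp [loopSide, h, ht]
  · filter_upwards [Real.continuous_sin.continuousAt.eventually_const_lt h] with t ht
    simp [loopSide, h.not_gt, ht.not_gt]

/-- The imaginary part of the primitive along the loop. -/
def loopY (j : Fin 2) (θ : ℝ) : ℝ := (if loopSide θ then 1 else -1) * (S).Y (P.loopU j θ)

theorem contour_eq_loopY (C : ℂ) (j : Fin 2) (θ : ℝ) : P.contour hk hz C j θ =
    P.alph * P.loopU j θ +
      P.bet * ((S).X (P.loopU j θ) + loopY hk hz j θ * Complex.I) + C := by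
  rw [contour, TwoSlits.bmap, TwoSlits.side_ofReal, loopY]
  split_ifs <;> simp

include hk hz in
theorem continuous_loopU (j : Fin 2) : Continuous (P.loopU j) :=
  continuous_iff_continuousAt.2 fun θ => (hasDerivAt_loopU hk hz j θ).continuousAt

/-- The side switches only at the slit ends, where `Y` vanishes. -/
theorem continuous_loopY (j : Fin 2) : Continuous (loopY hk hz j) := by
  have hY := (S).continuous_Y.comp (continuous_loopU hk hz j)
  refine continuous_iff_continuousAt.2 fun θ => ?_
  by_cases hθ : Real.sin θ = 0
  · have h0 : loopY hk hz j θ = 0 := by rw [loopY, Y_end hk hz hθ, mul_zero]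
    have h1 := hY.norm.tendsto θ
    simp only [Function.comp_apply, Y_end hk hz hθ, norm_zero] at h1
    rw [ContinuousAt, h0]
    refine squeeze_zero_norm (fun t => ?_) h1
    rw [loopY]
    split_ifs <;> simp
  · refine (hY.continuousAt.const_mul (if loopSide θ then 1 else -1)).congr ?_
    filter_upwards [eventually_loopSide hθ] with t ht
    simp only [loopY, Function.comp_apply, ht]

/-- The derivative of the contour. -/
def contourDeriv (j : Fin 2) (θ : ℝ) : ℂ :=
  P.loopU j θ ^ 2 * (P.alph * ((hi P.k j - lo P.k j) / 2 * Real.sin θ : ℝ) +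
    P.bet * Complex.I * (slitSign j * P.scale * P.quadR (loopPoint P.k j θ) /
      √(rest P.k j (loopPoint P.k j θ)) : ℝ))

theorem hasDerivAt_loopY {j : Fin 2} {θ : ℝ} (hθ : Real.sin θ ≠ 0) :
    HasDerivAt (loopY hk hz j) (P.loopU j θ ^ 2 * (slitSign j * P.scale *
      P.quadR (loopPoint P.k j θ) / √(rest P.k j (loopPoint P.k j θ)))) θ := by
  have h1 := ((S).hasDerivAt_Y (quartic_loopU hk hz (j := j) hθ)).comp θ
    (hasDerivAt_loopU hk hz j θ)
  have h2 := h1.const_mul (if loopSide θ then (1 : ℝ) else -1)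
  have h3 : HasDerivAt (loopY hk hz j) _ θ := h2.congr_of_eventuallyEq (by
    filter_upwards [eventually_loopSide hθ] with t ht
    simp only [loopY, Function.comp_apply, ht])
  refine h3.congr_deriv ?_
  have h4 : ((S).gUp (P.loopU j θ)).im = _ := (gUp_im_inv hk hz j (loopPoint_mem_Ioo hk j hθ)).2
  rw [h4, sqrt_abs_p2_loopPoint hk]
  have h5 := (sqrt_rest_pos hk j θ).ne'
  have h6 : (hi P.k j - lo P.k j) ≠ 0 := (sub_pos.2 (lo_lt_hi hk j)).ne'
  rcases hθ.lt_or_gt with h | h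
  · rw [abs_of_neg h, loopSide, if_pos (decide_eq_true h)]
    field_simp
  · rw [abs_of_pos h, loopSide, if_neg (by simp [h.le])]
    field_simp

theorem X_loopU (j : Fin 2) (θ θ' : ℝ) : (S).X (P.loopU j θ) = (S).X (P.loopU j θ') := by
  rcases loopU_mem hk hz j θ with h | h <;> rcases loopU_mem hk hz j θ' with h' | h'
  · rw [(S).X_const₀ h.2, (S).X_const₀ h'.2]
  · exact absurd (h.1.symm.trans h'.1) (by decide)
  · exact absurd (h.1.symm.trans h'.1) (by decide)
  · rw [← (S).X_const₁ h.2, ← (S).X_const₁ h'.2]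

include hk hz in
theorem continuous_contourDeriv (j : Fin 2) : Continuous (P.contourDeriv j) := by
  have h1 := continuous_loopU hk hz j
  have h2 := continuous_loopPoint (P := P) j
  have h3 : Continuous fun θ => slitSign j * P.scale * P.quadR (loopPoint P.k j θ) /
      √(rest P.k j (loopPoint P.k j θ)) := by
    refine Continuous.div ?_ ((continuous_rest j).comp h2).sqrt fun θ => (sqrt_rest_pos hk j θ).ne'
    unfold quadR; fun_prop
  unfold contourDeriv
  fun_prop

/-- The formula is first obtained for `sin θ ≠ 0`. The contour is continuous, the remaining angles
are countable and `contourDeriv` is continuous, so the contour is its integral and is differentiable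
at the remaining angles as well. -/
theorem hasDerivAt_contour (C : ℂ) (j : Fin 2) (θ : ℝ) :
    HasDerivAt (P.contour hk hz C j) (P.contourDeriv j θ) θ := by
  have hfun : P.contour hk hz C j = fun θ => P.alph * P.loopU j θ +
      P.bet * ((S).X (P.loopU j 0) + loopY hk hz j θ * Complex.I) + C := by
    funext t
    rw [contour_eq_loopY, X_loopU hk hz j t 0]
  have hcont : Continuous (P.contour hk hz C j) := by
    rw [hfun]
    have := continuous_loopU hk hz j
    have := continuous_loopY hk hz j
    fun_prop
  have hder : ∀ t, Real.sin t ≠ 0 → HasDerivAt (P.contour hk hz C j) (P.contourDeriv j t) t := by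
    intro t ht
    rw [hfun]
    have h1 := (hasDerivAt_loopU hk hz j t).ofReal_comp.const_mul P.alph
    have h2 := (((hasDerivAt_loopY hk hz (j := j) ht).ofReal_comp.mul_const Complex.I).const_add
      ((S).X (P.loopU j 0) : ℂ)).const_mul P.bet
    refine ((h1.add h2).add_const C).congr_deriv ?_
    rw [contourDeriv]
    push_cast
    ring
  have hcount : {t : ℝ | Real.sin t = 0}.Countable := by
    refine (countable_range fun n : ℤ => (n : ℝ) * π).mono fun t ht => ?_
    exact Real.sin_eq_zero_iff.1 ht
  have hD := continuous_contourDeriv hk hz (P := P) j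
  have hsplit : ∀ t, P.contour hk hz C j t =
      P.contour hk hz C j 0 + ∫ x in (0 : ℝ)..t, P.contourDeriv j x := by
    intro t
    rw [integral_eq_of_hasDerivAt_off_countable _ _ hcount hcont.continuousOn
      (fun x hx => hder x hx.2) (hD.intervalIntegrable _ _)]
    ring
  have := (hD.integral_hasStrictDerivAt 0 θ).hasDerivAt.const_add (P.contour hk hz C j 0)
  exact this.congr_of_eventuallyEq (Eventually.of_forall hsplit)

-- Up to a nonzero factor the derivative is `α x + iβ m` with real `x` and `m`. Multiplying by `conj
-- β` and taking real parts gives `x = 0`, hence `sin θ = 0`. At a slit end `quad ≠ 0`, so `m ≠ 0`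
-- and `β = 0`, against `Re (α conj β) > 0`.
include hk hz in
theorem contourDeriv_ne_zero (hre : 0 < (P.alph * conj P.bet).re) (j : Fin 2) (θ : ℝ) :
    P.contourDeriv j θ ≠ 0 := by
  have hξ := loopPoint_mem hk j θ
  have hne := ne_zinf_of_mem hk hz j hξ
  intro h
  have hU : (P.loopU j θ : ℂ) ^ 2 ≠ 0 := by
    refine pow_ne_zero _ (Complex.ofReal_ne_zero.2 (one_div_ne_zero (sub_ne_zero.2 hne)))
  have h1 := (mul_eq_zero.1 h).resolve_left hU
  set x := (hi P.k j - lo P.k j) / 2 * Real.sin θ with hx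
  set m := slitSign j * P.scale * P.quadR (loopPoint P.k j θ) /
      √(rest P.k j (loopPoint P.k j θ)) with hm
  have h2 : P.alph * conj P.bet * x + P.bet * conj P.bet * (m * Complex.I) = 0 := by
    linear_combination conj P.bet * h1
  rw [Complex.mul_conj] at h2
  have h3 := congrArg Complex.re h2
  rw [Complex.add_re, Complex.re_mul_ofReal, Complex.re_ofReal_mul] at h3
  simp only [Complex.mul_re, Complex.ofReal_re, Complex.I_re, mul_zero, Complex.ofReal_im,
    Complex.I_im, mul_one, sub_self, add_zero, Complex.zero_re] at h3
  have hx0 : x = 0 := by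
    rcases mul_eq_zero.1 h3 with h' | h'
    · exact absurd h' hre.ne'
    · exact h'
  have hsin : Real.sin θ = 0 :=
    (mul_eq_zero.1 hx0).resolve_left (div_pos (sub_pos.2 (lo_lt_hi hk j)) two_pos).ne'
  have hq : P.quadR (loopPoint P.k j θ) ≠ 0 := by
    refine quadR_ne_zero_of_p2 hk hz hξ ?_
    rw [sqrt_abs_p2_loopPoint hk, hsin]; simp
  have hs : slitSign j ≠ 0 := by unfold slitSign; split_ifs <;> norm_num
  have hm0 : m ≠ 0 := div_ne_zero (mul_ne_zero (mul_ne_zero hs (scale_pos hk hz).ne') hq)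
    (sqrt_rest_pos hk j θ).ne'
  rw [hx0, Complex.ofReal_zero, mul_zero, zero_add] at h1
  have hb : P.bet = 0 := by
    have h4 := (mul_eq_zero.1 h1).resolve_right (Complex.ofReal_ne_zero.2 hm0)
    exact (mul_eq_zero.1 h4).resolve_right Complex.I_ne_zero
  rw [hb] at hre
  simp at hre

theorem contour_periodic (C : ℂ) (j : Fin 2) :
    Function.Periodic (P.contour hk hz C j) (2 * π) := by
  intro θ
  simp only [contour, loopSide, loopU, loopPoint, Real.sin_add_two_pi, Real.cos_add_two_pi]

/-- Injectivity in `u` determines `cos θ`. Inside the slit the two sides have different images,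
which determines the sign of `sin θ`. -/
theorem contour_injOn (hre : 0 < (P.alph * conj P.bet).re) (C : ℂ) (j : Fin 2) :
    InjOn (P.contour hk hz C j) (Ico 0 (2 * π)) := by
  have hb : P.bet ≠ 0 := by
    intro h; rw [h] at hre; simp at hre
  intro θ₁ h1 θ₂ h2 h
  have hu := (closed hk hz).bmap_inj_of_pos hre (ofReal_mem_closedHalf _ _)
    (ofReal_mem_closedHalf _ _) h
  have hu : P.loopU j θ₁ = P.loopU j θ₂ := by exact_mod_cast hu
  have hcos : Real.cos θ₁ = Real.cos θ₂ := by
    have h3 := hu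
    rw [loopU, loopU, one_div, one_div, inv_inj] at h3
    have h4 : (hi P.k j - lo P.k j) / 2 * (Real.cos θ₁ - Real.cos θ₂) = 0 := by
      simp only [loopPoint] at h3; linarith
    exact sub_eq_zero.1 ((mul_eq_zero.1 h4).resolve_left
      (div_pos (sub_pos.2 (lo_lt_hi hk j)) two_pos).ne')
  have hsq : Real.sin θ₁ ^ 2 = Real.sin θ₂ ^ 2 := by rw [Real.sin_sq, Real.sin_sq, hcos]
  have hsin : Real.sin θ₁ = Real.sin θ₂ := by
    by_cases h0 : Real.sin θ₁ = 0
    · rw [h0] at hsq ⊢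
      exact (pow_eq_zero_iff two_ne_zero).1 (hsq.symm.trans (by norm_num)) |>.symm
    · have hside : loopSide θ₁ = loopSide θ₂ := by
        have h3 := h
        rw [contour, contour, ← hu] at h3
        exact (closed hk hz).bmap_side_ne hb (loopU_mem_Ioo hk hz (j := j) h0) h3
      rcases sq_eq_sq_iff_eq_or_eq_neg.1 hsq with h3 | h3
      · exact h3
      · exfalso
        rw [loopSide, loopSide, decide_eq_decide] at hside
        rcases lt_or_gt_of_ne h0 with h4 | h4
        · have := hside.1 h4; linarith
        · have := hside.2 (by linarith); linarith
  obtain ⟨n, hn⟩ := Real.Angle.angle_eq_iff_two_pi_dvd_sub.1 (Real.Angle.cos_sin_inj hcos hsin)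
  have hπ := Real.pi_pos
  have hn1 : (n : ℝ) < 1 := by
    by_contra! h'
    have := mul_le_mul_of_nonneg_left h' (by positivity : (0 : ℝ) ≤ 2 * π)
    linarith [h1.2, h2.1]
  have hn2 : (-1 : ℝ) < n := by
    by_contra! h'
    have := mul_le_mul_of_nonneg_left h' (by positivity : (0 : ℝ) ≤ 2 * π)
    linarith [h1.1, h2.2]
  have hn0 : n = 0 := by
    have a1 : n < 1 := by exact_mod_cast hn1
    have a2 : -1 < n := by exact_mod_cast hn2
    omega
  rw [hn0] at hn
  simp only [Int.cast_zero, mul_zero] at hn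
  linarith

theorem isSimpleClosedCurve_contour (hre : 0 < (P.alph * conj P.bet).re) (C : ℂ) (j : Fin 2) :
    IsSimpleClosedCurve (P.contour hk hz C j) where
  periodic := contour_periodic hk hz C j
  contDiff := by
    have hd : deriv (P.contour hk hz C j) = P.contourDeriv j :=
      funext fun θ => (hasDerivAt_contour hk hz C j θ).deriv
    rw [contDiff_one_iff_deriv, hd]
    exact ⟨fun θ => (hasDerivAt_contour hk hz C j θ).differentiableAt,
      continuous_contourDeriv hk hz j⟩
  regular θ := by
    rw [(hasDerivAt_contour hk hz C j θ).deriv]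
    exact contourDeriv_ne_zero hk hz hre j θ
  simple := contour_injOn hk hz hre C j

/-! ### Degenerate contours -/

/-- A periodic curve on a line traverses a segment. -/
theorem range_eq_segment {ρ : ℝ → ℝ} (hρ : Continuous ρ) (hp : Function.Periodic ρ (2 * π))
    {x y : ℝ} (hxy : ρ x ≠ ρ y) {w q : ℂ} (hq : q ≠ 0) :
    ∃ z₁ z₂ : ℂ, z₁ ≠ z₂ ∧ (range fun θ => w + ρ θ * q) = segment ℝ z₁ z₂ := by
  have h2π : (0 : ℝ) < 2 * π := by positivity
  have hr : range ρ = Icc (sInf (ρ '' Icc 0 (2 * π))) (sSup (ρ '' Icc 0 (2 * π))) := by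
    rw [← ContinuousOn.image_Icc h2π.le hρ.continuousOn, ← hp.image_Icc h2π 0, zero_add]
  set m := sInf (ρ '' Icc 0 (2 * π))
  set M := sSup (ρ '' Icc 0 (2 * π))
  have hx : ρ x ∈ Icc m M := hr ▸ mem_range_self x
  have hy : ρ y ∈ Icc m M := hr ▸ mem_range_self y
  have hmM : m < M := by
    by_contra! h
    exact hxy (le_antisymm (hx.2.trans (h.trans hy.1)) (hy.2.trans (h.trans hx.1)))
  refine ⟨w + m * q, w + M * q, fun h => ?_, ?_⟩
  · have h1 : (m : ℂ) = M := mul_right_cancel₀ hq (add_left_cancel h)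
    exact hmM.ne (by exact_mod_cast h1)
  · have h1 : (range fun θ => w + ρ θ * q) = (AffineMap.lineMap w (w + q) : ℝ →ᵃ[ℝ] ℂ) '' range ρ := by
      rw [← range_comp]
      congr 1
      funext θ
      simp [AffineMap.lineMap_apply]
      ring
    rw [h1, hr, ← segment_eq_Icc hmM.le, image_segment]
    simp only [AffineMap.lineMap_apply]
    congr 1 <;> simp <;> ring

/-- For `γ = 1` and `β ≠ 0` one has `α = iκβ` with real `κ`, and the real part of the primitive is
constant along a slit, so the contour is a constant plus a real function times `iβ`. It is not a
point: at `θ = ±π/2` the values of `u` agree while `Y > 0` enters with opposite signs. For `β = 0`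
the contour is an affine image of the slit. -/
theorem range_contour_segment (hc : P.c ≠ 0) (ha : P.a ≠ 0) (hg : P.gam = 1) (C : ℂ) (j : Fin 2) :
    ∃ z₁ z₂ : ℂ, z₁ ≠ z₂ ∧ range (P.contour hk hz C j) = segment ℝ z₁ z₂ := by
  have hre : (P.alph * conj P.bet).re = 0 := by
    rw [re_alph_mul_conj_bet, (gam_eq_one_iff hc ha).1 hg, sub_self, zero_div]
  have hUp : Function.Periodic (P.loopU j) (2 * π) := fun θ => by
    simp only [loopU, loopPoint, Real.cos_add_two_pi]
  have hYp : Function.Periodic (loopY hk hz j) (2 * π) := fun θ => by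
    have : loopSide (θ + 2 * π) = loopSide θ := by rw [loopSide, loopSide, Real.sin_add_two_pi]
    rw [loopY, loopY, this, hUp θ]
  have hUne : P.loopU j 0 ≠ P.loopU j π := by
    intro h
    rw [loopU, loopU, one_div, one_div, inv_inj] at h
    simp only [loopPoint, Real.cos_zero, Real.cos_pi] at h
    linarith [lo_lt_hi hk j]
  by_cases hb : P.bet = 0
  · have hα : P.alph ≠ 0 := by
      have := alph_add_bet ha
      rw [hb, add_zero] at this
      rwa [this]
    have hfun : P.contour hk hz C j = fun θ => C + P.loopU j θ * P.alph := by
      funext θ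
      rw [contour_eq_loopY, hb]; ring
    rw [hfun]
    exact range_eq_segment (continuous_loopU hk hz j) hUp hUne hα
  · set κ : ℝ := (P.alph / P.bet).im with hκ
    have hα : P.alph = κ * Complex.I * P.bet := by
      have h1 : P.alph / P.bet = P.alph * conj P.bet / (Complex.normSq P.bet : ℝ) := by
        rw [← Complex.mul_conj]
        have : conj P.bet ≠ 0 := by simpa using hb
        field_simp
      have h2 : (P.alph / P.bet).re = 0 := by
        rw [h1, Complex.div_ofReal_re, hre, zero_div]
      have h3 : P.alph / P.bet = κ * Complex.I := by
        apply Complex.ext <;> simp [h2, hκ]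
      rw [← h3]; field_simp
    have hfun : P.contour hk hz C j = fun θ => (P.bet * (S).X (P.loopU j 0) + C) +
        ((κ * P.loopU j θ + loopY hk hz j θ : ℝ) : ℂ) * (P.bet * Complex.I) := by
      funext θ
      rw [contour_eq_loopY, X_loopU hk hz j θ 0, hα]
      push_cast
      ring
    rw [hfun]
    refine range_eq_segment (x := π / 2) (y := -(π / 2)) ?_ ?_ ?_
      (mul_ne_zero hb Complex.I_ne_zero)
    · exact ((continuous_loopU hk hz j).const_mul κ).add (continuous_loopY hk hz j)
    · intro θ; simp only [hUp θ, hYp θ]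
    · have h0 : Real.sin (π / 2) ≠ 0 := by rw [Real.sin_pi_div_two]; exact one_ne_zero
      have hY := (closed hk hz).Y_pos (loopU_mem_Ioo hk hz (j := j) h0)
      have hU : P.loopU j (-(π / 2)) = P.loopU j (π / 2) := by
        simp only [loopU, loopPoint, Real.cos_neg]
      simp only [loopY, loopSide, hU, Real.sin_neg, Real.sin_pi_div_two]
      norm_num
      intro h
      linarith

end Data

/-! ### Boundary values of `R` and their compatibility with the map -/

namespace TwoSlits

variable (S : TwoSlits)

/-- Boundary values of `R` on the closed half-planes. -/
def Rside (s : Bool) (u : ℂ) : ℂ := if s then S.Rup u else conj (S.Rup u)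

theorem continuous_Rside (s : Bool) : Continuous (S.Rside s) := by
  cases s
  · exact Complex.continuous_conj.comp S.continuous_Rup
  · exact S.continuous_Rup

theorem Rside_eq_R {s : Bool} {u : ℂ} (hu : u ∉ S.slits) (hs : u ∈ closedHalf s) :
    S.Rside s u = S.R u := by
  cases s
  · have h : (conj u).im ≥ 0 := by
      have : u.im ≤ 0 := hs
      simpa using this
    have h1 := S.R_eq_Rup (S.conj_notMem_slits hu) h
    rw [S.R_conj hu, S.Rup_conj] at h1
    simp [Rside, ← h1]
  · exact (S.R_eq_Rup hu hs).symm

theorem Rside_of_mem {s : Bool} {x : ℝ} (hx : (x : ℂ) ∈ S.slits) : (S.Rside s x).re = 0 := by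
  have h : (S.Rup x).re = 0 := by
    rcases S.ofReal_mem_slits.1 hx with h | h
    · rw [S.Rup_of_mem_slit₀ h]; simp
    · rw [S.Rup_of_mem_slit₁ h]; simp
  cases s <;> simp [Rside, h]

theorem Rside_eq_zero {s : Bool} {u : ℂ} : S.Rside s u = 0 ↔ S.Rup u = 0 := by
  cases s <;> simp [Rside]

variable {S}

/-- The inequality `Re g ≥ 0` without division, so that it survives at the slit ends, where `g` is
infinite. -/
theorem Closed.E_mul_conj_Rside (hS : S.Closed) {s : Bool} {u : ℂ} (hs : u ∈ closedHalf s) :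
    0 ≤ (S.E u * conj (S.Rside s u)).re := by
  by_cases hu : u ∈ S.slits
  · obtain ⟨x, rfl⟩ : ∃ x : ℝ, u = x :=
      ⟨u.re, Complex.ext rfl (by simpa using S.im_eq_zero_of_mem_slits hu)⟩
    rw [S.E_ofReal, Complex.re_ofReal_mul, Complex.conj_re, S.Rside_of_mem hu, mul_zero]
  · rw [S.Rside_eq_R hu hs]
    have hR := S.R_ne_zero hu
    have : S.E u * conj (S.R u) = S.g u * (Complex.normSq (S.R u) : ℝ) := by
      rw [← Complex.mul_conj, g]; field_simp
    rw [this, Complex.re_mul_ofReal]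
    exact mul_nonneg (hS.g_re_pos hu).le (Complex.normSq_nonneg _)

/-- The boundary values from the two half-planes are compatible. -/
theorem Closed.Rside_congr (hS : S.Closed) {α β C : ℂ} (hre : 0 < (α * conj β).re)
    {s₁ s₂ : Bool} {u₁ u₂ : ℂ} (h1 : u₁ ∈ closedHalf s₁) (h2 : u₂ ∈ closedHalf s₂)
    (h : S.bmap α β C s₁ u₁ = S.bmap α β C s₂ u₂) :
    u₁ = u₂ ∧ S.Rside s₁ u₁ = S.Rside s₂ u₂ := by
  have hβ : β ≠ 0 := by rintro rfl; simp at hre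
  obtain rfl := hS.bmap_inj_of_pos hre h1 h2 h
  refine ⟨rfl, ?_⟩
  by_cases hu : u₁ ∈ S.slits
  · obtain ⟨x, rfl⟩ : ∃ x : ℝ, u₁ = x :=
      ⟨u₁.re, Complex.ext rfl (by simpa using S.im_eq_zero_of_mem_slits hu)⟩
    by_cases h0 : S.Rup x = 0
    · rw [S.Rside_eq_zero.2 h0, S.Rside_eq_zero.2 h0]
    · have hI : x ∈ Ioo S.a₀ S.b₀ ∨ x ∈ Ioo S.a₁ S.b₁ := by
        rw [S.Rup_eq_zero] at h0
        norm_cast at h0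
        push Not at h0
        obtain ⟨n1, n2, n3, n4⟩ := h0
        refine (S.ofReal_mem_slits.1 hu).imp (fun h => ?_) fun h => ?_
        · exact ⟨lt_of_le_of_ne h.1 (Ne.symm n1), lt_of_le_of_ne h.2 n2⟩
        · exact ⟨lt_of_le_of_ne h.1 (Ne.symm n3), lt_of_le_of_ne h.2 n4⟩
      rw [hS.bmap_side_ne hβ hI h]
  · rw [S.Rside_eq_R hu h1, S.Rside_eq_R hu h2]

end TwoSlits

namespace Data

variable {P : Data}

variable (hk : P.k ∈ Ioo (0 : ℝ) 1) (hz : P.zinf ∈ Ioo (-1 : ℝ) 1)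

local notation "S" => inverseSlits hk hz

/-! ### The potential in the elastic domain -/

variable (P) in
/-- The numerator of `ψ` in terms of the quadratic polynomial `E` and the root `X`. -/
def psiNum (X E : ℂ) : ℂ := conj P.a * (conj P.na * (X - E) - conj P.mb * (X + E))

variable (P) in
/-- The denominator of `ψ`. -/
def psiDen (X E : ℂ) : ℂ := P.mb * (X - E) - P.na * (X + E)

/-- `Re (E conj X) ≥ 0` gives `‖X - E‖ ≤ ‖X + E‖`. With `‖mb‖ < ‖na‖` a zero of the denominator then
forces `X + E = X - E = 0`. -/
theorem psiDen_ne_zero {X E : ℂ} (h : ‖P.mb‖ < ‖P.na‖) (hXE : 0 ≤ (E * conj X).re)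
    (h0 : X = 0 → E ≠ 0) : P.psiDen X E ≠ 0 := by
  intro h1
  have h2 : ‖P.mb‖ * ‖X - E‖ = ‖P.na‖ * ‖X + E‖ := by
    rw [← norm_mul, ← norm_mul, sub_eq_zero.1 h1]
  have h3 : ‖X - E‖ ≤ ‖X + E‖ := by
    refine le_of_sq_le_sq ?_ (norm_nonneg _)
    rw [← Complex.normSq_eq_norm_sq, ← Complex.normSq_eq_norm_sq]
    simp only [Complex.normSq_apply, Complex.mul_re, Complex.conj_re, Complex.conj_im,
      Complex.add_re, Complex.add_im, Complex.sub_re, Complex.sub_im] at hXE ⊢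
    nlinarith
  have h4 : ‖X + E‖ = 0 := by
    by_contra hne
    have hpos : 0 < ‖X + E‖ := lt_of_le_of_ne (norm_nonneg _) (Ne.symm hne)
    have := mul_lt_mul_of_pos_right h hpos
    have := mul_le_mul_of_nonneg_left h3 (norm_nonneg P.mb)
    linarith
  have h5 : ‖X - E‖ = 0 := le_antisymm (h3.trans h4.le) (norm_nonneg _)
  rw [norm_eq_zero] at h4 h5
  have hX : X = 0 := by linear_combination (h4 + h5) / 2
  have hE : E = 0 := by linear_combination (h4 - h5) / 2
  exact h0 hX hE

/-- Multiplying numerator and denominator by `R` removes the poles of `g`; the resulting quotient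
extends continuously to the slits including their ends when `γ < 1`. -/
theorem psi_eq_quot (ha : P.a ≠ 0) {ζ : ℂ} (h : ζ ∈ P.punctured) :
    P.psi ζ = P.psiNum ((S).R (1 / (ζ - P.zinf))) ((S).E (1 / (ζ - P.zinf))) /
      P.psiDen ((S).R (1 / (ζ - P.zinf))) ((S).E (1 / (ζ - P.zinf))) := by
  have ha' := conj_a_ne_zero ha
  have hR := (S).R_ne_zero (inv_notMem_slits hk hz h)
  have hne : ζ - P.zinf ≠ 0 := sub_ne_zero.2 h.2
  have hG := G_eq hk hz h
  rw [TwoSlits.g] at hG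
  rw [psi, Fplus_add_Fminus hk hz, omegaDeriv_den hk hz, den, hG, psiNum, psiDen]
  generalize (S).R (1 / (ζ - P.zinf)) = X at *
  generalize (S).E (1 / (ζ - P.zinf)) = E
  have e1 : 1 + -(E / X) = (X - E) / X := by field_simp; ring
  have e2 : 1 - -(E / X) = (X + E) / X := by field_simp; ring
  rw [e1, e2]
  have e3 : P.mb * ((X - E) / X) - P.na * ((X + E) / X) =
      (P.mb * (X - E) - P.na * (X + E)) / X := by ring
  have e4 : conj P.na * ((X - E) / X) - conj P.mb * ((X + E) / X) =
      (conj P.na * (X - E) - conj P.mb * (X + E)) / X := by ring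
  rw [e3, e4]
  generalize P.mb * (X - E) - P.na * (X + E) = D
  generalize conj P.na * (X - E) - conj P.mb * (X + E) = N
  by_cases hD : D = 0
  · simp [hD]
  · field_simp

theorem Rside_loop (j : Fin 2) (θ : ℝ) : (S).Rside (loopSide θ) (P.loopU j θ) =
    ((-(slitSign j * ((hi P.k j - lo P.k j) / 2 * Real.sin θ) *
      √(rest P.k j (loopPoint P.k j θ)) / P.scale * P.loopU j θ ^ 2) : ℝ) : ℂ) * Complex.I := by
  have hs := scale_pos hk hz
  have h1 := sqrt_quartic_inv hk hz (ne_zinf_of_mem hk hz j (loopPoint_mem hk j θ))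
  rw [sqrt_abs_p2_loopPoint hk] at h1
  have h2 : √|(S).quartic (P.loopU j θ)| = (hi P.k j - lo P.k j) / 2 * |Real.sin θ| *
      √(rest P.k j (loopPoint P.k j θ)) / P.scale * P.loopU j θ ^ 2 := by
    rw [loopU]
    rw [← mul_right_inj' hs.ne', h1]
    field_simp
  have h3 : (S).Rup (P.loopU j θ) = (slitSign j * √|(S).quartic (P.loopU j θ)| : ℝ) * Complex.I := by
    rcases loopU_mem hk hz j θ with ⟨h, h'⟩ | ⟨h, h'⟩
    · rw [(S).Rup_of_mem_slit₀ h', h]; simp [slitSign]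
    · rw [(S).Rup_of_mem_slit₁ h', h]; simp [slitSign]
  rcases lt_or_ge (Real.sin θ) 0 with h | h
  · rw [TwoSlits.Rside, loopSide, if_pos (decide_eq_true h), h3, h2, abs_of_neg h]
    congr 2
    ring
  · rw [TwoSlits.Rside, loopSide, if_neg (by simpa using h), h3, h2, abs_of_nonneg h, map_mul,
      Complex.conj_I, Complex.conj_ofReal]
    push_cast
    ring

/-- The relation between the potential and the direction of the contour. -/
theorem psi_contour (hc : P.c ≠ 0) (ha : P.a ≠ 0) (hg : P.gam < 1) (j : Fin 2) (θ : ℝ) :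
    P.psiNum ((S).Rside (loopSide θ) (P.loopU j θ)) ((S).E (P.loopU j θ)) /
      P.psiDen ((S).Rside (loopSide θ) (P.loopU j θ)) ((S).E (P.loopU j θ)) * P.contourDeriv j θ =
      -(P.a * conj (P.contourDeriv j θ)) := by
  have ha' := conj_a_ne_zero ha
  have hD : P.psiDen ((S).Rside (loopSide θ) (P.loopU j θ)) ((S).E (P.loopU j θ)) ≠ 0 :=
    psiDen_ne_zero ((gam_lt_one_iff hc ha).1 hg)
      ((closed hk hz).E_mul_conj_Rside (ofReal_mem_closedHalf _ _))
      fun h => (closed hk hz).E_ne_zero_of_Rup ((S).Rside_eq_zero.1 h)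
  have hE : (S).E (P.loopU j θ) =
      (P.quadR (loopPoint P.k j θ) * P.loopU j θ ^ 2 : ℝ) := by
    rw [(S).E_ofReal, loopU, quadR_inv hk hz (ne_zinf_of_mem hk hz j (loopPoint_mem hk j θ))]
  have hs := (scale_pos hk hz).ne'
  have hq := (sqrt_rest_pos hk j θ).ne'
  have hsg : slitSign j ^ 2 = 1 := by unfold slitSign; split_ifs <;> norm_num
  rw [hE, Rside_loop hk hz] at hD ⊢
  set X : ℝ := -(slitSign j * ((hi P.k j - lo P.k j) / 2 * Real.sin θ) *
      √(rest P.k j (loopPoint P.k j θ)) / P.scale * P.loopU j θ ^ 2) with hX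
  set E : ℝ := P.quadR (loopPoint P.k j θ) * P.loopU j θ ^ 2 with hEd
  set κ : ℝ := slitSign j * √(rest P.k j (loopPoint P.k j θ)) / P.scale with hκ
  -- The denominator of `ψ` is proportional to the tangent of the contour.
  have h1 : P.psiDen (X * Complex.I) E = 2 * conj P.a * Complex.I * κ * P.contourDeriv j θ := by
    have e1 : P.psiDen (X * Complex.I) E =
        -(2 * conj P.a) * (P.alph * (X * Complex.I) + P.bet * E) := by
      rw [psiDen, alph, bet]; field_simp; ring
    have e2 : κ * P.loopU j θ ^ 2 * ((hi P.k j - lo P.k j) / 2 * Real.sin θ) = -X := by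
      rw [hX, hκ]; ring
    have e3 : κ * P.loopU j θ ^ 2 * (slitSign j * P.scale * P.quadR (loopPoint P.k j θ) /
        √(rest P.k j (loopPoint P.k j θ))) = E := by
      rw [hEd, hκ]
      field_simp
      rw [hsg, one_mul]
    have e2' := congrArg (fun r : ℝ => (r : ℂ)) e2
    have e3' := congrArg (fun r : ℝ => (r : ℂ)) e3
    rw [e1, contourDeriv]
    simp only [Complex.ofReal_mul (κ * P.loopU j θ ^ 2), Complex.ofReal_mul κ, Complex.ofReal_neg,
      Complex.ofReal_pow] at e2' e3'
    generalize (((hi P.k j - lo P.k j) / 2 * Real.sin θ : ℝ) : ℂ) = x at *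
    generalize ((slitSign j * P.scale * P.quadR (loopPoint P.k j θ) /
        √(rest P.k j (loopPoint P.k j θ)) : ℝ) : ℂ) = m at *
    linear_combination -(2 * conj P.a * Complex.I * P.alph) * e2' +
      (2 * conj P.a * P.bet) * e3' -
      2 * conj P.a * P.bet * κ * P.loopU j θ ^ 2 * m * Complex.I_sq
  -- On a slit `R` is imaginary and `E` is real, so the numerator is `conj a` times the conjugate of
  -- the denominator; with `h1` the quotient becomes `-a conj L' / L'`.
  have h2 : P.psiNum (X * Complex.I) E = conj P.a * conj (P.psiDen (X * Complex.I) E) := by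
    simp only [psiNum, psiDen, map_sub, map_mul, map_add, Complex.conj_I, Complex.conj_ofReal]
    ring
  have h3 : P.contourDeriv j θ ≠ 0 := by
    intro h0
    rw [h1, h0, mul_zero] at hD
    exact hD rfl
  rw [h2, div_mul_eq_mul_div, div_eq_iff hD, h1]
  simp only [map_mul, Complex.conj_conj, Complex.conj_I, Complex.conj_ofReal, map_ofNat]
  ring

theorem exists_potential (hc : P.c ≠ 0) (ha : P.a ≠ 0) (hg : P.gam < 1) (C : ℂ) :
    ∃ Ψ : ℂ → ℂ, ContinuousOn Ψ (closure ((S).imap P.alph P.bet C '' (S).slitsᶜ)) ∧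
      DifferentiableOn ℂ Ψ ((S).imap P.alph P.bet C '' (S).slitsᶜ) ∧
      (∀ ζ ∈ P.punctured, Ψ (P.wmap hk hz C ζ) = P.psi ζ) ∧
      ∀ j θ, Ψ (P.contour hk hz C j θ) * P.contourDeriv j θ =
        -(P.a * conj (P.contourDeriv j θ)) := by
  have hre := re_alph_pos hc ha hg
  have hαβ : P.alph + P.bet ≠ 0 := by rwa [alph_add_bet ha]
  have hlt := (gam_lt_one_iff hc ha).1 hg
  have hS := closed hk hz
  have hne : ∀ s, ∀ u ∈ TwoSlits.closedHalf s, P.psiDen ((S).Rside s u) ((S).E u) ≠ 0 :=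
    fun s u hu => psiDen_ne_zero hlt (hS.E_mul_conj_Rside hu)
      fun h => hS.E_ne_zero_of_Rup ((S).Rside_eq_zero.1 h)
  obtain ⟨Ψ, hΨ, hval⟩ := hS.exists_descend (C := C) (asympId hk hz) hαβ
    (f := fun s u => P.psiNum ((S).Rside s u) ((S).E u) / P.psiDen ((S).Rside s u) ((S).E u))
    (fun s => by
      have h1 := (S).continuous_Rside s
      have h2 := (S).continuous_E
      refine ContinuousOn.div ?_ ?_ (hne s)
      · unfold psiNum; fun_prop
      · unfold psiDen; fun_prop)
    (fun s₁ s₂ u₁ u₂ h1 h2 h => by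
      obtain ⟨rfl, h3⟩ := hS.Rside_congr hre h1 h2 h
      simp only [h3])
  have himap : ∀ u ∉ (S).slits, Ψ ((S).imap P.alph P.bet C u) =
      P.psiNum ((S).R u) ((S).E u) / P.psiDen ((S).R u) ((S).E u) := by
    intro u hu
    obtain ⟨s, hs⟩ : ∃ s, u ∈ TwoSlits.closedHalf s :=
      (le_total 0 u.im).elim (fun h => ⟨true, h⟩) fun h => ⟨false, h⟩
    rw [hS.imap_eq_bmap hu hs, hval s u hs]
    simp only [(S).Rside_eq_R hu hs]
  refine ⟨Ψ, hΨ, ?_, fun ζ hζ => ?_, fun j θ => ?_⟩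
  · refine hS.differentiableOn_descend hαβ hre.le (fun u hu => ?_) himap
    obtain ⟨s, hs⟩ : ∃ s, u ∈ TwoSlits.closedHalf s :=
      (le_total 0 u.im).elim (fun h => ⟨true, h⟩) fun h => ⟨false, h⟩
    have h1 := (S).differentiableAt_R hu
    have h2 : DifferentiableAt ℂ (S).E u := by unfold TwoSlits.E; fun_prop
    have h3 := hne s u hs
    rw [(S).Rside_eq_R hu hs] at h3
    refine DifferentiableAt.div ?_ ?_ h3
    · unfold psiNum; fun_prop
    · unfold psiDen; fun_prop
  · rw [wmap, himap _ (inv_notMem_slits hk hz hζ), psi_eq_quot hk hz ha hζ]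
  · rw [contour, hval _ _ (ofReal_mem_closedHalf _ _)]
    exact psi_contour hk hz hc ha hg j θ

/-- The behaviour of the potential at infinity. -/
theorem isBigO_potential (hc : P.c ≠ 0) (ha : P.a ≠ 0) (hg : P.gam < 1) {C : ℂ} {Ψ : ℂ → ℂ}
    (hΨ : ∀ ζ ∈ P.punctured, Ψ (P.wmap hk hz C ζ) = P.psi ζ) :
    (fun w => Ψ w - P.b) =O[cocompact ℂ] fun w => (‖w‖ ^ 2)⁻¹ := by
  have hαβ : P.alph + P.bet ≠ 0 := by rwa [alph_add_bet ha]
  obtain ⟨K, hK⟩ := (isBigO_psi_zinf hk hz hc ha).bound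
  rw [eventually_nhdsWithin_iff, Metric.eventually_nhds_iff] at hK
  obtain ⟨δ, hδ, hK⟩ := hK
  have hb : ∀ s, ∃ M ρ : ℝ, 0 < M ∧ 0 < ρ ∧
      (∀ u ∈ TwoSlits.closedHalf s, ρ ≤ ‖u‖ →
        ‖(S).bmap P.alph P.bet C s u‖ ≤ ‖P.c‖ * ‖u‖ + M) ∧
      (∀ u ∈ TwoSlits.closedHalf s, ‖u‖ ≤ ρ → ‖(S).bmap P.alph P.bet C s u‖ ≤ M) ∧
      1 / ρ < δ := by
    intro s
    obtain ⟨M, ρ, hM, h⟩ := (asympId hk hz).norm_bmap (α := P.alph) (β := P.bet) (C := C) s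
    rw [alph_add_bet ha] at h
    set ρ' := max (max ρ 1) (2 / δ) with hρ'
    have h1 : 1 ≤ ρ' := (le_max_right _ _).trans (le_max_left _ _)
    have h2 : 2 / δ ≤ ρ' := le_max_right _ _
    obtain ⟨M', hM'⟩ := (isCompact_closedBall (0 : ℂ) ρ').exists_bound_of_continuousOn
      ((S).continuous_bmap_fold P.alph P.bet C s).continuousOn
    refine ⟨max M M', ρ', lt_of_lt_of_le hM (le_max_left _ _), by linarith, fun u hu hn => ?_,
      fun u hu hn => ?_, ?_⟩
    · have := (h u hu (((le_max_left _ _).trans (le_max_left _ _)).trans hn)).2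
      linarith [le_max_left M M']
    · have := hM' u (by simpa using hn)
      rw [TwoSlits.fold_eq hu] at this
      exact this.trans (le_max_right _ _)
    · rw [div_lt_iff₀ (by linarith)]
      have := mul_le_mul_of_nonneg_left h2 hδ.le
      rw [mul_div_cancel₀ _ hδ.ne'] at this
      linarith
  obtain ⟨M₁, ρ₁, hM₁, hρ₁, g₁, s₁, d₁⟩ := hb true
  obtain ⟨M₂, ρ₂, hM₂, hρ₂, g₂, s₂, d₂⟩ := hb false
  have hext := (isExteriorDomain_wmap hk hz hc ha hg.le C).mem_infinity
  rw [elasticDomain_wmap] at hext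
  refine IsBigO.of_bound (|K| * (2 * ‖P.c‖) ^ 2) ?_
  have hfar : ∀ᶠ w : ℂ in cocompact ℂ, 2 * (M₁ + M₂) < ‖w‖ :=
    (tendsto_norm_cocompact_atTop).eventually_gt_atTop _
  filter_upwards [hext, hfar] with w hw hn
  obtain ⟨u, hu, rfl⟩ := hw
  have key : ∀ (s : Bool) (M ρ : ℝ), u ∈ TwoSlits.closedHalf s → 0 < M → 0 < ρ →
      (∀ u ∈ TwoSlits.closedHalf s, ρ ≤ ‖u‖ →
        ‖(S).bmap P.alph P.bet C s u‖ ≤ ‖P.c‖ * ‖u‖ + M) →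
      (∀ u ∈ TwoSlits.closedHalf s, ‖u‖ ≤ ρ → ‖(S).bmap P.alph P.bet C s u‖ ≤ M) →
      1 / ρ < δ → 2 * M < ‖(S).imap P.alph P.bet C u‖ →
      ‖Ψ ((S).imap P.alph P.bet C u) - P.b‖ ≤
        |K| * (2 * ‖P.c‖) ^ 2 * ‖(‖(S).imap P.alph P.bet C u‖ ^ 2)⁻¹‖ := by
    intro s M ρ hus hM hρ hg hsm hd hn
    rw [(closed hk hz).imap_eq_bmap hu hus] at hn
    have hρu : ρ ≤ ‖u‖ := by
      by_contra! h
      have := hsm u hus h.le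
      linarith
    have hu0 : 0 < ‖u‖ := hρ.trans_le hρu
    have hune : u ≠ 0 := norm_pos_iff.1 hu0
    have h1 := hg u hus hρu
    rw [← (closed hk hz).imap_eq_bmap hu hus] at h1 hn
    set w := (S).imap P.alph P.bet C u with hw
    have hmem := add_inv_mem_punctured hk hz hu hune
    have hΨu := hΨ _ hmem
    rw [wmap, add_sub_cancel_left, one_div_one_div, ← hw] at hΨu
    rw [hΨu]
    have hdist : dist ((P.zinf : ℂ) + 1 / u) P.zinf < δ := by
      rw [dist_eq_norm, add_sub_cancel_left, norm_div, norm_one]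
      exact (one_div_le_one_div_of_le hρ hρu).trans_lt hd
    have h2 := hK hdist hmem.2
    rw [add_sub_cancel_left, norm_pow, norm_norm, norm_div, norm_one] at h2
    refine h2.trans ?_
    have hwpos : 0 < ‖w‖ := by linarith
    -- From `‖w‖ ≤ ‖c‖ ‖u‖ + M` and `2M < ‖w‖` it follows that `‖w‖ ≤ 2 ‖c‖ ‖u‖`.
    have h3 : 1 / ‖u‖ ≤ 2 * ‖P.c‖ / ‖w‖ := by
      rw [div_le_div_iff₀ hu0 hwpos]; linarith
    have h4 : (1 / ‖u‖) ^ 2 ≤ (2 * ‖P.c‖ / ‖w‖) ^ 2 := pow_le_pow_left₀ (by positivity) h3 2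
    calc K * (1 / ‖u‖) ^ 2 ≤ |K| * (1 / ‖u‖) ^ 2 :=
          mul_le_mul_of_nonneg_right (le_abs_self K) (by positivity)
      _ ≤ |K| * (2 * ‖P.c‖ / ‖w‖) ^ 2 := mul_le_mul_of_nonneg_left h4 (abs_nonneg K)
      _ = |K| * (2 * ‖P.c‖) ^ 2 * ‖(‖w‖ ^ 2)⁻¹‖ := by
          rw [norm_inv, norm_pow, norm_norm, div_pow]; ring
  rcases le_total 0 u.im with h | h
  · exact key true M₁ ρ₁ h hM₁ hρ₁ g₁ s₁ d₁ (by linarith)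
  · exact key false M₂ ρ₂ h hM₂ hρ₂ g₂ s₂ d₂ (by linarith)

/-- Passing to the frame of the normal `e^{iα}` multiplies the deviator `(σ₂ - σ₁)/2 + iτ₁₂` by
`e^{2iα}` and leaves the mean stress `m` unchanged. The rotated deviator is `(σ_t - σ_n)/2 +
iτ_{nt}`. -/
theorem stresses_of_rotation {a w : ℂ} {m α : ℝ}
    (h : w * Complex.exp (Complex.I * α) ^ 2 = a) :
    normalStress (m - w.re) (m + w.re) w.im α = m - a.re ∧
      shearStress (m - w.re) (m + w.re) w.im α = a.im ∧
      tangentNormalStress (m - w.re) (m + w.re) w.im α = m + a.re := by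
  rw [mul_comm Complex.I, Complex.exp_mul_I, ← Complex.ofReal_cos, ← Complex.ofReal_sin] at h
  have h1 := Real.sin_sq_add_cos_sq α
  have hr := congrArg Complex.re h
  have hi := congrArg Complex.im h
  simp only [pow_two, Complex.mul_re, Complex.mul_im, Complex.add_re, Complex.add_im,
    Complex.ofReal_re, Complex.ofReal_im, Complex.I_re, Complex.I_im] at hr hi
  refine ⟨?_, ?_, ?_⟩
  · rw [normalStress]; linear_combination m * h1 - hr
  · rw [shearStress]; linear_combination hi
  · rw [tangentNormalStress]; linear_combination m * h1 + hr

/-- The solution of the equal-strength problem. -/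
theorem exists_solvesEqualStrength (hc : P.c ≠ 0) (ha : P.a ≠ 0) (hg : P.gam < 1) (C : ℂ)
    (C' : ℝ) : ∃ Ψ : ℂ → ℂ, (∀ ζ ∈ P.punctured, Ψ (P.wmap hk hz C ζ) = P.psi ζ) ∧
      SolvesEqualStrength P.toLoading
        (P.elasticDomain (P.wmap hk hz C) ((S).imap P.alph P.bet C 0)) (P.contour hk hz C)
        (fun _ => (((P.sigma1 + P.sigma2) / 4 : ℝ) : ℂ) + Complex.I * C') Ψ C' := by
  have hre := re_alph_pos hc ha hg
  obtain ⟨Ψ, hΨc, hΨd, hψ, hcon⟩ := exists_potential hk hz hc ha hg C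
  rw [← elasticDomain_wmap] at hΨc hΨd
  have hO := isBigO_potential hk hz hc ha hg hψ
  have hlim : Tendsto Ψ (cocompact ℂ) (𝓝 P.b) := by
    have h0 : Tendsto (fun w : ℂ => (‖w‖ ^ 2)⁻¹) (cocompact ℂ) (𝓝 0) :=
      tendsto_inv_atTop_zero.comp
        ((tendsto_pow_atTop two_ne_zero).comp tendsto_norm_cocompact_atTop)
    have h1 := (hO.trans_tendsto h0).add_const P.b
    simpa using h1
  have hre' : Tendsto (fun w => (Ψ w).re) (cocompact ℂ) (𝓝 P.b.re) :=
    (Complex.continuous_re.tendsto _).comp hlim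
  have him' : Tendsto (fun w => (Ψ w).im) (cocompact ℂ) (𝓝 P.b.im) :=
    (Complex.continuous_im.tendsto _).comp hlim
  have hcre : ContinuousOn (fun w => (Ψ w).re)
      (closure (P.elasticDomain (P.wmap hk hz C) ((S).imap P.alph P.bet C 0))) :=
    Complex.continuous_re.comp_continuousOn hΨc
  refine ⟨Ψ, hψ, isExteriorDomain_wmap hk hz hc ha hg.le C,
    isSimpleClosedCurve_contour hk hz hre C, differentiableOn_const _, hΨd, continuousOn_const,
    hΨc, ?_, hO, fun w => (P.sigma1 + P.sigma2) / 2 - (Ψ w).re,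
    fun w => (P.sigma1 + P.sigma2) / 2 + (Ψ w).re, fun w => (Ψ w).im,
    continuousOn_const.sub hcre, continuousOn_const.add hcre,
    Complex.continuous_im.comp_continuousOn hΨc, fun w _ => ⟨?_, ?_⟩, ?_, ?_, ?_, ?_⟩
  · simp only [sub_self]
    exact isBigO_zero _ _
  · simp only [Complex.add_re, Complex.ofReal_re, Complex.mul_re, Complex.I_re, Complex.I_im,
      Complex.ofReal_im]
    ring
  · rw [deriv_const, mul_zero, zero_add]
    apply Complex.ext
    · simp; ring
    · simp
  · have := hre'.const_sub ((P.sigma1 + P.sigma2) / 2)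
    rw [b_re] at this
    convert this using 2
    ring
  · have := hre'.const_add ((P.sigma1 + P.sigma2) / 2)
    rw [b_re] at this
    convert this using 2
    ring
  · rw [b_im] at him'
    exact him'
  · intro j θ α hα
    rw [(hasDerivAt_contour hk hz C j θ).deriv] at hα
    have h0 := contourDeriv_ne_zero hk hz hre j θ
    have h1 := hcon j θ
    set D := P.contourDeriv j θ with hD
    set w := Complex.exp (Complex.I * α) with hw
    have hww : w * conj w = 1 := by
      rw [Complex.mul_conj, Complex.normSq_eq_norm_sq, hw, mul_comm, Complex.norm_exp_ofReal_mul_I]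
      norm_num
    have h2 : w * conj D + conj w * D = 0 := by
      have := Complex.add_conj (w * conj D)
      rw [hα, map_mul, Complex.conj_conj] at this
      rw [this]; simp
    -- A unit normal `w` orthogonal to the tangent `D` satisfies this identity, which turns `Ψ D =
    -- -a conj D` into `Ψ w² = a`.
    have h3 : D = -(w ^ 2 * conj D) := by
      linear_combination w * h2 - D * hww
    have hD' : conj D ≠ 0 := by simpa using h0
    have h4 : Ψ (P.contour hk hz C j θ) * w ^ 2 = P.a := by
      rw [h3] at h1
      have h5 : conj (-(w ^ 2 * conj D)) = conj D := by rw [← h3]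
      rw [h5] at h1
      exact mul_right_cancel₀ hD' (by linear_combination -h1)
    have h5 := stresses_of_rotation (m := (P.sigma1 + P.sigma2) / 2) h4
    rw [a_re, a_im] at h5
    refine ⟨h5.1.trans ?_, h5.2.1, h5.2.2.trans ?_⟩
    · ring
    · rw [Loading.sigma]; ring

end Data

end

end TwoCavities

/-! ### Assembly of the theorem -/

theorem mainTheorem2 (P : TwoCavities.Data) (hk : P.k ∈ Ioo (0 : ℝ) 1)
    (hz : P.zinf ∈ Ioo (-1 : ℝ) 1) (hc : P.c ≠ 0) (ha : P.a ≠ 0) :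
    -- the integrals converge and the linear system has exactly the stated solution
    (∀ j : ℕ, j ≤ 2 → IntervalIntegrable (P.intI P.zinf j) volume 1 (1 / P.k) ∧
      IntervalIntegrable (P.intI (-P.zinf) j) volume 1 (1 / P.k)) ∧
    P.lam0 ≠ 0 ∧
    (∀ d, d = P.dP ∨ d = P.dM →
      (∀ A₁ A₂ A₃ : ℝ, P.PoleEquations d A₁ A₂ A₃ ∧ P.RightLoopEquation A₁ A₂ A₃ ↔
        A₁ = P.coef1 d ∧ A₂ = P.coef2 d ∧ A₃ = P.coef3 d) ∧
      P.LeftLoopEquation (P.coef1 d) (P.coef2 d) (P.coef3 d)) ∧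
    -- the coupled Schwarz problems: solution, uniqueness, and zero-free solvability
    P.IsSchwarzPair P.Fplus P.Fminus ∧
    (∀ Fp Fm : ℂ → ℂ, P.IsSchwarzPair Fp Fm →
      EqOn Fp P.Fplus P.punctured ∧ EqOn Fm P.Fminus P.punctured) ∧
    ((∃ Fp Fm : ℂ → ℂ, P.IsSchwarzPair Fp Fm ∧ P.NoZeros fun ζ => Fp ζ - Fm ζ) ↔ P.gam ≤ 1) ∧
    -- the derivative of the map, single-valuedness, boundary condition for `ψ`
    (∀ ζ ∈ P.punctured, P.omegaDeriv ζ = (P.Fplus ζ - P.Fminus ζ) / (2 * conj P.a)) ∧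
    (∀ j, TwoCavities.LoopIntegralVanishes P.k j P.omegaDeriv) ∧
    (∀ j, ∀ s, ∀ ξ ∈ Ioo (TwoCavities.lo P.k j) (TwoCavities.hi P.k j),
      Tendsto (fun ζ => P.psi ζ * P.omegaDeriv ζ + P.a * conj (P.omegaDeriv ζ))
        (𝓝[TwoCavities.halfPlane s] (ξ : ℂ)) (𝓝 0)) ∧
    (fun ζ => P.psi ζ - P.b) =O[𝓝[≠] (P.zinf : ℂ)] (fun ζ => ‖ζ - P.zinf‖ ^ 2) ∧
    -- the map itself
    (∀ ζ₀ ∈ P.punctured, ∀ B : ℂ, ∃ (ω : ℂ → ℂ) (d₀ : ℂ) (L : Fin 2 → ℝ → ℂ),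
      P.IsEllipticMap ζ₀ B ω ∧
      (∀ ω' : ℂ → ℂ, P.IsEllipticMap ζ₀ B ω' → EqOn ω' ω P.punctured) ∧
      (∀ ζ ∈ P.punctured, HasDerivAt ω (P.omegaDeriv ζ) ζ) ∧
      (∃ g : ℂ → ℂ, AnalyticAt ℂ g P.zinf ∧
        ∀ᶠ ζ in 𝓝[≠] (P.zinf : ℂ), ω ζ = P.c / (ζ - P.zinf) + g ζ) ∧
      Tendsto ω (cocompact ℂ) (𝓝 d₀) ∧
      (∀ j, TwoCavities.IsContour P.k j ω (L j)) ∧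
      -- one-to-one map onto the exterior of the two contours
      (P.gam ≤ 1 → InjOn ω P.punctured ∧ d₀ ∉ ω '' P.punctured ∧
        TwoCavities.IsExteriorDomain (P.elasticDomain ω d₀) (range (L 0)) (range (L 1))) ∧
      -- solution of the equal-strength problem
      (P.gam < 1 → ∀ C' : ℝ, ∃ Ψ : ℂ → ℂ, (∀ ζ ∈ P.punctured, Ψ (ω ζ) = P.psi ζ) ∧
        TwoCavities.SolvesEqualStrength P.toLoading (P.elasticDomain ω d₀) L
          (fun _ => (((P.sigma1 + P.sigma2) / 4 : ℝ) : ℂ) + Complex.I * C') Ψ C') ∧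
      -- degeneration of both contours to straight segments
      (P.gam = 1 → ∀ j, ∃ z₁ z₂ : ℂ, z₁ ≠ z₂ ∧ range (L j) = segment ℝ z₁ z₂)) ∧
    -- the zeros of `ω'` are the poles of `ψ`; their number
    (∀ ζ ∈ TwoCavities.slitDomain P.k, MeromorphicAt P.omegaDeriv ζ ∧ MeromorphicAt P.psi ζ ∧
      P.poleOrder ζ = P.zeroOrder ζ) ∧
    P.poleOrderInf = P.zeroOrderInf ∧
    {ζ ∈ TwoCavities.slitDomain P.k | P.zeroOrder ζ ≠ 0}.Finite ∧
    (P.gam ≠ 1 →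
      (∀ j, IntervalIntegrable P.countIntegrand volume
        (TwoCavities.lo P.k j) (TwoCavities.hi P.k j)) ∧
      (P.Z : ℂ) = 2 + 1 / (2 * π * Complex.I) *
        ((∫ ξ in -(1 / P.k)..(-1 : ℝ), P.countIntegrand ξ) -
          ∫ ξ in (1 : ℝ)..(1 / P.k), P.countIntegrand ξ)) ∧
    (P.gam < 1 → P.Z = 0) ∧
    (1 < P.gam → P.Z = 4) ∧
    -- the degenerate case: the four zeros lie on the loops and the singularities of `ψ` disappear
    (P.gam = 1 → (∀ ζ ∈ P.punctured, P.psi ζ = P.b) ∧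
      ∀ j, {ξ ∈ Icc (TwoCavities.lo P.k j) (TwoCavities.hi P.k j) | P.etaSide 1 ξ = 0}.ncard +
        {ξ ∈ Ioo (TwoCavities.lo P.k j) (TwoCavities.hi P.k j) | P.etaSide (-1) ξ = 0}.ncard
          = 2) := by
  refine ⟨fun j _ => TwoCavities.Data.intervalIntegrable_intI hk hz j,
    (TwoCavities.Data.lam0_pos hk hz).ne', fun d _ => ⟨fun A₁ A₂ A₃ =>
      TwoCavities.Data.pole_right_iff hk hz d A₁ A₂ A₃, ?_⟩,
    TwoCavities.Data.isSchwarzPair hk hz,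
    fun Fp Fm h => TwoCavities.Data.schwarzPair_unique hk hz h,
    TwoCavities.Data.noZeros_iff hk hz hc ha, fun ζ _ => ?_, fun j => ?_,
    fun j s ξ hξ => TwoCavities.Data.tendsto_psi_boundary hk hz hc ha j s hξ,
    TwoCavities.Data.isBigO_psi_zinf hk hz hc ha, fun ζ₀ h0 B => ?_, fun ζ hζ => ?_,
    (TwoCavities.Data.order_infinity hk hz hc ha).2, ?_,
    fun hg => TwoCavities.Data.Z_eq_integral hk hz hc ha hg,
    fun hg => TwoCavities.Data.Z_of_gam_le_one hk hz hc ha hg.le,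
    fun hg => (TwoCavities.Data.Z_of_one_lt_gam hk hz hc ha hg).2,
    fun hg => ⟨fun ζ hζ => TwoCavities.Data.psi_eq_of_gam_eq_one hk hz hc ha hg hζ,
      fun j => TwoCavities.Data.ncard_etaSide hk hz hc ha hg j⟩⟩
  · obtain ⟨e1, e2, e3⟩ := TwoCavities.Data.coef_smul (P := P) d
    have h := TwoCavities.Data.left_loop hk hz
    rw [TwoCavities.Data.LeftLoopEquation] at h ⊢
    rw [e1, e2, e3]
    linear_combination d * h
  · have := TwoCavities.Data.conj_a_ne_zero ha
    rw [TwoCavities.Data.Fplus_sub_Fminus hk hz, TwoCavities.Data.omegaDeriv_eq hk hz,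
      TwoCavities.Data.comb, TwoCavities.Data.comb]
    ring
  · rw [TwoCavities.Data.omegaDeriv_eq hk hz]
    exact TwoCavities.Data.loopIntegralVanishes_comb hk hz _ _ j
  · obtain ⟨C, hC⟩ := TwoCavities.Data.exists_isEllipticMap hk hz ha ζ₀ B
    exact ⟨P.wmap hk hz C, _, P.contour hk hz C, hC,
      fun ω' h' => hC.eqOn hk hz h' h0,
      fun ζ hζ => TwoCavities.Data.hasDerivAt_wmap hk hz C hζ,
      TwoCavities.Data.wmap_expansion hk hz ha C,
      TwoCavities.Data.tendsto_wmap_cocompact hk hz C,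
      TwoCavities.Data.isContour hk hz C,
      fun hg => ⟨(TwoCavities.Data.wmap_injOn hk hz hc ha hg C).1,
        (TwoCavities.Data.wmap_injOn hk hz hc ha hg C).2,
        TwoCavities.Data.isExteriorDomain_wmap hk hz hc ha hg C⟩,
      fun hg C' => TwoCavities.Data.exists_solvesEqualStrength hk hz hc ha hg C C',
      fun hg j => TwoCavities.Data.range_contour_segment hk hz hc ha hg C j⟩
  · by_cases h : ζ = P.zinf
    · obtain ⟨h1, h2, h3, h4⟩ := TwoCavities.Data.order_zinf hk hz hc ha
      rw [h]
      exact ⟨h1, h2, h3.trans h4.symm⟩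
    · obtain ⟨h1, h2, -, h4⟩ := TwoCavities.Data.order_punctured hk hz hc ha ⟨hζ, h⟩
      exact ⟨h1, h2, h4⟩
  · rcases le_or_gt P.gam 1 with hg | hg
    · refine (Set.finite_empty).subset fun ζ hζ => hζ.2 ?_
      exact TwoCavities.Data.zeroOrder_of_gam_le_one hk hz hc ha hg hζ.1
    · exact (TwoCavities.Data.Z_of_one_lt_gam hk hz hc ha hg).1
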